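/- **Theorem.** Let $(M,\boldsymbol{c})$ be a smooth conformal manifold of Riemannian signature and dimension $d\ge 3$. Let $\mathcal T M$ be its standard tractor bundle, let $\mathcal T^\Phi M$ be a tensor power of $\mathcal T M$ or a tensor part of one (the subbundle given by a subspace stable under the orthogonal group of the tractor metric $h$), and let $\mathcal T^\Phi M[w]$ be this bundle tensored with the conformal densities $\mathcal E M[w]$. Let $D^A$ be the Thomas D-operator, in a scale $g\in\boldsymbol c$ and on weight $w$ $$D^A\stackrel g=\big((d+2w-2)w,\ (d+2w-2)\nabla_a,\ -(\Delta+w\mathrm J)\big),$$ with $\nabla$ the coupled Levi-Civita--tractor connection, $\Delta=g^{ab}\nabla_a\nabla_b$, $\mathrm J=\mathrm{Sc}/(2(d-1))$. For $\sigma\in\Gamma(\mathcal E M[1])$ put $I_\sigma^A=\frac1d D^A\sigma$ and $I_\sigma^2=h(I_\sigma,I_\sigma)$. Let $\Sigma\subset M$ be a hypersurface and $\bar\sigma\in\Gamma(\mathcal E M[1])$ a *conformal unit defining density* for it: $\Sigma$ is the zero locus of $\bar\sigma$, $\nabla\bar\sigma\ne0$ along $\Sigma$, and $I_{\bar\sigma}^2=1+\bar\sigma^dB$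 for some smooth $B\in\Gamma(\mathcal E M[-d])$; suppose also $I_{\bar\sigma}^2>0$ on $M$. For an integer $k\ge1$ let $$\mathcal P_k^{\bar\sigma}=\Big(-\frac1{I_{\bar\sigma}^2}\,I_{\bar\sigma}\cdot D\Big)^k .$$ 1. $\mathcal P_k^{\bar\sigma}$ is a well-defined (conformally invariant) smooth linear differential operator $\Gamma\big(\mathcal T^\Phi M[\tfrac{k-d+1}2]\big)\to\Gamma\big(\mathcal T^\Phi M[\tfrac{-k-d+1}2]\big)$, and it is tangential: $\mathcal P_k^{\bar\sigma}(\bar\sigma f)=\bar\sigma\,\widetilde{\mathcal P}f$ for all $f\in\Gamma\big(\mathcal T^\Phi M[\tfrac{k-d-1}2]\big)$, for some smooth linear differential operator $\widetilde{\mathcal P}:\Gamma\big(\mathcal T^\Phi M[\tfrac{k-d-1}2]\big)\to\Gamma\big(\mathcal T^\Phi M[\tfrac{-k-d-1}2]\big)$. 2. Hence it induces a linear differential operator along $\Sigma$ (the *extrinsic conformal Laplacian*) $$\mathsf P_k:\Gamma\big(\mathcal T^\Phi M[\tfrac{k-d+1}2]\big)\big|_\Sigma\to\Gamma\big(\mathcal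 T^\Phi M[\tfrac{-k-d+1}2]\big)\big|_\Sigma ,\qquad \mathsf P_k(f|_\Sigma)=(\mathcal P_k^{\bar\sigma}f)|_\Sigma .$$ 3. If $k$ is even, then in any scale $\mathsf P_k$ equals $(-1)^k\big((k-1)!!\big)^2(\Delta^{\!\top})^{k/2}$ plus a differential operator of order at most $k-1$. Here $\Delta^{\!\top}=g^{ab}\nabla^\top_a\nabla^\top_b$, $\nabla^\top_a=(\delta_a^b-\hat n_a\hat n^b)\nabla_b$, and $\hat n=\nabla\bar\sigma/|\nabla\bar\sigma|$ near $\Sigma$. 4. If $k\le d-1$, then $\mathsf P_k$ is determined by $(M,\boldsymbol c,\Sigma)$ and, for odd $k$, the co-orientation of $\Sigma$. That is, let $\bar\sigma'$ be another conformal unit defining density for $\Sigma$ with $I_{\bar\sigma'}^2>0$ on $M$. At each $p\in\Sigma$ the differentials of $\bar\sigma'$ and $\bar\sigma$ are proportional, and for all $f\in\Gamma\big(\mathcal T^\Phi M[\tfrac{k-d+1}2]\big)$: $(\mathcal P_k^{\bar\sigma'}f)(p)=(\mathcal P_k^{\bar\sigma}f)(p)$ if the factor is positive, and $(\mathcal P_k^{\bar\sigma'}f)(p)=(-1)^k(\mathcal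 P_k^{\bar\sigma}f)(p)$ if it is negative. -/

import Mathlib

open scoped Manifold ContDiff

noncomputable section

namespace ConformalTractor

/-! ### Metrics and conformal structures -/

/-- The model space of a `d`-dimensional manifold. -/
abbrev Model (d : ℕ) : Type := EuclideanSpace ℝ (Fin d)

/-- Smooth Riemannian metrics on a `d`-manifold `M`. -/
abbrev SmoothMetric (d : ℕ) (M : Type*) [TopologicalSpace M] [ChartedSpace (Model d) M]
    [IsManifold (𝓡 d) ∞ M] :=
  Bundle.ContMDiffRiemannianMetric (𝓡 d) ∞ (Model d)
    (fun x : M => TangentSpace (𝓡 d) x)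

/-- `g' = Ω² g` with `Ω` smooth and positive. -/
structure IsRescaling {d : ℕ} {M : Type*} [TopologicalSpace M] [ChartedSpace (Model d) M]
    [IsManifold (𝓡 d) ∞ M] (Ω : M → ℝ) (g g' : SmoothMetric d M) : Prop where
  smooth : ContMDiff (𝓡 d) 𝓘(ℝ) ∞ Ω
  pos : ∀ x, 0 < Ω x
  eq : ∀ (x : M) (v w : TangentSpace (𝓡 d) x), g'.inner x v w = Ω x ^ 2 * g.inner x v w

/-- A conformal structure: an equivalence class of metrics under conformal rescaling. -/
structure ConformalStructure (d : ℕ) (M : Type*) [TopologicalSpace M] [ChartedSpace (Model d) M]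
    [IsManifold (𝓡 d) ∞ M] where
  metrics : Set (SmoothMetric d M)
  nonempty : metrics.Nonempty
  mem_iff : ∀ g ∈ metrics, ∀ g', g' ∈ metrics ↔ ∃ Ω, IsRescaling Ω g g'

/-! ### Local Riemannian geometry

`G` is the matrix of components `g_{ij}` of a metric in a coordinate chart. -/

/-- The partial derivative `∂_a f`. -/
def pd {d : ℕ} {V : Type*} [NormedAddCommGroup V] [NormedSpace ℝ V]
    (a : Fin d) (f : Model d → V) (y : Model d) : V :=
  fderiv ℝ f y (EuclideanSpace.single a 1)

/-- The Christoffel symbol `Γ^c_{ab}`. -/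
def christoffel {d : ℕ} (G : Model d → Matrix (Fin d) (Fin d) ℝ) (c a b : Fin d)
    (y : Model d) : ℝ :=
  (1 / 2) * ∑ e, (G y)⁻¹ c e *
    (pd a (fun z => G z b e) y + pd b (fun z => G z a e) y - pd e (fun z => G z a b) y)

/-- The Riemann curvature `R_{ab}{}^c{}_d`, with
`R(u,v)w = ∇_u ∇_v w - ∇_v ∇_u w - ∇_{[u,v]} w = u^a v^b w^d R_{ab}{}^c{}_d`. -/
def riemann {d : ℕ} (G : Model d → Matrix (Fin d) (Fin d) ℝ) (a b c f : Fin d)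
    (y : Model d) : ℝ :=
  pd a (christoffel G c b f) y - pd b (christoffel G c a f) y
    + ∑ e, (christoffel G c a e y * christoffel G e b f y
      - christoffel G c b e y * christoffel G e a f y)

/-- The Ricci tensor `Ric_{ab} = R_{ca}{}^c{}_b`. -/
def ricci {d : ℕ} (G : Model d → Matrix (Fin d) (Fin d) ℝ) (a b : Fin d) (y : Model d) : ℝ :=
  ∑ c, riemann G c a c b y

/-- The scalar curvature. -/
def scalarCurv {d : ℕ} (G : Model d → Matrix (Fin d) (Fin d) ℝ) (y : Model d) : ℝ :=
  ∑ a, ∑ b, (G y)⁻¹ a b * ricci G a b y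

/-- `J = Sc / (2 (d - 1))`. -/
def schoutenTrace {d : ℕ} (G : Model d → Matrix (Fin d) (Fin d) ℝ) (y : Model d) : ℝ :=
  scalarCurv G y / (2 * ((d : ℝ) - 1))

/-- The Schouten tensor: `Ric_{ab} = (d - 2) P_{ab} + J g_{ab}` (for `d ≥ 3`). -/
def schouten {d : ℕ} (G : Model d → Matrix (Fin d) (Fin d) ℝ) (a b : Fin d) (y : Model d) : ℝ :=
  (ricci G a b y - schoutenTrace G y * G y a b) / ((d : ℝ) - 2)

/-! ### Tractor algebra -/

/-- The slots of a standard tractor `(σ, μ_a, ρ)` in a scale and a chart. -/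
abbrev Slot (d : ℕ) : Type := Unit ⊕ (Fin d ⊕ Unit)

/-- Assemble `(σ, μ_a, ρ)`. -/
def slots {d : ℕ} {V : Type*} (s : V) (μ : Fin d → V) (r : V) : Slot d → V
  | Sum.inl _ => s
  | Sum.inr (Sum.inl a) => μ a
  | Sum.inr (Sum.inr _) => r

/-- Components of a rank `m` tractor tensor. -/
abbrev Tensor (d m : ℕ) : Type := (Fin m → Slot d) → ℝ

/-- The scalar underlying a tensor of rank zero. -/
def scalar {d : ℕ} (t : Tensor d 0) : ℝ := t Fin.elim0

/-- The tractor metric `h_{AB}`, i.e. `h(U,V) = σ κ + g^{ab} μ_a ν_b + ρ τ`, for the inner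
product `g` on the tangent space with matrix `g`. -/
def tractorGram {d : ℕ} (g : Matrix (Fin d) (Fin d) ℝ) : Matrix (Slot d) (Slot d) ℝ :=
  Matrix.of <| slots (slots 0 (fun _ => 0) 1)
    (fun a => slots 0 (fun b => g⁻¹ a b) 0) (slots 1 (fun _ => 0) 0)

/-- The diagonal action of a matrix on tensors of rank `m`. -/
def tensorAct {d m : ℕ} (A : Matrix (Slot d) (Slot d) ℝ) : Tensor d m →ₗ[ℝ] Tensor d m where
  toFun t := fun I => ∑ K : Fin m → Slot d, (∏ i, A (I i) (K i)) * t K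
  map_add' s t := by
    funext I
    simp [mul_add, Finset.sum_add_distrib]
  map_smul' r t := by
    funext I
    simp only [Pi.smul_apply, smul_eq_mul, RingHom.id_apply, Finset.mul_sum]
    exact Finset.sum_congr rfl fun K _ => by ring

/-- A tensor part of the `m`-th tensor power of the standard tractor representation: a subspace
stable under the orthogonal group of the tractor metric. -/
structure TensorPart (d m : ℕ) where
  carrier : Submodule ℝ (Tensor d m)
  invariant : ∀ A : Matrix (Slot d) (Slot d) ℝ,
    A.transpose * tractorGram 1 * A = tractorGram 1 → carrier ≤ carrier.comap (tensorAct A)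

/-- The corresponding subspace of tractor tensors at a point where the metric has matrix `g`:
the tensors that any isometry to the model sends into the model subspace. -/
def TensorPart.fiber {d m : ℕ} (Φ : TensorPart d m) (g : Matrix (Fin d) (Fin d) ℝ) :
    Submodule ℝ (Tensor d m) :=
  ⨅ A : {A : Matrix (Slot d) (Slot d) ℝ // A.transpose * tractorGram 1 * A = tractorGram g},
    Φ.carrier.comap (tensorAct A.1)

/-! ### Local tractor calculus

Densities are trivialized by the scale `g`, whose Levi-Civita connection is then the flat
connection on them. -/

/-- The connection matrix of the tractor connection: `∇_a U = ∂_a U + ω_a U` on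
`U = (σ, μ_b, ρ)`, where `∇_a σ - μ_a`, `∇_a μ_b + g_{ab} ρ + P_{ab} σ`, `∇_a ρ - P_{ac} μ^c` are
the slots of `∇_a U`. -/
def connMatrix {d : ℕ} (G : Model d → Matrix (Fin d) (Fin d) ℝ) (a : Fin d) (y : Model d) :
    Matrix (Slot d) (Slot d) ℝ :=
  Matrix.of <| slots
    (slots 0 (fun c => if c = a then -1 else 0) 0)
    (fun b => slots (schouten G a b y) (fun c => -christoffel G c a b y) (G y a b))
    (slots 0 (fun c => -∑ e, schouten G a e y * (G y)⁻¹ e c) 0)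

/-- The tractor connection on tensors of rank `m`. -/
def cov {d m : ℕ} (G : Model d → Matrix (Fin d) (Fin d) ℝ) (a : Fin d)
    (t : Model d → Tensor d m) (y : Model d) : Tensor d m :=
  pd a t y + fun I => ∑ i, ∑ K, connMatrix G a y (I i) K * t y (Function.update I i K)

/-- The Laplacian `g^{ab} ∇_a ∇_b` of the coupled Levi-Civita-tractor connection. -/
def laplacian {d m : ℕ} (G : Model d → Matrix (Fin d) (Fin d) ℝ)
    (t : Model d → Tensor d m) (y : Model d) : Tensor d m :=
  ∑ a, ∑ b, (G y)⁻¹ a b •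
    (cov G a (cov G b t) y - ∑ c, christoffel G c a b y • cov G c t y)

/-- The Thomas D-operator on tractors of weight `w`, with the new index `A` listed first. -/
def thomasD {d m : ℕ} (G : Model d → Matrix (Fin d) (Fin d) ℝ) (w : ℝ)
    (t : Model d → Tensor d m) (y : Model d) : Slot d → Tensor d m :=
  slots ((((d : ℝ) + 2 * w - 2) * w) • t y)
    (fun a => ((d : ℝ) + 2 * w - 2) • cov G a t y)
    (-(laplacian G t y + (w * schoutenTrace G y) • t y))

/-- `D̂ = D / (d + 2 w - 2)`. -/
def thomasDHat {d m : ℕ} (G : Model d → Matrix (Fin d) (Fin d) ℝ) (w : ℝ)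
    (t : Model d → Tensor d m) (y : Model d) : Slot d → Tensor d m :=
  ((d : ℝ) + 2 * w - 2)⁻¹ • thomasD G w t y

/-- The scale tractor `I = D̂ σ` of a density `σ` of weight one. -/
def scaleTractor {d : ℕ} (G : Model d → Matrix (Fin d) (Fin d) ℝ)
    (s : Model d → Tensor d 0) (y : Model d) (A : Slot d) : ℝ :=
  scalar (thomasDHat G 1 s y A)

/-- `I² = h(I, I)`. -/
def scaleSq {d : ℕ} (G : Model d → Matrix (Fin d) (Fin d) ℝ)
    (s : Model d → Tensor d 0) (y : Model d) : ℝ :=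
  ∑ A, ∑ B, tractorGram (G y) A B * scaleTractor G s y A * scaleTractor G s y B

/-- The Laplace-Robin operator `I·D = h_{AB} I^A D^B` on tractors of weight `w`. -/
def laplaceRobin {d m : ℕ} (G : Model d → Matrix (Fin d) (Fin d) ℝ)
    (s : Model d → Tensor d 0) (w : ℝ) (t : Model d → Tensor d m) (y : Model d) : Tensor d m :=
  ∑ A, ∑ B, (tractorGram (G y) A B * scaleTractor G s y A) • thomasD G w t y B

/-- The operator `y = -I⁻² I·D` on tractors of weight `w`. -/
def yOp {d m : ℕ} (G : Model d → Matrix (Fin d) (Fin d) ℝ)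
    (s : Model d → Tensor d 0) (w : ℝ) (t : Model d → Tensor d m) (y : Model d) : Tensor d m :=
  -((scaleSq G s y)⁻¹ • laplaceRobin G s w t y)

/-- The `k`-fold composition of `y`, starting at weight `w`; each factor lowers the weight by
one. -/
def yPow {d m : ℕ} (G : Model d → Matrix (Fin d) (Fin d) ℝ) (s : Model d → Tensor d 0) :
    ℕ → ℝ → (Model d → Tensor d m) → (Model d → Tensor d m)
  | 0, _, t => t
  | k + 1, w, t => yPow G s k (w - 1) (yOp G s w t)

/-- The projection `δ_a^c - n̂_a n̂^c` orthogonal to `n̂ = ∇σ / |∇σ|` (where `∇σ ≠ 0`). -/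
def tangProj {d : ℕ} (G : Model d → Matrix (Fin d) (Fin d) ℝ)
    (s : Model d → Tensor d 0) (a c : Fin d) (y : Model d) : ℝ :=
  (if a = c then 1 else 0)
    - pd a (fun z => scalar (s z)) y * (∑ b, (G y)⁻¹ c b * pd b (fun z => scalar (s z)) y)
      / ∑ b, ∑ e, (G y)⁻¹ b e * pd b (fun z => scalar (s z)) y * pd e (fun z => scalar (s z)) y

/-- The tangential derivative `∇^⊤_a = (δ_a^c - n̂_a n̂^c) ∇_c` of a tractor. -/
def tangCov {d m : ℕ} (G : Model d → Matrix (Fin d) (Fin d) ℝ) (s : Model d → Tensor d 0)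
    (a : Fin d) (t : Model d → Tensor d m) (y : Model d) : Tensor d m :=
  ∑ c, tangProj G s a c y • cov G c t y

/-- The tangential Laplacian `Δ^⊤ = g^{ab} ∇^⊤_a ∇^⊤_b`, the outer derivative being that of the
coupled Levi-Civita-tractor connection on tractor valued one-forms. -/
def tangLaplacian {d m : ℕ} (G : Model d → Matrix (Fin d) (Fin d) ℝ) (s : Model d → Tensor d 0)
    (t : Model d → Tensor d m) (y : Model d) : Tensor d m :=
  ∑ a, ∑ b, (G y)⁻¹ a b • ∑ c, tangProj G s a c y •
    (cov G c (tangCov G s b t) y - ∑ e, christoffel G e c b y • tangCov G s e t y)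

/-! ### Tractor fields on a conformal manifold -/

section Manifold

variable {d : ℕ} {M : Type*} [TopologicalSpace M] [ChartedSpace (Model d) M]
  [IsManifold (𝓡 d) ∞ M]

/-- A gauge: a smooth chart of `M` and a metric of the conformal class. -/
structure Gauge (c : ConformalStructure d M) where
  chart : OpenPartialHomeomorph M (Model d)
  chart_mem : chart ∈ IsManifold.maximalAtlas (𝓡 d) ∞ M
  metric : SmoothMetric d M
  metric_mem : metric ∈ c.metrics

/-- The components `g_{ij}` in a gauge, as functions of the coordinates. -/
def Gauge.G {c : ConformalStructure d M} (γ : Gauge c) (y : Model d) :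
    Matrix (Fin d) (Fin d) ℝ :=
  Matrix.of fun i j => γ.metric.inner (γ.chart.symm y)
    (mfderiv (𝓡 d) (𝓡 d) γ.chart.symm y (EuclideanSpace.single i (1 : ℝ) : Model d))
    (mfderiv (𝓡 d) (𝓡 d) γ.chart.symm y (EuclideanSpace.single j (1 : ℝ) : Model d))

/-- The change of splitting under `ĝ = Ω² g`, in a chart `φ`:
`(σ, μ_b, ρ) ↦ (σ, μ_b + σ Υ_b, ρ - Υ·μ - σ |Υ|² / 2)` with `Υ = d log Ω`, where the three slots,
being densities of weights `1`, `1`, `-1` trivialized by `g` and then by `ĝ`, are also multiplied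
by `Ω`, `Ω`, `Ω⁻¹`. -/
def rescaleMatrix {c : ConformalStructure d M} (γ : Gauge c) (Ω : M → ℝ) (y : Model d) :
    Matrix (Slot d) (Slot d) ℝ :=
  let r : ℝ := Ω (γ.chart.symm y)
  let Υ : Fin d → ℝ := fun b => pd b (fun z => Real.log (Ω (γ.chart.symm z))) y
  let Υup : Fin d → ℝ := fun b => ∑ e, (γ.G y)⁻¹ b e * Υ e
  Matrix.of <| slots
    (slots r (fun _ => 0) 0)
    (fun b => slots (r * Υ b) (fun e => if b = e then r else 0) 0)
    (slots (-(r⁻¹ * (∑ b, Υ b * Υup b) / 2)) (fun e => -(r⁻¹ * Υup e)) r⁻¹)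

/-- The change of chart: the middle slot is a covector, `μ'_a = (∂x^b / ∂x'^a) μ_b`. -/
def chartMatrix {c : ConformalStructure d M} (γ γ' : Gauge c) (p : M) :
    Matrix (Slot d) (Slot d) ℝ :=
  Matrix.of <| slots
    (slots 1 (fun _ => 0) 0)
    (fun a => slots 0
      (fun b => fderiv ℝ (fun z => γ.chart (γ'.chart.symm z)) (γ'.chart p)
        (EuclideanSpace.single a (1 : ℝ)) b) 0)
    (slots 0 (fun _ => 0) 1)

/-- A family of rank `m` components, one for each gauge, as functions of the coordinates. -/
abbrev Components (c : ConformalStructure d M) (m : ℕ) := Gauge c → Model d → Tensor d m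

/-- The smooth sections of the `m`-th tensor power of the standard tractor bundle with weight
`w`: families of smooth components related by the transformation law under changes of chart and
scale. (Outside the image of the chart the components are set to zero.) For `m = 0` these are the
conformal densities of weight `w`. -/
def tractorFields (c : ConformalStructure d M) (m : ℕ) (w : ℝ) :
    Submodule ℝ (Components c m) where
  carrier := {f |
    (∀ γ, ContDiffOn ℝ ∞ (f γ) γ.chart.target) ∧
    (∀ γ, ∀ y ∉ γ.chart.target, f γ y = 0) ∧
    (∀ (γ γ' : Gauge c) (Ω : M → ℝ), IsRescaling Ω γ.metric γ'.metric →
      ∀ p ∈ γ.chart.source, p ∈ γ'.chart.source →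
        f γ' (γ'.chart p) = Ω p ^ w •
          tensorAct (chartMatrix γ γ' p * rescaleMatrix γ Ω (γ.chart p)) (f γ (γ.chart p)))}
  zero_mem' := ⟨fun _ => contDiffOn_const, fun _ _ _ => rfl, fun _ _ _ _ _ _ _ => by simp⟩
  add_mem' := fun {f g} hf hg =>
    ⟨fun γ => (hf.1 γ).add (hg.1 γ),
      fun γ y hy => by simp [hf.2.1 γ y hy, hg.2.1 γ y hy],
      fun γ γ' Ω hΩ p hp hp' => by
        simp only [Pi.add_apply, map_add, smul_add]
        rw [hf.2.2 γ γ' Ω hΩ p hp hp', hg.2.2 γ γ' Ω hΩ p hp hp']⟩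
  smul_mem' := fun r f hf =>
    ⟨fun γ => (hf.1 γ).const_smul r,
      fun γ y hy => by simp [hf.2.1 γ y hy],
      fun γ γ' Ω hΩ p hp hp' => by
        simp only [Pi.smul_apply, map_smul]
        rw [hf.2.2 γ γ' Ω hΩ p hp hp', smul_comm]⟩

/-- The smooth conformal densities of weight `w`. -/
abbrev densities (c : ConformalStructure d M) (w : ℝ) : Submodule ℝ (Components c 0) :=
  tractorFields c 0 w

/-- The families of components with values in the tensor part `Φ`. -/
def partValued {m : ℕ} (c : ConformalStructure d M) (Φ : TensorPart d m) :
    Submodule ℝ (Components c m) where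
  carrier := {f | ∀ γ, ∀ y ∈ γ.chart.target, f γ y ∈ Φ.fiber (γ.G y)}
  zero_mem' := by
    intro γ y _
    exact (Φ.fiber (γ.G y)).zero_mem
  add_mem' := by
    intro f g hf hg γ y hy
    have h := (Φ.fiber (γ.G y)).add_mem (hf γ y hy) (hg γ y hy)
    exact h
  smul_mem' := by
    intro r f hf γ y hy
    have h := (Φ.fiber (γ.G y)).smul_mem r (hf γ y hy)
    exact h

/-- The smooth sections `Γ(T^Φ M[w])` of the tractor bundle of a tensor part `Φ`. -/
def sections {m : ℕ} (c : ConformalStructure d M) (Φ : TensorPart d m) (w : ℝ) :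
    Submodule ℝ (Components c m) :=
  tractorFields c m w ⊓ partValued c Φ

theorem tensorAct_zero_rank (A : Matrix (Slot d) (Slot d) ℝ) (t : Tensor d 0) :
    tensorAct A t = t := by
  funext I
  change ∑ K : Fin 0 → Slot d, (∏ i, A (I i) (K i)) * t K = t I
  rw [Fintype.sum_eq_single I fun K hK => absurd (Subsingleton.elim K I) hK]
  simp

/-- Multiplication by a density of weight one, `x f = σ f`. -/
def mulDensity {m : ℕ} {c : ConformalStructure d M} (Φ : TensorPart d m)
    (σ : densities c 1) (w : ℝ) : sections c Φ (w - 1) →ₗ[ℝ] sections c Φ w where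
  toFun f := ⟨fun γ y => scalar (σ.1 γ y) • f.1 γ y, by
    refine ⟨⟨fun γ => ?_, fun γ y hy => ?_, fun γ γ' Ω hΩ p hp hp' => ?_⟩, fun γ y hy => ?_⟩
    · exact (contDiffOn_pi.1 (σ.2.1 γ) Fin.elim0).smul (f.2.1.1 γ)
    · simp [f.2.1.2.1 γ y hy]
    · have h1 := σ.2.2.2 γ γ' Ω hΩ p hp hp'
      rw [tensorAct_zero_rank] at h1
      have h2 := f.2.1.2.2 γ γ' Ω hΩ p hp hp'
      have h3 : Ω p ^ w = Ω p ^ (1 : ℝ) * Ω p ^ (w - 1) := by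
        rw [← Real.rpow_add (hΩ.pos p)]
        ring_nf
      simp only [h1, h2, h3, scalar, Pi.smul_apply, map_smul, smul_smul, smul_eq_mul]
      congr 1
      ring
    · exact Submodule.smul_mem _ _ (f.2.2 γ y hy)⟩
  map_add' f g := by
    ext γ y I
    simp [mul_add]
  map_smul' r f := by
    ext γ y I
    simp only [Submodule.coe_smul, Pi.smul_apply, smul_eq_mul, RingHom.id_apply]
    ring

/-! ### Hypersurfaces and conformal unit defining densities -/

/-- `σ` is a defining density of `S`: `S` is its zero locus and `∇σ` vanishes nowhere on `S`. -/
structure IsDefiningDensity {c : ConformalStructure d M} (S : Set M) (σ : densities c 1) :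
    Prop where
  zero_iff : ∀ γ : Gauge c, ∀ p ∈ γ.chart.source, p ∈ S ↔ scalar (σ.1 γ (γ.chart p)) = 0
  deriv_ne : ∀ γ : Gauge c, ∀ p ∈ γ.chart.source, p ∈ S →
    fderiv ℝ (fun z => scalar (σ.1 γ z)) (γ.chart p) ≠ 0

/-- A conformal unit defining density of `S`: `I² = 1 + σ^d B` for a smooth density `B` of
weight `-d`. -/
structure IsConformalUnit {c : ConformalStructure d M} (S : Set M) (σ : densities c 1) :
    Prop extends IsDefiningDensity S σ where
  unit : ∃ B : densities c (-(d : ℝ)), ∀ γ : Gauge c, ∀ y ∈ γ.chart.target,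
    scaleSq γ.G (σ.1 γ) y = 1 + scalar (σ.1 γ y) ^ d * scalar (B.1 γ y)

/-- `I² > 0` everywhere on `M`. -/
def PositiveScale {c : ConformalStructure d M} (σ : densities c 1) : Prop :=
  ∀ γ : Gauge c, ∀ y ∈ γ.chart.target, 0 < scaleSq γ.G (σ.1 γ) y

/-- At `p`, the differential of `σ'` is `r` times that of `σ` for some positive multiple `r` of
`ε`. With `ε = 1` the densities co-orient their common zero locus in the same way at `p`, with
`ε = -1` in opposite ways. -/
def CoorientedAt {c : ConformalStructure d M} (σ σ' : densities c 1) (ε : ℝ) (p : M) : Prop :=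
  ∀ γ : Gauge c, p ∈ γ.chart.source → ∃ r : ℝ, 0 < r ∧
    fderiv ℝ (fun z => scalar (σ'.1 γ z)) (γ.chart p)
      = (ε * r) • fderiv ℝ (fun z => scalar (σ.1 γ z)) (γ.chart p)

/-- The components of `(-I⁻² I·D)^k f` for `f` of weight `w`. -/
def laplaceRobinPow {m : ℕ} {c : ConformalStructure d M} (σ : densities c 1) (k : ℕ) (w : ℝ)
    (f : Components c m) : Components c m :=
  fun γ => Set.indicator γ.chart.target (yPow γ.G (σ.1 γ) k w (f γ))

/-! ### Differential operators, restriction to a hypersurface -/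

/-- Linear maps from the `j`-jets (of order exactly `j`) of tensor valued functions to tensors. -/
abbrev JetCoeff (d m j : ℕ) : Type :=
  ContinuousMultilinearMap ℝ (fun _ : Fin j => Model d) (Tensor d m) →L[ℝ] Tensor d m

/-- Linear differential operators with smooth coefficients. -/
def IsDifferentialOperator {m : ℕ} {c : ConformalStructure d M} {Φ : TensorPart d m}
    {w w' : ℝ} (P : sections c Φ w →ₗ[ℝ] sections c Φ w') : Prop :=
  ∃ N : ℕ, ∀ γ : Gauge c, ∃ A : (j : ℕ) → Model d → JetCoeff d m j,
    (∀ j, ContDiffOn ℝ ∞ (A j) γ.chart.target) ∧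
    ∀ f : sections c Φ w, ∀ y ∈ γ.chart.target,
      (P f).1 γ y = ∑ j ∈ Finset.range (N + 1), A j y (iteratedFDeriv ℝ j (f.1 γ) y)

/-- `P` is tangential for `σ`: `P ∘ x = x ∘ P'` for a smooth (differential) operator `P'`, where
`x` is multiplication by `σ`. -/
def IsTangential {m : ℕ} {c : ConformalStructure d M} {Φ : TensorPart d m} {w w' : ℝ}
    (σ : densities c 1) (P : sections c Φ w →ₗ[ℝ] sections c Φ w') : Prop :=
  ∃ P' : sections c Φ (w - 1) →ₗ[ℝ] sections c Φ (w' - 1), IsDifferentialOperator P' ∧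
    P ∘ₗ mulDensity Φ σ w = mulDensity Φ σ w' ∘ₗ P'

/-- The sections that vanish along `S`. -/
def vanishing {m : ℕ} (c : ConformalStructure d M) (Φ : TensorPart d m) (w : ℝ) (S : Set M) :
    Submodule ℝ (sections c Φ w) where
  carrier := {f | ∀ γ : Gauge c, ∀ p ∈ γ.chart.source, p ∈ S → f.1 γ (γ.chart p) = 0}
  zero_mem' := fun _ _ _ _ => rfl
  add_mem' := fun hf hg γ p hp hS => by simp [hf γ p hp hS, hg γ p hp hS]
  smul_mem' := fun r _ hf γ p hp hS => by simp [hf γ p hp hS]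

/-- `Γ(T^Φ M[w])|_S`: sections along `S`, i.e. sections modulo those vanishing along `S`. -/
abbrev SectionsAlong {m : ℕ} (c : ConformalStructure d M) (Φ : TensorPart d m) (w : ℝ)
    (S : Set M) : Type _ :=
  sections c Φ w ⧸ vanishing c Φ w S

/-- Restriction of a section to `S`. -/
abbrev restrict {m : ℕ} {c : ConformalStructure d M} {Φ : TensorPart d m} {w : ℝ} (S : Set M) :
    sections c Φ w →ₗ[ℝ] SectionsAlong c Φ w S :=
  (vanishing c Φ w S).mkQ

/-- `Q` is a differential operator along `S`: in each gauge, the values of `Q (f|_S)` are those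
along `S` of a differential expression in `f` with coefficients smooth near `S`. -/
def IsDifferentialOperatorAlong {m : ℕ} {c : ConformalStructure d M} {Φ : TensorPart d m}
    {w w' : ℝ} (S : Set M) (Q : SectionsAlong c Φ w S →ₗ[ℝ] SectionsAlong c Φ w' S) : Prop :=
  ∃ N : ℕ, ∀ γ : Gauge c, ∃ U : Set (Model d), IsOpen U ∧ U ⊆ γ.chart.target ∧
    (∀ p ∈ γ.chart.source, p ∈ S → γ.chart p ∈ U) ∧
    ∃ A : (j : ℕ) → Model d → JetCoeff d m j,
      (∀ j, ContDiffOn ℝ ∞ (A j) U) ∧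
      ∀ (f : sections c Φ w) (h : sections c Φ w'), Q (restrict S f) = restrict S h →
        ∀ p ∈ γ.chart.source, p ∈ S →
          h.1 γ (γ.chart p)
            = ∑ j ∈ Finset.range (N + 1), A j (γ.chart p)
                (iteratedFDeriv ℝ j (f.1 γ) (γ.chart p))

/-- `Q` has leading term `C (Δ^⊤)^l`: in each gauge `Q = C (Δ^⊤)^l + L` along `S` with `L` a
differential operator of order less than `2 l` with coefficients smooth near `S`. -/
def HasLeadingTerm {m : ℕ} {c : ConformalStructure d M} {Φ : TensorPart d m}
    {w w' : ℝ} (S : Set M) (σ : densities c 1)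
    (Q : SectionsAlong c Φ w S →ₗ[ℝ] SectionsAlong c Φ w' S) (C : ℝ) (l : ℕ) : Prop :=
  ∀ γ : Gauge c, ∃ U : Set (Model d), IsOpen U ∧ U ⊆ γ.chart.target ∧
    (∀ p ∈ γ.chart.source, p ∈ S → γ.chart p ∈ U) ∧
    ∃ A : (j : ℕ) → Model d → JetCoeff d m j,
      (∀ j, ContDiffOn ℝ ∞ (A j) U) ∧
      ∀ (f : sections c Φ w) (h : sections c Φ w'), Q (restrict S f) = restrict S h →
        ∀ p ∈ γ.chart.source, p ∈ S →
          h.1 γ (γ.chart p)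
            = C • (tangLaplacian γ.G (σ.1 γ))^[l] (f.1 γ) (γ.chart p)
              + ∑ j ∈ Finset.range (2 * l), A j (γ.chart p)
                  (iteratedFDeriv ℝ j (f.1 γ) (γ.chart p))

end Manifold

end ConformalTractor

end

open ConformalTractor

/-! Let `y` denote `-I⁻² I·D` and `x` multiplication by `σ`. The Leibniz rule for the Laplacian
gives `I·D (σ t) = σ I·D t + (d + 2w - 2) I² t` at weight `w` (`lrR_smul`), so that `x`, `y` and the
weight obey `sl(2)` relations. Iterating them, `y^k x = x y^k - k (d + 2w - 1 - k) y^(k-1)`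
(`yPowR_smul`), and the correction disappears at `w = (k - d + 1) / 2`. This is tangentiality.

These identities, and the transformation laws of curvature, tractor connection and Laplacian,
involve only derivations. They are therefore proved over a commutative `ℝ`-algebra with `d`
derivations and specialised afterwards to the ring `Sm U` of smooth functions on an open set of
coordinates. Invariance of `I·D` is obtained for a change of scale (`lrR_conformal`) and for a
change of coordinates (`lrR_eq`), and the two are combined in `laplaceRobin_change`. Tensor parts
are preserved because the tractor metric is parallel (`conn_gramR`): along a coordinate line a curve
of isometries can be chosen whose velocity is the connection matrix (`exists_isometry_curve`), and
it carries the section into one fixed closed subspace.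

Descent to the hypersurface uses division to finite order only: a section vanishing on it is locally
`σ g + r` with `r` vanishing there to order `k + 1` (`exists_eq_mul_add`). The second order part of
`y` carries the factor `σ`, so each `y` lowers the order of vanishing by at most one. Hence `y^k r`
vanishes on the hypersurface, and `y^k (σ g)` does so by tangentiality.

For the leading term, with `k = 2l`, an operator has order less than `2l` at `p`, as far as jets of
functions can tell, once it kills at `p` every tensor vanishing there to order `2l` (`IsJet.tail`).
On such a tensor a multiple of `σ` may be subtracted to make the normal derivative vanish to order
`2l` too (`exists_dir_mem_van`). Neither `y^(2l)` nor the symbol of `(Δ^⊤)^l` notices the change at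
`p`. After it, `y τ` equals `σ Δ τ` up to order `2l`, and the `sl(2)` relation trades two factors
`y` for one Laplacian and a number. At the critical weight the numbers multiply to `((2l - 1)!!)²`
(`eval_yPowR_critical`).

For independence of `σ`, two conformal unit defining densities have unit differential along the
hypersurface, so these agree up to sign. With `δ` the difference after fixing the sign and `N` the
gradient of `σ`, the equation for `I²` linearises to `N δ - d⁻¹ σ N N δ = 0` up to higher order. If
`δ` vanishes to order `i + 2`, applying `N^(i+1)` produces the indicial factor `d - (i + 1)`, which
is nonzero for `i + 1 < d`. So `δ` vanishes to order `d + 1` (`mem_van_of_isqR`), the coefficients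
of the two operators `y` differ to order `d - 1`, and their `k`-th powers differ to order `d - k ≥
1` (`vanT_yPowR_sub_yPowR`). -/

open scoped Manifold ContDiff

noncomputable section

namespace ConformalTractor

/-! ### Riemannian geometry over a differential ring -/

section DifferentialRing

variable {d : ℕ} {R : Type*} [CommRing R] [Algebra ℝ R] (D : Fin d → Derivation ℝ R R)

/-- A symmetric matrix `g` with inverse `gi`. -/
structure IsMetricPair (g gi : Matrix (Fin d) (Fin d) R) : Prop where
  symm : ∀ a b, g a b = g b a
  symm_inv : ∀ a b, gi a b = gi b a
  inv_mul : ∀ a b, ∑ e, gi a e * g e b = if a = b then 1 else 0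

theorem IsMetricPair.mul_inv {g gi : Matrix (Fin d) (Fin d) R} (h : IsMetricPair g gi)
    (a b : Fin d) : ∑ e, g a e * gi e b = if a = b then 1 else 0 := by
  have := h.inv_mul b a
  rw [if_congr (eq_comm (a := a)) rfl rfl, ← this]
  exact Finset.sum_congr rfl fun e _ => by rw [h.symm a e, h.symm_inv e b, mul_comm]

theorem IsMetricPair.raise_lower {g gi : Matrix (Fin d) (Fin d) R} (h : IsMetricPair g gi)
    (v : Fin d → R) (a : Fin d) : ∑ e, gi a e * ∑ f, g e f * v f = v a := by
  simp only [Finset.mul_sum, ← mul_assoc]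
  rw [Finset.sum_comm]
  simp [← Finset.sum_mul, h.inv_mul]

theorem IsMetricPair.lower_raise {g gi : Matrix (Fin d) (Fin d) R} (h : IsMetricPair g gi)
    (v : Fin d → R) (a : Fin d) : ∑ e, g a e * ∑ f, gi e f * v f = v a := by
  simp only [Finset.mul_sum, ← mul_assoc]
  rw [Finset.sum_comm]
  simp [← Finset.sum_mul, h.mul_inv]

/-- The Christoffel symbols in a differential ring. -/
def chr (g gi : Matrix (Fin d) (Fin d) R) (c a b : Fin d) : R :=
  (1 / 2 : ℝ) • ∑ e, gi c e * (D a (g b e) + D b (g a e) - D e (g a b))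

/-- The curvature of connection symbols. -/
def riem (Γ : Fin d → Fin d → Fin d → R) (a b c f : Fin d) : R :=
  D a (Γ c b f) - D b (Γ c a f) + ∑ e, (Γ c a e * Γ e b f - Γ c b e * Γ e a f)

/-- The Ricci tensor of connection symbols. -/
def ric (Γ : Fin d → Fin d → Fin d → R) (a b : Fin d) : R :=
  ∑ c, riem D Γ c a c b

/-- `J` of a metric, computed from connection symbols. -/
def jtr (gi : Matrix (Fin d) (Fin d) R) (Γ : Fin d → Fin d → Fin d → R) : R :=
  (2 * ((d : ℝ) - 1))⁻¹ • ∑ a, ∑ b, gi a b * ric D Γ a b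

/-- The Schouten tensor, computed from connection symbols. -/
def sch (g gi : Matrix (Fin d) (Fin d) R) (Γ : Fin d → Fin d → Fin d → R) (a b : Fin d) : R :=
  ((d : ℝ) - 2)⁻¹ • (ric D Γ a b - jtr D gi Γ * g a b)

/-- The symbols `Γ` are torsion free and preserve `g`. -/
structure IsLeviCivita (g : Matrix (Fin d) (Fin d) R) (Γ : Fin d → Fin d → Fin d → R) :
    Prop where
  symm : ∀ c a b, Γ c a b = Γ c b a
  compat : ∀ c a b, D c (g a b) = ∑ e, g e b * Γ e c a + ∑ e, g a e * Γ e c b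

variable {D}

/-- Uniqueness of the Levi-Civita connection: in the Koszul combination of three compatibility
equations all but one lowered symbol cancel. Thanks to it, every transformation law of Christoffel
symbols below needs only a check that a candidate is symmetric and compatible. -/
theorem IsLeviCivita.eq_chr {g gi : Matrix (Fin d) (Fin d) R} (h : IsMetricPair g gi)
    {Γ : Fin d → Fin d → Fin d → R} (hΓ : IsLeviCivita D g Γ) : chr D g gi = Γ := by
  funext c a b
  have h1 : ∀ e, D a (g b e) + D b (g a e) - D e (g a b) = (2 : ℝ) • ∑ f, g e f * Γ f a b := by
    intro e
    rw [hΓ.compat, hΓ.compat, hΓ.compat]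
    simp only [hΓ.symm _ b a, hΓ.symm _ e a, hΓ.symm _ e b, h.symm _ e, two_smul, h.symm _ b]
    ring
  simp only [chr, h1, mul_smul_comm, ← Finset.smul_sum, smul_smul]
  rw [h.raise_lower (fun f => Γ f a b)]
  norm_num

theorem isLeviCivita_chr {g gi : Matrix (Fin d) (Fin d) R} (h : IsMetricPair g gi) :
    IsLeviCivita D g (chr D g gi) := by
  have hlow : ∀ b a c, ∑ e, g b e * chr D g gi e a c
      = (1 / 2 : ℝ) • (D a (g c b) + D c (g a b) - D b (g a c)) := by
    intro b a c
    simp only [chr, mul_smul_comm, ← Finset.smul_sum]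
    rw [h.lower_raise (fun e => D a (g c e) + D c (g a e) - D e (g a c))]
  refine ⟨fun c a b => ?_, fun c a b => ?_⟩
  · unfold chr
    congr 1
    refine Finset.sum_congr rfl fun e _ => ?_
    rw [h.symm a b]
    ring
  · simp only [fun e => h.symm e b]
    rw [hlow, hlow, h.symm b a, ← smul_add]
    module

/-! ### Conformal change -/

/-- The difference of the Levi-Civita connections of `Ω² g` and `g`, for `Υ = d log Ω`. -/
def weylDiff (g : Matrix (Fin d) (Fin d) R) (Υ u : Fin d → R) (c a b : Fin d) : R :=
  (if c = a then Υ b else 0) + (if c = b then Υ a else 0) - g a b * u c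

theorem IsLeviCivita.conformal {g : Matrix (Fin d) (Fin d) R}
    {Γ : Fin d → Fin d → Fin d → R} (hs : ∀ a b, g a b = g b a)
    (hΓ : IsLeviCivita D g Γ) {Υ u : Fin d → R}
    (hu : ∀ a, ∑ c, g a c * u c = Υ a) {o : R} (ho : ∀ a, D a o = Υ a * o) :
    IsLeviCivita D (o ^ 2 • g) (fun c a b => Γ c a b + weylDiff g Υ u c a b) := by
  refine ⟨fun c a b => ?_, fun c a b => ?_⟩
  · simp only [hΓ.symm c b a, weylDiff, hs b a]
    ring
  · have h1 : ∀ a b c, ∑ e, g a e * weylDiff g Υ u e b c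
        = g a b * Υ c + g a c * Υ b - g b c * Υ a := by
      intro a b c
      simp only [weylDiff, mul_add, mul_sub, Finset.sum_add_distrib, Finset.sum_sub_distrib,
        mul_ite, mul_zero, Finset.sum_ite_eq', Finset.mem_univ, if_true]
      rw [← hu a, Finset.mul_sum]
      congr 1
      exact Finset.sum_congr rfl fun e _ => by ring
    simp only [Matrix.smul_apply, smul_eq_mul, Derivation.leibniz, hΓ.compat c a b, mul_add,
      Finset.sum_add_distrib, Derivation.leibniz_pow, ho, mul_assoc, ← Finset.mul_sum]
    simp only [fun e => hs e b, h1]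
    rw [hs b c, hs b a, hs a c]
    simp only [nsmul_eq_mul]
    push_cast
    ring

/-- Expand the curvature of `Γ + W` and contract; `T1` to `T6` and `E1` to `E3` evaluate the
contractions of `W`. The partial derivative of `g` left over from the trace of `D W` is rewritten by
compatibility (`E4`) and cancels against the cross terms of `Γ` with `W`. Closedness of `Υ`
identifies the two derivatives `D a (Υ b)` and `D b (Υ a)`. -/
theorem ric_conformal {g : Matrix (Fin d) (Fin d) R}
    {Γ : Fin d → Fin d → Fin d → R} (hs : ∀ a b, g a b = g b a)
    (hΓ : IsLeviCivita D g Γ) {Υ u : Fin d → R}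
    (hu : ∀ a, ∑ c, g a c * u c = Υ a) (hD : ∀ a b, D a (Υ b) = D b (Υ a)) (a b : Fin d) :
    ric D (fun c a b => Γ c a b + weylDiff g Υ u c a b) a b
      = ric D Γ a b - ((d : R) - 2) * (D a (Υ b) - ∑ e, Γ e a b * Υ e - Υ a * Υ b)
        - (∑ c, D c (u c) + ∑ c, (∑ e, Γ e e c) * u c + ((d : R) - 2) * ∑ c, Υ c * u c)
          * g a b := by
  have hu' : ∀ a, ∑ c, g c a * u c = Υ a := fun a => by simp only [← hu a, hs a]
  have T1 : ∑ c, D c (weylDiff g Υ u c a b)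
      = D a (Υ b) + D b (Υ a) - (∑ c, D c (g a b) * u c) - g a b * ∑ c, D c (u c) := by
    have : ∀ c, D c (weylDiff g Υ u c a b) = (if c = a then D c (Υ b) else 0)
        + (if c = b then D c (Υ a) else 0) - (D c (g a b) * u c + g a b * D c (u c)) := by
      intro c
      simp only [weylDiff, map_add, map_sub, apply_ite (D c), map_zero, Derivation.leibniz,
        smul_eq_mul]
      ring
    simp only [this, Finset.sum_add_distrib, Finset.sum_sub_distrib, Finset.sum_ite_eq',
      Finset.mem_univ, if_true, ← Finset.mul_sum]
    ring
  have tr : ∀ b, ∑ c, weylDiff g Υ u c c b = (d : R) * Υ b := by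
    intro b
    simp only [weylDiff, Finset.sum_add_distrib, Finset.sum_sub_distrib, Finset.sum_ite_eq',
      Finset.mem_univ, if_true, Finset.sum_const, Finset.card_univ, Fintype.card_fin, hu']
    simp
  have T2 : ∑ c, D a (weylDiff g Υ u c c b) = (d : R) * D a (Υ b) := by
    rw [← map_sum, tr, Derivation.leibniz]
    simp
  have T3 : ∀ X : Fin d → R, ∑ e, X e * weylDiff g Υ u e a b
      = X a * Υ b + X b * Υ a - g a b * ∑ e, X e * u e := by
    intro X
    simp only [weylDiff, mul_add, mul_sub, Finset.sum_add_distrib, Finset.sum_sub_distrib,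
        mul_ite, mul_zero, Finset.sum_ite_eq', Finset.mem_univ, if_true, Finset.mul_sum]
    congr 1
    exact Finset.sum_congr rfl fun e _ => by ring
  have T4 : ∀ X : Fin d → Fin d → R, ∑ c, ∑ e, weylDiff g Υ u c a e * X e c
      = ∑ e, Υ e * X e a + Υ a * ∑ e, X e e - ∑ c, u c * ∑ e, g a e * X e c := by
    intro X
    simp only [weylDiff, add_mul, sub_mul, Finset.sum_add_distrib, Finset.sum_sub_distrib,
        ite_mul, zero_mul, Finset.sum_ite_eq, Finset.mem_univ, if_true,
        Finset.mul_sum]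
    congr 1
    · congr 1
      rw [Finset.sum_comm]
      simp
    · exact Finset.sum_congr rfl fun e _ => Finset.sum_congr rfl fun f _ => by ring
  have T5 : ∀ X : Fin d → Fin d → R, ∑ c, ∑ e, X c e * weylDiff g Υ u e c b
      = (∑ c, X c c) * Υ b + ∑ c, X c b * Υ c - ∑ e, u e * ∑ c, g c b * X c e := by
    intro X
    simp only [weylDiff, mul_add, mul_sub, Finset.sum_add_distrib, Finset.sum_sub_distrib,
        mul_ite, mul_zero, Finset.sum_ite_eq', Finset.mem_univ, if_true,
        Finset.mul_sum, Finset.sum_mul]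
    congr 1
    rw [Finset.sum_comm]
    exact Finset.sum_congr rfl fun e _ => Finset.sum_congr rfl fun f _ => by ring
  have hW : ∀ c a b, weylDiff g Υ u c a b = weylDiff g Υ u c b a := by
    intro c a b
    simp only [weylDiff, hs b a]
    ring
  have T6 : ∑ c, ∑ e, weylDiff g Υ u c a e * weylDiff g Υ u e c b
      = ((d : R) + 2) * (Υ a * Υ b) - 2 * (g a b * ∑ c, Υ c * u c) := by
    rw [T4 fun e c => weylDiff g Υ u e c b, T3 Υ, tr]
    have : ∑ c, u c * ∑ e, g a e * weylDiff g Υ u e c b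
        = g a b * ∑ c, Υ c * u c := by
      have h1 : ∀ c, ∑ e, g a e * weylDiff g Υ u e c b
          = g a c * Υ b + g a b * Υ c - g c b * Υ a := by
        intro c
        simp only [weylDiff, mul_add, mul_sub, Finset.sum_add_distrib, Finset.sum_sub_distrib,
          mul_ite, mul_zero, Finset.sum_ite_eq', Finset.mem_univ, if_true]
        rw [← hu a, Finset.mul_sum]
        congr 1
        exact Finset.sum_congr rfl fun e _ => by ring
      simp only [h1, mul_add, mul_sub, Finset.sum_add_distrib, Finset.sum_sub_distrib]
      have h2 : ∑ c, u c * (g a c * Υ b) = Υ a * Υ b := by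
        rw [← hu a, Finset.sum_mul]
        exact Finset.sum_congr rfl fun e _ => by ring
      have h3 : ∑ c, u c * (g c b * Υ a) = Υ b * Υ a := by
        rw [← hu' b, Finset.sum_mul]
        exact Finset.sum_congr rfl fun e _ => by ring
      rw [h2, h3, Finset.mul_sum]
      have h4 : ∀ c, u c * (g a b * Υ c) = g a b * (Υ c * u c) := fun c => by ring
      simp only [h4]
      ring
    rw [this]
    ring
  simp only [ric, riem, Finset.sum_add_distrib, Finset.sum_sub_distrib, map_add, add_mul, mul_add,
    T1, T2, T6]
  have E1 : ∑ c, ∑ e, weylDiff g Υ u c c e * Γ e a b = (d : R) * ∑ e, Γ e a b * Υ e := by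
    rw [Finset.sum_comm]
    simp only [← Finset.sum_mul, tr, Finset.mul_sum]
    exact Finset.sum_congr rfl fun e _ => by ring
  have E2 : ∑ c, ∑ e, Γ c c e * weylDiff g Υ u e a b
      = (∑ e, Γ e e a) * Υ b + (∑ e, Γ e e b) * Υ a - g a b * ∑ c, (∑ e, Γ e e c) * u c := by
    rw [Finset.sum_comm]
    simp only [← Finset.sum_mul]
    exact T3 fun c => ∑ e, Γ e e c
  have E3 : ∑ c, ∑ e, weylDiff g Υ u c c e * weylDiff g Υ u e a b
      = (d : R) * (2 * (Υ a * Υ b) - g a b * ∑ c, Υ c * u c) := by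
    rw [Finset.sum_comm]
    simp only [← Finset.sum_mul, tr, mul_assoc, ← Finset.mul_sum, T3]
    ring
  rw [E1, E2, E3, T4 fun e c => Γ e c b, T5 fun c e => Γ c a e]
  have E4 : ∑ c, D c (g a b) * u c
      = (∑ c, u c * ∑ e, g a e * Γ e c b) + ∑ e, u e * ∑ c, g c b * Γ c a e := by
    rw [← Finset.sum_add_distrib]
    refine Finset.sum_congr rfl fun c _ => ?_
    rw [hΓ.compat c a b]
    simp only [hΓ.symm _ a c]
    ring
  have E5 : ∑ e, Γ e a b * Υ e = ∑ e, Υ e * Γ e a b :=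
    Finset.sum_congr rfl fun e _ => mul_comm _ _
  have E6 : ∑ e, Γ e e a = ∑ c, Γ c a c := Finset.sum_congr rfl fun e _ => hΓ.symm _ _ _
  rw [E4, hD b a, E5, E6]
  ring

end DifferentialRing

/-! ### Conformal change of the trace `J` and of the Schouten tensor. -/

section DifferentialRing

variable {d : ℕ} {R : Type*} [CommRing R] [Algebra ℝ R] {D : Fin d → Derivation ℝ R R}

variable (D) in
/-- The covariant derivative `∇_a Υ_b` of a covector. -/
def hess (Γ : Fin d → Fin d → Fin d → R) (Υ : Fin d → R) (a b : Fin d) : R :=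
  D a (Υ b) - ∑ e, Γ e a b * Υ e

theorem IsMetricPair.contract {g gi : Matrix (Fin d) (Fin d) R} (h : IsMetricPair g gi) :
    ∑ a, ∑ b, gi a b * g a b = (d : R) := by
  have : ∀ a, ∑ b, gi a b * g a b = 1 := fun a => by
    simp only [h.symm a]
    rw [h.inv_mul, if_pos rfl]
  simp [this]

/-- The metric is parallel, so raising an index commutes with covariant differentiation; here this
is solved for the partial derivative of the raised components. -/
theorem derivation_raise {g gi : Matrix (Fin d) (Fin d) R} (h : IsMetricPair g gi)
    {Γ : Fin d → Fin d → Fin d → R} (hΓ : IsLeviCivita D g Γ) {Υ u : Fin d → R}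
    (hu : ∀ a, ∑ c, g a c * u c = Υ a) (a e : Fin d) :
    D a (u e) = ∑ f, gi e f * hess D Γ Υ a f - ∑ c, Γ e a c * u c := by
  have h1 : ∀ b, hess D Γ Υ a b = ∑ x, g b x * (D a (u x) + ∑ c, Γ x a c * u c) := by
    intro b
    have hΥ : D a (Υ b) = ∑ c, (D a (g b c) * u c + g b c * D a (u c)) := by
      rw [← hu b, map_sum]
      exact Finset.sum_congr rfl fun c _ => by
        rw [Derivation.leibniz, smul_eq_mul, smul_eq_mul]
        ring
    have h2 : ∑ e, Γ e a b * Υ e = ∑ c, (∑ e, g e c * Γ e a b) * u c := by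
      simp only [← hu, Finset.mul_sum, Finset.sum_mul]
      rw [Finset.sum_comm]
      exact Finset.sum_congr rfl fun c _ => Finset.sum_congr rfl fun e _ => by ring
    have h3 : ∑ x, g b x * ∑ c, Γ x a c * u c = ∑ c, (∑ x, g b x * Γ x a c) * u c := by
      simp only [Finset.mul_sum, Finset.sum_mul]
      rw [Finset.sum_comm]
      exact Finset.sum_congr rfl fun c _ => Finset.sum_congr rfl fun e _ => by ring
    rw [hess, hΥ, h2]
    simp only [mul_add, Finset.sum_add_distrib, h3, hΓ.compat a b, add_mul]
    ring
  simp only [h1]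
  rw [h.raise_lower fun x => D a (u x) + ∑ c, Γ x a c * u c]
  ring

/-- The right side is the coordinate form of the divergence that comes out of `ric_conformal`. -/
theorem trace_hess {g gi : Matrix (Fin d) (Fin d) R} (h : IsMetricPair g gi)
    {Γ : Fin d → Fin d → Fin d → R} (hΓ : IsLeviCivita D g Γ) {Υ u : Fin d → R}
    (hu : ∀ a, ∑ c, g a c * u c = Υ a) :
    ∑ a, ∑ b, gi a b * hess D Γ Υ a b
      = ∑ c, D c (u c) + ∑ c, (∑ e, Γ e e c) * u c := by
  simp only [derivation_raise h hΓ hu, Finset.sum_sub_distrib, Finset.sum_mul]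
  rw [Finset.sum_comm (f := fun c e => Γ e e c * u c)]
  ring

theorem derivation_normSq {g gi : Matrix (Fin d) (Fin d) R} (h : IsMetricPair g gi)
    {Γ : Fin d → Fin d → Fin d → R} (hΓ : IsLeviCivita D g Γ) {Υ u : Fin d → R}
    (hu : ∀ a, ∑ c, g a c * u c = Υ a) (a : Fin d) :
    D a (∑ c, Υ c * u c) = 2 * ∑ c, u c * hess D Γ Υ a c := by
  have h1 : ∑ c, Υ c * ∑ f, gi c f * hess D Γ Υ a f = ∑ c, u c * hess D Γ Υ a c := by
    have : ∀ f, ∑ c, Υ c * gi c f = u f := fun f => by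
      rw [← h.raise_lower u f]
      exact Finset.sum_congr rfl fun c _ => by rw [hu, h.symm_inv f c, mul_comm]
    simp only [Finset.mul_sum, ← mul_assoc]
    rw [Finset.sum_comm]
    simp only [← Finset.sum_mul, this]
  have h2 : ∑ c, Υ c * ∑ f, Γ c a f * u f = ∑ c, u c * ∑ e, Γ e a c * Υ e := by
    simp only [Finset.mul_sum]
    rw [Finset.sum_comm]
    exact Finset.sum_congr rfl fun c _ => Finset.sum_congr rfl fun e _ => by ring
  have h3 : ∀ c, D a (Υ c) = hess D Γ Υ a c + ∑ e, Γ e a c * Υ e := fun c => by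
    rw [hess]
    ring
  simp only [map_sum, Derivation.leibniz, smul_eq_mul, derivation_raise h hΓ hu, h3, mul_sub,
    mul_add, Finset.sum_add_distrib, Finset.sum_sub_distrib, h1, h2]
  ring

/-- Trace of `ric_conformal`: the Hessian appears `2 (d - 1)` times and `|Υ|²` appears `(d - 1) (d -
2)` times, which the normalisation of `J` turns into `1` and `(d - 2) / 2`. -/
theorem jtr_conformal (hd : 3 ≤ d) {g gi : Matrix (Fin d) (Fin d) R} (h : IsMetricPair g gi)
    {Γ : Fin d → Fin d → Fin d → R} (hΓ : IsLeviCivita D g Γ) {Υ u : Fin d → R}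
    (hu : ∀ a, ∑ c, g a c * u c = Υ a) (hD : ∀ a b, D a (Υ b) = D b (Υ a)) (p : R) :
    jtr D (p ^ 2 • gi) (fun c a b => Γ c a b + weylDiff g Υ u c a b)
      = p ^ 2 * (jtr D gi Γ - ∑ a, ∑ b, gi a b * hess D Γ Υ a b
        - (((d : ℝ) - 2) / 2) • ∑ c, Υ c * u c) := by
  have hd' : (3 : ℝ) ≤ d := by exact_mod_cast hd
  have hup : ∀ a, ∑ b, gi a b * Υ b = u a := fun a => by
    simp only [← hu]
    exact h.raise_lower u a
  have h1 : ∑ a, ∑ b, gi a b * (Υ a * Υ b) = ∑ c, Υ c * u c := by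
    refine Finset.sum_congr rfl fun a _ => ?_
    rw [← hup a, Finset.mul_sum]
    exact Finset.sum_congr rfl fun b _ => by ring
  have h2 : ∑ a, ∑ b, gi a b * ric D (fun c a b => Γ c a b + weylDiff g Υ u c a b) a b
      = ∑ a, ∑ b, gi a b * ric D Γ a b - (2 * ((d : R) - 1))
        * (∑ a, ∑ b, gi a b * hess D Γ Υ a b)
        - (((d : R) - 1) * ((d : R) - 2)) * ∑ c, Υ c * u c := by
    have : ∀ a b, gi a b * ric D (fun c a b => Γ c a b + weylDiff g Υ u c a b) a b
        = gi a b * ric D Γ a b - ((d : R) - 2) * (gi a b * hess D Γ Υ a b)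
          + ((d : R) - 2) * (gi a b * (Υ a * Υ b))
          - (∑ a, ∑ b, gi a b * hess D Γ Υ a b + ((d : R) - 2) * ∑ c, Υ c * u c)
            * (gi a b * g a b) := by
      intro a b
      rw [ric_conformal h.symm hΓ hu hD, trace_hess h hΓ hu, hess]
      ring
    simp only [this, Finset.sum_add_distrib, Finset.sum_sub_distrib, ← Finset.mul_sum, h1,
      h.contract]
    ring
  simp only [jtr, Matrix.smul_apply, smul_eq_mul, mul_assoc, ← Finset.mul_sum, h2]
  have e1 : (d : R) = algebraMap ℝ R d := by simp
  have e2 : (2 : R) = algebraMap ℝ R 2 := (map_ofNat (algebraMap ℝ R) 2).symm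
  -- `R` need not be a field. The inverse constants enter through `algebraMap`, and relations such
  -- as `k1` and `k2` make them available to ring arithmetic.
  have k1 : algebraMap ℝ R (2 * ((d : ℝ) - 1))⁻¹ * (2 * ((d : R) - 1)) = 1 := by
    rw [e1, e2, ← map_one (algebraMap ℝ R), ← map_sub, ← map_mul, ← map_mul, map_one,
      inv_mul_cancel₀ (by linarith), map_one]
  have k2 : algebraMap ℝ R (((d : ℝ) - 2) / 2) * 2 = (d : R) - 2 := by
    rw [e1, e2, ← map_sub, ← map_mul]
    congr 1
    ring
  simp only [Algebra.smul_def]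
  set κ := algebraMap ℝ R (2 * ((d : ℝ) - 1))⁻¹
  set ν := algebraMap ℝ R (((d : ℝ) - 2) / 2)
  set H := ∑ a, ∑ b, gi a b * hess D Γ Υ a b
  set V := ∑ c, Υ c * u c
  linear_combination (-p ^ 2 * H - p ^ 2 * V * ν) * k1 +
    (p ^ 2 * κ * ((d : R) - 1) * V) * k2

/-- In the change of the Ricci tensor the multiple of `g` containing the trace of the Hessian is
absorbed exactly by the change of `J g`, and division by `d - 2` normalises the remaining Hessian.
-/
theorem sch_conformal (hd : 3 ≤ d) {g gi : Matrix (Fin d) (Fin d) R} (h : IsMetricPair g gi)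
    {Γ : Fin d → Fin d → Fin d → R} (hΓ : IsLeviCivita D g Γ) {Υ u : Fin d → R}
    (hu : ∀ a, ∑ c, g a c * u c = Υ a) (hD : ∀ a b, D a (Υ b) = D b (Υ a)) {o p : R}
    (hop : o * p = 1) (a b : Fin d) :
    sch D (o ^ 2 • g) (p ^ 2 • gi) (fun c a b => Γ c a b + weylDiff g Υ u c a b) a b
      = sch D g gi Γ a b - hess D Γ Υ a b + Υ a * Υ b
        - (1 / 2 : ℝ) • ((∑ c, Υ c * u c) * g a b) := by
  have hd' : (3 : ℝ) ≤ d := by exact_mod_cast hd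
  have e1 : (d : R) = algebraMap ℝ R d := by simp
  have e2 : (2 : R) = algebraMap ℝ R 2 := (map_ofNat (algebraMap ℝ R) 2).symm
  have k1 : algebraMap ℝ R ((d : ℝ) - 2)⁻¹ * ((d : R) - 2) = 1 := by
    rw [e1, e2, ← map_one (algebraMap ℝ R), ← map_sub, ← map_mul,
      inv_mul_cancel₀ (by linarith)]
  have k2 : algebraMap ℝ R (((d : ℝ) - 2) / 2) * 2 = (d : R) - 2 := by
    rw [e1, e2, ← map_sub, ← map_mul]
    congr 1
    ring
  have k3 : algebraMap ℝ R (((d : ℝ) - 2) / 2)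
      = algebraMap ℝ R (1 / 2) * ((d : R) - 2) := by
    rw [e1, e2, ← map_sub, ← map_mul]
    congr 1
    ring
  have k4 : algebraMap ℝ R (1 / 2) * 2 = 1 := by
    rw [e2, ← map_mul]
    norm_num
  rw [sch, sch, jtr_conformal hd h hΓ hu hD, ric_conformal h.symm hΓ hu hD, ← trace_hess h hΓ hu]
  simp only [Matrix.smul_apply, smul_eq_mul, Algebra.smul_def, k3]
  set κ := algebraMap ℝ R ((d : ℝ) - 2)⁻¹
  set ν := algebraMap ℝ R (1 / 2)
  have hh : D a (Υ b) - ∑ e, Γ e a b * Υ e = hess D Γ Υ a b := rfl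
  rw [hh]
  set H := ∑ a, ∑ b, gi a b * hess D Γ Υ a b
  set V := ∑ c, Υ c * u c
  set J := jtr D gi Γ
  have hop2 : o ^ 2 * p ^ 2 = 1 := by rw [← mul_pow, hop, one_pow]
  linear_combination (-hess D Γ Υ a b + Υ a * Υ b - V * g a b * ν) * k1
    + (-κ * (J - H - ν * ((d : R) - 2) * V) * g a b) * hop2
    + (V * g a b * κ * ((d : R) - 2)) * k4

/-! ### The tractor connection -/

variable (D) in
/-- The tractor connection matrix, over a differential ring. -/
def conn (g gi : Matrix (Fin d) (Fin d) R) (Γ : Fin d → Fin d → Fin d → R) (a : Fin d) :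
    Matrix (Slot d) (Slot d) R :=
  Matrix.of <| slots
    (slots 0 (fun c => if c = a then -1 else 0) 0)
    (fun b => slots (sch D g gi Γ a b) (fun c => -Γ c a b) (g a b))
    (slots 0 (fun c => -∑ e, sch D g gi Γ a e * gi e c) 0)

/-- The change of splitting, over a differential ring. -/
def rescaleR (o p : R) (Υ u : Fin d → R) : Matrix (Slot d) (Slot d) R :=
  Matrix.of <| slots
    (slots o (fun _ => 0) 0)
    (fun b => slots (o * Υ b) (fun e => if b = e then o else 0) 0)
    (slots (-(p * (1 / 2 : ℝ) • ∑ b, Υ b * u b)) (fun e => -(p * u e)) p)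

/-- This gauge law says that the tractor connection commutes with the change of splitting, so that
it does not depend on the scale. It is checked block by block. The Christoffel law gives the middle
block, the Schouten law the entries feeding on `σ` and landing in `ρ`, and the derivative of `|Υ|²`
the corner entry. -/
theorem conn_conformal (hd : 3 ≤ d) {g gi : Matrix (Fin d) (Fin d) R} (h : IsMetricPair g gi)
    {Γ : Fin d → Fin d → Fin d → R} (hΓ : IsLeviCivita D g Γ) {Υ u : Fin d → R}
    (hu : ∀ a, ∑ c, g a c * u c = Υ a) (hD : ∀ a b, D a (Υ b) = D b (Υ a)) {o p : R}
    (hop : o * p = 1) (ho : ∀ a, D a o = Υ a * o) (a : Fin d) :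
    conn D (o ^ 2 • g) (p ^ 2 • gi) (fun c a b => Γ c a b + weylDiff g Υ u c a b) a
        * rescaleR o p Υ u + (rescaleR o p Υ u).map (D a)
      = rescaleR o p Υ u * conn D g gi Γ a := by
  have hp : D a p = -(Υ a * p) := by
    have h1 : D a (o * p) = 0 := by rw [hop]; simp
    rw [Derivation.leibniz, ho, smul_eq_mul, smul_eq_mul] at h1
    linear_combination p * h1 - (D a p + Υ a * p) * hop
  have hup : ∀ a, ∑ b, gi a b * Υ b = u a := fun a => by
    simp only [← hu]
    exact h.raise_lower u a
  have hV : ∑ c, Υ c * u c = ∑ c, u c * Υ c := Finset.sum_congr rfl fun _ _ => mul_comm _ _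
  have k4 : algebraMap ℝ R (1 / 2) * 2 = 1 := by
    rw [show (2 : R) = algebraMap ℝ R 2 from (map_ofNat (algebraMap ℝ R) 2).symm, ← map_mul]
    norm_num
  -- The Schouten tensor with its second index raised by the new inverse metric, as it occurs in the
  -- bottom row of the connection matrix.
  have hP : ∀ c, ∑ e, sch D (o ^ 2 • g) (p ^ 2 • gi)
        (fun c a b => Γ c a b + weylDiff g Υ u c a b) a e * (p ^ 2 • gi) e c
      = p ^ 2 * (∑ e, sch D g gi Γ a e * gi e c - ∑ f, gi c f * hess D Γ Υ a f + Υ a * u c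
        - (if a = c then (1 / 2 : ℝ) • ∑ c, Υ c * u c else 0)) := by
    intro c
    have h1 : ∑ e, g a e * gi e c = if a = c then 1 else 0 := h.mul_inv a c
    have h2 : ∀ e, gi e c = gi c e := fun e => h.symm_inv e c
    have h3 : (if a = c then (1 / 2 : ℝ) • ∑ c, Υ c * u c else 0)
      = ∑ e, (1 / 2 : ℝ) • ((∑ c, Υ c * u c) * (g a e * gi e c)) := by
      rw [← Finset.smul_sum, ← Finset.mul_sum, h1]
      split_ifs <;> simp
    rw [h3, ← hup c, Finset.mul_sum, ← Finset.sum_sub_distrib, ← Finset.sum_add_distrib,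
      ← Finset.sum_sub_distrib, Finset.mul_sum]
    refine Finset.sum_congr rfl fun e _ => ?_
    rw [sch_conformal hd h hΓ hu hD hop]
    simp only [Matrix.smul_apply, h2, Algebra.smul_def, Algebra.algebraMap_self_apply]
    ring
  have hN := derivation_normSq h hΓ hu a
  have hc : conn D (o ^ 2 • g) (p ^ 2 • gi) (fun c a b => Γ c a b + weylDiff g Υ u c a b) a
      = Matrix.of (slots
    (slots 0 (fun c => if c = a then -1 else 0) 0)
    (fun b => slots (sch D g gi Γ a b - hess D Γ Υ a b + Υ a * Υ b
        - (1 / 2 : ℝ) • ((∑ c, Υ c * u c) * g a b))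
        (fun c => -(Γ c a b + weylDiff g Υ u c a b)) (o ^ 2 * g a b))
    (slots 0 (fun c => -(p ^ 2 * (∑ e, sch D g gi Γ a e * gi e c
      - ∑ f, gi c f * hess D Γ Υ a f + Υ a * u c
        - (if a = c then (1 / 2 : ℝ) • ∑ c, Υ c * u c else 0)))) 0)) := by
    rw [conn]
    simp only [hP]
    simp only [sch_conformal hd h hΓ hu hD hop, Matrix.smul_apply, smul_eq_mul]
  rw [hc]
  ext A B
  rcases A with _ | b | _ <;> rcases B with _ | e | _ <;>
    simp only [Matrix.add_apply, Matrix.mul_apply, Fintype.sum_sum_type, Matrix.map_apply, conn,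
      rescaleR, Matrix.of_apply, slots, Finset.univ_unique, Finset.sum_singleton,
      Derivation.leibniz, ho, hp, map_neg, map_zero, hN,
      Derivation.map_smul, mul_ite, ite_mul, zero_mul, mul_zero, Finset.sum_ite_eq,
      Finset.sum_ite_eq', Finset.mem_univ, if_true, neg_mul, mul_neg, neg_zero, add_zero,
      zero_add, smul_eq_mul, apply_ite (D a), derivation_raise h hΓ hu,
      Finset.sum_const_zero, Finset.sum_neg_distrib, one_mul, mul_one]
  · ring
  · have h1 : ∑ c, weylDiff g Υ u c a b * (o * Υ c)
        = o * (2 * (Υ a * Υ b) - g a b * ∑ c, Υ c * u c) := by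
      simp only [weylDiff, add_mul, sub_mul, Finset.sum_add_distrib, Finset.sum_sub_distrib,
        ite_mul, zero_mul, Finset.sum_ite_eq', Finset.mem_univ, if_true]
      have : ∀ c, g a b * u c * (o * Υ c) = o * g a b * (Υ c * u c) := fun c => by ring
      simp only [this, ← Finset.mul_sum]
      ring
    have h2 : ∑ c, Γ c a b * (o * Υ c) = o * (D a (Υ b) - hess D Γ Υ a b) := by
      rw [hess, sub_sub_cancel, Finset.mul_sum]
      exact Finset.sum_congr rfl fun c _ => by ring
    simp only [add_mul, Finset.sum_add_distrib, h1, h2, Algebra.smul_def]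
    linear_combination (-o * g a b * algebraMap ℝ R (1 / 2) * (∑ c, Υ c * u c)) * hop
      - (∑ c, Υ c * u c) * o * g a b * k4
  · rw [weylDiff]
    have e1 : (if b = e then Υ a * o else 0) = (if e = b then Υ a else 0) * o := by
      simp only [ite_mul, zero_mul, eq_comm]
    have e2 : (if e = a then -(o * Υ b) else 0) = -(o * if e = a then Υ b else 0) := by
      split_ifs <;> simp
    rw [e1, e2]
    linear_combination -(o * g a b * u e) * hop
  · linear_combination o * g a b * hop
  · have h1 : ∀ X c, p ^ 2 * X * (o * Υ c) = p * (X * Υ c) := fun X c => by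
      linear_combination p * X * Υ c * hop
    have h2 : ∀ S : Fin d → R, ∑ c, (∑ e, S e * gi e c) * Υ c = ∑ c, u c * S c := by
      intro S
      simp only [← hup, Finset.sum_mul]
      rw [Finset.sum_comm]
      exact Finset.sum_congr rfl fun c _ => Finset.sum_congr rfl fun e _ => by ring
    have h3 : ∑ c, (∑ f, gi c f * hess D Γ Υ a f) * Υ c = ∑ c, u c * hess D Γ Υ a c := by
      rw [← h2]
      exact Finset.sum_congr rfl fun c _ => by
        congr 1
        exact Finset.sum_congr rfl fun e _ => by rw [h.symm_inv c e, mul_comm]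
    simp only [h1, ← Finset.mul_sum, add_mul, sub_mul, Finset.sum_add_distrib,
      Finset.sum_sub_distrib, ite_mul, zero_mul, Finset.sum_ite_eq, Finset.mem_univ, if_true,
      h2, h3, mul_assoc]
    simp only [Algebra.smul_def, ← hV]
    linear_combination (-p * (∑ c, Υ c * u c) * Υ a - p * ∑ c, u c * hess D Γ Υ a c) * k4
      + 2 * p * (∑ c, Υ c * u c) * Υ a * k4
  · have e2 : (if e = a then p * (1 / 2 : ℝ) • ∑ c, Υ c * u c else 0)
        = p * if a = e then (1 / 2 : ℝ) • ∑ c, Υ c * u c else 0 := by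
      simp only [mul_ite, mul_zero, eq_comm]
    have h1 : ∀ X, p ^ 2 * X * o = p * X := fun X => by linear_combination p * X * hop
    have h2 : ∑ c, p * u c * Γ e a c = p * ∑ c, Γ e a c * u c := by
      rw [Finset.mul_sum]
      exact Finset.sum_congr rfl fun c _ => by ring
    simp only [h1, neg_neg, e2, h2]
    ring
  · rw [← hu a, Finset.sum_mul]
    congr 1
    exact Finset.sum_congr rfl fun c _ => by ring

end DifferentialRing

/-! ### Change of coordinates -/

section CoordinateChange

variable {d : ℕ} {R R' : Type*} [CommRing R] [Algebra ℝ R] [CommRing R'] [Algebra ℝ R']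
  {D : Fin d → Derivation ℝ R R} {D' : Fin d → Derivation ℝ R' R'}

theorem map_derivation_mul {l m n : Type*} [Fintype m] (δ : Derivation ℝ R R)
    (A : Matrix l m R) (B : Matrix m n R) :
    (A * B).map δ = A.map δ * B + A * B.map δ := by
  ext i j
  simp only [Matrix.map_apply, Matrix.mul_apply, Matrix.add_apply, map_sum, Derivation.leibniz,
    ← Finset.sum_add_distrib, smul_eq_mul]
  exact Finset.sum_congr rfl fun k _ => by ring

variable (D D') in
/-- A change of coordinates: a homomorphism `φ` of differential rings with Jacobian matrix `J`,
whose inverse is `K`. -/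
structure IsCoordChange (φ : R →ₐ[ℝ] R') (J K : Matrix (Fin d) (Fin d) R') : Prop where
  mul_inv : J * K = 1
  inv_mul : K * J = 1
  chain : ∀ a f, D' a (φ f) = ∑ b, J a b * φ (D b f)
  symm : ∀ a b c, D' c (J a b) = D' a (J c b)

/-- The connection symbols as matrices acting on covectors. -/
def symMat (Γ : Fin d → Fin d → Fin d → R) (a : Fin d) : Matrix (Fin d) (Fin d) R :=
  Matrix.of fun f c => Γ c a f

variable {φ : R →ₐ[ℝ] R'} {J K : Matrix (Fin d) (Fin d) R'}

theorem IsCoordChange.chain_map (h : IsCoordChange D D' φ J K) {l m : Type*}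
    (A : Matrix l m R) (a : Fin d) :
    (A.map φ).map (D' a) = ∑ b, J a b • (A.map (D b)).map φ := by
  ext i j
  simp [Matrix.sum_apply, h.chain]

theorem map_mul_algHom {l m n : Type*} [Fintype m] (A : Matrix l m R) (B : Matrix m n R) :
    (A * B).map φ = A.map φ * B.map φ := by
  ext i j
  simp [Matrix.mul_apply]

theorem IsCoordChange.isMetricPair (h : IsCoordChange D D' φ J K)
    {g gi : Matrix (Fin d) (Fin d) R} (hg : IsMetricPair g gi) :
    IsMetricPair (J * g.map φ * J.transpose) (K.transpose * gi.map φ * K) := by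
  have hgT : g.transpose = g := by ext a b; exact hg.symm b a
  have hgiT : gi.transpose = gi := by ext a b; exact hg.symm_inv b a
  refine ⟨fun a b => ?_, fun a b => ?_, fun a b => ?_⟩
  · have : (J * g.map φ * J.transpose).transpose = J * g.map φ * J.transpose := by
      rw [Matrix.transpose_mul, Matrix.transpose_mul, Matrix.transpose_transpose,
        ← Matrix.transpose_map, hgT, Matrix.mul_assoc]
    rw [← Matrix.transpose_apply (J * _ * _), this]
  · have : (K.transpose * gi.map φ * K).transpose = K.transpose * gi.map φ * K := by
      rw [Matrix.transpose_mul, Matrix.transpose_mul, Matrix.transpose_transpose,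
        ← Matrix.transpose_map, hgiT, Matrix.mul_assoc]
    rw [← Matrix.transpose_apply (K.transpose * _ * _), this]
  · have h1 : gi * g = 1 := by
      ext a b
      rw [Matrix.mul_apply, hg.inv_mul, Matrix.one_apply]
    have h2 : gi.map φ * g.map φ = 1 := by
      rw [← map_mul_algHom, h1]
      exact Matrix.map_one _ (map_zero φ) (map_one φ)
    have : K.transpose * gi.map φ * K * (J * g.map φ * J.transpose) = 1 := by
      calc _ = K.transpose * gi.map φ * (K * J) * g.map φ * J.transpose := by
            simp only [Matrix.mul_assoc]
        _ = K.transpose * (gi.map φ * g.map φ) * J.transpose := by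
            rw [h.inv_mul, Matrix.mul_one, Matrix.mul_assoc K.transpose]
        _ = 1 := by
            rw [h2, Matrix.mul_one, ← Matrix.transpose_mul, h.mul_inv, Matrix.transpose_one]
    rw [← Matrix.mul_apply, this, Matrix.one_apply]

theorem IsLeviCivita.compat_mat {g : Matrix (Fin d) (Fin d) R}
    {Γ : Fin d → Fin d → Fin d → R} (hΓ : IsLeviCivita D g Γ) (c : Fin d) :
    g.map (D c) = symMat Γ c * g + g * (symMat Γ c).transpose := by
  ext a b
  simp only [Matrix.map_apply, hΓ.compat c a b, Matrix.add_apply, Matrix.mul_apply, symMat,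
    Matrix.of_apply, Matrix.transpose_apply]
  congr 1
  exact Finset.sum_congr rfl fun e _ => mul_comm _ _

/-- The transformation law of the Christoffel symbols. -/
theorem IsCoordChange.symMat_chr (h : IsCoordChange D D' φ J K)
    {g gi : Matrix (Fin d) (Fin d) R} (hg : IsMetricPair g gi) (a : Fin d) :
    symMat (chr D' (J * g.map φ * J.transpose) (K.transpose * gi.map φ * K)) a * J
      = ∑ e, J a e • (J * (symMat (chr D g gi) e).map φ) + J.map (D' a) := by
  set Γ := chr D g gi
  have hΓ : IsLeviCivita D g Γ := isLeviCivita_chr hg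
  set X : Fin d → Matrix (Fin d) (Fin d) R' :=
    fun a => ∑ e, J a e • (J * (symMat Γ e).map φ) + J.map (D' a) with hX
  -- The Koszul formula is not transformed directly. The transported connection `X K` is shown to be
  -- torsion free and compatible with the transported metric, and uniqueness identifies it. Torsion
  -- freeness is where the symmetry of second derivatives of the coordinates enters.
  have hLC : IsLeviCivita D' (J * g.map φ * J.transpose) (fun c a b => (X a * K) b c) := by
    refine ⟨fun c a b => ?_, fun c a b => ?_⟩
    · have : ∀ e, X a b e = X b a e := by
        intro e
        simp only [hX, Matrix.add_apply, Matrix.sum_apply, Matrix.smul_apply, Matrix.mul_apply,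
          Matrix.map_apply, symMat, Matrix.of_apply, smul_eq_mul, Finset.mul_sum, h.symm b e a]
        congr 1
        rw [Finset.sum_comm]
        refine Finset.sum_congr rfl fun x _ => Finset.sum_congr rfl fun y _ => ?_
        rw [hΓ.symm e y x]
        ring
      simp only [Matrix.mul_apply, this]
    · have key : (J * g.map φ * J.transpose).map (D' c)
          = X c * K * (J * g.map φ * J.transpose)
            + J * g.map φ * J.transpose * (X c * K).transpose := by
        have e1 : X c * K * (J * g.map φ * J.transpose) = X c * g.map φ * J.transpose := by
          calc _ = X c * (K * J) * g.map φ * J.transpose := by simp only [Matrix.mul_assoc]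
            _ = _ := by rw [h.inv_mul, Matrix.mul_one]
        have e2 : J * g.map φ * J.transpose * (X c * K).transpose
            = J * g.map φ * (X c).transpose := by
          calc _ = J * g.map φ * (K * J).transpose * (X c).transpose := by
                simp only [Matrix.mul_assoc, Matrix.transpose_mul]
            _ = _ := by rw [h.inv_mul, Matrix.transpose_one, Matrix.mul_one]
        have e3 : J.transpose.map (D' c) = (J.map (D' c)).transpose := rfl
        rw [e1, e2, map_derivation_mul, map_derivation_mul, h.chain_map, e3]
        simp only [hΓ.compat_mat, hX]
        have e4 : ∀ b, (symMat Γ b * g + g * (symMat Γ b).transpose).map φ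
            = (symMat Γ b).map φ * g.map φ + g.map φ * ((symMat Γ b).map φ).transpose := by
          intro b
          ext i j
          simp [Matrix.mul_apply]
        simp only [e4, Matrix.add_mul, Matrix.mul_add, Matrix.transpose_add, Matrix.transpose_sum,
          Matrix.transpose_smul, Matrix.sum_mul, Matrix.mul_sum, Matrix.mul_smul, Matrix.smul_mul,
          smul_add, Finset.sum_add_distrib, Matrix.transpose_mul, Matrix.mul_assoc]
        abel
      have := congrFun (congrFun key a) b
      rw [Matrix.map_apply] at this
      rw [this]
      simp only [Matrix.add_apply, Matrix.mul_apply (M := X c * K),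
        Matrix.mul_apply (M := J * g.map φ * J.transpose), Matrix.transpose_apply]
      congr 1
      exact Finset.sum_congr rfl fun e _ => mul_comm _ _
  rw [hLC.eq_chr (h.isMetricPair hg)]
  have : symMat (fun c a b => (X a * K) b c) a = X a * K := rfl
  rw [this, Matrix.mul_assoc, h.inv_mul, Matrix.mul_one]

variable (D) in
/-- The curvature as a matrix valued two-form. -/
def curvMat (Γ : Fin d → Fin d → Fin d → R) (a b : Fin d) : Matrix (Fin d) (Fin d) R :=
  (symMat Γ b).map (D a) - (symMat Γ a).map (D b) + symMat Γ b * symMat Γ a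
    - symMat Γ a * symMat Γ b

theorem curvMat_apply (Γ : Fin d → Fin d → Fin d → R) (a b c f : Fin d) :
    curvMat D Γ a b f c = riem D Γ a b c f := by
  simp only [curvMat, riem, symMat, Matrix.sub_apply, Matrix.add_apply, Matrix.map_apply,
    Matrix.of_apply, Matrix.mul_apply, Finset.sum_sub_distrib, ← add_sub_assoc]
  simp only [mul_comm]

/-- The hypothesis presents `Γ'` as a gauge transform by `J` of the pulled back matrices `S`. In the
curvature the second derivatives of `J` cancel because the derivations commute (`hDD`), and the
first derivatives of `J` inside `S` cancel by the symmetry of the Jacobian. -/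
theorem IsCoordChange.curvMat_eq (h : IsCoordChange D D' φ J K)
    (hD' : ∀ a b f, D' a (D' b f) = D' b (D' a f))
    {Γ : Fin d → Fin d → Fin d → R} {Γ' : Fin d → Fin d → Fin d → R'}
    (hΓ : ∀ a, symMat Γ' a * J = ∑ e, J a e • (J * (symMat Γ e).map φ) + J.map (D' a))
    (a b : Fin d) :
    curvMat D' Γ' a b * J
      = ∑ x, ∑ y, (J a x * J b y) • (J * (curvMat D Γ x y).map φ) := by
  set S : Fin d → Matrix (Fin d) (Fin d) R' := fun a => ∑ e, J a e • (symMat Γ e).map φ with hS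
  have hL : ∀ a, symMat Γ' a * J = J * S a + J.map (D' a) := by
    intro a
    rw [hΓ, hS]
    simp only [Matrix.mul_sum, Matrix.mul_smul]
  have key : ∀ a b, (symMat Γ' b).map (D' a) * J + symMat Γ' b * symMat Γ' a * J
      = J.map (D' a) * S b + J * (S b).map (D' a) + (J.map (D' b)).map (D' a)
        + J * S b * S a + J.map (D' b) * S a := by
    intro a b
    have h1 : (symMat Γ' b * J).map (D' a) = (J * S b + J.map (D' b)).map (D' a) := by rw [hL]
    have h2 : (J * S b + J.map (D' b)).map (D' a)
        = (J * S b).map (D' a) + (J.map (D' b)).map (D' a) := by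
      ext i j
      simp
    rw [map_derivation_mul, h2, map_derivation_mul] at h1
    have h3 : symMat Γ' b * symMat Γ' a * J
        = J * S b * S a + J.map (D' b) * S a + symMat Γ' b * J.map (D' a) := by
      rw [Matrix.mul_assoc, hL a, Matrix.mul_add, ← Matrix.mul_assoc, hL b, Matrix.add_mul]
    rw [h3, eq_sub_of_add_eq h1]
    abel
  have hDD : (J.map (D' b)).map (D' a) = (J.map (D' a)).map (D' b) := by
    ext i j
    exact hD' a b _
  have hDS : ∀ a b, (S b).map (D' a) = ∑ y, D' a (J b y) • (symMat Γ y).map φ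
      + ∑ x, ∑ y, (J a x * J b y) • ((symMat Γ y).map (D x)).map φ := by
    intro a b
    ext i j
    simp only [hS, Matrix.map_apply, Matrix.sum_apply, Matrix.smul_apply, map_sum,
      smul_eq_mul, Derivation.leibniz, h.chain, Matrix.add_apply, Finset.sum_add_distrib,
      Finset.mul_sum]
    rw [add_comm, Finset.sum_comm]
    congr 1
    · exact Finset.sum_congr rfl fun y _ => by ring
    · exact Finset.sum_congr rfl fun y _ => Finset.sum_congr rfl fun x _ => by ring
  have hSS : ∀ a b, S b * S a
      = ∑ x, ∑ y, (J a x * J b y) • ((symMat Γ y).map φ * (symMat Γ x).map φ) := by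
    intro a b
    simp only [hS, Matrix.sum_mul, Matrix.mul_sum, Matrix.mul_smul, Matrix.smul_mul, Finset.smul_sum,
      smul_smul]
  have hfin : curvMat D' Γ' a b * J
      = J * ((S b).map (D' a) - (S a).map (D' b) + S b * S a - S a * S b) := by
    have e1 : curvMat D' Γ' a b * J
        = ((symMat Γ' b).map (D' a) * J + symMat Γ' b * symMat Γ' a * J)
          - ((symMat Γ' a).map (D' b) * J + symMat Γ' a * symMat Γ' b * J) := by
      simp only [curvMat, Matrix.add_mul, Matrix.sub_mul]
      abel
    rw [e1, key, key, hDD]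
    simp only [Matrix.mul_add, Matrix.mul_sub, Matrix.mul_assoc]
    abel
  have hswap : ∀ f : Fin d → Fin d → Matrix (Fin d) (Fin d) R',
      ∑ x, ∑ y, (J b x * J a y) • f x y = ∑ x, ∑ y, (J a x * J b y) • f y x := by
    intro f
    rw [Finset.sum_comm]
    exact Finset.sum_congr rfl fun y _ => Finset.sum_congr rfl fun x _ => by
      rw [mul_comm (J b x)]
  have hsub : ∀ x y, (curvMat D Γ x y).map φ
      = ((symMat Γ y).map (D x)).map φ - ((symMat Γ x).map (D y)).map φ
        + (symMat Γ y).map φ * (symMat Γ x).map φ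
        - (symMat Γ x).map φ * (symMat Γ y).map φ := by
    intro x y
    ext i j
    simp [curvMat, Matrix.mul_apply]
  rw [hfin, hDS, hDS, hSS, hSS, hswap, hswap]
  simp only [h.symm b _ a, hsub, smul_sub, smul_add, Matrix.mul_add, Matrix.mul_sub,
    Finset.sum_add_distrib, Finset.sum_sub_distrib, Matrix.mul_sum, Matrix.mul_smul]
  abel

/-- The Ricci tensor as a matrix. -/
theorem IsCoordChange.ric_eq (h : IsCoordChange D D' φ J K)
    (hD' : ∀ a b f, D' a (D' b f) = D' b (D' a f))
    {Γ : Fin d → Fin d → Fin d → R} {Γ' : Fin d → Fin d → Fin d → R'}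
    (hΓ : ∀ a, symMat Γ' a * J = ∑ e, J a e • (J * (symMat Γ e).map φ) + J.map (D' a)) :
    Matrix.of (ric D' Γ') = J * (Matrix.of (ric D Γ)).map φ * J.transpose := by
  have hc : ∀ a b, curvMat D' Γ' a b
      = ∑ x, ∑ y, (J a x * J b y) • (J * (curvMat D Γ x y).map φ * K) := by
    intro a b
    have := congrArg (· * K) (h.curvMat_eq hD' hΓ a b)
    simp only [Matrix.mul_assoc, h.mul_inv, Matrix.mul_one, Matrix.sum_mul,
      Matrix.smul_mul] at this
    simpa only [Matrix.mul_assoc] using this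
  ext a b
  -- The contraction of the upper index with a lower one meets `K * J = 1`, leaving one Jacobian for
  -- each of the two free lower indices.
  have h1 : ∀ x y, ∑ c, J c x * (J a y * (J * (curvMat D Γ x y).map φ * K) b c)
      = J a y * ∑ z, J b z * φ (riem D Γ x y x z) := by
    intro x y
    have : J * (curvMat D Γ x y).map φ * K * J
        = J * (curvMat D Γ x y).map φ := by
      rw [Matrix.mul_assoc, h.inv_mul, Matrix.mul_one]
    have := congrFun (congrFun this b) x
    rw [Matrix.mul_apply, Matrix.mul_apply] at this
    simp only [Matrix.map_apply, curvMat_apply] at this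
    rw [← this, Finset.mul_sum]
    exact Finset.sum_congr rfl fun c _ => by ring
  calc ric D' Γ' a b = ∑ c, curvMat D' Γ' c a b c := by
        simp only [ric, curvMat_apply]
    _ = ∑ x, ∑ y, ∑ c,
          J c x * (J a y * (J * (curvMat D Γ x y).map φ * K) b c) := by
        simp only [hc, Matrix.sum_apply, Matrix.smul_apply, smul_eq_mul, mul_assoc]
        rw [Finset.sum_comm]
        exact Finset.sum_congr rfl fun y _ => Finset.sum_comm
    _ = ∑ y, ∑ z, J a y * (J b z * φ (ric D Γ y z)) := by
        simp only [h1, ric, map_sum, Finset.mul_sum]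
        rw [Finset.sum_comm]
        exact Finset.sum_congr rfl fun y _ => Finset.sum_comm
    _ = _ := by
        simp only [Matrix.mul_apply, Matrix.transpose_apply, Matrix.map_apply, Matrix.of_apply,
          Finset.sum_mul]
        rw [Finset.sum_comm]
        exact Finset.sum_congr rfl fun y _ => Finset.sum_congr rfl fun z _ => by ring

theorem IsCoordChange.jtr_eq (h : IsCoordChange D D' φ J K)
    (hD' : ∀ a b f, D' a (D' b f) = D' b (D' a f)) (gi : Matrix (Fin d) (Fin d) R)
    {Γ : Fin d → Fin d → Fin d → R} {Γ' : Fin d → Fin d → Fin d → R'}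
    (hΓ : ∀ a, symMat Γ' a * J = ∑ e, J a e • (J * (symMat Γ e).map φ) + J.map (D' a)) :
    jtr D' (K.transpose * gi.map φ * K) Γ' = φ (jtr D gi Γ) := by
  have tr : ∀ {S : Type _} [CommRing S] (A B : Matrix (Fin d) (Fin d) S),
      ∑ a, ∑ b, A a b * B a b = (A.transpose * B).trace := by
    intro S _ A B
    simp only [Matrix.trace, Matrix.diag_apply, Matrix.mul_apply, Matrix.transpose_apply]
    exact Finset.sum_comm
  have h1 : ∑ a, ∑ b, (K.transpose * gi.map φ * K) a b * ric D' Γ' a b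
      = φ (∑ a, ∑ b, gi a b * ric D Γ a b) := by
    have e1 := tr (K.transpose * gi.map φ * K) (Matrix.of (ric D' Γ'))
    have e2 := tr (gi.map φ) ((Matrix.of (ric D Γ)).map φ)
    simp only [Matrix.of_apply, Matrix.map_apply] at e1 e2
    simp only [map_sum, map_mul]
    rw [e1, e2, h.ric_eq hD' hΓ]
    have : (K.transpose * gi.map φ * K).transpose
        * (J * (Matrix.of (ric D Γ)).map φ * J.transpose)
        = K.transpose * ((gi.map φ).transpose
          * (Matrix.of (ric D Γ)).map φ * J.transpose) := by
      calc _ = K.transpose * (gi.map φ).transpose * (K * J)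
            * (Matrix.of (ric D Γ)).map φ * J.transpose := by
              simp only [Matrix.transpose_mul, Matrix.transpose_transpose, Matrix.mul_assoc]
        _ = _ := by rw [h.inv_mul]; simp only [Matrix.mul_one, Matrix.mul_assoc]
    rw [this, Matrix.trace_mul_comm, Matrix.mul_assoc, ← Matrix.transpose_mul, h.inv_mul,
      Matrix.transpose_one, Matrix.mul_one]
  rw [jtr, jtr, h1, map_smul]

theorem IsCoordChange.sch_eq (h : IsCoordChange D D' φ J K)
    (hD' : ∀ a b f, D' a (D' b f) = D' b (D' a f)) (g gi : Matrix (Fin d) (Fin d) R)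
    {Γ : Fin d → Fin d → Fin d → R} {Γ' : Fin d → Fin d → Fin d → R'}
    (hΓ : ∀ a, symMat Γ' a * J = ∑ e, J a e • (J * (symMat Γ e).map φ) + J.map (D' a)) :
    Matrix.of (sch D' (J * g.map φ * J.transpose) (K.transpose * gi.map φ * K) Γ')
      = J * (Matrix.of (sch D g gi Γ)).map φ * J.transpose := by
  have h1 : Matrix.of (sch D' (J * g.map φ * J.transpose) (K.transpose * gi.map φ * K) Γ')
      = ((d : ℝ) - 2)⁻¹ • (Matrix.of (ric D' Γ')
        - φ (jtr D gi Γ) • (J * g.map φ * J.transpose)) := by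
    rw [← h.jtr_eq hD' gi hΓ]
    rfl
  have h2 : (Matrix.of (sch D g gi Γ)).map φ
      = ((d : ℝ) - 2)⁻¹ • ((Matrix.of (ric D Γ)).map φ
        - φ (jtr D gi Γ) • g.map φ) := by
    ext a b
    simp [sch]
  rw [h1, h2, h.ric_eq hD' hΓ]
  simp only [Matrix.mul_smul, Matrix.smul_mul, Matrix.mul_sub, Matrix.sub_mul]

/-- The change of chart on standard tractors, for the Jacobian matrix `J`. -/
def jacSlot (J : Matrix (Fin d) (Fin d) R) : Matrix (Slot d) (Slot d) R :=
  Matrix.of <| slots (slots 1 (fun _ => 0) 0) (fun a => slots 0 (fun b => J a b) 0)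
    (slots 0 (fun _ => 0) 1)

/-- Only the middle block of `jacSlot J` varies, and its derivative is the inhomogeneous term of the
law for the Christoffel symbols. The other entries of the connection matrix are tensors. -/
theorem IsCoordChange.conn_eq (h : IsCoordChange D D' φ J K)
    (hD' : ∀ a b f, D' a (D' b f) = D' b (D' a f)) {g gi : Matrix (Fin d) (Fin d) R}
    {Γ : Fin d → Fin d → Fin d → R} {Γ' : Fin d → Fin d → Fin d → R'}
    (hΓ : ∀ a, symMat Γ' a * J = ∑ e, J a e • (J * (symMat Γ e).map φ) + J.map (D' a))
    (a : Fin d) :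
    conn D' (J * g.map φ * J.transpose) (K.transpose * gi.map φ * K) Γ' a * jacSlot J
        + (jacSlot J).map (D' a)
      = ∑ b, J a b • (jacSlot J * (conn D g gi Γ b).map φ) := by
  have hS := h.sch_eq hD' g gi hΓ
  have hSg : Matrix.of (sch D' (J * g.map φ * J.transpose) (K.transpose * gi.map φ * K) Γ')
      * (K.transpose * gi.map φ * K) * J
      = J * ((Matrix.of (sch D g gi Γ)).map φ * gi.map φ) := by
    rw [hS]
    calc _ = J * (Matrix.of (sch D g gi Γ)).map φ * (K * J).transpose
          * gi.map φ * (K * J) := by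
            simp only [Matrix.transpose_mul, Matrix.mul_assoc]
      _ = _ := by
        rw [h.inv_mul]
        simp only [Matrix.mul_one, Matrix.mul_assoc, Matrix.transpose_one]
  have two : ∀ (A : Matrix (Fin d) (Fin d) R') (a b : Fin d),
      (J * A * J.transpose) a b = ∑ x, J a x * ∑ y, J b y * A x y := by
    intro A a b
    simp only [Matrix.mul_apply, Matrix.transpose_apply, Finset.sum_mul, Finset.mul_sum]
    rw [Finset.sum_comm]
    exact Finset.sum_congr rfl fun y _ => Finset.sum_congr rfl fun z _ => by ring
  have hS' : ∀ b, sch D' (J * g.map φ * J.transpose)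
      (K.transpose * gi.map φ * K) Γ' a b
      = ∑ x, J a x * ∑ y, J b y * φ (sch D g gi Γ x y) := fun b => by
    rw [← Matrix.of_apply (f := sch D' _ _ _) , hS, two]
    rfl
  have hg' : ∀ b, (J * g.map φ * J.transpose) a b
      = ∑ x, J a x * ∑ y, J b y * φ (g x y) := fun b => two _ _ _
  have hP : ∀ e, ∑ c, (∑ x, sch D' (J * g.map φ * J.transpose)
      (K.transpose * gi.map φ * K) Γ' a x * (K.transpose * gi.map φ * K) x c) * J c e
      = ∑ x, J a x * φ (∑ y, sch D g gi Γ x y * gi y e) := fun e => by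
    have := congrFun (congrFun hSg a) e
    simp only [Matrix.mul_apply (N := J), Matrix.mul_apply (M := J),
      Matrix.mul_apply (M := Matrix.of _),
      Matrix.mul_apply (M := (Matrix.of (sch D g gi Γ)).map φ), Matrix.of_apply,
      Matrix.map_apply] at this
    simpa only [map_sum, map_mul] using this
  have hΓ' : ∀ b e, ∑ c, Γ' c a b * J c e
      = ∑ x, J a x * (∑ y, J b y * φ (Γ e x y)) + D' a (J b e) := fun b e => by
    have := congrFun (congrFun (hΓ a) b) e
    simpa [Matrix.mul_apply, Matrix.sum_apply, symMat] using this
  unfold conn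
  -- From here on the transformed metric enters only through the entries recorded in `hS'`, `hg'`,
  -- `hP` and `hΓ'`.
  generalize J * g.map φ * J.transpose = g' at *
  generalize K.transpose * gi.map φ * K = gi' at *
  ext A B
  rcases A with _ | b | _ <;> rcases B with _ | e | _ <;>
    simp only [Matrix.add_apply, Matrix.mul_apply, Matrix.sum_apply,
      Matrix.smul_apply,
      Fintype.sum_sum_type, Matrix.map_apply, Derivation.map_one_eq_zero,
      jacSlot, Matrix.of_apply, slots, Finset.univ_unique, Finset.sum_singleton, apply_ite φ,
      map_neg, map_zero, map_one, mul_ite, ite_mul, zero_mul, mul_zero, Finset.sum_ite_eq,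
      Finset.sum_ite_eq', Finset.mem_univ, if_true, neg_mul, mul_neg, neg_zero, add_zero,
      zero_add, smul_eq_mul,
      Finset.sum_const_zero, one_mul, mul_one, Finset.sum_neg_distrib, hS', hP, hg', hΓ']
  · simp only [ite_self, zero_add, mul_neg, Finset.sum_neg_distrib]
    ring
  · simp only [ite_self, zero_add, mul_neg, Finset.sum_neg_distrib, ← hS', hP]

end CoordinateChange

/-! ### Diagonal and derivation actions of matrices on tensors, and the connection on tensors. -/

section TensorAlgebra

variable {d m : ℕ} {R R' : Type*} [CommRing R] [Algebra ℝ R] [CommRing R'] [Algebra ℝ R']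

/-- Components of tensors over a ring. -/
abbrev TensorR (d m : ℕ) (R : Type*) : Type _ := (Fin m → Slot d) → R

/-- The diagonal action of a matrix on tensors. -/
def tActR (A : Matrix (Slot d) (Slot d) R) (t : TensorR d m R) : TensorR d m R :=
  fun I => ∑ K : Fin m → Slot d, (∏ i, A (I i) (K i)) * t K

/-- The derivation action of a matrix on tensors. -/
def dActR (A : Matrix (Slot d) (Slot d) R) (t : TensorR d m R) : TensorR d m R :=
  fun I => ∑ i, ∑ K, A (I i) K * t (Function.update I i K)

/-- The derivative of the diagonal action at `Q` in the direction `X`. -/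
def lderR (Q X : Matrix (Slot d) (Slot d) R) (t : TensorR d m R) : TensorR d m R :=
  fun I => ∑ K : Fin m → Slot d,
    (∑ i, X (I i) (K i) * ∏ j ∈ Finset.univ.erase i, Q (I j) (K j)) * t K

theorem tActR_add (A : Matrix (Slot d) (Slot d) R) (s t : TensorR d m R) :
    tActR A (s + t) = tActR A s + tActR A t := by
  funext I
  simp [tActR, mul_add, Finset.sum_add_distrib]

theorem tActR_smul (A : Matrix (Slot d) (Slot d) R) (r : R) (t : TensorR d m R) :
    tActR A (r • t) = r • tActR A t := by
  funext I
  simp only [tActR, Pi.smul_apply, smul_eq_mul, Finset.mul_sum]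
  exact Finset.sum_congr rfl fun K _ => by ring

theorem tActR_sum {ι : Type*} (s : Finset ι) (A : Matrix (Slot d) (Slot d) R)
    (t : ι → TensorR d m R) : tActR A (∑ i ∈ s, t i) = ∑ i ∈ s, tActR A (t i) := by
  funext I
  simp only [tActR, Finset.sum_apply, Finset.mul_sum]
  exact Finset.sum_comm

theorem dActR_add (A : Matrix (Slot d) (Slot d) R) (s t : TensorR d m R) :
    dActR A (s + t) = dActR A s + dActR A t := by
  funext I
  simp [dActR, mul_add, Finset.sum_add_distrib]

theorem dActR_smul (A : Matrix (Slot d) (Slot d) R) (r : R) (t : TensorR d m R) :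
    dActR A (r • t) = r • dActR A t := by
  funext I
  simp only [dActR, Pi.smul_apply, smul_eq_mul, Finset.mul_sum]
  exact Finset.sum_congr rfl fun K _ => Finset.sum_congr rfl fun K _ => by ring

theorem lderR_add (Q X Y : Matrix (Slot d) (Slot d) R) (t : TensorR d m R) :
    lderR Q (X + Y) t = lderR Q X t + lderR Q Y t := by
  funext I
  simp [lderR, add_mul, Finset.sum_add_distrib]

theorem lderR_sum_smul {ι : Type*} (s : Finset ι) (Q : Matrix (Slot d) (Slot d) R) (c : ι → R)
    (X : ι → Matrix (Slot d) (Slot d) R) (t : TensorR d m R) :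
    lderR Q (∑ b ∈ s, c b • X b) t = ∑ b ∈ s, c b • lderR Q (X b) t := by
  funext I
  simp only [lderR, Matrix.sum_apply, Matrix.smul_apply, smul_eq_mul, Finset.sum_apply,
    Pi.smul_apply, Finset.mul_sum, Finset.sum_mul]
  conv_rhs => rw [Finset.sum_comm]
  refine Finset.sum_congr rfl fun K _ => ?_
  rw [Finset.sum_comm]
  refine Finset.sum_congr rfl fun i _ => Finset.sum_congr rfl fun K _ => ?_
  ring

theorem derivation_prod {ι : Type*} [DecidableEq ι] (δ : Derivation ℝ R R) (s : Finset ι)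
    (f : ι → R) : δ (∏ i ∈ s, f i) = ∑ i ∈ s, δ (f i) * ∏ j ∈ s.erase i, f j := by
  induction s using Finset.induction_on with
  | empty => simp
  | insert a s ha ih =>
    rw [Finset.prod_insert ha, Derivation.leibniz, ih, Finset.sum_insert ha,
      Finset.erase_insert ha, smul_eq_mul, smul_eq_mul, add_comm, Finset.mul_sum]
    congr 1
    · ring
    · refine Finset.sum_congr rfl fun i hi => ?_
      have : i ≠ a := fun h => ha (h ▸ hi)
      rw [Finset.erase_insert_of_ne this.symm, Finset.prod_insert (by simp [ha])]
      ring

theorem derivation_tActR (δ : Derivation ℝ R R) (Q : Matrix (Slot d) (Slot d) R)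
    (t : TensorR d m R) (I : Fin m → Slot d) :
    δ (tActR Q t I) = tActR Q (fun K => δ (t K)) I + lderR Q (Q.map δ) t I := by
  simp only [tActR, lderR, map_sum, Derivation.leibniz, derivation_prod, smul_eq_mul,
    Finset.sum_add_distrib, Matrix.map_apply]
  congr 1
  exact Finset.sum_congr rfl fun K _ => mul_comm _ _

/-- With `tActR_dActR` this writes both composites of the infinitesimal and the diagonal action as
the derivative of the diagonal action at `Q`, in the direction `A * Q` or `Q * A`. A gauge law for
matrices then passes to tensors of any rank. -/
theorem dActR_tActR (A Q : Matrix (Slot d) (Slot d) R) (t : TensorR d m R) :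
    dActR A (tActR Q t) = lderR Q (A * Q) t := by
  funext I
  simp only [dActR, tActR, lderR, Matrix.mul_apply, Finset.mul_sum, Finset.sum_mul]
  have h1 : ∀ i K' K, A (I i) K' * ((∏ j, Q (Function.update I i K' j) (K j)) * t K)
      = A (I i) K' * Q K' (K i) * (∏ j ∈ Finset.univ.erase i, Q (I j) (K j)) * t K := by
    intro i K' K
    rw [← Finset.mul_prod_erase _ _ (Finset.mem_univ i), Function.update_self]
    have : ∏ j ∈ Finset.univ.erase i, Q (Function.update I i K' j) (K j)
        = ∏ j ∈ Finset.univ.erase i, Q (I j) (K j) :=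
      Finset.prod_congr rfl fun j hj => by
        rw [Function.update_of_ne (Finset.ne_of_mem_erase hj)]
    rw [this]
    ring
  simp only [h1]
  rw [Finset.sum_comm (s := Finset.univ (α := Fin m → Slot d))]
  exact Finset.sum_congr rfl fun i _ => Finset.sum_comm

theorem tActR_dActR (A Q : Matrix (Slot d) (Slot d) R) (t : TensorR d m R) :
    tActR Q (dActR A t) = lderR Q (Q * A) t := by
  funext I
  simp only [dActR, tActR, lderR, Matrix.mul_apply, Finset.mul_sum, Finset.sum_mul]
  rw [Finset.sum_comm]
  rw [Finset.sum_comm (s := Finset.univ (α := Fin m → Slot d)) (t := Finset.univ (α := Fin m))]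
  refine Finset.sum_congr rfl fun i _ => ?_
  rw [← Finset.sum_product', ← Finset.sum_product']
  -- The bijection is an involution: it exchanges the `i`-th entry of the multi-index with the free
  -- summation index of `A`.
  refine Finset.sum_nbij' (fun x => (Function.update x.1 i x.2, x.1 i))
    (fun x => (Function.update x.1 i x.2, x.1 i)) (by simp) (by simp) (by simp) (by simp) ?_
  rintro ⟨K, k⟩ -
  simp only [Function.update_self]
  rw [← Finset.mul_prod_erase _ _ (Finset.mem_univ i)]
  have : ∏ j ∈ Finset.univ.erase i, Q (I j) (Function.update K i k j)
      = ∏ j ∈ Finset.univ.erase i, Q (I j) (K j) :=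
    Finset.prod_congr rfl fun j hj => by
      rw [Function.update_of_ne (Finset.ne_of_mem_erase hj)]
  rw [this]
  ring

/-- The tractor connection on tensors. -/
def covR (D : Fin d → Derivation ℝ R R) (θ : Fin d → Matrix (Slot d) (Slot d) R) (a : Fin d)
    (t : TensorR d m R) : TensorR d m R :=
  (fun I => D a (t I)) + dActR (θ a) t

/-- The transformation law of the connection under a change of coordinates and frame. -/
theorem covR_change {D : Fin d → Derivation ℝ R R} {D' : Fin d → Derivation ℝ R' R'}
    {φ : R →ₐ[ℝ] R'} {J : Matrix (Fin d) (Fin d) R'} {Q : Matrix (Slot d) (Slot d) R'}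
    {θ : Fin d → Matrix (Slot d) (Slot d) R} {θ' : Fin d → Matrix (Slot d) (Slot d) R'}
    (hφ : ∀ a f, D' a (φ f) = ∑ b, J a b * φ (D b f))
    (hθ : ∀ a, θ' a * Q + Q.map (D' a) = ∑ b, J a b • (Q * (θ b).map φ))
    (t : TensorR d m R) (a : Fin d) :
    covR D' θ' a (tActR Q (φ ∘ t)) = ∑ b, J a b • tActR Q (φ ∘ covR D θ b t) := by
  have h1 : ∀ b, φ ∘ covR D θ b t
      = (fun I => φ (D b (t I))) + dActR ((θ b).map φ) (φ ∘ t) := by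
    intro b
    funext I
    simp [covR, dActR]
  have h2 : (fun I => D' a (tActR Q (φ ∘ t) I))
      = ∑ b, J a b • tActR Q (fun I => φ (D b (t I))) + lderR Q (Q.map (D' a)) (φ ∘ t) := by
    funext I
    rw [derivation_tActR, Pi.add_apply]
    congr 1
    have : (fun K => D' a ((φ ∘ t) K)) = ∑ b, J a b • fun I => φ (D b (t I)) := by
      funext K
      simp [hφ]
    rw [this, tActR_sum]
    simp only [tActR_smul]
  rw [covR, h2, dActR_tActR]
  simp only [h1, tActR_add, tActR_dActR, smul_add, Finset.sum_add_distrib]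
  rw [← lderR_sum_smul, ← hθ, lderR_add]
  abel

end TensorAlgebra

/-! ### Connections and Laplacians -/

section Laplacian

variable {d : ℕ} {R R' : Type*} [CommRing R] [Algebra ℝ R] [CommRing R'] [Algebra ℝ R']
  {M M' : Type*} [AddCommGroup M] [Module R M] [AddCommGroup M'] [Module R' M']

/-- A connection on the module `M`. -/
structure IsConnection (D : Fin d → Derivation ℝ R R) (nab : Fin d → M → M) : Prop where
  add : ∀ a s t, nab a (s + t) = nab a s + nab a t
  leibniz : ∀ a (f : R) t, nab a (f • t) = D a f • t + f • nab a t

theorem IsConnection.sum {D : Fin d → Derivation ℝ R R} {nab : Fin d → M → M}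
    (h : IsConnection D nab) {ι : Type*} (s : Finset ι) (a : Fin d) (t : ι → M) :
    nab a (∑ i ∈ s, t i) = ∑ i ∈ s, nab a (t i) :=
  map_sum (AddMonoidHom.mk' (nab a) (h.add a)) t s

theorem isConnection_derivation (D : Fin d → Derivation ℝ R R) :
    IsConnection D (fun a (f : R) => D a f) :=
  ⟨fun a s t => map_add _ _ _, fun a f t => by
    rw [smul_eq_mul, Derivation.leibniz, smul_eq_mul, smul_eq_mul, smul_eq_mul]
    ring⟩

theorem isConnection_covR {m : ℕ} (D : Fin d → Derivation ℝ R R)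
    (θ : Fin d → Matrix (Slot d) (Slot d) R) :
    IsConnection D (fun a (t : TensorR d m R) => covR D θ a t) := by
  refine ⟨fun a s t => ?_, fun a f t => ?_⟩
  · simp only [covR, dActR_add]
    funext I
    simp only [Pi.add_apply, map_add]
    ring
  · simp only [covR, dActR_smul]
    funext I
    simp only [Pi.add_apply, Pi.smul_apply, smul_eq_mul, Derivation.leibniz]
    ring

/-- The Laplacian of a connection. -/
def lapR (gi : Matrix (Fin d) (Fin d) R) (Γ : Fin d → Fin d → Fin d → R) (nab : Fin d → M → M)
    (t : M) : M :=
  ∑ a, ∑ b, gi a b • (nab a (nab b t) - ∑ c, Γ c a b • nab c t)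

/-- The map `Ψ` is any transport that is semilinear over `φ` and intertwines the connections, so the
statement serves scalars and tractors alike. The derivative of `J` produced by the outer connection
cancels the inhomogeneous part of `Γ'`, and the Hessian of `t` transforms as a tensor. -/
theorem lapR_change {D : Fin d → Derivation ℝ R R} {D' : Fin d → Derivation ℝ R' R'}
    {φ : R →ₐ[ℝ] R'} {J K : Matrix (Fin d) (Fin d) R'} (h : IsCoordChange D D' φ J K)
    {gi : Matrix (Fin d) (Fin d) R} {Γ : Fin d → Fin d → Fin d → R}
    {Γ' : Fin d → Fin d → Fin d → R'}
    (hΓ : ∀ a, symMat Γ' a * J = ∑ e, J a e • (J * (symMat Γ e).map φ) + J.map (D' a))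
    {nab : Fin d → M → M} {nab' : Fin d → M' → M'} (hn' : IsConnection D' nab')
    (Ψ : M →+ M') (hΨ : ∀ (f : R) t, Ψ (f • t) = φ f • Ψ t)
    (hnab : ∀ a t, nab' a (Ψ t) = ∑ b, J a b • Ψ (nab b t)) (t : M) :
    lapR (K.transpose * gi.map φ * K) Γ' nab' (Ψ t) = Ψ (lapR gi Γ nab t) := by
  have hΓ' : ∀ a b e, ∑ c, Γ' c a b * J c e
      = ∑ x, ∑ y, J a x * J b y * φ (Γ e x y) + D' a (J b e) := fun a b e => by
    have := congrFun (congrFun (hΓ a) b) e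
    simpa [Matrix.mul_apply, Matrix.sum_apply, symMat, Finset.mul_sum, mul_assoc] using this
  have key : ∀ a b, nab' a (nab' b (Ψ t)) - ∑ c, Γ' c a b • nab' c (Ψ t)
      = ∑ x, ∑ y, (J a x * J b y) • Ψ (nab x (nab y t) - ∑ c, Γ c x y • nab c t) := by
    intro a b
    have e1 : nab' a (nab' b (Ψ t)) = ∑ y, D' a (J b y) • Ψ (nab y t)
        + ∑ x, ∑ y, (J a x * J b y) • Ψ (nab x (nab y t)) := by
      rw [hnab, hn'.sum]
      simp only [hn'.leibniz, hnab, Finset.sum_add_distrib, Finset.smul_sum, smul_smul]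
      congr 1
      rw [Finset.sum_comm]
      exact Finset.sum_congr rfl fun x _ => Finset.sum_congr rfl fun y _ => by rw [mul_comm]
    have e2 : ∑ c, Γ' c a b • nab' c (Ψ t) = ∑ y, D' a (J b y) • Ψ (nab y t)
        + ∑ x, ∑ y, (J a x * J b y) • Ψ (∑ c, Γ c x y • nab c t) := by
      simp only [hnab, Finset.smul_sum, smul_smul, map_sum, hΨ]
      rw [Finset.sum_comm]
      simp only [← Finset.sum_smul, hΓ', add_smul, Finset.sum_add_distrib]
      rw [add_comm]
      congr 1
      simp only [Finset.sum_smul]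
      rw [Finset.sum_comm]
      refine Finset.sum_congr rfl fun x _ => ?_
      rw [Finset.sum_comm]
    rw [e1, e2]
    simp only [map_sub, smul_sub, Finset.sum_sub_distrib]
    abel
  have hgi : ∀ x y, ∑ a, ∑ b, (K.transpose * gi.map φ * K) a b * (J a x * J b y)
      = φ (gi x y) := by
    intro x y
    have : J.transpose * (K.transpose * gi.map φ * K) * J = gi.map φ := by
      calc _ = (K * J).transpose * gi.map φ * (K * J) := by
            simp only [Matrix.transpose_mul, Matrix.mul_assoc]
        _ = _ := by rw [h.inv_mul]; simp
    rw [Matrix.mul_assoc J.transpose] at this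
    have := congrFun (congrFun this x) y
    rw [Matrix.map_apply] at this
    rw [← this]
    generalize K.transpose * gi.map φ * K = X
    simp only [Matrix.mul_apply, Matrix.transpose_apply, Finset.mul_sum]
    exact Finset.sum_congr rfl fun a _ => Finset.sum_congr rfl fun b _ => by ring
  simp only [lapR, key, map_sum, hΨ, Finset.smul_sum, smul_smul, ← hgi, Finset.sum_smul]
  calc _ = ∑ a, ∑ x, ∑ y, ∑ b, ((K.transpose * gi.map φ * K) a b * (J a x * J b y))
        • Ψ (nab x (nab y t) - ∑ c, Γ c x y • nab c t) :=
      Finset.sum_congr rfl fun a _ => by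
        rw [Finset.sum_comm]
        exact Finset.sum_congr rfl fun x _ => Finset.sum_comm
    _ = _ := by
      rw [Finset.sum_comm]
      exact Finset.sum_congr rfl fun x _ => Finset.sum_comm

/-- Here `r` stands for `Ω^w`, with `w` a constant of the differential ring. The coefficient `d + 2w
- 2` of the first order term is `2 (w - 1)` from the two terms symmetric in `Υ` and `∇t`, plus `d`
from the trace of `g`. Its vanishing at the Yamabe weight explains the factor in the Thomas
operator. -/
theorem lapR_conformal {D : Fin d → Derivation ℝ R R} {g gi : Matrix (Fin d) (Fin d) R}
    (h : IsMetricPair g gi) {Γ : Fin d → Fin d → Fin d → R} {Υ u : Fin d → R}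
    (hu : ∀ a, ∑ c, g a c * u c = Υ a) {nab : Fin d → M → M}
    {M' : Type*} [AddCommGroup M'] [Module R M'] {nab' : Fin d → M' → M'}
    (hn : IsConnection D nab) (hn' : IsConnection D nab')
    (Ψ : M →ₗ[R] M') (hnab : ∀ a t, nab' a (Ψ t) = Ψ (nab a t))
    {w r p : R} (hw : ∀ a, D a w = 0) (hr : ∀ a, D a r = w * Υ a * r) (t : M) :
    lapR (p ^ 2 • gi) (fun c a b => Γ c a b + weylDiff g Υ u c a b) nab' (r • Ψ t)
      = (p ^ 2 * r) • Ψ (lapR gi Γ nab t + ((d : R) + 2 * w - 2) • ∑ a, u a • nab a t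
        + (w * (∑ a, ∑ b, gi a b * hess D Γ Υ a b) + w * (w + d - 2) * ∑ c, Υ c * u c) • t) := by
  have hup : ∀ a, ∑ b, gi a b * Υ b = u a := fun a => by
    simp only [← hu]
    exact h.raise_lower u a
  have hgg : ∑ a, ∑ b, gi a b * g a b = (d : R) := h.contract
  have n1 : ∀ b s, nab' b (r • Ψ s) = r • Ψ (nab b s + (w * Υ b) • s) := by
    intro b s
    rw [hn'.leibniz, hr, hnab, map_add, map_smul, smul_add, smul_smul, mul_comm r, add_comm]
  have hW : ∀ a b (X : Fin d → M), ∑ c, weylDiff g Υ u c a b • X c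
      = Υ b • X a + Υ a • X b - g a b • ∑ c, u c • X c := by
    intro a b X
    simp only [weylDiff, add_smul, sub_smul, Finset.sum_add_distrib, Finset.sum_sub_distrib,
      ite_smul, zero_smul, Finset.sum_ite_eq', Finset.mem_univ, if_true, Finset.smul_sum,
      smul_smul]
  have n2 : ∀ a b, nab' a (nab' b (r • Ψ t))
      - ∑ c, (Γ c a b + weylDiff g Υ u c a b) • nab' c (r • Ψ t)
      = r • Ψ ((nab a (nab b t) - ∑ c, Γ c a b • nab c t) + (w * hess D Γ Υ a b) • t
        + (w - 1) • (Υ b • nab a t + Υ a • nab b t) + ((w * w - 2 * w) * (Υ a * Υ b)) • t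
        + g a b • ∑ c, u c • (nab c t + (w * Υ c) • t)) := by
    intro a b
    simp only [n1, add_smul, Finset.sum_add_distrib]
    have e1 : ∑ c, Γ c a b • r • Ψ (nab c t + (w * Υ c) • t)
        = r • Ψ (∑ c, Γ c a b • nab c t + (w * ∑ c, Γ c a b * Υ c) • t) := by
      simp only [map_add, map_sum, map_smul, smul_add, Finset.smul_sum, Finset.sum_add_distrib,
        Finset.mul_sum, Finset.sum_smul, smul_smul]
      congr 1 <;> exact Finset.sum_congr rfl fun c _ => by ring_nf
    have e2 : ∑ c, weylDiff g Υ u c a b • r • Ψ (nab c t + (w * Υ c) • t)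
        = r • Ψ (Υ b • (nab a t + (w * Υ a) • t) + Υ a • (nab b t + (w * Υ b) • t)
          - g a b • ∑ c, u c • (nab c t + (w * Υ c) • t)) := by
      rw [← hW a b fun c => nab c t + (w * Υ c) • t, map_sum, Finset.smul_sum]
      exact Finset.sum_congr rfl fun c _ => by rw [map_smul, smul_comm]
    rw [e1, e2, ← smul_add, ← map_add, ← smul_sub, ← map_sub]
    congr 2
    rw [hn.add, hn.leibniz, Derivation.leibniz, hw, hess]
    simp only [smul_eq_mul, mul_zero, add_zero]
    module
  have n3 : ∀ a b (X : M), (p ^ 2 • gi) a b • r • Ψ X = (p ^ 2 * r) • Ψ (gi a b • X) := by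
    intro a b X
    rw [Matrix.smul_apply, map_smul, smul_smul, smul_smul, smul_eq_mul]
    congr 1
    ring
  simp only [lapR, n2, n3, ← Finset.smul_sum, ← map_sum]
  congr 2
  have f1 : ∑ a, ∑ b, gi a b • (Υ b • nab a t + Υ a • nab b t)
      = (2 : R) • ∑ a, u a • nab a t := by
    have e1 : ∑ a, ∑ b, gi a b • (Υ b • nab a t) = ∑ a, u a • nab a t := by
      refine Finset.sum_congr rfl fun a _ => ?_
      rw [← hup a, Finset.sum_smul]
      exact Finset.sum_congr rfl fun b _ => by rw [smul_smul]
    have e2 : ∑ a, ∑ b, gi a b • (Υ a • nab b t) = ∑ a, u a • nab a t := by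
      rw [← e1, Finset.sum_comm]
      exact Finset.sum_congr rfl fun a _ => Finset.sum_congr rfl fun b _ => by
        rw [h.symm_inv]
    simp only [smul_add, Finset.sum_add_distrib, e1, e2]
    module
  have f2 : ∑ a, ∑ b, gi a b * (Υ a * Υ b) = ∑ c, Υ c * u c := by
    refine Finset.sum_congr rfl fun a _ => ?_
    rw [← hup a, Finset.mul_sum]
    exact Finset.sum_congr rfl fun b _ => by ring
  have f3 : ∑ c, u c • (nab c t + (w * Υ c) • t)
      = ∑ a, u a • nab a t + (w * ∑ c, Υ c * u c) • t := by
    simp only [smul_add, Finset.sum_add_distrib, Finset.mul_sum, Finset.sum_smul, smul_smul]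
    congr 1
    exact Finset.sum_congr rfl fun c _ => by ring_nf
  rw [f3]
  have f4 : ∀ a b, gi a b • ((nab a (nab b t) - ∑ c, Γ c a b • nab c t)
        + (w * hess D Γ Υ a b) • t
        + (w - 1) • (Υ b • nab a t + Υ a • nab b t) + ((w * w - 2 * w) * (Υ a * Υ b)) • t
        + g a b • (∑ a, u a • nab a t + (w * ∑ c, Υ c * u c) • t))
      = gi a b • (nab a (nab b t) - ∑ c, Γ c a b • nab c t)
        + (gi a b * hess D Γ Υ a b) • (w • t)
        + (w - 1) • (gi a b • (Υ b • nab a t + Υ a • nab b t))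
        + (gi a b * (Υ a * Υ b)) • ((w * w - 2 * w) • t)
        + (gi a b * g a b) • (∑ a, u a • nab a t + (w * ∑ c, Υ c * u c) • t) := by
    intro a b
    module
  simp only [f4, Finset.sum_add_distrib, ← Finset.sum_smul, ← Finset.smul_sum, f1, f2, hgg]
  module

end Laplacian

/-! ### The Laplace-Robin operator over a differential ring -/

section LaplaceRobin

variable {d : ℕ} {R R' : Type*} [CommRing R] [Algebra ℝ R] [CommRing R'] [Algebra ℝ R']
  {M M' : Type*} [AddCommGroup M] [Module R M] [AddCommGroup M'] [Module R' M']

/-- The bottom slot of the scale tractor. -/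
def rhoR (D : Fin d → Derivation ℝ R R) (gi : Matrix (Fin d) (Fin d) R)
    (Γ : Fin d → Fin d → Fin d → R) (σ : R) : R :=
  -((d : ℝ)⁻¹ • (lapR gi Γ (fun a f => D a f) σ + jtr D gi Γ * σ))

/-- The square of the scale tractor. -/
def isqR (D : Fin d → Derivation ℝ R R) (gi : Matrix (Fin d) (Fin d) R)
    (Γ : Fin d → Fin d → Fin d → R) (σ : R) : R :=
  ∑ a, ∑ b, gi a b * D a σ * D b σ + 2 * (σ * rhoR D gi Γ σ)

/-- The Laplace-Robin operator. -/
def lrR (D : Fin d → Derivation ℝ R R) (gi : Matrix (Fin d) (Fin d) R)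
    (Γ : Fin d → Fin d → Fin d → R) (nab : Fin d → M → M) (σ : R) (w : ℝ) (t : M) : M :=
  -(σ • (lapR gi Γ nab t + (w • jtr D gi Γ) • t))
    + algebraMap ℝ R ((d : ℝ) + 2 * w - 2)
      • (∑ a, ∑ b, (gi a b * D a σ) • nab b t + (w • rhoR D gi Γ σ) • t)

/-- The normalized Laplace-Robin operator, for `v` the inverse of `I²`. -/
def yR (D : Fin d → Derivation ℝ R R) (gi : Matrix (Fin d) (Fin d) R)
    (Γ : Fin d → Fin d → Fin d → R) (nab : Fin d → M → M) (σ v : R) (w : ℝ) (t : M) : M :=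
  -(v • lrR D gi Γ nab σ w t)

/-- Powers of the normalized Laplace-Robin operator. -/
def yPowR (D : Fin d → Derivation ℝ R R) (gi : Matrix (Fin d) (Fin d) R)
    (Γ : Fin d → Fin d → Fin d → R) (nab : Fin d → M → M) (σ v : R) : ℕ → ℝ → M → M
  | 0, _, t => t
  | k + 1, w, t => yPowR D gi Γ nab σ v k (w - 1) (yR D gi Γ nab σ v w t)

section Linearity

variable {D : Fin d → Derivation ℝ R R} {nab : Fin d → M → M} (h : IsConnection D nab)

include h

theorem IsConnection.lapR_add (gi : Matrix (Fin d) (Fin d) R) (Γ : Fin d → Fin d → Fin d → R)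
    (s t : M) : lapR gi Γ nab (s + t) = lapR gi Γ nab s + lapR gi Γ nab t := by
  simp only [lapR, ← Finset.sum_add_distrib]
  refine Finset.sum_congr rfl fun a _ => Finset.sum_congr rfl fun b _ => ?_
  simp only [h.add, smul_add, Finset.sum_add_distrib]
  module

theorem IsConnection.const_smul (a : Fin d) (r : ℝ) (t : M) :
    nab a (algebraMap ℝ R r • t) = algebraMap ℝ R r • nab a t := by
  rw [h.leibniz, Derivation.map_algebraMap, zero_smul, zero_add]

theorem IsConnection.lapR_const_smul (gi : Matrix (Fin d) (Fin d) R)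
    (Γ : Fin d → Fin d → Fin d → R) (r : ℝ) (t : M) :
    lapR gi Γ nab (algebraMap ℝ R r • t) = algebraMap ℝ R r • lapR gi Γ nab t := by
  simp only [lapR, h.const_smul, smul_comm _ (algebraMap ℝ R r), ← Finset.smul_sum, ← smul_sub]

theorem IsConnection.yR_add (gi : Matrix (Fin d) (Fin d) R) (Γ : Fin d → Fin d → Fin d → R)
    (σ v : R) (w : ℝ) (s t : M) :
    yR D gi Γ nab σ v w (s + t) = yR D gi Γ nab σ v w s + yR D gi Γ nab σ v w t := by
  simp only [yR, lrR, h.lapR_add, h.add, smul_add, Finset.sum_add_distrib]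
  module

theorem IsConnection.yR_const_smul (gi : Matrix (Fin d) (Fin d) R)
    (Γ : Fin d → Fin d → Fin d → R) (σ v : R) (w r : ℝ) (t : M) :
    yR D gi Γ nab σ v w (algebraMap ℝ R r • t) = algebraMap ℝ R r • yR D gi Γ nab σ v w t := by
  simp only [yR, lrR, h.lapR_const_smul, h.const_smul, smul_comm _ (algebraMap ℝ R r), smul_add,
    smul_neg, Finset.smul_sum]

theorem IsConnection.yPowR_add (gi : Matrix (Fin d) (Fin d) R) (Γ : Fin d → Fin d → Fin d → R)
    (σ v : R) (k : ℕ) (w : ℝ) (s t : M) :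
    yPowR D gi Γ nab σ v k w (s + t)
      = yPowR D gi Γ nab σ v k w s + yPowR D gi Γ nab σ v k w t := by
  induction k generalizing w s t with
  | zero => rfl
  | succ k ih => rw [yPowR, h.yR_add, ih]; rfl

theorem IsConnection.yPowR_const_smul (gi : Matrix (Fin d) (Fin d) R)
    (Γ : Fin d → Fin d → Fin d → R) (σ v : R) (k : ℕ) (w r : ℝ) (t : M) :
    yPowR D gi Γ nab σ v k w (algebraMap ℝ R r • t)
      = algebraMap ℝ R r • yPowR D gi Γ nab σ v k w t := by
  induction k generalizing w t with
  | zero => rfl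
  | succ k ih => rw [yPowR, h.yR_const_smul, ih]; rfl

theorem IsConnection.lapR_smul {gi : Matrix (Fin d) (Fin d) R}
    (hgi : ∀ a b, gi a b = gi b a) (Γ : Fin d → Fin d → Fin d → R) (f : R) (t : M) :
    lapR gi Γ nab (f • t) = f • lapR gi Γ nab t
      + (2 : R) • ∑ a, ∑ b, (gi a b * D a f) • nab b t
      + lapR gi Γ (fun a f => D a f) f • t := by
  have e1 : ∑ a, ∑ b, (gi a b * D b f) • nab a t = ∑ a, ∑ b, (gi a b * D a f) • nab b t := by
    rw [Finset.sum_comm]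
    exact Finset.sum_congr rfl fun a _ => Finset.sum_congr rfl fun b _ => by rw [hgi]
  have e2 : ∀ a b, gi a b • (nab a (nab b (f • t)) - ∑ c, Γ c a b • nab c (f • t))
      = f • (gi a b • (nab a (nab b t) - ∑ c, Γ c a b • nab c t))
        + ((gi a b * D a f) • nab b t + (gi a b * D b f) • nab a t)
        + (gi a b * (D a (D b f) - ∑ c, Γ c a b * D c f)) • t := by
    intro a b
    have : ∑ c, Γ c a b • nab c (f • t)
        = f • ∑ c, Γ c a b • nab c t + (∑ c, Γ c a b * D c f) • t := by
      simp only [h.leibniz, smul_add, Finset.sum_add_distrib, smul_smul, Finset.smul_sum,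
        Finset.sum_smul]
      rw [add_comm]
      congr 1
      exact Finset.sum_congr rfl fun c _ => by rw [mul_comm]
    rw [this, h.leibniz, h.add, h.leibniz, h.leibniz]
    module
  simp only [lapR, e2, Finset.sum_add_distrib, e1]
  simp only [← Finset.smul_sum, ← Finset.sum_smul, smul_eq_mul]
  module

/-- The commutator of the Laplace-Robin operator with its scale. -/
theorem IsConnection.lrR_smul (hd : d ≠ 0) {gi : Matrix (Fin d) (Fin d) R}
    (hgi : ∀ a b, gi a b = gi b a) (Γ : Fin d → Fin d → Fin d → R) (σ : R) (w : ℝ) (t : M) :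
    lrR D gi Γ nab σ w (σ • t) = σ • lrR D gi Γ nab σ (w - 1) t
      + (algebraMap ℝ R ((d : ℝ) + 2 * w - 2) * isqR D gi Γ σ) • t := by
  -- Expressing `Δσ` by the bottom slot of the scale tractor lets the zeroth order terms combine:
  -- the products `σ ρ` add up to `2 (d + 2w - 2) σ ρ`, which together with `(d + 2w - 2) |dσ|²` is
  -- the stated multiple of `I²`.
  have hρ : lapR gi Γ (fun a f => D a f) σ
      = -(algebraMap ℝ R d * rhoR D gi Γ σ) - jtr D gi Γ * σ := by
    have : (d : ℝ) ≠ 0 := by exact_mod_cast hd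
    rw [rhoR, ← Algebra.smul_def, smul_neg, smul_smul, mul_inv_cancel₀ this, one_smul]
    ring
  have e1 : ∑ a, ∑ b, (gi a b * D a σ) • nab b (σ • t)
      = σ • ∑ a, ∑ b, (gi a b * D a σ) • nab b t
        + (∑ a, ∑ b, gi a b * D a σ * D b σ) • t := by
    simp only [h.leibniz, smul_add, Finset.sum_add_distrib, smul_smul, Finset.smul_sum,
      Finset.sum_smul]
    rw [add_comm]
    congr 1
    exact Finset.sum_congr rfl fun a _ => Finset.sum_congr rfl fun b _ => by rw [mul_comm σ]
  simp only [lrR, h.lapR_smul hgi, hρ, e1, isqR, Algebra.smul_def]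
  simp only [map_add, map_sub, map_mul, map_one, map_ofNat]
  module

theorem IsConnection.yR_smul (hd : d ≠ 0) {gi : Matrix (Fin d) (Fin d) R}
    (hgi : ∀ a b, gi a b = gi b a) (Γ : Fin d → Fin d → Fin d → R) {σ v : R}
    (hv : v * isqR D gi Γ σ = 1) (w : ℝ) (t : M) :
    yR D gi Γ nab σ v w (σ • t) = σ • yR D gi Γ nab σ v (w - 1) t
      - algebraMap ℝ R ((d : ℝ) + 2 * w - 2) • t := by
  have : v • (algebraMap ℝ R ((d : ℝ) + 2 * w - 2) * isqR D gi Γ σ) • t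
      = algebraMap ℝ R ((d : ℝ) + 2 * w - 2) • t := by
    rw [smul_smul, mul_left_comm, hv, mul_one]
  rw [yR, yR, h.lrR_smul hd hgi, smul_add, this, smul_neg, smul_comm]
  abel

/-- Each factor contributes the commutator at its own weight, and the weights drop by one, so the
coefficient is the sum of `d + 2 (w - i) - 2` over `i < k`. For `k = 0` the truncated exponent `k -
1` is harmless, its coefficient being zero. -/
theorem IsConnection.yPowR_smul (hd : d ≠ 0) {gi : Matrix (Fin d) (Fin d) R}
    (hgi : ∀ a b, gi a b = gi b a) (Γ : Fin d → Fin d → Fin d → R) {σ v : R}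
    (hv : v * isqR D gi Γ σ = 1) (k : ℕ) (w : ℝ) (t : M) :
    yPowR D gi Γ nab σ v k w (σ • t) = σ • yPowR D gi Γ nab σ v k (w - 1) t
      - algebraMap ℝ R (k * ((d : ℝ) + 2 * w - 2 - k + 1))
        • yPowR D gi Γ nab σ v (k - 1) (w - 1) t := by
  induction k generalizing w t with
  | zero => simp [yPowR]
  | succ k ih =>
    have hsub : ∀ s t, yPowR D gi Γ nab σ v k (w - 1) (s - t)
        = yPowR D gi Γ nab σ v k (w - 1) s - yPowR D gi Γ nab σ v k (w - 1) t := by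
      intro s t
      rw [eq_sub_iff_add_eq, ← h.yPowR_add, sub_add_cancel]
    rw [yPowR, h.yR_smul hd hgi Γ hv, hsub, ih, h.yPowR_const_smul, Nat.add_sub_cancel]
    -- The extra factor `y` is absorbed into the power `k - 1`. For `k = 0` this would fail, but
    -- both sides then carry the coefficient zero.
    have : algebraMap ℝ R (k * ((d : ℝ) + 2 * (w - 1) - 2 - k + 1))
        • yPowR D gi Γ nab σ v (k - 1) (w - 1 - 1) (yR D gi Γ nab σ v (w - 1) t)
        = algebraMap ℝ R (k * ((d : ℝ) + 2 * (w - 1) - 2 - k + 1))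
          • yPowR D gi Γ nab σ v k (w - 1) t := by
      cases k with
      | zero => simp
      | succ k => rfl
    rw [this, sub_sub, ← add_smul, ← map_add]
    have e : k * ((d : ℝ) + 2 * (w - 1) - 2 - k + 1) + ((d : ℝ) + 2 * w - 2)
        = (k + 1 : ℕ) * ((d : ℝ) + 2 * w - 2 - (k + 1 : ℕ) + 1) := by
      push_cast
      ring
    rw [e]
    rfl

/-- The operator `y ^ k` is tangential at the weight `(k - d + 1) / 2`. -/
theorem IsConnection.yPowR_smul_critical (hd : d ≠ 0) {gi : Matrix (Fin d) (Fin d) R}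
    (hgi : ∀ a b, gi a b = gi b a) (Γ : Fin d → Fin d → Fin d → R) {σ v : R}
    (hv : v * isqR D gi Γ σ = 1) (k : ℕ) (t : M) :
    yPowR D gi Γ nab σ v k (((k : ℝ) - d + 1) / 2) (σ • t)
      = σ • yPowR D gi Γ nab σ v k (((k : ℝ) - d + 1) / 2 - 1) t := by
  rw [h.yPowR_smul hd hgi Γ hv]
  have : (d : ℝ) + 2 * (((k : ℝ) - d + 1) / 2) - 2 - k + 1 = 0 := by ring
  rw [this, mul_zero, map_zero, zero_smul, sub_zero]

end Linearity

/-! ### Covariance -/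

section Covariance

variable {D : Fin d → Derivation ℝ R R} {D' : Fin d → Derivation ℝ R' R'}

theorem IsCoordChange.pair {φ : R →ₐ[ℝ] R'} {J K : Matrix (Fin d) (Fin d) R'}
    (h : IsCoordChange D D' φ J K) (gi : Matrix (Fin d) (Fin d) R) (X : Fin d → R)
    (Y : Fin d → M') :
    ∑ a, ∑ b, ((K.transpose * gi.map φ * K) a b * ∑ c, J a c * φ (X c))
        • ∑ e, J b e • Y e
      = ∑ a, ∑ b, φ (gi a b * X a) • Y b := by
  have hgi : ∀ x y, ∑ a, ∑ b, (K.transpose * gi.map φ * K) a b * (J a x * J b y)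
      = φ (gi x y) := by
    intro x y
    have : J.transpose * (K.transpose * gi.map φ * K) * J = gi.map φ := by
      calc _ = (K * J).transpose * gi.map φ * (K * J) := by
            simp only [Matrix.transpose_mul, Matrix.mul_assoc]
        _ = _ := by rw [h.inv_mul]; simp
    rw [Matrix.mul_assoc J.transpose] at this
    have := congrFun (congrFun this x) y
    rw [Matrix.map_apply] at this
    rw [← this]
    generalize K.transpose * gi.map φ * K = X
    simp only [Matrix.mul_apply, Matrix.transpose_apply, Finset.mul_sum]
    exact Finset.sum_congr rfl fun a _ => Finset.sum_congr rfl fun b _ => by ring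
  generalize K.transpose * gi.map φ * K = A at *
  have e1 : ∀ a b, (A a b * ∑ c, J a c * φ (X c)) • ∑ e, J b e • Y e
      = ∑ x, ∑ y, (A a b * (J a x * J b y)) • φ (X x) • Y y := by
    intro a b
    simp only [Finset.mul_sum, Finset.smul_sum, Finset.sum_smul, smul_smul]
    rw [Finset.sum_comm]
    refine Finset.sum_congr rfl fun y _ => ?_
    rw [Finset.sum_mul, Finset.sum_smul]
    exact Finset.sum_congr rfl fun x _ => by
      congr 1
      ring
  simp only [e1, map_mul, ← hgi, mul_smul _ (φ _), Finset.sum_smul]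
  calc _ = ∑ a, ∑ x, ∑ y, ∑ b, (A a b * (J a x * J b y)) • φ (X x) • Y y :=
        Finset.sum_congr rfl fun a _ => by
          rw [Finset.sum_comm]
          exact Finset.sum_congr rfl fun x _ => Finset.sum_comm
    _ = _ := by
      rw [Finset.sum_comm]
      exact Finset.sum_congr rfl fun x _ => Finset.sum_comm

theorem IsCoordChange.rhoR_eq {φ : R →ₐ[ℝ] R'} {J K : Matrix (Fin d) (Fin d) R'}
    (h : IsCoordChange D D' φ J K) (hD' : ∀ a b f, D' a (D' b f) = D' b (D' a f))
    {gi : Matrix (Fin d) (Fin d) R} {Γ : Fin d → Fin d → Fin d → R}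
    {Γ' : Fin d → Fin d → Fin d → R'}
    (hΓ : ∀ a, symMat Γ' a * J = ∑ e, J a e • (J * (symMat Γ e).map φ) + J.map (D' a)) (σ : R) :
    rhoR D' (K.transpose * gi.map φ * K) Γ' (φ σ) = φ (rhoR D gi Γ σ) := by
  have h1 := lapR_change h (gi := gi) hΓ (isConnection_derivation D') (φ : R →+ R')
    (fun f t => by simp) (nab := fun a f => D a f) (fun a t => h.chain a t) σ
  simp only [AddMonoidHom.coe_coe] at h1
  rw [rhoR, rhoR, h1, h.jtr_eq hD' gi hΓ, map_neg, map_smul, map_add, map_mul]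

theorem IsCoordChange.isqR_eq {φ : R →ₐ[ℝ] R'} {J K : Matrix (Fin d) (Fin d) R'}
    (h : IsCoordChange D D' φ J K) (hD' : ∀ a b f, D' a (D' b f) = D' b (D' a f))
    {gi : Matrix (Fin d) (Fin d) R} {Γ : Fin d → Fin d → Fin d → R}
    {Γ' : Fin d → Fin d → Fin d → R'}
    (hΓ : ∀ a, symMat Γ' a * J = ∑ e, J a e • (J * (symMat Γ e).map φ) + J.map (D' a)) (σ : R) :
    isqR D' (K.transpose * gi.map φ * K) Γ' (φ σ) = φ (isqR D gi Γ σ) := by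
  have h1 := h.pair gi (fun a => D a σ) (fun a => φ (D a σ))
  simp only [smul_eq_mul] at h1
  simp only [isqR, h.rhoR_eq hD' hΓ, h.chain, h1, map_add, map_sum, map_mul, map_ofNat]

theorem IsCoordChange.lrR_eq {φ : R →ₐ[ℝ] R'} {J K : Matrix (Fin d) (Fin d) R'}
    (h : IsCoordChange D D' φ J K) (hD' : ∀ a b f, D' a (D' b f) = D' b (D' a f))
    {gi : Matrix (Fin d) (Fin d) R} {Γ : Fin d → Fin d → Fin d → R}
    {Γ' : Fin d → Fin d → Fin d → R'}
    (hΓ : ∀ a, symMat Γ' a * J = ∑ e, J a e • (J * (symMat Γ e).map φ) + J.map (D' a))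
    {nab : Fin d → M → M} {nab' : Fin d → M' → M'} (hn' : IsConnection D' nab')
    (Ψ : M →+ M') (hΨ : ∀ (f : R) t, Ψ (f • t) = φ f • Ψ t)
    (hnab : ∀ a t, nab' a (Ψ t) = ∑ b, J a b • Ψ (nab b t)) (σ : R) (w : ℝ) (t : M) :
    lrR D' (K.transpose * gi.map φ * K) Γ' nab' (φ σ) w (Ψ t) = Ψ (lrR D gi Γ nab σ w t) := by
  have h1 := h.pair gi (fun a => D a σ) (fun a => Ψ (nab a t))
  have h2 : ∀ r : ℝ, φ (algebraMap ℝ R r) = algebraMap ℝ R' r := fun r => by simp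
  simp only [lrR, lapR_change h hΓ hn' Ψ hΨ hnab, h.jtr_eq hD' gi hΓ, h.rhoR_eq hD' hΓ, h.chain,
    hnab, h1, map_add, map_neg, hΨ, map_sum, map_smul, h2]

variable {g gi : Matrix (Fin d) (Fin d) R} {Γ : Fin d → Fin d → Fin d → R} {Υ u : Fin d → R}
  {o p : R}

/-- Weight one in `lapR_conformal`: the trace of the Hessian in `Δ(Ωσ)` cancels the one in `J`, so
the bottom slot changes by first derivatives of the scale only. -/
theorem rhoR_conformal (hd : 3 ≤ d) (h : IsMetricPair g gi) (hΓ : IsLeviCivita D g Γ)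
    (hu : ∀ a, ∑ c, g a c * u c = Υ a) (hD : ∀ a b, D a (Υ b) = D b (Υ a))
    (hop : o * p = 1) (ho : ∀ a, D a o = Υ a * o) (σ : R) :
    rhoR D (p ^ 2 • gi) (fun c a b => Γ c a b + weylDiff g Υ u c a b) (o * σ)
      = p * (rhoR D gi Γ σ - ∑ a, u a * D a σ - (1 / 2 : ℝ) • ((∑ c, Υ c * u c) * σ)) := by
  have h1 := lapR_conformal (p := p) h (Γ := Γ) hu (isConnection_derivation D)
    (isConnection_derivation D) LinearMap.id (fun a t => rfl) (w := 1) (r := o)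
    (fun a => Derivation.map_one_eq_zero _) (fun a => by rw [ho, one_mul]) σ
  simp only [LinearMap.id_coe, id_eq, smul_eq_mul] at h1
  rw [rhoR, rhoR, h1, jtr_conformal hd h hΓ hu hD]
  have k1 : algebraMap ℝ R (d : ℝ)⁻¹ * (d : R) = 1 := by
    rw [← map_natCast (algebraMap ℝ R), ← map_mul, inv_mul_cancel₀, map_one]
    have : (3 : ℝ) ≤ d := by exact_mod_cast hd
    linarith
  have k2 : algebraMap ℝ R (((d : ℝ) - 2) / 2) = algebraMap ℝ R (1 / 2) * ((d : R) - 2) := by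
    rw [← map_natCast (algebraMap ℝ R), ← map_ofNat (algebraMap ℝ R) 2, ← map_sub, ← map_mul]
    congr 1
    ring
  have k4 : algebraMap ℝ R (1 / 2) * 2 = 1 := by
    rw [← map_ofNat (algebraMap ℝ R) 2, ← map_mul]
    norm_num
  simp only [Algebra.smul_def, k2]
  generalize algebraMap ℝ R (1 / 2) = ν at *
  generalize algebraMap ℝ R (d : ℝ)⁻¹ = κ at *
  generalize ∑ c, Υ c * u c = V
  generalize ∑ a, u a * D a σ = N
  generalize ∑ a, ∑ b, gi a b * hess D Γ Υ a b = H
  generalize lapR gi Γ (fun a f => D a f) σ = L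
  generalize jtr D gi Γ = T
  linear_combination (-κ * p * (L + T * σ + d * N + d * ν * V * σ)) * hop
    - p * (N + ν * V * σ) * k1 + (κ * p ^ 2 * o * (d - 1) * V * σ) * k4

/-- The terms that `Υ` adds to the squared length of the gradient are the opposite of those it adds
to `2 σ ρ`. -/
theorem isqR_conformal (hd : 3 ≤ d) (h : IsMetricPair g gi) (hΓ : IsLeviCivita D g Γ)
    (hu : ∀ a, ∑ c, g a c * u c = Υ a) (hD : ∀ a b, D a (Υ b) = D b (Υ a))
    (hop : o * p = 1) (ho : ∀ a, D a o = Υ a * o) (σ : R) :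
    isqR D (p ^ 2 • gi) (fun c a b => Γ c a b + weylDiff g Υ u c a b) (o * σ)
      = isqR D gi Γ σ := by
  have hup : ∀ a, ∑ b, gi a b * Υ b = u a := fun a => by
    simp only [← hu]
    exact h.raise_lower u a
  have e1 : ∑ a, ∑ b, (p ^ 2 • gi) a b * D a (o * σ) * D b (o * σ)
      = ∑ a, ∑ b, gi a b * D a σ * D b σ + 2 * σ * ∑ a, u a * D a σ
        + σ ^ 2 * ∑ c, Υ c * u c := by
    have f1 : ∑ a, ∑ b, gi a b * (D a σ * Υ b) = ∑ a, u a * D a σ := by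
      refine Finset.sum_congr rfl fun a _ => ?_
      rw [← hup a, Finset.sum_mul]
      exact Finset.sum_congr rfl fun b _ => by ring
    have f2 : ∑ a, ∑ b, gi a b * (Υ a * D b σ) = ∑ a, u a * D a σ := by
      rw [← f1, Finset.sum_comm]
      exact Finset.sum_congr rfl fun a _ => Finset.sum_congr rfl fun b _ => by
        rw [h.symm_inv]
        ring
    have f3 : ∑ a, ∑ b, gi a b * (Υ a * Υ b) = ∑ c, Υ c * u c := by
      refine Finset.sum_congr rfl fun a _ => ?_
      rw [← hup a, Finset.mul_sum]
      exact Finset.sum_congr rfl fun b _ => by ring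
    have hop2 : o ^ 2 * p ^ 2 = 1 := by rw [← mul_pow, hop, one_pow]
    have f4 : ∀ a b, (p ^ 2 • gi) a b * D a (o * σ) * D b (o * σ)
        = gi a b * D a σ * D b σ + σ * (gi a b * (D a σ * Υ b)) + σ * (gi a b * (Υ a * D b σ))
          + σ ^ 2 * (gi a b * (Υ a * Υ b)) := by
      intro a b
      simp only [Matrix.smul_apply, smul_eq_mul, Derivation.leibniz, ho]
      linear_combination (gi a b * (D a σ + σ * Υ a) * (D b σ + σ * Υ b)) * hop2
    simp only [f4, Finset.sum_add_distrib, ← Finset.mul_sum, f1, f2, f3]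
    ring
  have k4 : algebraMap ℝ R (1 / 2) * 2 = 1 := by
    rw [← map_ofNat (algebraMap ℝ R) 2, ← map_mul]
    norm_num
  rw [isqR, isqR, e1, rhoR_conformal hd h hΓ hu hD hop ho]
  simp only [Algebra.smul_def]
  linear_combination (2 * σ * (rhoR D gi Γ σ - ∑ a, u a * D a σ
    - algebraMap ℝ R (1 / 2) * ((∑ c, Υ c * u c) * σ))) * hop - σ ^ 2 * (∑ c, Υ c * u c) * k4

/-- Two cancellations carry this. The Hessian of the scale in `Δ` is removed by `w J`. The first
order term `(d + 2w - 2) σ Υ·∇t` from the Laplacian is removed by the change of `dσ` in the gradient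
term, which carries the same factor. -/
theorem lrR_conformal (hd : 3 ≤ d) (h : IsMetricPair g gi) (hΓ : IsLeviCivita D g Γ)
    (hu : ∀ a, ∑ c, g a c * u c = Υ a) (hD : ∀ a b, D a (Υ b) = D b (Υ a))
    (hop : o * p = 1) (ho : ∀ a, D a o = Υ a * o) (σ : R)
    {M' : Type*} [AddCommGroup M'] [Module R M'] {nab : Fin d → M → M} {nab' : Fin d → M' → M'}
    (hn : IsConnection D nab) (hn' : IsConnection D nab')
    (Ψ : M →ₗ[R] M') (hnab : ∀ a t, nab' a (Ψ t) = Ψ (nab a t))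
    {w : ℝ} {r : R} (hr : ∀ a, D a r = algebraMap ℝ R w * Υ a * r) (t : M) :
    lrR D (p ^ 2 • gi) (fun c a b => Γ c a b + weylDiff g Υ u c a b) nab' (o * σ) w (r • Ψ t)
      = (p * r) • Ψ (lrR D gi Γ nab σ w t) := by
  have hup : ∀ a, ∑ b, gi a b * Υ b = u a := fun a => by
    simp only [← hu]
    exact h.raise_lower u a
  have n1 : ∀ b, nab' b (r • Ψ t) = r • Ψ (nab b t + (algebraMap ℝ R w * Υ b) • t) := by
    intro b
    rw [hn'.leibniz, hr, hnab, map_add, map_smul, smul_add, smul_smul, mul_comm r, add_comm]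
  have e1 : ∑ a, ∑ b, ((p ^ 2 • gi) a b * D a (o * σ)) • nab' b (r • Ψ t)
      = (p * r) • Ψ (∑ a, ∑ b, (gi a b * D a σ) • nab b t
        + σ • ∑ a, u a • nab a t
        + (algebraMap ℝ R w * ∑ a, u a * D a σ) • t
        + (algebraMap ℝ R w * σ * ∑ c, Υ c * u c) • t) := by
    have f0 : ∑ a, ∑ b, (gi a b * Υ a) • nab b t = ∑ a, u a • nab a t := by
      rw [Finset.sum_comm]
      refine Finset.sum_congr rfl fun a _ => ?_
      rw [← hup a, Finset.sum_smul]
      exact Finset.sum_congr rfl fun b _ => by rw [h.symm_inv]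
    have f1 : ∑ a, ∑ b, gi a b * (D a σ * Υ b) = ∑ a, u a * D a σ := by
      refine Finset.sum_congr rfl fun a _ => ?_
      rw [← hup a, Finset.sum_mul]
      exact Finset.sum_congr rfl fun b _ => by ring
    have f3 : ∑ a, ∑ b, gi a b * (Υ a * Υ b) = ∑ c, Υ c * u c := by
      refine Finset.sum_congr rfl fun a _ => ?_
      rw [← hup a, Finset.mul_sum]
      exact Finset.sum_congr rfl fun b _ => by ring
    have f4 : ∀ a b, ((p ^ 2 • gi) a b * D a (o * σ)) • nab' b (r • Ψ t)
        = (p * r) • Ψ ((gi a b * D a σ) • nab b t + σ • ((gi a b * Υ a) • nab b t)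
          + (gi a b * (D a σ * Υ b)) • (algebraMap ℝ R w • t)
          + (gi a b * (Υ a * Υ b)) • ((algebraMap ℝ R w * σ) • t)) := by
      intro a b
      have : (p ^ 2 • gi) a b * D a (o * σ) = p * (gi a b * D a σ + σ * (gi a b * Υ a)) := by
        simp only [Matrix.smul_apply, smul_eq_mul, Derivation.leibniz, ho]
        linear_combination (p * gi a b * (D a σ + σ * Υ a)) * hop
      have gen : ∀ (X : R) (Z : M), (p * X) • r • Ψ Z = (p * r) • Ψ (X • Z) := fun X Z => by
        rw [map_smul, smul_smul, smul_smul]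
        congr 1
        ring
      rw [this, n1, gen]
      congr 2
      module
    simp only [f4, ← Finset.smul_sum, ← map_sum, Finset.sum_add_distrib, f0,
      ← Finset.sum_smul, f1, f3]
    congr 2
    module
  have k2 : algebraMap ℝ R (((d : ℝ) - 2) / 2) = algebraMap ℝ R (1 / 2) * ((d : R) - 2) := by
    rw [← map_natCast (algebraMap ℝ R), ← map_ofNat (algebraMap ℝ R) 2, ← map_sub, ← map_mul]
    congr 1
    ring
  have k4 : algebraMap ℝ R (1 / 2) * 2 = 1 := by
    rw [← map_ofNat (algebraMap ℝ R) 2, ← map_mul]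
    norm_num
  have k5 : algebraMap ℝ R ((d : ℝ) + 2 * w - 2) = (d : R) + 2 * algebraMap ℝ R w - 2 := by
    simp only [map_add, map_sub, map_mul, map_ofNat, map_natCast]
  have e2 := lapR_conformal (p := p) h (Γ := Γ) hu hn hn' Ψ hnab
    (fun a => Derivation.map_algebraMap _ _) hr t
  rw [lrR, lrR, e1, e2, rhoR_conformal hd h hΓ hu hD hop ho, jtr_conformal hd h hΓ hu hD]
  simp only [Algebra.smul_def, k2, k5]
  have e3 : ∀ X : R, (X : R) • r • Ψ t = r • Ψ (X • t) := fun X => by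
    rw [map_smul, smul_comm]
  simp only [e3]
  have e4 : ∀ X, (o * σ) • ((p ^ 2 * r) • Ψ X) = (p * r) • Ψ (σ • X) := fun X => by
    rw [map_smul, smul_smul, smul_smul]
    congr 1
    linear_combination (σ * p * r) * hop
  generalize algebraMap ℝ R (1 / 2) = ν at *
  generalize algebraMap ℝ R w = W at *
  generalize ∑ c, Υ c * u c = V
  generalize ∑ a, u a * D a σ = N
  generalize ∑ a, ∑ b, gi a b * hess D Γ Υ a b = H
  generalize ∑ a, ∑ b, (gi a b * D a σ) • nab b t = A
  generalize ∑ a, u a • nab a t = B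
  generalize lapR gi Γ nab t = L
  generalize rhoR D gi Γ σ = T
  generalize jtr D gi Γ = C
  have e5 : (W * (p ^ 2 * (C - H - ν * ((d : R) - 2) * V))) • t
      = p ^ 2 • ((W * (C - H - ν * ((d : R) - 2) * V)) • t) := by
    rw [smul_smul]
    ring_nf
  have e6 : (W * (p * (T - N - ν * (V * σ)))) • t = p • ((W * (T - N - ν * (V * σ))) • t) := by
    rw [smul_smul]
    ring_nf
  have e7 : ∀ X Y (k : R), -((p * r) • Ψ X) + k • (p * r) • Ψ Y = (p * r) • Ψ (-X + k • Y) := by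
    intro X Y k
    rw [map_add, map_neg, map_smul, smul_add, smul_neg, smul_comm k]
  rw [e5, e6, map_smul _ (p ^ 2), map_smul _ p, smul_comm r (p ^ 2), smul_comm r p, ← mul_smul p,
    ← mul_smul (p ^ 2), ← smul_add (p ^ 2 * r), ← smul_add (p * r), ← map_add, ← map_add, e4, e7]
  congr 2
  have k7 : (ν * 2) • t = t := by rw [k4, one_smul]
  linear_combination (norm := module) (-(W ^ 2 * σ * V)) • k7

end Covariance

end LaplaceRobin

/-! ### The differential ring of smooth functions on an open set -/

section SmoothRing

variable {d m : ℕ} (U : TopologicalSpace.Opens (Model d))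

/-- The smooth functions on `U` as a subalgebra of all functions. -/
def smSubalgebra : Subalgebra ℝ (U → ℝ) where
  carrier := {f | ∃ F : Model d → ℝ, ContDiffOn ℝ ∞ F U ∧ ∀ y : U, F y = f y}
  mul_mem' := by
    rintro f g ⟨F, hF, hf⟩ ⟨G, hG, hg⟩
    exact ⟨fun y => F y * G y, hF.mul hG, fun y => by simp [hf, hg]⟩
  add_mem' := by
    rintro f g ⟨F, hF, hf⟩ ⟨G, hG, hg⟩
    exact ⟨fun y => F y + G y, hF.add hG, fun y => by simp [hf, hg]⟩
  algebraMap_mem' := fun r => ⟨fun _ => r, contDiffOn_const, fun _ => rfl⟩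

/-- The ring of smooth functions on `U`. -/
def Sm : Type := smSubalgebra U

instance : CommRing (Sm U) := inferInstanceAs (CommRing (smSubalgebra U))

instance : Algebra ℝ (Sm U) := inferInstanceAs (Algebra ℝ (smSubalgebra U))

variable {U}

/-- Evaluation at a point. -/
def Sm.ev (y : U) : Sm U →ₐ[ℝ] ℝ :=
  (Pi.evalAlgHom ℝ (fun _ : U => ℝ) y).comp (smSubalgebra U).val

/-- The function `F` represents `f` on `U`. -/
def Rep (F : Model d → ℝ) (f : Sm U) : Prop := ∀ y : U, F y = Sm.ev y f

theorem Sm.ext {f g : Sm U} (h : ∀ y, Sm.ev y f = Sm.ev y g) : f = g :=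
  Subtype.ext (funext h)

theorem Sm.exists_rep (f : Sm U) : ∃ F : Model d → ℝ, ContDiffOn ℝ ∞ F U ∧ Rep F f := f.2

theorem exists_rep_of_contDiffOn {F : Model d → ℝ} (hF : ContDiffOn ℝ ∞ F U) :
    ∃ f : Sm U, Rep F f :=
  ⟨⟨fun y => F y, F, hF, fun _ => rfl⟩, fun _ => rfl⟩

theorem Rep.eqOn {F G : Model d → ℝ} {f : Sm U} (hF : Rep F f) (hG : Rep G f) :
    Set.EqOn F G U := fun y hy => (hF ⟨y, hy⟩).trans (hG ⟨y, hy⟩).symm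

theorem Rep.contDiffOn {F : Model d → ℝ} {f : Sm U} (hF : Rep F f) : ContDiffOn ℝ ∞ F U := by
  obtain ⟨G, hG, h⟩ := (Sm.exists_rep f)
  exact hG.congr (hF.eqOn h)

theorem pd_congr {V : Type*} [NormedAddCommGroup V] [NormedSpace ℝ V] {f g : Model d → V}
    (h : Set.EqOn f g U) (a : Fin d) {y : Model d} (hy : y ∈ U) : pd a f y = pd a g y := by
  rw [pd, pd, Filter.EventuallyEq.fderiv_eq (h.eventuallyEq_of_mem (U.isOpen.mem_nhds hy))]

theorem contDiffOn_pd {V : Type*} [NormedAddCommGroup V] [NormedSpace ℝ V] {f : Model d → V}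
    (h : ContDiffOn ℝ ∞ f U) (a : Fin d) : ContDiffOn ℝ ∞ (pd a f) U :=
  (h.fderiv_of_isOpen U.isOpen (by simp)).clm_apply contDiffOn_const

theorem differentiableAt_of_contDiffOn {V : Type*} [NormedAddCommGroup V] [NormedSpace ℝ V]
    {f : Model d → V} (h : ContDiffOn ℝ ∞ f U) {y : Model d} (hy : y ∈ U) :
    DifferentiableAt ℝ f y :=
  (h.contDiffAt (U.isOpen.mem_nhds hy)).differentiableAt (by simp)

theorem pd_comm {f : Model d → ℝ} (h : ContDiffOn ℝ ∞ f U) (a b : Fin d) {y : Model d}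
    (hy : y ∈ U) : pd a (pd b f) y = pd b (pd a f) y := by
  have hc : ContDiffAt ℝ 2 f y :=
    (h.contDiffAt (U.isOpen.mem_nhds hy)).of_le (by norm_cast)
  have hs := hc.isSymmSndFDerivAt (by simp)
  have hd : DifferentiableAt ℝ (fderiv ℝ f) y :=
    differentiableAt_of_contDiffOn (h.fderiv_of_isOpen U.isOpen (by simp)) hy
  have key : ∀ a b : Fin d, pd a (pd b f) y
      = fderiv ℝ (fderiv ℝ f) y (EuclideanSpace.single a 1) (EuclideanSpace.single b 1) := by
    intro a b
    rw [pd]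
    change fderiv ℝ (fun z => fderiv ℝ f z (EuclideanSpace.single b 1)) y _ = _
    rw [fderiv_clm_apply hd (differentiableAt_const _)]
    simp
  rw [key, key]
  exact hs _ _

/-- The partial derivatives as derivations. -/
def Sm.D (a : Fin d) : Derivation ℝ (Sm U) (Sm U) :=
  Derivation.mk'
    -- An element of the ring is a function on `U`; it is differentiated through some extension to
    -- the whole space. Since `U` is open, `pd_congr` shows that the extension is irrelevant.
    { toFun := fun f => ⟨fun y => pd a (Classical.choose (Sm.exists_rep f)) y,
        pd a (Classical.choose (Sm.exists_rep f)),
        contDiffOn_pd (Classical.choose_spec (Sm.exists_rep f)).1 a, fun _ => rfl⟩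
      map_add' := by
        intro f g
        refine Subtype.ext (funext fun y => ?_)
        have hf := Classical.choose_spec (Sm.exists_rep f)
        have hg := Classical.choose_spec (Sm.exists_rep g)
        have hfg := Classical.choose_spec (Sm.exists_rep (f + g))
        change pd a (Classical.choose (Sm.exists_rep (f + g))) y
          = pd a (Classical.choose (Sm.exists_rep f)) y + pd a (Classical.choose (Sm.exists_rep g)) y
        have : Set.EqOn (Classical.choose (Sm.exists_rep (f + g)))
            (fun z => Classical.choose (Sm.exists_rep f) z + Classical.choose (Sm.exists_rep g) z) U :=
          fun z hz => by
            have h1 := hfg.2 ⟨z, hz⟩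
            have h2 := hf.2 ⟨z, hz⟩
            have h3 := hg.2 ⟨z, hz⟩
            dsimp only at h1 h2 h3 ⊢
            rw [h1, h2, h3, map_add]
        rw [pd_congr this a y.2, pd, fderiv_fun_add (differentiableAt_of_contDiffOn hf.1 y.2)
          (differentiableAt_of_contDiffOn hg.1 y.2)]
        rfl
      map_smul' := by
        intro r f
        refine Subtype.ext (funext fun y => ?_)
        have hf := Classical.choose_spec (Sm.exists_rep f)
        have hfg := Classical.choose_spec (Sm.exists_rep (r • f))
        change pd a (Classical.choose (Sm.exists_rep (r • f))) y
          = r • pd a (Classical.choose (Sm.exists_rep f)) y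
        have : Set.EqOn (Classical.choose (Sm.exists_rep (r • f)))
            (fun z => r • Classical.choose (Sm.exists_rep f) z) U :=
          fun z hz => by
            have h1 := hfg.2 ⟨z, hz⟩
            have h2 := hf.2 ⟨z, hz⟩
            dsimp only at h1 h2 ⊢
            rw [h1, h2, map_smul]
        rw [pd_congr this a y.2, pd,
          fderiv_fun_const_smul (differentiableAt_of_contDiffOn hf.1 y.2)]
        rfl }
    (by
      intro f g
      refine Subtype.ext (funext fun y => ?_)
      have hf := Classical.choose_spec (Sm.exists_rep f)
      have hg := Classical.choose_spec (Sm.exists_rep g)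
      have hfg := Classical.choose_spec (Sm.exists_rep (f * g))
      change pd a (Classical.choose (Sm.exists_rep (f * g))) y
        = Sm.ev y f * pd a (Classical.choose (Sm.exists_rep g)) y
          + Sm.ev y g * pd a (Classical.choose (Sm.exists_rep f)) y
      have : Set.EqOn (Classical.choose (Sm.exists_rep (f * g)))
          (fun z => Classical.choose (Sm.exists_rep f) z * Classical.choose (Sm.exists_rep g) z) U :=
        fun z hz => by
          have h1 := hfg.2 ⟨z, hz⟩
          have h2 := hf.2 ⟨z, hz⟩
          have h3 := hg.2 ⟨z, hz⟩
          dsimp only at h1 h2 h3 ⊢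
          rw [h1, h2, h3, map_mul]
      rw [pd_congr this a y.2, pd, fderiv_fun_mul (differentiableAt_of_contDiffOn hf.1 y.2)
        (differentiableAt_of_contDiffOn hg.1 y.2), ← hf.2 y, ← hg.2 y]
      rfl)

theorem Rep.pd {F : Model d → ℝ} {f : Sm U} (h : Rep F f) (a : Fin d) :
    Rep (pd a F) (Sm.D a f) := fun y =>
  pd_congr (h.eqOn (Classical.choose_spec (Sm.exists_rep f)).2) a y.2

theorem Sm.D_comm (a b : Fin d) (f : Sm U) : Sm.D a (Sm.D b f) = Sm.D b (Sm.D a f) := by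
  obtain ⟨F, hF, h⟩ := (Sm.exists_rep f)
  refine Sm.ext fun y => ?_
  rw [← (h.pd b).pd a y, ← (h.pd a).pd b y, pd_comm hF a b y.2]

/-- The tensor valued function `t` represents `τ` on `U`. -/
def RepT (t : Model d → Tensor d m) (τ : TensorR d m (Sm U)) : Prop :=
  ∀ I, Rep (fun y => t y I) (τ I)

theorem RepT.contDiffOn {t : Model d → Tensor d m} {τ : TensorR d m (Sm U)} (h : RepT t τ) :
    ContDiffOn ℝ ∞ t U :=
  contDiffOn_pi.2 fun I => (h I).contDiffOn

theorem exists_repT_of_contDiffOn {t : Model d → Tensor d m} (ht : ContDiffOn ℝ ∞ t U) :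
    ∃ τ : TensorR d m (Sm U), RepT t τ := by
  choose τ hτ using fun I => exists_rep_of_contDiffOn (contDiffOn_pi.1 ht I)
  exact ⟨τ, hτ⟩

theorem RepT.eqOn {s t : Model d → Tensor d m} {τ : TensorR d m (Sm U)} (hs : RepT s τ)
    (ht : RepT t τ) : Set.EqOn s t U :=
  fun _ hy => funext fun I => (hs I).eqOn (ht I) hy

theorem pd_apply {t : Model d → Tensor d m} {y : Model d} (h : DifferentiableAt ℝ t y)
    (a : Fin d) (I : Fin m → Slot d) : pd a t y I = pd a (fun z => t z I) y := by
  rw [pd, pd, fderiv_pi fun i => differentiableAt_pi.1 h i]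
  rfl

theorem RepT.pd {t : Model d → Tensor d m} {τ : TensorR d m (Sm U)} (h : RepT t τ)
    (a : Fin d) : RepT (pd a t) (fun I => Sm.D a (τ I)) := fun I y => by
  change ConformalTractor.pd a t y I = _
  rw [pd_apply (differentiableAt_of_contDiffOn h.contDiffOn y.2)]
  exact (h I).pd a y

/-! ### Comparison of the local expressions -/

section Compare

variable {G : Model d → Matrix (Fin d) (Fin d) ℝ} {g gi : Matrix (Fin d) (Fin d) (Sm U)}

variable (G g gi) in
/-- `g` and `gi` represent the metric `G` and its inverse. -/
structure RepMetric : Prop where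
  rep : ∀ i j, Rep (fun y => G y i j) (g i j)
  rep_inv : ∀ i j, Rep (fun y => (G y)⁻¹ i j) (gi i j)

variable (hG : RepMetric G g gi)

include hG

theorem RepMetric.rep_christoffel (c a b : Fin d) :
    Rep (christoffel G c a b) (chr Sm.D g gi c a b) := fun y => by
  simp only [christoffel, chr, map_smul, map_sum, map_mul, map_add, map_sub,
    fun i j => hG.rep_inv i j y, fun i j a => (hG.rep i j).pd a y, smul_eq_mul]

theorem RepMetric.rep_riemann (a b c f : Fin d) :
    Rep (riemann G a b c f) (riem Sm.D (chr Sm.D g gi) a b c f) := fun y => by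
  simp only [riemann, riem, map_sum, map_mul, map_add, map_sub,
    fun c a b => hG.rep_christoffel c a b y, fun c a b e => (hG.rep_christoffel c a b).pd e y]

theorem RepMetric.rep_ricci (a b : Fin d) :
    Rep (ricci G a b) (ric Sm.D (chr Sm.D g gi) a b) := fun y => by
  simp only [ricci, ric, map_sum, fun a b c f => hG.rep_riemann a b c f y]

theorem RepMetric.rep_schoutenTrace :
    Rep (schoutenTrace G) (jtr Sm.D gi (chr Sm.D g gi)) := fun y => by
  simp only [schoutenTrace, scalarCurv, jtr, map_sum, map_mul, map_smul,
    fun a b => hG.rep_ricci a b y, fun i j => hG.rep_inv i j y, smul_eq_mul]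
  rw [div_eq_inv_mul]

theorem RepMetric.rep_schouten (a b : Fin d) :
    Rep (schouten G a b) (sch Sm.D g gi (chr Sm.D g gi) a b) := fun y => by
  simp only [schouten, sch, map_sub, map_mul, map_smul,
    fun a b => hG.rep_ricci a b y, fun i j => hG.rep i j y, hG.rep_schoutenTrace y, smul_eq_mul]
  rw [div_eq_inv_mul]

theorem RepMetric.rep_connMatrix (a : Fin d) (A B : Slot d) :
    Rep (fun y => connMatrix G a y A B) (conn Sm.D g gi (chr Sm.D g gi) a A B) := fun y => by
  rcases A with _ | b | _ <;> rcases B with _ | e | _ <;>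
    simp [connMatrix, conn, slots, fun a b => hG.rep_schouten a b y,
      fun i j => hG.rep i j y, fun i j => hG.rep_inv i j y,
      fun c a b => hG.rep_christoffel c a b y, apply_ite (Sm.ev y)]

theorem RepMetric.rep_cov (a : Fin d) {t : Model d → Tensor d m} {τ : TensorR d m (Sm U)}
    (h : RepT t τ) :
    RepT (cov G a t) (covR Sm.D (conn Sm.D g gi (chr Sm.D g gi)) a τ) := fun I y => by
  simp only [cov, covR, Pi.add_apply, dActR, map_add, map_sum, map_mul,
    h.pd a I y, fun A B => hG.rep_connMatrix a A B y, fun I => h I y]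

theorem RepMetric.rep_laplacian {t : Model d → Tensor d m} {τ : TensorR d m (Sm U)}
    (h : RepT t τ) :
    RepT (laplacian G t) (lapR gi (chr Sm.D g gi)
      (covR Sm.D (conn Sm.D g gi (chr Sm.D g gi))) τ) := fun I y => by
  simp only [laplacian, lapR, Pi.sub_apply, Pi.smul_apply, smul_eq_mul,
    Finset.sum_apply, map_sub, map_sum, map_mul, fun c a b => hG.rep_christoffel c a b y,
    fun a b => hG.rep_cov a (hG.rep_cov b h) I y, fun a => hG.rep_cov a h I y, fun i j => hG.rep_inv i j y]

end Compare

end SmoothRing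

/-! ### The scale tractor and the Laplace-Robin operator expanded in slots. -/

section LaplaceRobinPointwise

variable {d m : ℕ}

theorem scaleTractor_eq (hd : d ≠ 0) (G : Model d → Matrix (Fin d) (Fin d) ℝ)
    (s : Model d → Tensor d 0) (y : Model d) :
    scaleTractor G s y = slots (scalar (s y)) (fun a => scalar (cov G a s y))
      (-((d : ℝ)⁻¹ * (scalar (laplacian G s y) + schoutenTrace G y * scalar (s y)))) := by
  have hd' : (d : ℝ) ≠ 0 := Nat.cast_ne_zero.2 hd
  funext A
  rcases A with _ | a | _ <;>
    simp [scaleTractor, thomasDHat, thomasD, slots, scalar, hd']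
  ring

theorem sum_tractorGram {V : Type*} [AddCommGroup V] [Module ℝ V]
    (g : Matrix (Fin d) (Fin d) ℝ) (X : Slot d → ℝ) (Y : Slot d → V) :
    ∑ A, ∑ B, (tractorGram g A B * X A) • Y B
      = X (Sum.inl ()) • Y (Sum.inr (Sum.inr ()))
        + (∑ a, ∑ b, (g⁻¹ a b * X (Sum.inr (Sum.inl a))) • Y (Sum.inr (Sum.inl b))
          + X (Sum.inr (Sum.inr ())) • Y (Sum.inl ())) := by
  simp [Fintype.sum_sum_type, tractorGram, slots]

theorem laplaceRobin_eq (hd : d ≠ 0) (G : Model d → Matrix (Fin d) (Fin d) ℝ)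
    (s : Model d → Tensor d 0) (w : ℝ) (t : Model d → Tensor d m) (y : Model d) :
    laplaceRobin G s w t y
      = -(scalar (s y) • (laplacian G t y + (w * schoutenTrace G y) • t y))
        + ((d : ℝ) + 2 * w - 2) •
          (∑ a, ∑ b, ((G y)⁻¹ a b * scalar (cov G a s y)) • cov G b t y
            + (w * -((d : ℝ)⁻¹ * (scalar (laplacian G s y) + schoutenTrace G y * scalar (s y))))
              • t y) := by
  rw [laplaceRobin, sum_tractorGram, scaleTractor_eq hd]
  simp only [slots, thomasD, smul_neg]
  congr 1
  rw [smul_add]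
  congr 1
  · simp only [Finset.smul_sum]
    exact Finset.sum_congr rfl fun a _ => Finset.sum_congr rfl fun b _ => smul_comm _ _ _
  · simp only [smul_smul]
    congr 1
    ring

theorem scaleSq_eq (hd : d ≠ 0) (G : Model d → Matrix (Fin d) (Fin d) ℝ)
    (s : Model d → Tensor d 0) (y : Model d) :
    scaleSq G s y
      = ∑ a, ∑ b, (G y)⁻¹ a b * scalar (cov G a s y) * scalar (cov G b s y)
        + 2 * (scalar (s y)
          * -((d : ℝ)⁻¹ * (scalar (laplacian G s y) + schoutenTrace G y * scalar (s y)))) := by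
  have := sum_tractorGram (G y) (scaleTractor G s y) (scaleTractor G s y)
  simp only [smul_eq_mul] at this
  rw [scaleSq, this, scaleTractor_eq hd]
  simp only [slots]
  ring

end LaplaceRobinPointwise

/-! ### The concrete operators represented over the ring of smooth functions. -/

section Compare

variable {d m : ℕ} {U : TopologicalSpace.Opens (Model d)}
variable {G : Model d → Matrix (Fin d) (Fin d) ℝ} {g gi : Matrix (Fin d) (Fin d) (Sm U)}

variable (gi) in
/-- The Levi-Civita-tractor derivative over the ring of smooth functions. -/
abbrev nabS (g : Matrix (Fin d) (Fin d) (Sm U)) :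
    Fin d → TensorR d m (Sm U) → TensorR d m (Sm U) :=
  covR Sm.D (conn Sm.D g gi (chr Sm.D g gi))

theorem covR_rank_zero {R : Type*} [CommRing R] [Algebra ℝ R] (D : Fin d → Derivation ℝ R R)
    (θ : Fin d → Matrix (Slot d) (Slot d) R) (a : Fin d) (σ : R) :
    covR D θ a (fun _ : Fin 0 → Slot d => σ) = fun _ => D a σ := by
  funext I
  simp [covR, dActR]

theorem lapR_rank_zero {R : Type*} [CommRing R] [Algebra ℝ R] (D : Fin d → Derivation ℝ R R)
    (θ : Fin d → Matrix (Slot d) (Slot d) R) (gi : Matrix (Fin d) (Fin d) R)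
    (Γ : Fin d → Fin d → Fin d → R) (σ : R) :
    lapR gi Γ (covR D θ) (fun _ : Fin 0 → Slot d => σ)
      = fun _ => lapR gi Γ (fun a f => D a f) σ := by
  funext I
  simp [lapR, covR_rank_zero]

variable (hG : RepMetric G g gi)

include hG

theorem RepMetric.rep_cov_scalar (a : Fin d) {s : Model d → Tensor d 0} {σ : Sm U}
    (h : RepT s fun _ => σ) : Rep (fun y => scalar (cov G a s y)) (Sm.D a σ) := by
  have := hG.rep_cov a h
  rw [covR_rank_zero] at this
  exact this Fin.elim0

theorem RepMetric.rep_laplacian_scalar {s : Model d → Tensor d 0} {σ : Sm U}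
    (h : RepT s fun _ => σ) :
    Rep (fun y => scalar (laplacian G s y))
      (lapR gi (chr Sm.D g gi) (fun a f => Sm.D a f) σ) := by
  have := hG.rep_laplacian h
  rw [lapR_rank_zero] at this
  exact this Fin.elim0

theorem RepMetric.rep_rho (s : Model d → Tensor d 0) {σ : Sm U} (h : RepT s fun _ => σ) :
    Rep (fun y => -((d : ℝ)⁻¹ * (scalar (laplacian G s y) + schoutenTrace G y * scalar (s y))))
      (rhoR Sm.D gi (chr Sm.D g gi) σ) := fun y => by
  simp only [rhoR, map_neg, map_smul, map_add, map_mul, hG.rep_laplacian_scalar h y,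
    hG.rep_schoutenTrace y, smul_eq_mul]
  rw [← h Fin.elim0 y]
  rfl

theorem RepMetric.rep_scaleSq (hd : d ≠ 0) {s : Model d → Tensor d 0} {σ : Sm U}
    (h : RepT s fun _ => σ) : Rep (scaleSq G s) (isqR Sm.D gi (chr Sm.D g gi) σ) := fun y => by
  rw [scaleSq_eq hd]
  have h0 : scalar (s y) = Sm.ev y σ := h Fin.elim0 y
  simp only [isqR, map_add, map_mul, map_sum, hG.rep_inv _ _ y, hG.rep_cov_scalar _ h y,
    ← hG.rep_rho s h y, h0, map_ofNat]

theorem RepMetric.rep_laplaceRobin (hd : d ≠ 0) {s : Model d → Tensor d 0} {σ : Sm U}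
    (h : RepT s fun _ => σ) (w : ℝ) {t : Model d → Tensor d m} {τ : TensorR d m (Sm U)}
    (ht : RepT t τ) :
    RepT (laplaceRobin G s w t) (lrR Sm.D gi (chr Sm.D g gi) (nabS gi g) σ w τ) := fun I y => by
  have h0 : scalar (s y) = Sm.ev y σ := h Fin.elim0 y
  change laplaceRobin G s w t y I = _
  rw [laplaceRobin_eq hd]
  simp only [lrR, nabS, Pi.add_apply, Pi.neg_apply, Pi.smul_apply, smul_eq_mul, Finset.sum_apply,
    map_add, map_neg, map_mul, map_sum, map_smul, hG.rep_inv _ _ y, hG.rep_cov_scalar _ h y,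
    ← hG.rep_rho s h y, h0, hG.rep_laplacian ht I y, hG.rep_schoutenTrace y, ht I y, hG.rep_cov _ ht I y,
    AlgHom.commutes, Algebra.algebraMap_self, RingHom.id_apply]

theorem RepMetric.rep_yOp (hd : d ≠ 0) {s : Model d → Tensor d 0} {σ v : Sm U}
    (h : RepT s fun _ => σ) (hv : v * isqR Sm.D gi (chr Sm.D g gi) σ = 1) (w : ℝ)
    {t : Model d → Tensor d m} {τ : TensorR d m (Sm U)} (ht : RepT t τ) :
    RepT (yOp G s w t) (yR Sm.D gi (chr Sm.D g gi) (nabS gi g) σ v w τ) := fun I y => by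
  have hv' : (scaleSq G s y)⁻¹ = Sm.ev y v := by
    rw [hG.rep_scaleSq hd h y]
    have := congrArg (Sm.ev y) hv
    rw [map_mul, map_one] at this
    exact (eq_inv_of_mul_eq_one_left this).symm
  simp only [yOp, yR, Pi.neg_apply, Pi.smul_apply, smul_eq_mul, map_neg, map_mul,
    hv', hG.rep_laplaceRobin hd h w ht I y]

theorem RepMetric.rep_yPow (hd : d ≠ 0) {s : Model d → Tensor d 0} {σ v : Sm U}
    (h : RepT s fun _ => σ) (hv : v * isqR Sm.D gi (chr Sm.D g gi) σ = 1) (k : ℕ) (w : ℝ)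
    {t : Model d → Tensor d m} {τ : TensorR d m (Sm U)} (ht : RepT t τ) :
    RepT (yPow G s k w t) (yPowR Sm.D gi (chr Sm.D g gi) (nabS gi g) σ v k w τ) := by
  induction k generalizing w t τ with
  | zero => exact ht
  | succ k ih => exact ih (w - 1) (hG.rep_yOp hd h hv w ht)

end Compare

/-! ### Orders of vanishing -/

section Vanishing

variable {d m : ℕ} {R : Type*} [CommRing R] [Algebra ℝ R]
variable (D : Fin d → Derivation ℝ R R) (ε : R →ₐ[ℝ] ℝ)

/-- Elements vanishing to order `j` at `ε`, as a set. -/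
def VanSet : ℕ → Set R
  | 0 => Set.univ
  | j + 1 => {f | ε f = 0 ∧ ∀ a, D a f ∈ VanSet j}

theorem vanSet_succ_subset (j : ℕ) : VanSet D ε (j + 1) ⊆ VanSet D ε j := by
  induction j with
  | zero => exact fun _ _ => trivial
  | succ j ih => exact fun f hf => ⟨hf.1, fun a => ih (hf.2 a)⟩

/-- The ideal of elements vanishing to order `j` at the point `ε`. -/
def Van (j : ℕ) : Ideal R where
  carrier := VanSet D ε j
  zero_mem' := by
    induction j with
    | zero => trivial
    | succ j ih => exact ⟨map_zero ε, fun a => by rw [map_zero]; exact ih⟩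
  add_mem' := by
    intro f g hf hg
    induction j generalizing f g with
    | zero => trivial
    | succ j ih =>
      exact ⟨by rw [map_add, hf.1, hg.1, add_zero],
        fun a => by rw [map_add]; exact ih (hf.2 a) (hg.2 a)⟩
  smul_mem' := by
    have hadd : ∀ (j : ℕ) {f g : R}, f ∈ VanSet D ε j → g ∈ VanSet D ε j →
        f + g ∈ VanSet D ε j := by
      intro j
      induction j with
      | zero => exact fun _ _ => trivial
      | succ j ih =>
        exact fun hf hg => ⟨by rw [map_add, hf.1, hg.1, add_zero],
          fun a => by rw [map_add]; exact ih (hf.2 a) (hg.2 a)⟩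
    intro c f hf
    induction j generalizing c f with
    | zero => trivial
    | succ j ih =>
      refine ⟨by rw [smul_eq_mul, map_mul, hf.1, mul_zero], fun a => ?_⟩
      rw [smul_eq_mul, Derivation.leibniz]
      refine hadd j (ih c (hf.2 a)) ?_
      rw [smul_eq_mul, mul_comm]
      exact ih _ (vanSet_succ_subset D ε j hf)

variable {D ε}

theorem mem_van_zero (f : R) : f ∈ Van D ε 0 := trivial

theorem mem_van_one {f : R} : f ∈ Van D ε 1 ↔ ε f = 0 :=
  ⟨fun h => h.1, fun h => ⟨h, fun _ => trivial⟩⟩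

theorem van_anti {i j : ℕ} (h : i ≤ j) : Van D ε j ≤ Van D ε i := by
  induction h with
  | refl => exact le_rfl
  | step _ ih => exact le_trans (vanSet_succ_subset D ε _) ih

theorem van_mono {i j : ℕ} {f : R} (hf : f ∈ Van D ε j) (h : i ≤ j) : f ∈ Van D ε i :=
  van_anti h hf

theorem eval_eq_zero {j : ℕ} {f : R} (hf : f ∈ Van D ε j) (h : 1 ≤ j) : ε f = 0 :=
  mem_van_one.1 (van_mono hf h)

theorem van_D {j : ℕ} {f : R} (hf : f ∈ Van D ε j) (a : Fin d) : D a f ∈ Van D ε (j - 1) := by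
  cases j with
  | zero => trivial
  | succ j => exact hf.2 a

theorem van_mul {i j : ℕ} {f g : R} (hf : f ∈ Van D ε i) (hg : g ∈ Van D ε j) :
    f * g ∈ Van D ε (i + j) := by
  -- Induction on the total order: the Leibniz rule lowers the order of one factor at a time, and
  -- the other one stays as it was.
  suffices H : ∀ n i j, i + j = n → ∀ {f g : R}, f ∈ Van D ε i → g ∈ Van D ε j →
      f * g ∈ Van D ε n from H _ i j rfl hf hg
  intro n
  induction n with
  | zero => exact fun _ _ _ _ _ _ _ => trivial
  | succ n ih =>
    intro i j hij f g hf hg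
    rcases i with _ | i
    · obtain rfl : j = n + 1 := by omega
      exact Ideal.mul_mem_left _ _ hg
    rcases j with _ | j
    · obtain rfl : i = n := by omega
      exact Ideal.mul_mem_right _ _ hf
    refine ⟨by rw [map_mul, hf.1, zero_mul], fun a => ?_⟩
    rw [Derivation.leibniz]
    refine add_mem (ih (i + 1) j (by omega) hf (hg.2 a)) ?_
    rw [smul_eq_mul, mul_comm]
    exact ih i (j + 1) (by omega) (hf.2 a) hg

theorem van_mul' {i j n : ℕ} {f g : R} (hf : f ∈ Van D ε i) (hg : g ∈ Van D ε j)
    (h : n ≤ i + j) : f * g ∈ Van D ε n := van_mono (van_mul hf hg) h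

theorem van_pow {f : R} (hf : f ∈ Van D ε 1) (n : ℕ) : f ^ n ∈ Van D ε n := by
  induction n with
  | zero => trivial
  | succ n ih => rw [pow_succ]; exact van_mul ih hf

theorem van_rsmul {j : ℕ} {f : R} (hf : f ∈ Van D ε j) (r : ℝ) : r • f ∈ Van D ε j :=
  Submodule.smul_of_tower_mem _ r hf

theorem sub_eval_mem_van_one (f : R) : f - algebraMap ℝ R (ε f) ∈ Van D ε 1 :=
  mem_van_one.2 (by rw [map_sub, AlgHom.commutes]; exact sub_self _)

variable (D) in
/-- The vector field with components `N`. -/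
def vf (N : Fin d → R) : Derivation ℝ R R := ∑ a, N a • D a

variable (D) in
/-- The directional derivative along a constant vector. -/
def dir (n : Fin d → ℝ) : Derivation ℝ R R := ∑ a, n a • D a

theorem derivation_sum_apply {ι : Type*} (s : Finset ι) (δ : ι → Derivation ℝ R R) (f : R) :
    (∑ i ∈ s, δ i) f = ∑ i ∈ s, δ i f := by
  have := congrFun (map_sum (Derivation.coeFnAddMonoidHom (R := ℝ) (A := R) (M := R)) δ s) f
  rw [Finset.sum_apply] at this
  exact this

theorem vf_apply (N : Fin d → R) (f : R) : vf D N f = ∑ a, N a * D a f := by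
  rw [vf, derivation_sum_apply]
  rfl

theorem dir_apply (n : Fin d → ℝ) (f : R) : dir D n f = ∑ a, n a • D a f := by
  rw [dir, derivation_sum_apply]
  rfl

theorem van_vf {j : ℕ} {f : R} (hf : f ∈ Van D ε j) (N : Fin d → R) :
    vf D N f ∈ Van D ε (j - 1) := by
  rw [vf_apply]
  exact sum_mem fun a _ => Ideal.mul_mem_left _ _ (van_D hf a)

theorem van_dir {j : ℕ} {f : R} (hf : f ∈ Van D ε j) (n : Fin d → ℝ) :
    dir D n f ∈ Van D ε (j - 1) := by
  rw [dir_apply]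
  exact sum_mem fun a _ => van_rsmul (van_D hf a) _

/-- Freezing the coefficients at the point costs nothing to this order, since the error in a
coefficient vanishes to first order and makes up for the derivative. Frozen fields are preferred
below because they commute with the `D a`. -/
theorem van_vf_sub_dir {j : ℕ} {f : R} (hf : f ∈ Van D ε j) (N : Fin d → R) :
    vf D N f - dir D (fun a => ε (N a)) f ∈ Van D ε j := by
  rw [vf_apply, dir_apply, ← Finset.sum_sub_distrib]
  refine sum_mem fun a _ => ?_
  rw [Algebra.smul_def, ← sub_mul]
  exact van_mul' (sub_eval_mem_van_one _) (van_D hf a) (by omega)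

theorem van_iterate_vf {j : ℕ} (N : Fin d → R) (i : ℕ) {f : R} (hf : f ∈ Van D ε j) :
    (vf D N)^[i] f ∈ Van D ε (j - i) := by
  induction i generalizing f j with
  | zero => exact hf
  | succ i ih =>
    rw [Function.iterate_succ_apply]
    exact van_mono (ih (van_vf hf N)) (by omega)

theorem van_iterate_dir {j : ℕ} (N : Fin d → ℝ) (i : ℕ) {f : R} (hf : f ∈ Van D ε j) :
    (dir D N)^[i] f ∈ Van D ε (j - i) := by
  induction i generalizing f j with
  | zero => exact hf
  | succ i ih =>
    rw [Function.iterate_succ_apply]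
    exact van_mono (ih (van_dir hf N)) (by omega)

theorem iterate_map_add (δ : Derivation ℝ R R) (n : ℕ) (f g : R) :
    δ^[n] (f + g) = δ^[n] f + δ^[n] g := by
  induction n generalizing f g with
  | zero => rfl
  | succ n ih => rw [Function.iterate_succ_apply, map_add, ih]; rfl

theorem iterate_map_sub (δ : Derivation ℝ R R) (n : ℕ) (f g : R) :
    δ^[n] (f - g) = δ^[n] f - δ^[n] g := by
  induction n generalizing f g with
  | zero => rfl
  | succ n ih => rw [Function.iterate_succ_apply, map_sub, ih]; rfl

theorem iterate_map_rsmul (δ : Derivation ℝ R R) (n : ℕ) (r : ℝ) (f : R) :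
    δ^[n] (r • f) = r • δ^[n] f := by
  induction n generalizing f with
  | zero => rfl
  | succ n ih => rw [Function.iterate_succ_apply, Derivation.map_smul, ih]; rfl

/-- `N^n (σ^n λ) = n! (Nσ)^n λ` where `σ = 0`. -/
theorem eval_iterate_vf_pow_mul {σ : R} (hσ : ε σ = 0) (N : Fin d → R) (n : ℕ) (f : R) :
    ε ((vf D N)^[n] (σ ^ n * f)) = n.factorial * ε (vf D N σ) ^ n * ε f := by
  induction n generalizing f with
  | zero => simp
  | succ n ih =>
    have h : vf D N (σ ^ (n + 1) * f)
        = σ ^ n * ((n + 1 : ℝ) • (vf D N σ * f) + σ * vf D N f) := by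
      rw [Derivation.leibniz, Derivation.leibniz_pow]
      simp only [Nat.add_sub_cancel, nsmul_eq_mul, smul_eq_mul]
      rw [Algebra.smul_def, map_add, map_natCast, map_one]
      push_cast
      ring
    rw [Function.iterate_succ_apply, h, ih, map_add, map_smul, map_mul, map_mul, hσ,
      Nat.factorial_succ]
    push_cast
    simp only [smul_eq_mul]
    ring

/-- For `f` vanishing to order `i`, `N^{i+1} (σ f) = (i+1) (Nσ) N^i f` where `σ = 0`. -/
theorem eval_iterate_vf_mul {σ : R} (hσ : ε σ = 0) (N : Fin d → R) (i : ℕ) {f : R}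
    (hf : f ∈ Van D ε i) :
    ε ((vf D N)^[i + 1] (σ * f)) = (i + 1) * ε (vf D N σ) * ε ((vf D N)^[i] f) := by
  induction i generalizing f with
  | zero =>
    rw [Function.iterate_succ_apply]
    simp [hσ, mul_comm]
  | succ i ih =>
    have h : vf D N (σ * f) = σ * vf D N f + (vf D N σ - algebraMap ℝ R (ε (vf D N σ))) * f
        + (ε (vf D N σ)) • f := by
      rw [Derivation.leibniz]
      simp only [smul_eq_mul, Algebra.smul_def]
      ring
    rw [Function.iterate_succ_apply, h, iterate_map_add, iterate_map_add, map_add, map_add,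
      ih (van_vf hf N), eval_eq_zero (van_iterate_vf N (i + 1)
        (van_mul (sub_eval_mem_van_one (ε := ε) (vf D N σ)) hf)) (by omega),
      iterate_map_rsmul, map_smul, Function.iterate_succ_apply, smul_eq_mul]
    push_cast
    ring

end Vanishing

/-! ### Vanishing along a hypersurface -/

section Along

variable {d m : ℕ} {R : Type*} [CommRing R] [Algebra ℝ R] {D : Fin d → Derivation ℝ R R}

/-- The points of `Z` are zeros of `σ`, and the differential of a function that vanishes on `Z` is
there a multiple of that of `σ`. -/
structure IsHypersurface (D : Fin d → Derivation ℝ R R) (σ : R) (Z : Set (R →ₐ[ℝ] ℝ)) : Prop where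
  zero : ∀ q ∈ Z, q σ = 0
  lagrange : ∀ f, (∀ q ∈ Z, q f = 0) → ∀ p ∈ Z, ∃ c : ℝ, ∀ a, p (D a f) = c * p (D a σ)

variable {σ : R} {Z : Set (R →ₐ[ℝ] ℝ)} (hZ : IsHypersurface D σ Z)
  (hD : ∀ a b f, D a (D b f) = D b (D a f))

include hD in
theorem dir_D (n : Fin d → ℝ) (a : Fin d) (f : R) : D a (dir D n f) = dir D n (D a f) := by
  simp only [dir_apply, map_sum, Derivation.map_smul, hD a]

include hZ hD

/-- By `lagrange`, a direction tangent at `p` kills functions that vanish on `Z`. Being constant, it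
commutes with each `D a`, and the `D a f` vanish to order one less all along `Z`, so induction
applies. The tangency is needed at `p` only, the vanishing at every point of `Z`. -/
theorem IsHypersurface.dir_mem {j : ℕ} {f : R} (hf : ∀ q ∈ Z, f ∈ Van D q j)
    {p : R →ₐ[ℝ] ℝ} (hp : p ∈ Z) {n : Fin d → ℝ} (hn : ∑ a, n a * p (D a σ) = 0) :
    dir D n f ∈ Van D p j := by
  induction j generalizing f with
  | zero => trivial
  | succ j ih =>
    obtain ⟨c, hc⟩ := hZ.lagrange f (fun q hq => (hf q hq).1) p hp
    refine ⟨?_, fun a => ?_⟩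
    · rw [dir_apply, map_sum]
      simp only [map_smul, hc, smul_eq_mul]
      rw [← mul_zero c, ← hn, Finset.mul_sum]
      exact Finset.sum_congr rfl fun a _ => by ring
    · rw [dir_D hD]
      exact ih fun q hq => (hf q hq).2 a

/-- At `p` each coordinate direction is a tangential direction plus a multiple of `N`. Tangential
directions lose no order of vanishing, so the single number `N^j f` at `p` decides whether one order
is gained. -/
theorem IsHypersurface.mem_van_succ {N : Fin d → R} {p : R →ₐ[ℝ] ℝ} (hp : p ∈ Z)
    (hN : p (vf D N σ) ≠ 0) {j : ℕ} {f : R} (hf : ∀ q ∈ Z, f ∈ Van D q j)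
    (h0 : p ((vf D N)^[j] f) = 0) : f ∈ Van D p (j + 1) := by
  induction j generalizing f with
  | zero => exact mem_van_one.2 h0
  | succ j ih =>
    refine ⟨(hf p hp).1, fun a => ?_⟩
    have h1 : vf D N f ∈ Van D p (j + 1) := ih (fun q hq => van_vf (hf q hq) N) h0
    have h2 : dir D (fun b => p (N b)) f ∈ Van D p (j + 1) := by
      have := sub_mem h1 (van_vf_sub_dir (hf p hp) N)
      rwa [sub_sub_cancel] at this
    -- The coefficient for which the `a`-th coordinate direction minus `c` times `N` annihilates `σ`
    -- at `p`.
    set c : ℝ := p (D a σ) / p (vf D N σ)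
    have h3 : dir D (fun b => (if b = a then 1 else 0) - c * p (N b)) f ∈ Van D p (j + 1) := by
      refine hZ.dir_mem hD hf hp ?_
      simp only [sub_mul, Finset.sum_sub_distrib, ite_mul, one_mul, zero_mul, Finset.sum_ite_eq',
        Finset.mem_univ, if_true, mul_assoc, ← Finset.mul_sum]
      rw [vf_apply, map_sum] at hN
      simp only [map_mul] at hN
      have : c = p (D a σ) / ∑ b, p (N b) * p (D b σ) := by
        simp only [c, vf_apply, map_sum, map_mul]
      rw [this, div_mul_cancel₀ _ hN, sub_self]
    have h4 : D a f = dir D (fun b => (if b = a then 1 else 0) - c * p (N b)) f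
        + c • dir D (fun b => p (N b)) f := by
      simp only [dir_apply, sub_smul, Finset.sum_sub_distrib, ite_smul, one_smul, zero_smul,
        Finset.sum_ite_eq', Finset.mem_univ, if_true, mul_smul, ← Finset.smul_sum]
      rw [sub_add_cancel]
    rw [h4]
    exact add_mem h3 (van_rsmul h2 _)

/-- Division by `σ` to finite order. -/
theorem IsHypersurface.exists_eq_mul_add {N : Fin d → R} {v : R} (hv : v * vf D N σ = 1) {f : R}
    (hf : ∀ q ∈ Z, q f = 0) (n : ℕ) :
    ∃ g r : R, f = σ * g + r ∧ ∀ q ∈ Z, r ∈ Van D q (n + 1) := by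
  induction n with
  | zero => exact ⟨0, f, by simp, fun q hq => mem_van_one.2 (hf q hq)⟩
  | succ n ih =>
    obtain ⟨g, r, hfr, hr⟩ := ih
    -- Along `Z` the derivative `N^(n+1)` of `σ^(n+1) l` is `(n+1)! (N σ)^(n+1) l`. As `v` inverts
    -- `N σ`, this choice makes it equal to `N^(n+1) r`, and the corrected remainder gains an order.
    set l : R := ((n + 1).factorial : ℝ)⁻¹ • (v ^ (n + 1) * (vf D N)^[n + 1] r) with hl
    refine ⟨g + σ ^ n * l, r - σ ^ (n + 1) * l, by rw [hfr]; ring, fun q hq => ?_⟩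
    have hvq : q v * q (vf D N σ) = 1 := by rw [← map_mul, hv, map_one]
    have hσ : ∀ q ∈ Z, σ ∈ Van D q 1 := fun q hq => mem_van_one.2 (hZ.zero q hq)
    refine hZ.mem_van_succ hD hq (right_ne_zero_of_mul_eq_one hvq)
      (fun q' hq' => sub_mem (hr q' hq') (Ideal.mul_mem_right _ _ (van_pow (hσ q' hq') _))) ?_
    rw [iterate_map_sub, map_sub, eval_iterate_vf_pow_mul (hZ.zero q hq), hl, map_smul, map_mul,
      map_pow, smul_eq_mul]
    have hn : ((n + 1).factorial : ℝ) ≠ 0 := Nat.cast_ne_zero.2 (Nat.factorial_ne_zero _)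
    have : q (vf D N σ) ^ (n + 1) * q v ^ (n + 1) = 1 := by
      rw [← mul_pow, mul_comm, hvq, one_pow]
    field_simp
    linear_combination (-q ((vf D N)^[n + 1] r)) * this

end Along

/-! ### Frozen second order symbols and the loss of vanishing order under the tractor operators. -/

section Symbols

variable {d m : ℕ} {R : Type*} [CommRing R] [Algebra ℝ R]
  {D : Fin d → Derivation ℝ R R} {ε : R →ₐ[ℝ] ℝ}

variable (D ε) in
/-- Tensors all of whose components vanish to order `j`. -/
def VanT (m j : ℕ) : Submodule R (TensorR d m R) := Submodule.pi Set.univ fun _ => Van D ε j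

theorem mem_vanT {j : ℕ} {τ : TensorR d m R} : τ ∈ VanT D ε m j ↔ ∀ I, τ I ∈ Van D ε j := by
  simp [VanT, Submodule.mem_pi]

theorem vanT_mono {i j : ℕ} {τ : TensorR d m R} (h : τ ∈ VanT D ε m j) (hij : i ≤ j) :
    τ ∈ VanT D ε m i := mem_vanT.2 fun I => van_mono (mem_vanT.1 h I) hij

theorem mem_vanT_zero (τ : TensorR d m R) : τ ∈ VanT D ε m 0 := mem_vanT.2 fun _ => mem_van_zero _

theorem vanT_smul {i j n : ℕ} {f : R} {τ : TensorR d m R} (hf : f ∈ Van D ε i)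
    (h : τ ∈ VanT D ε m j) (hn : n ≤ i + j) : f • τ ∈ VanT D ε m n :=
  mem_vanT.2 fun I => van_mul' hf (mem_vanT.1 h I) hn

variable (D) in
/-- A homogeneous second order operator with constant coefficients. -/
def sym2 (h : Fin d → Fin d → ℝ) : R →ₗ[ℝ] R :=
  ∑ a, ∑ b, h a b • ((D a : R →ₗ[ℝ] R) ∘ₗ (D b : R →ₗ[ℝ] R))

theorem sym2_apply (h : Fin d → Fin d → ℝ) (f : R) :
    sym2 D h f = ∑ a, ∑ b, h a b • D a (D b f) := by
  simp [sym2, LinearMap.sum_apply]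

theorem van_sym2 {j : ℕ} {f : R} (hf : f ∈ Van D ε j) (h : Fin d → Fin d → ℝ) :
    sym2 D h f ∈ Van D ε (j - 2) := by
  rw [sym2_apply]
  exact sum_mem fun a _ => sum_mem fun b _ => van_rsmul (van_D (van_D hf b) a) _

theorem van_iterate_sym2 {j : ℕ} (h : Fin d → Fin d → ℝ) (l : ℕ) {f : R} (hf : f ∈ Van D ε j) :
    (sym2 D h)^[l] f ∈ Van D ε (j - 2 * l) := by
  induction l generalizing f j with
  | zero => exact hf
  | succ l ih =>
    rw [Function.iterate_succ_apply]
    exact van_mono (ih (van_sym2 hf h)) (by omega)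

theorem iterate_linear_add {V : Type*} [AddCommGroup V] [Module ℝ V] (L : V →ₗ[ℝ] V) (n : ℕ)
    (f g : V) : L^[n] (f + g) = L^[n] f + L^[n] g := by
  simp [← Module.End.pow_apply]

theorem sym2_sub_dir_dir (h : Fin d → Fin d → ℝ) (n : Fin d → ℝ) (f : R) :
    sym2 D (fun a b => h a b - n a * n b) f = sym2 D h f - dir D n (dir D n f) := by
  simp only [sym2_apply, dir_apply, sub_smul, Finset.sum_sub_distrib, map_sum,
    Derivation.map_smul, Finset.smul_sum, mul_smul]
  congr 1
  rw [Finset.sum_comm]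
  exact Finset.sum_congr rfl fun a _ => Finset.sum_congr rfl fun b _ => smul_comm _ _ _

variable (hD : ∀ a b f, D a (D b f) = D b (D a f))

include hD in
theorem dir_sym2 (n : Fin d → ℝ) (h : Fin d → Fin d → ℝ) (f : R) :
    dir D n (sym2 D h f) = sym2 D h (dir D n f) := by
  simp only [sym2_apply, map_sum, Derivation.map_smul, dir_D hD]

/-! ### Symbols of the tractor operators -/

section Ops

variable {θ : Fin d → Matrix (Slot d) (Slot d) R} {gi : Matrix (Fin d) (Fin d) R}
  {Γ : Fin d → Fin d → Fin d → R}

theorem vanT_covR_sub {j : ℕ} {τ : TensorR d m R} (h : τ ∈ VanT D ε m j) (a : Fin d) :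
    covR D θ a τ - (fun I => D a (τ I)) ∈ VanT D ε m j := by
  rw [covR, add_sub_cancel_left]
  exact mem_vanT.2 fun I => sum_mem fun i _ => sum_mem fun K _ =>
    Ideal.mul_mem_left _ _ (mem_vanT.1 h _)

theorem vanT_D {j : ℕ} {τ : TensorR d m R} (h : τ ∈ VanT D ε m j) (a : Fin d) :
    (fun I => D a (τ I)) ∈ VanT D ε m (j - 1) :=
  mem_vanT.2 fun I => van_D (mem_vanT.1 h I) a

theorem vanT_covR {j : ℕ} {τ : TensorR d m R} (h : τ ∈ VanT D ε m j) (a : Fin d) :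
    covR D θ a τ ∈ VanT D ε m (j - 1) := by
  have := add_mem (vanT_mono (vanT_covR_sub (θ := θ) h a) (Nat.sub_le j 1)) (vanT_D h a)
  rwa [sub_add_cancel] at this

theorem vanT_covR_covR_sub {j : ℕ} {τ : TensorR d m R} (h : τ ∈ VanT D ε m j) (a b : Fin d) :
    covR D θ a (covR D θ b τ) - (fun I => D a (D b (τ I))) ∈ VanT D ε m (j - 1) := by
  have h1 := vanT_covR_sub (θ := θ) (vanT_covR (θ := θ) h b) a
  have h2 := vanT_D (vanT_covR_sub (θ := θ) h b) a
  have := add_mem h1 h2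
  convert this using 1
  funext I
  simp

/-- Used to freeze the coefficient of a second order term: replacing `f` by its value at the point
gains back one of the two orders that the term loses. -/
theorem rsmul_sub_mem {j : ℕ} {f : R} {τ : TensorR d m R} {σ : TensorR d m R}
    (h : τ - σ ∈ VanT D ε m (j - 1)) (hσ : σ ∈ VanT D ε m (j - 2)) :
    f • τ - (ε f) • σ ∈ VanT D ε m (j - 1) := by
  have h1 : f • τ - (ε f) • σ = f • (τ - σ) + (f - algebraMap ℝ R (ε f)) • σ := by
    rw [smul_sub, sub_smul, algebraMap_smul]
    abel
  rw [h1]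
  exact add_mem (Submodule.smul_mem _ _ h)
    (vanT_smul (sub_eval_mem_van_one f) hσ (by omega))

theorem vanT_DD {j : ℕ} {τ : TensorR d m R} (h : τ ∈ VanT D ε m j) (a b : Fin d) :
    (fun I => D a (D b (τ I))) ∈ VanT D ε m (j - 2) :=
  vanT_D (vanT_D h b) a

theorem sum_sym2_eq (h : Fin d → Fin d → ℝ) (τ : TensorR d m R) :
    (fun I => sym2 D h (τ I)) = ∑ a, ∑ b, h a b • fun I => D a (D b (τ I)) := by
  funext I
  simp [sym2_apply, Finset.sum_apply]

/-- Computes the principal symbol at the point. The connection matrices, the Christoffel terms and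
the variation of the inverse metric are of lower order, so together they lose one order of
vanishing, not two. -/
theorem vanT_lapR_sub {j : ℕ} {τ : TensorR d m R} (h : τ ∈ VanT D ε m j) :
    lapR gi Γ (covR D θ) τ - (fun I => sym2 D (fun a b => ε (gi a b)) (τ I))
      ∈ VanT D ε m (j - 1) := by
  rw [sum_sym2_eq, lapR, ← Finset.sum_sub_distrib]
  refine sum_mem fun a _ => ?_
  rw [← Finset.sum_sub_distrib]
  refine sum_mem fun b _ => rsmul_sub_mem ?_ (vanT_DD h a b)
  rw [sub_right_comm]
  exact sub_mem (vanT_covR_covR_sub h a b)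
    (sum_mem fun c _ => Submodule.smul_mem _ _ (vanT_covR h c))

theorem vanT_sym2 {j : ℕ} {τ : TensorR d m R} (h : τ ∈ VanT D ε m j) (c : Fin d → Fin d → ℝ) :
    (fun I => sym2 D c (τ I)) ∈ VanT D ε m (j - 2) :=
  mem_vanT.2 fun I => van_sym2 (mem_vanT.1 h I) c

theorem vanT_lapR {j : ℕ} {τ : TensorR d m R} (h : τ ∈ VanT D ε m j) :
    lapR gi Γ (covR D θ) τ ∈ VanT D ε m (j - 2) := by
  have := add_mem (vanT_mono (vanT_lapR_sub (gi := gi) (Γ := Γ) (θ := θ) h)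
    (show j - 2 ≤ j - 1 by omega)) (vanT_sym2 h fun a b => ε (gi a b))
  rwa [sub_add_cancel] at this

variable (D gi) in
/-- The gradient of `σ`. -/
def grad (σ : R) (b : Fin d) : R := ∑ a, gi a b * D a σ

theorem sum_smul_eq_grad {M : Type*} [AddCommGroup M] [Module R M] (σ : R) (X : Fin d → M) :
    ∑ a, ∑ b, (gi a b * D a σ) • X b = ∑ b, grad D gi σ b • X b := by
  rw [Finset.sum_comm]
  exact Finset.sum_congr rfl fun b _ => by rw [grad, Finset.sum_smul]

variable {σ v : R}

/-- The only second order term of `y` is multiplied by `σ`, which vanishes at the point and restores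
one of the two lost orders. -/
theorem vanT_yR (hσ : ε σ = 0) (w : ℝ) {j : ℕ} {τ : TensorR d m R} (h : τ ∈ VanT D ε m j) :
    yR D gi Γ (covR D θ) σ v w τ ∈ VanT D ε m (j - 1) := by
  rw [yR, lrR, sum_smul_eq_grad]
  refine neg_mem (Submodule.smul_mem _ _ (add_mem (neg_mem ?_) (Submodule.smul_mem _ _ ?_)))
  · exact vanT_smul (mem_van_one.2 hσ) (add_mem (vanT_lapR h)
      (Submodule.smul_mem _ _ (vanT_mono h (by omega)))) (by omega)
  · exact add_mem (sum_mem fun b _ => Submodule.smul_mem _ _ (vanT_covR h b))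
      (Submodule.smul_mem _ _ (vanT_mono h (by omega)))

theorem vanT_yPowR (hσ : ε σ = 0) (k : ℕ) (w : ℝ) {j : ℕ} {τ : TensorR d m R}
    (h : τ ∈ VanT D ε m j) : yPowR D gi Γ (covR D θ) σ v k w τ ∈ VanT D ε m (j - k) := by
  induction k generalizing w j τ with
  | zero => exact h
  | succ k ih => exact vanT_mono (ih (w - 1) (vanT_yR hσ w h)) (by omega)

/-- If the frozen normal derivative of `τ` loses no order, then the gradient term of `y` loses none
either, and only `σ` times the symbol of the Laplacian remains. The factor `v` may be replaced by
its value `1`. -/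
theorem vanT_yR_sub (hσ : ε σ = 0) (hv : ε v = 1) (w : ℝ) {n : ℕ} {τ : TensorR d m R}
    (h : τ ∈ VanT D ε m n)
    (hN : (fun I => dir D (fun a => ε (grad D gi σ a)) (τ I)) ∈ VanT D ε m n) :
    yR D gi Γ (covR D θ) σ v w τ - σ • (fun I => sym2 D (fun a b => ε (gi a b)) (τ I))
      ∈ VanT D ε m n := by
  have h1 : ∑ b, grad D gi σ b • covR D θ b τ ∈ VanT D ε m n := by
    have e : ∑ b, grad D gi σ b • covR D θ b τ
        = ∑ b, grad D gi σ b • (covR D θ b τ - fun I => D b (τ I))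
          + ((fun I => vf D (grad D gi σ) (τ I) - dir D (fun a => ε (grad D gi σ a)) (τ I))
          + fun I => dir D (fun a => ε (grad D gi σ a)) (τ I)) := by
      funext I
      simp [Finset.sum_apply, vf_apply, mul_sub, Finset.sum_sub_distrib]
    rw [e]
    exact add_mem (sum_mem fun b _ => Submodule.smul_mem _ _ (vanT_covR_sub h b))
      (add_mem (mem_vanT.2 fun I => van_vf_sub_dir (mem_vanT.1 h I) _) hN)
  have h2 : v - 1 ∈ Van D ε 1 := mem_van_one.2 (by rw [map_sub, hv, map_one, sub_self])
  have hσ1 : σ ∈ Van D ε 1 := mem_van_one.2 hσ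
  have e : yR D gi Γ (covR D θ) σ v w τ - σ • (fun I => sym2 D (fun a b => ε (gi a b)) (τ I))
      = (v * σ) • (lapR gi Γ (covR D θ) τ - (fun I => sym2 D (fun a b => ε (gi a b)) (τ I)))
        + ((v - 1) * σ) • (fun I => sym2 D (fun a b => ε (gi a b)) (τ I))
        + (v * σ * (w • jtr D gi Γ)) • τ
        - (v * algebraMap ℝ R ((d : ℝ) + 2 * w - 2)) •
          (∑ b, grad D gi σ b • covR D θ b τ + (w • rhoR D gi Γ σ) • τ) := by
    rw [yR, lrR, sum_smul_eq_grad]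
    module
  rw [e]
  refine sub_mem (add_mem (add_mem ?_ ?_) (Submodule.smul_mem _ _ h))
    (Submodule.smul_mem _ _ (add_mem h1 (Submodule.smul_mem _ _ h)))
  · exact vanT_smul (Ideal.mul_mem_left _ v hσ1) (vanT_lapR_sub h) (by omega)
  · exact vanT_smul (van_mul h2 hσ1) (vanT_sym2 h _) (by omega)

/-- One factor `y` gives `σ L` plus a remainder of full order, where `L` is the symbol of the
Laplacian applied to `τ`; the remaining odd power is too short to make the remainder visible. By
`yPowR_smul` that odd power acts on `σ L` as a number times an even power on `L`, up to a multiple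
of `σ`. The frozen symbols commute, so `L` inherits the condition on the normal derivative. -/
theorem eval_yPowR_even (hd : d ≠ 0) (hD : ∀ a b f, D a (D b f) = D b (D a f))
    (hgi : ∀ a b, gi a b = gi b a) (hσ : ε σ = 0) (hv : v * isqR D gi Γ σ = 1)
    (hv1 : ε v = 1) (l : ℕ) (w : ℝ) {τ : TensorR d m R} (h : τ ∈ VanT D ε m (2 * l))
    (hN : (fun I => dir D (fun a => ε (grad D gi σ a)) (τ I)) ∈ VanT D ε m (2 * l))
    (I : Fin m → Slot d) :
    ε (yPowR D gi Γ (covR D θ) σ v (2 * l) w τ I)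
      = (∏ i ∈ Finset.range l, ((2 * i + 1 : ℝ) * (2 * l - 1 - (d + 2 * w - 2) + 2 * i + 1)))
        * ε ((sym2 D fun a b => ε (gi a b))^[l] (τ I)) := by
  induction l generalizing w τ with
  | zero => simp [yPowR]
  | succ l ih =>
    set L : TensorR d m R := fun I => sym2 D (fun a b => ε (gi a b)) (τ I) with hL
    set r := yR D gi Γ (covR D θ) σ v w τ - σ • L with hr
    have hr' : r ∈ VanT D ε m (2 * (l + 1)) := vanT_yR_sub hσ hv1 w h hN
    have hyr : yR D gi Γ (covR D θ) σ v w τ = r + σ • L := by rw [hr, sub_add_cancel]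
    have hc := isConnection_covR (m := m) D θ
    have h0 : ε (yPowR D gi Γ (covR D θ) σ v (2 * l + 1) (w - 1) r I) = 0 :=
      eval_eq_zero (mem_vanT.1 (vanT_yPowR hσ _ _ hr') I) (by omega)
    change ε (yPowR D gi Γ (covR D θ) σ v (2 * l + 1) (w - 1)
      (yR D gi Γ (covR D θ) σ v w τ) I) = _
    rw [hyr, hc.yPowR_add, Pi.add_apply, map_add, h0, zero_add, hc.yPowR_smul hd hgi Γ hv]
    simp only [Pi.sub_apply, Pi.smul_apply, smul_eq_mul, map_sub, map_mul, hσ, zero_mul, zero_sub,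
      AlgHom.commutes, Nat.add_sub_cancel]
    -- The new number is the top factor of the product of odd integers times the bottom factor of
    -- the product depending on the weight; lowering the weight by two shifts the index of the
    -- latter by one. Hence the two products are split at opposite ends.
    rw [ih (w - 1 - 1) (τ := L) (vanT_sym2 h _) ?_, Finset.prod_mul_distrib,
      Finset.prod_mul_distrib, Finset.prod_range_succ,
      Finset.prod_range_succ' (fun i : ℕ => (2 * ((l + 1 : ℕ) : ℝ) - 1 - (d + 2 * w - 2) + 2 * i + 1)),
      Function.iterate_succ_apply]
    · have : ∀ i : ℕ, (2 * ((l + 1 : ℕ) : ℝ) - 1 - (d + 2 * w - 2) + 2 * ((i + 1 : ℕ) : ℝ) + 1)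
          = (2 * (l : ℝ) - 1 - (d + 2 * (w - 1 - 1) - 2) + 2 * (i : ℝ) + 1) := by
        intro i; push_cast; ring
      simp only [this, Algebra.algebraMap_self, RingHom.id_apply]
      push_cast
      ring
    · refine mem_vanT.2 fun J => ?_
      change dir D _ (sym2 D _ (τ J)) ∈ _
      rw [dir_sym2 hD]
      exact van_sym2 (mem_vanT.1 hN J) _

end Ops

end Symbols

/-! ### The tangential Laplacian and the leading term at the critical weight. -/

section Tangential

variable {d m : ℕ} {R : Type*} [CommRing R] [Algebra ℝ R]
  {D : Fin d → Derivation ℝ R R} {ε : R →ₐ[ℝ] ℝ}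

variable (D) in
/-- The tangential projection, for `u` the inverse of `|dσ|²`. -/
def projR (gi : Matrix (Fin d) (Fin d) R) (σ u : R) (a c : Fin d) : R :=
  (if a = c then 1 else 0) - D a σ * grad D gi σ c * u

variable (D) in
/-- The tangential derivative. -/
def tangR {M : Type*} [AddCommGroup M] [Module R M] (gi : Matrix (Fin d) (Fin d) R) (σ u : R)
    (nab : Fin d → M → M) (a : Fin d) (t : M) : M :=
  ∑ c, projR D gi σ u a c • nab c t

variable (D) in
/-- The tangential Laplacian. -/
def tangLapR {M : Type*} [AddCommGroup M] [Module R M] (gi : Matrix (Fin d) (Fin d) R)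
    (Γ : Fin d → Fin d → Fin d → R) (σ u : R) (nab : Fin d → M → M) (t : M) : M :=
  ∑ a, ∑ b, gi a b • ∑ c, projR D gi σ u a c •
    (nab c (tangR D gi σ u nab b t) - ∑ e, Γ e c b • tangR D gi σ u nab e t)

variable {θ : Fin d → Matrix (Slot d) (Slot d) R} {gi : Matrix (Fin d) (Fin d) R}
  {Γ : Fin d → Fin d → Fin d → R} {σ v u : R}

theorem tangR_add (a : Fin d) (s t : TensorR d m R) :
    tangR D gi σ u (covR D θ) a (s + t)
      = tangR D gi σ u (covR D θ) a s + tangR D gi σ u (covR D θ) a t := by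
  simp only [tangR, (isConnection_covR D θ).add, smul_add, Finset.sum_add_distrib]

theorem tangLapR_add (s t : TensorR d m R) :
    tangLapR D gi Γ σ u (covR D θ) (s + t)
      = tangLapR D gi Γ σ u (covR D θ) s + tangLapR D gi Γ σ u (covR D θ) t := by
  simp only [tangLapR, tangR_add, (isConnection_covR D θ).add, smul_add, Finset.sum_add_distrib,
    add_sub_add_comm]

theorem vanT_tangR {j : ℕ} {τ : TensorR d m R} (h : τ ∈ VanT D ε m j) (a : Fin d) :
    tangR D gi σ u (covR D θ) a τ ∈ VanT D ε m (j - 1) :=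
  sum_mem fun c _ => Submodule.smul_mem _ _ (vanT_covR h c)

theorem proj_gram {g : Fin d → Fin d → ℝ} (hg : ∀ a b, g a b = g b a) {s n : Fin d → ℝ}
    (hn : ∀ b, n b = ∑ a, g a b * s a) (h1 : ∑ b, n b * s b = 1) (c e : Fin d) :
    ∑ a, ∑ b, g a b * (((if a = c then 1 else 0) - s a * n c)
      * ((if b = e then 1 else 0) - s b * n e)) = g c e - n c * n e := by
  have h2 : ∀ a, ∑ b, g a b * ((if b = e then 1 else 0) - s b * n e) = g a e - n a * n e := by
    intro a
    simp only [mul_sub, Finset.sum_sub_distrib, mul_ite, mul_one, mul_zero, Finset.sum_ite_eq',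
      Finset.mem_univ, if_true, ← mul_assoc, ← Finset.sum_mul]
    rw [hn a]
    simp only [hg a]
  have h3 : ∀ a, ∑ b, g a b * (((if a = c then 1 else 0) - s a * n c)
      * ((if b = e then 1 else 0) - s b * n e))
      = ((if a = c then 1 else 0) - s a * n c) * (g a e - n a * n e) := by
    intro a
    rw [← h2, Finset.mul_sum]
    exact Finset.sum_congr rfl fun b _ => by ring
  rw [Finset.sum_congr rfl fun a _ => h3 a]
  simp only [sub_mul, Finset.sum_sub_distrib, ite_mul, one_mul, zero_mul, Finset.sum_ite_eq',
    Finset.mem_univ, if_true]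
  have h4 : ∑ a, s a * n c * (g a e - n a * n e) = n c * (n e - n e * 1) := by
    rw [← h1]
    nth_rewrite 2 [hn e]
    rw [Finset.mul_sum, ← Finset.sum_sub_distrib, Finset.mul_sum]
    exact Finset.sum_congr rfl fun a _ => by ring
  rw [h4]
  ring

/-- The symbol is the inverse metric with the unit normal direction removed. Derivatives that fall
on the projection, and Christoffel terms, leave only one derivative on `τ`. -/
theorem vanT_tangLapR_sub (hgi : ∀ a b, gi a b = gi b a) (h1 : ε (vf D (grad D gi σ) σ) = 1)
    (hu : u * vf D (grad D gi σ) σ = 1) {j : ℕ}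
    {τ : TensorR d m R} (h : τ ∈ VanT D ε m j) :
    tangLapR D gi Γ σ u (covR D θ) τ
      - (fun I => sym2 D (fun a b => ε (gi a b) - ε (grad D gi σ a) * ε (grad D gi σ b)) (τ I))
      ∈ VanT D ε m (j - 1) := by
  have hc := isConnection_covR (m := m) D θ
  have hu1 : ε u = 1 := by
    have := congrArg ε hu
    rwa [map_mul, h1, mul_one, map_one] at this
  have hP : ∀ a c, ε (projR D gi σ u a c)
      = (if a = c then 1 else 0) - ε (D a σ) * ε (grad D gi σ c) := by
    intro a c
    rw [projR, map_sub, map_mul, map_mul, hu1, mul_one, apply_ite ε, map_one, map_zero]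
  have hsym : (fun I => sym2 D
      (fun a b => ε (gi a b) - ε (grad D gi σ a) * ε (grad D gi σ b)) (τ I))
      = ∑ a, ∑ b, ∑ c, ∑ e, ε (gi a b * projR D gi σ u a c * projR D gi σ u b e) •
          fun I => D c (D e (τ I)) := by
    have hpg := proj_gram (g := fun a b => ε (gi a b)) (fun a b => by rw [hgi])
      (s := fun a => ε (D a σ)) (n := fun a => ε (grad D gi σ a))
      (fun b => by rw [grad, map_sum]; simp only [map_mul])
      (by rw [← h1, vf_apply, map_sum]; simp only [map_mul])
    rw [sum_sym2_eq]
    have e1 : ∀ a b, ∑ c, ∑ e, ε (gi a b * projR D gi σ u a c * projR D gi σ u b e) •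
          (fun I => D c (D e (τ I)))
        = ∑ c, ∑ e, (ε (gi a b) * (((if a = c then 1 else 0) - ε (D a σ) * ε (grad D gi σ c))
      * ((if b = e then 1 else 0) - ε (D b σ) * ε (grad D gi σ e)))) •
          (fun I => D c (D e (τ I))) := by
      intro a b
      simp only [map_mul, hP, mul_assoc]
    simp only [e1]
    have e2 : ∀ (X : Fin d → Fin d → Fin d → Fin d → TensorR d m R),
        ∑ a, ∑ b, ∑ c, ∑ e, X a b c e = ∑ c, ∑ e, ∑ a, ∑ b, X a b c e := by
      intro X
      have s1 : ∀ a, ∑ b, ∑ c, ∑ e, X a b c e = ∑ c, ∑ e, ∑ b, X a b c e := fun a => by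
        rw [Finset.sum_comm]
        exact Finset.sum_congr rfl fun c _ => Finset.sum_comm
      simp only [s1]
      rw [Finset.sum_comm]
      exact Finset.sum_congr rfl fun c _ => Finset.sum_comm
    rw [e2]
    refine Finset.sum_congr rfl fun c _ => Finset.sum_congr rfl fun e _ => ?_
    simp only [← Finset.sum_smul]
    rw [hpg]
  rw [hsym, tangLapR, ← Finset.sum_sub_distrib]
  refine sum_mem fun a _ => ?_
  rw [← Finset.sum_sub_distrib]
  refine sum_mem fun b _ => ?_
  rw [Finset.smul_sum, ← Finset.sum_sub_distrib]
  refine sum_mem fun c _ => ?_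
  have e3 : gi a b • projR D gi σ u a c • (covR D θ c (tangR D gi σ u (covR D θ) b τ)
        - ∑ e, Γ e c b • tangR D gi σ u (covR D θ) e τ)
      = ∑ e, (gi a b * projR D gi σ u a c * projR D gi σ u b e) • covR D θ c (covR D θ e τ)
        + (gi a b * projR D gi σ u a c) • (∑ e, D c (projR D gi σ u b e) • covR D θ e τ
          - ∑ e, Γ e c b • tangR D gi σ u (covR D θ) e τ) := by
    rw [tangR, hc.sum]
    simp only [hc.leibniz, Finset.sum_add_distrib, smul_sub, smul_add, Finset.smul_sum, mul_smul]
    abel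
  rw [e3, add_sub_right_comm, ← Finset.sum_sub_distrib]
  exact add_mem (sum_mem fun e _ => rsmul_sub_mem (vanT_covR_covR_sub h c e) (vanT_DD h c e))
    (Submodule.smul_mem _ _ (sub_mem
      (sum_mem fun e _ => Submodule.smul_mem _ _ (vanT_covR h e))
      (sum_mem fun e _ => Submodule.smul_mem _ _ (vanT_tangR h e))))

theorem vanT_tangLapR {j : ℕ} {τ : TensorR d m R} (hgi : ∀ a b, gi a b = gi b a)
    (h1 : ε (vf D (grad D gi σ) σ) = 1) (hu : u * vf D (grad D gi σ) σ = 1)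
    (h : τ ∈ VanT D ε m j) : tangLapR D gi Γ σ u (covR D θ) τ ∈ VanT D ε m (j - 2) := by
  have := add_mem (vanT_mono (vanT_tangLapR_sub (Γ := Γ) (θ := θ) hgi h1 hu h)
    (show j - 2 ≤ j - 1 by omega)) (vanT_sym2 h
      fun a b => ε (gi a b) - ε (grad D gi σ a) * ε (grad D gi σ b))
  rwa [sub_add_cancel] at this

theorem eval_iterate_tangLapR (hgi : ∀ a b, gi a b = gi b a)
    (h1 : ε (vf D (grad D gi σ) σ) = 1) (hu : u * vf D (grad D gi σ) σ = 1) (l : ℕ)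
    {τ : TensorR d m R} (h : τ ∈ VanT D ε m (2 * l)) (I : Fin m → Slot d) :
    ε ((tangLapR D gi Γ σ u (covR D θ))^[l] τ I)
      = ε ((sym2 D fun a b => ε (gi a b) - ε (grad D gi σ a) * ε (grad D gi σ b))^[l] (τ I)) := by
  have hadd : ∀ l (s t : TensorR d m R), (tangLapR D gi Γ σ u (covR D θ))^[l] (s + t)
      = (tangLapR D gi Γ σ u (covR D θ))^[l] s + (tangLapR D gi Γ σ u (covR D θ))^[l] t := by
    intro l
    induction l with
    | zero => exact fun _ _ => rfl
    | succ l ih => intro s t; simp only [Function.iterate_succ_apply, tangLapR_add, ih]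
  have hvan : ∀ l {j : ℕ} {τ : TensorR d m R}, τ ∈ VanT D ε m j →
      (tangLapR D gi Γ σ u (covR D θ))^[l] τ ∈ VanT D ε m (j - 2 * l) := by
    intro l
    induction l with
    | zero => exact fun h => h
    | succ l ih =>
      intro j τ h
      rw [Function.iterate_succ_apply]
      exact vanT_mono (ih (vanT_tangLapR hgi h1 hu h)) (by omega)
  induction l generalizing τ with
  | zero => rfl
  | succ l ih =>
    have hr := vanT_tangLapR_sub (Γ := Γ) (θ := θ) hgi h1 hu h
    rw [Function.iterate_succ_apply, Function.iterate_succ_apply,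
      ← sub_add_cancel (tangLapR D gi Γ σ u (covR D θ) τ) (fun I => sym2 D
      (fun a b => ε (gi a b) - ε (grad D gi σ a) * ε (grad D gi σ b)) (τ I)), hadd, Pi.add_apply,
      map_add, eval_eq_zero (mem_vanT.1 (hvan l hr) I) (by omega), zero_add,
      ih (vanT_sym2 h _)]

/-- `σ T - T σ` loses no order of vanishing, for `T` the tangential symbol. -/
theorem van_sym2_mul_sub (hgi : ∀ a b, gi a b = gi b a) (h1 : ε (vf D (grad D gi σ) σ) = 1)
    {j : ℕ} {f : R} (h : f ∈ Van D ε j) :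
    sym2 D (fun a b => ε (gi a b) - ε (grad D gi σ a) * ε (grad D gi σ b)) (σ * f)
      - σ * sym2 D (fun a b => ε (gi a b) - ε (grad D gi σ a) * ε (grad D gi σ b)) f
      ∈ Van D ε j := by
  set c : Fin d → Fin d → ℝ := fun a b => ε (gi a b) - ε (grad D gi σ a) * ε (grad D gi σ b)
    with hc
  have hcs : ∀ a b, c a b = c b a := fun a b => by simp only [hc, hgi a b]; ring
  have e : sym2 D c (σ * f) - σ * sym2 D c f
      = (2 : ℝ) • ∑ b, (∑ a, c a b • D a σ) * D b f + sym2 D c σ * f := by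
    have e1 : ∑ a, ∑ b, c a b • (D a f * D b σ) = ∑ a, ∑ b, c a b • (D a σ * D b f) := by
      rw [Finset.sum_comm]
      refine Finset.sum_congr rfl fun a _ => Finset.sum_congr rfl fun b _ => ?_
      rw [hcs, mul_comm]
    have e2 : ∑ b, (∑ a, c a b • D a σ) * D b f = ∑ a, ∑ b, c a b • (D a σ * D b f) := by
      rw [Finset.sum_comm]
      simp only [Finset.sum_mul, smul_mul_assoc]
    have e3 : sym2 D c (σ * f) = σ * sym2 D c f + ∑ a, ∑ b, c a b • (D a σ * D b f)
        + ∑ a, ∑ b, c a b • (D a f * D b σ) + sym2 D c σ * f := by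
      simp only [sym2_apply, Finset.sum_mul, Finset.mul_sum, ← Finset.sum_add_distrib]
      refine Finset.sum_congr rfl fun a _ => Finset.sum_congr rfl fun b _ => ?_
      simp only [Derivation.leibniz, smul_eq_mul, map_add, Algebra.smul_def]
      ring
    rw [e3, e1, e2, two_smul]
    ring
  rw [e]
  refine add_mem (van_rsmul (sum_mem fun b _ => ?_) _) (Ideal.mul_mem_left _ _ h)
  -- The first order part of the commutator has coefficient the tangential symbol contracted with
  -- `dσ`. It vanishes at the point because `dσ` has unit length there, and so makes up for the
  -- derivative of `f`.
  refine van_mul' (mem_van_one.2 ?_) (van_D h b) (by omega : j ≤ 1 + (j - 1))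
  rw [map_sum]
  simp only [map_smul, hc, smul_eq_mul, sub_mul, Finset.sum_sub_distrib]
  rw [vf_apply, map_sum] at h1
  simp only [map_mul] at h1
  have e4 : ∑ a, ε (grad D gi σ a) * ε (grad D gi σ b) * ε (D a σ)
      = ε (grad D gi σ b) * 1 := by
    rw [← h1, Finset.mul_sum]
    exact Finset.sum_congr rfl fun a _ => by ring
  rw [e4, grad, map_sum]
  simp only [map_mul]
  ring

/-- Moving `σ` to the left through the tangential symbols produces commutators that still vanish to
an order large enough to be zero at the point, and finally `σ` itself is zero there. -/
theorem eval_iterate_sym2_mul (hgi : ∀ a b, gi a b = gi b a)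
    (h1 : ε (vf D (grad D gi σ) σ) = 1) (hσ : ε σ = 0) (l : ℕ) {f : R}
    (h : f ∈ Van D ε (2 * l - 1)) :
    ε ((sym2 D fun a b => ε (gi a b) - ε (grad D gi σ a) * ε (grad D gi σ b))^[l] (σ * f)) = 0 := by
  induction l generalizing f with
  | zero => simp [hσ]
  | succ l ih =>
    have hr := van_sym2_mul_sub hgi h1 h
    rw [Function.iterate_succ_apply, ← sub_add_cancel (sym2 D _ (σ * f)) (σ * sym2 D _ f),
      iterate_linear_add, map_add, eval_eq_zero (van_iterate_sym2 _ l hr) (by omega), zero_add]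
    exact ih (van_mono (van_sym2 h _) (by omega))

/-- The two symbols differ by a second normal derivative. One normal derivative of `f` keeps order
`2l`, so the second leaves order `2l - 1`, one more than the remaining `l - 1` symbols can consume.
-/
theorem eval_iterate_sym2_tang (hD : ∀ a b f, D a (D b f) = D b (D a f))
    {c : Fin d → Fin d → ℝ} {n : Fin d → ℝ} (l : ℕ) {f : R}
    (h : f ∈ Van D ε (2 * l)) (hN : dir D n f ∈ Van D ε (2 * l)) :
    ε ((sym2 D fun a b => c a b - n a * n b)^[l] f) = ε ((sym2 D c)^[l] f) := by
  induction l generalizing f with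
  | zero => rfl
  | succ l ih =>
    have h2 : (sym2 D fun a b => c a b - n a * n b)^[l] (-(dir D n (dir D n f)))
        ∈ Van D ε (2 * (l + 1) - 1 - 2 * l) :=
      van_iterate_sym2 _ l (neg_mem (van_dir hN n))
    rw [Function.iterate_succ_apply, Function.iterate_succ_apply, sym2_sub_dir_dir, sub_eq_add_neg,
      iterate_linear_add, map_add, eval_eq_zero h2 (by omega), add_zero]
    refine ih (van_sym2 h c) ?_
    rw [dir_sym2 hD]
    exact van_sym2 hN c

/-- The truncated Taylor projection onto functions that are constant in the direction `n`. -/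
theorem exists_dir_mem_van {n : Fin d → ℝ} (hσ : ε σ = 0) (hn : ε (dir D n σ) = 1) {k : ℕ}
    {f : R} (h : f ∈ Van D ε k) :
    ∃ g ∈ Van D ε (k - 1), f - σ * g ∈ Van D ε k ∧ dir D n (f - σ * g) ∈ Van D ε k := by
  have hσ1 : σ ∈ Van D ε 1 := mem_van_one.2 hσ
  -- The correction is a partial sum of `f - σ ∂f + σ² ∂²f / 2 - ...` with `∂` the frozen direction.
  -- Differentiation telescopes: after `i` steps only the term with `σ^i ∂^(i+1) f` survives, the
  -- error `r` coming from `∂σ` being `1` at the point only. At `i = k` the power of `σ` gives order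
  -- `k`.
  suffices H : ∀ i, ∃ g ∈ Van D ε (k - 1), f - σ * g ∈ Van D ε k ∧
      ∃ r ∈ Van D ε k, dir D n (f - σ * g)
        = r + ((-1 : ℝ) ^ i / i.factorial) • (σ ^ i * (dir D n)^[i + 1] f) by
    obtain ⟨g, hg, h1, r, hr, h2⟩ := H k
    refine ⟨g, hg, h1, ?_⟩
    rw [h2]
    exact add_mem hr (van_rsmul (Ideal.mul_mem_right _ _ (van_pow hσ1 k)) _)
  intro i
  induction i with
  | zero => exact ⟨0, zero_mem _, by simpa using h, 0, zero_mem _, by simp⟩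
  | succ i ih =>
    obtain ⟨g, hg, h1, r, hr, h2⟩ := ih
    set c : ℝ := (-1 : ℝ) ^ i / (i + 1).factorial with hc
    set F := (dir D n)^[i + 1] f with hF
    have hFv : F ∈ Van D ε (k - (i + 1)) := van_iterate_dir n (i + 1) h
    have h3 : σ * (σ ^ i * F) ∈ Van D ε k :=
      van_mul' hσ1 (van_mul (van_pow hσ1 i) hFv) (by omega)
    refine ⟨g + c • (σ ^ i * F), add_mem hg (van_rsmul (van_mul' (van_pow hσ1 i) hFv (by omega)) _),
      ?_, r - ((i + 1 : ℝ) * c) • ((dir D n σ - 1) * (σ ^ i * F)), sub_mem hr (van_rsmul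
        (van_mul' (mem_van_one.2 (by rw [map_sub, hn, map_one, sub_self]))
          (van_mul (van_pow hσ1 i) hFv) (by omega)) _), ?_⟩
    · rw [mul_add, ← sub_sub, mul_smul_comm]
      exact sub_mem h1 (van_rsmul h3 _)
    · have e1 : (-1 : ℝ) ^ i / i.factorial = (i + 1) * c := by
        rw [hc, Nat.factorial_succ]
        have : (i.factorial : ℝ) ≠ 0 := Nat.cast_ne_zero.2 (Nat.factorial_ne_zero _)
        push_cast
        field_simp
      have e2 : (-1 : ℝ) ^ (i + 1) / (i + 1).factorial = -c := by
        rw [hc, pow_succ]; ring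
      have e3 : dir D n (σ * (σ ^ i * F))
          = (i + 1 : ℝ) • (dir D n σ * (σ ^ i * F)) + σ ^ (i + 1) * dir D n F := by
        have : σ * (σ ^ i * F) = σ ^ (i + 1) * F := by ring
        rw [this, Derivation.leibniz, Derivation.leibniz_pow]
        simp only [Nat.add_sub_cancel, nsmul_eq_mul, smul_eq_mul]
        rw [Algebra.smul_def, map_add, map_natCast, map_one]
        push_cast
        ring
      have e4 : (dir D n)^[i + 1 + 1] f = dir D n F := Function.iterate_succ_apply' _ _ _
      rw [mul_add, ← sub_sub, mul_smul_comm, map_sub, h2, Derivation.map_smul, e3, e1, e2, e4,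
        sub_mul, one_mul]
      module

/-- The leading term of the critical even powers. -/
theorem eval_yPowR_critical (hd : d ≠ 0) (hD : ∀ a b f, D a (D b f) = D b (D a f))
    (hgi : ∀ a b, gi a b = gi b a) (hσ : ε σ = 0) (hv : v * isqR D gi Γ σ = 1)
    (h1 : ε (vf D (grad D gi σ) σ) = 1) (hu : u * vf D (grad D gi σ) σ = 1) (l : ℕ)
    {τ : TensorR d m R} (h : τ ∈ VanT D ε m (2 * l)) (I : Fin m → Slot d) :
    ε (yPowR D gi Γ (covR D θ) σ v (2 * l) ((((2 * l : ℕ) : ℝ) - d + 1) / 2) τ I)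
      = (Nat.doubleFactorial (2 * l - 1) : ℝ) ^ 2
        * ε ((tangLapR D gi Γ σ u (covR D θ))^[l] τ I) := by
  -- Where `σ` vanishes `I²` is the squared length of `dσ`, so its inverse is `1` there.
  have hv1 : ε v = 1 := by
    have e : isqR D gi Γ σ = vf D (grad D gi σ) σ + 2 * (σ * rhoR D gi Γ σ) := by
      rw [isqR, vf_apply]
      have := sum_smul_eq_grad (D := D) (gi := gi) σ (fun b => D b σ)
      simp only [smul_eq_mul] at this
      rw [this]
    have := congrArg ε hv
    rwa [e, map_mul, map_add, h1, map_mul, map_mul, hσ, zero_mul, mul_zero, add_zero, mul_one,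
      map_one] at this
  have hn : ε (dir D (fun a => ε (grad D gi σ a)) σ) = 1 := by
    rw [← h1, vf_apply, dir_apply, map_sum, map_sum]
    simp only [map_smul, map_mul, smul_eq_mul]
  choose g hg hφ hNφ using fun J => exists_dir_mem_van hσ hn (mem_vanT.1 h J)
  have hτ : τ = (fun J => τ J - σ * g J) + σ • g := by
    funext J
    simp
  have hc := isConnection_covR (m := m) D θ
  -- The multiple of `σ` drops out on both sides: on the left by tangentiality at the critical
  -- weight, on the right because the tangential symbol does not see it.
  rw [eval_iterate_tangLapR hgi h1 hu l h, hτ, hc.yPowR_add, hc.yPowR_smul_critical hd hgi Γ hv]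
  simp only [Pi.add_apply, Pi.smul_apply, smul_eq_mul, map_add, map_mul, hσ, zero_mul, add_zero]
  rw [iterate_linear_add, map_add, eval_iterate_sym2_mul hgi h1 hσ l (hg I), add_zero,
    eval_yPowR_even hd hD hgi hσ hv hv1 l _ (mem_vanT.2 hφ) (mem_vanT.2 hNφ),
    eval_iterate_sym2_tang hD l (hφ I) (hNφ I)]
  congr 1
  -- At the critical weight the second factor of each pair is also `2 i + 1`, so the product is the
  -- square of a double factorial.
  have e : ∀ i : ℕ, (2 * (l : ℝ) - 1 - (d + 2 * ((((2 * l : ℕ) : ℝ) - d + 1) / 2) - 2)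
      + 2 * i + 1) = 2 * i + 1 := by
    intro i; push_cast; ring
  simp only [e]
  rw [Finset.prod_mul_distrib, ← sq]
  congr 1
  -- For `l = 0` the truncated `2 * l - 1` is `0`, whose double factorial is `1`, as the empty
  -- product requires.
  rcases l with _ | l
  · simp
  · have := Nat.doubleFactorial_eq_prod_odd l
    rw [show 2 * (l + 1) - 1 = 2 * l + 1 by omega, this, Finset.prod_range_succ']
    push_cast
    simp

end Tangential

/-! ### Comparison of two scales with nearly the same squared length. -/

section Uniqueness

variable {d m : ℕ} {R : Type*} [CommRing R] [Algebra ℝ R]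
  {D : Fin d → Derivation ℝ R R} {ε : R →ₐ[ℝ] ℝ}
  {θ : Fin d → Matrix (Slot d) (Slot d) R} {gi : Matrix (Fin d) (Fin d) R}
  {Γ : Fin d → Fin d → Fin d → R} {σ δ v v' : R}

theorem rhoR_add (σ δ : R) : rhoR D gi Γ (σ + δ) = rhoR D gi Γ σ + rhoR D gi Γ δ := by
  rw [rhoR, rhoR, rhoR, (isConnection_derivation D).lapR_add, mul_add]
  module

theorem grad_add (σ δ : R) (b : Fin d) :
    grad D gi (σ + δ) b = grad D gi σ b + grad D gi δ b := by
  simp only [grad, map_add, mul_add, Finset.sum_add_distrib]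

theorem isqR_add (hgi : ∀ a b, gi a b = gi b a) (σ δ : R) :
    isqR D gi Γ (σ + δ) = isqR D gi Γ σ + ((2 : ℝ) • vf D (grad D gi σ) δ
      + ∑ a, ∑ b, gi a b * D a δ * D b δ
      + (2 : ℝ) • (σ * rhoR D gi Γ δ + δ * rhoR D gi Γ σ + δ * rhoR D gi Γ δ)) := by
  have h1 : ∑ a, ∑ b, gi a b * D a σ * D b δ = vf D (grad D gi σ) δ := by
    have := sum_smul_eq_grad (D := D) (gi := gi) σ (fun b => D b δ)
    simp only [smul_eq_mul] at this
    rw [this, vf_apply]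
  have h2 : ∑ a, ∑ b, gi a b * D a δ * D b σ = vf D (grad D gi σ) δ := by
    rw [← h1, Finset.sum_comm]
    refine Finset.sum_congr rfl fun a _ => Finset.sum_congr rfl fun b _ => ?_
    rw [hgi b a]
    ring
  have h3 : ∑ a, ∑ b, gi a b * D a (σ + δ) * D b (σ + δ)
      = ∑ a, ∑ b, gi a b * D a σ * D b σ + (∑ a, ∑ b, gi a b * D a σ * D b δ
        + ∑ a, ∑ b, gi a b * D a δ * D b σ) + ∑ a, ∑ b, gi a b * D a δ * D b δ := by
    simp only [← Finset.sum_add_distrib, map_add]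
    exact Finset.sum_congr rfl fun a _ => Finset.sum_congr rfl fun b _ => by ring
  rw [isqR, isqR, rhoR_add, h3, h1, h2, two_smul, two_smul]
  ring

theorem lapR_derivation_sub {j : ℕ} (h : δ ∈ Van D ε j) :
    lapR gi Γ (fun a f => D a f) δ - sym2 D (fun a b => ε (gi a b)) δ ∈ Van D ε (j - 1) := by
  have h0 : (fun _ : Fin 0 → Slot d => δ) ∈ VanT D ε 0 j := mem_vanT.2 fun _ => h
  have := mem_vanT.1 (vanT_lapR_sub (gi := gi) (Γ := Γ) (θ := 0) h0) Fin.elim0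
  rwa [lapR_rank_zero] at this

theorem van_rhoR_add {j : ℕ} (h : δ ∈ Van D ε j) :
    rhoR D gi Γ δ + (d : ℝ)⁻¹ • sym2 D (fun a b => ε (gi a b)) δ ∈ Van D ε (j - 1) := by
  have e : rhoR D gi Γ δ + (d : ℝ)⁻¹ • sym2 D (fun a b => ε (gi a b)) δ
      = -((d : ℝ)⁻¹ • ((lapR gi Γ (fun a f => D a f) δ - sym2 D (fun a b => ε (gi a b)) δ)
        + jtr D gi Γ * δ)) := by
    rw [rhoR]
    module
  rw [e]
  exact neg_mem (van_rsmul (add_mem (lapR_derivation_sub h)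
    (Ideal.mul_mem_left _ _ (van_mono h (by omega)))) _)

theorem van_rhoR {j : ℕ} (h : δ ∈ Van D ε j) : rhoR D gi Γ δ ∈ Van D ε (j - 2) := by
  have := sub_mem (van_mono (van_rhoR_add (gi := gi) (Γ := Γ) h) (show j - 2 ≤ j - 1 by omega))
    (van_rsmul (van_sym2 h fun a b => ε (gi a b)) (d : ℝ)⁻¹)
  rwa [add_sub_cancel_right] at this

theorem van_vf_vf_sub {j : ℕ} (h : δ ∈ Van D ε j) (N : Fin d → R) :
    vf D N (vf D N δ) - dir D (fun a => ε (N a)) (dir D (fun a => ε (N a)) δ)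
      ∈ Van D ε (j - 1) := by
  have h1 := van_vf_sub_dir (van_vf h N) N
  have h2 := van_dir (van_vf_sub_dir h N) (fun a => ε (N a))
  have := add_mem h1 h2
  rwa [map_sub, sub_add_sub_cancel] at this

variable {Z : Set (R →ₐ[ℝ] ℝ)}

/-- The tangential symbol is a sum of `D a` composed with the constant direction given by its `a`-th
row. Each row is tangent at `q` and loses nothing, so only the outer derivative costs an order. -/
theorem IsHypersurface.sym2_tang_mem (hZ : IsHypersurface D σ Z)
    (hD : ∀ a b f, D a (D b f) = D b (D a f)) (hgi : ∀ a b, gi a b = gi b a)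
    (h1 : ∀ q ∈ Z, q (vf D (grad D gi σ) σ) = 1) {j : ℕ} (hδ : ∀ q ∈ Z, δ ∈ Van D q j)
    {q : R →ₐ[ℝ] ℝ} (hq : q ∈ Z) :
    sym2 D (fun a b => q (gi a b) - q (grad D gi σ a) * q (grad D gi σ b)) δ
      ∈ Van D q (j - 1) := by
  have e : sym2 D (fun a b => q (gi a b) - q (grad D gi σ a) * q (grad D gi σ b)) δ
      = ∑ a, D a (dir D (fun b => q (gi a b) - q (grad D gi σ a) * q (grad D gi σ b)) δ) := by
    simp only [sym2_apply, dir_apply, map_sum, Derivation.map_smul]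
  rw [e]
  refine sum_mem fun a _ => van_D (hZ.dir_mem hD hδ hq ?_) a
  have h2 := h1 q hq
  rw [vf_apply, map_sum] at h2
  simp only [map_mul] at h2
  simp only [sub_mul, Finset.sum_sub_distrib, mul_assoc, ← Finset.mul_sum]
  rw [h2, grad, map_sum, mul_one]
  simp only [map_mul, hgi a, sub_self]

/-- Up to order `i + 2`, the difference of the two squares is twice `N δ + σ ρ(δ)`, and the bottom
slot `ρ(δ)` may be replaced by `-d⁻¹ N N δ` since the tangential second derivatives are of lower
order. Applying `N^(i+1)` at `q` gives `(1 - (i + 1) / d) N^(i+2) δ = 0`. The indicial factor is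
nonzero in the range `i + 1 < d`. -/
theorem IsHypersurface.mem_van_succ_of_isqR (hZ : IsHypersurface D σ Z) (hd : d ≠ 0)
    (hD : ∀ a b f, D a (D b f) = D b (D a f)) (hgi : ∀ a b, gi a b = gi b a)
    (h1 : ∀ q ∈ Z, q (vf D (grad D gi σ) σ) = 1)
    (hI : ∀ q ∈ Z, isqR D gi Γ (σ + δ) - isqR D gi Γ σ ∈ Van D q d)
    {i : ℕ} (hi : i + 1 < d) (hδ : ∀ q ∈ Z, δ ∈ Van D q (i + 2)) {q : R →ₐ[ℝ] ℝ} (hq : q ∈ Z) :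
    δ ∈ Van D q (i + 3) := by
  set N := grad D gi σ with hN
  refine hZ.mem_van_succ hD (N := N) hq (by rw [h1 q hq]; exact one_ne_zero) hδ ?_
  have hδq := hδ q hq
  have hσ1 : σ ∈ Van D q 1 := mem_van_one.2 (hZ.zero q hq)
  have hE : vf D N δ - (d : ℝ)⁻¹ • (σ * vf D N (vf D N δ)) ∈ Van D q (i + 2) := by
    -- An exact identity that isolates the linear part. The other terms are the quadratic one,
    -- multiples of `δ`, and `σ` times errors from freezing coefficients or from tangential
    -- derivatives.
    have e : vf D N δ - (d : ℝ)⁻¹ • (σ * vf D N (vf D N δ))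
        = (1 / 2 : ℝ) • (isqR D gi Γ (σ + δ) - isqR D gi Γ σ)
          - (1 / 2 : ℝ) • (∑ a, ∑ b, gi a b * D a δ * D b δ)
          - (δ * rhoR D gi Γ σ + δ * rhoR D gi Γ δ)
          - σ * ((rhoR D gi Γ δ + (d : ℝ)⁻¹ • sym2 D (fun a b => q (gi a b)) δ)
            + (d : ℝ)⁻¹ • ((vf D N (vf D N δ)
              - dir D (fun a => q (N a)) (dir D (fun a => q (N a)) δ))
            - sym2 D (fun a b => q (gi a b) - q (N a) * q (N b)) δ)) := by
      rw [isqR_add hgi, sym2_sub_dir_dir]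
      simp only [Algebra.smul_def, ← hN]
      have : algebraMap ℝ R (1 / 2) * algebraMap ℝ R 2 = 1 := by
        rw [← map_mul]
        norm_num
      linear_combination (-(vf D N δ) -
        (σ * rhoR D gi Γ δ + δ * rhoR D gi Γ σ + δ * rhoR D gi Γ δ)) * this
    rw [e]
    refine sub_mem (sub_mem (sub_mem (van_rsmul (van_mono (hI q hq) (by omega)) _)
      (van_rsmul (sum_mem fun a _ => sum_mem fun b _ => ?_) _)) (add_mem
        (Ideal.mul_mem_right _ _ hδq) (Ideal.mul_mem_right _ _ hδq))) ?_
    · rw [mul_assoc]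
      exact Ideal.mul_mem_left _ _ (van_mul' (van_D hδq a) (van_D hδq b) (by omega))
    · exact van_mul' hσ1 (add_mem (van_rhoR_add hδq) (van_rsmul (sub_mem
        (van_vf_vf_sub hδq N) (hZ.sym2_tang_mem hD hgi h1 hδ hq)) _)) (by omega)
  have h0 := eval_eq_zero (van_iterate_vf N (i + 1) hE) (by omega)
  rw [iterate_map_sub, iterate_map_rsmul, map_sub, map_smul,
    eval_iterate_vf_mul (hZ.zero q hq) N i (van_mono (van_vf (van_vf hδq N) N) (by omega)),
    h1 q hq, mul_one, smul_eq_mul, ← Function.iterate_succ_apply (vf D N),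
    ← Function.iterate_succ_apply (vf D N), ← Function.iterate_succ_apply (vf D N)] at h0
  have hd' : (d : ℝ) ≠ 0 := Nat.cast_ne_zero.2 hd
  have hi' : (d : ℝ) - (i + 1) ≠ 0 := by
    have : ((i + 1 : ℕ) : ℝ) < d := Nat.cast_lt.2 hi
    push_cast at this
    linarith
  field_simp at h0
  have h2 : ((d : ℝ) - (i + 1)) * q ((vf D N)^[i + 2] δ) = 0 := by
    linear_combination h0
  exact (mul_eq_zero.1 h2).resolve_left hi'

/-- Two unit defining densities with the same differential agree to order `d + 1`. -/
theorem IsHypersurface.mem_van_of_isqR (hZ : IsHypersurface D σ Z) (hd : 1 ≤ d)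
    (hD : ∀ a b f, D a (D b f) = D b (D a f)) (hgi : ∀ a b, gi a b = gi b a)
    (h1 : ∀ q ∈ Z, q (vf D (grad D gi σ) σ) = 1)
    (hI : ∀ q ∈ Z, isqR D gi Γ (σ + δ) - isqR D gi Γ σ ∈ Van D q d)
    (h0 : ∀ q ∈ Z, q δ = 0) (hδ : ∀ q ∈ Z, ∀ a, q (D a δ) = 0) :
    ∀ q ∈ Z, δ ∈ Van D q (d + 1) := by
  have H : ∀ i, i + 1 ≤ d → ∀ q ∈ Z, δ ∈ Van D q (i + 2) := by
    intro i
    induction i with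
    | zero => exact fun _ q hq => ⟨h0 q hq, fun a => mem_van_one.2 (hδ q hq a)⟩
    | succ i ih =>
      exact fun hi q hq => hZ.mem_van_succ_of_isqR (by omega) hD hgi h1 hI (by omega)
        (ih (by omega)) hq
  intro q hq
  obtain ⟨e, rfl⟩ : ∃ e, d = e + 1 := ⟨d - 1, by omega⟩
  exact H e le_rfl q hq

/-- The worst coefficient of the difference is the bottom slot of `δ`, with two derivatives of a
quantity of order `d + 1`. The gradient of `δ` and `v' - v` are of order `d`. No vanishing of `τ` is
assumed. -/
theorem vanT_yR_sub_yR (hδ : δ ∈ Van D ε (d + 1))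
    (hI : isqR D gi Γ (σ + δ) - isqR D gi Γ σ ∈ Van D ε d)
    (hv : v * isqR D gi Γ σ = 1) (hv' : v' * isqR D gi Γ (σ + δ) = 1) (w : ℝ)
    (τ : TensorR d m R) :
    yR D gi Γ (covR D θ) (σ + δ) v' w τ - yR D gi Γ (covR D θ) σ v w τ ∈ VanT D ε m (d - 1) := by
  have h1 : v' - v ∈ Van D ε d := by
    have : v' - v = -(v * v') * (isqR D gi Γ (σ + δ) - isqR D gi Γ σ) := by
      linear_combination (-v') * hv + v * hv'
    rw [this]
    exact Ideal.mul_mem_left _ _ hI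
  have h2 : ∀ b, grad D gi δ b ∈ Van D ε (d - 1) := fun b =>
    sum_mem fun a _ => Ideal.mul_mem_left _ _ (van_mono (van_D hδ a) (by omega))
  have h3 : rhoR D gi Γ δ ∈ Van D ε (d - 1) := van_mono (van_rhoR hδ) (by omega)
  have e : yR D gi Γ (covR D θ) (σ + δ) v' w τ - yR D gi Γ (covR D θ) σ v w τ
      = -((v' - v) • lrR D gi Γ (covR D θ) (σ + δ) w τ)
        - v • (-(δ • (lapR gi Γ (covR D θ) τ + (w • jtr D gi Γ) • τ))
          + algebraMap ℝ R ((d : ℝ) + 2 * w - 2)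
            • (∑ b, grad D gi δ b • covR D θ b τ + (w • rhoR D gi Γ δ) • τ)) := by
    simp only [yR, lrR, sum_smul_eq_grad, grad_add, rhoR_add, smul_add w, add_smul,
      Finset.sum_add_distrib]
    module
  have hz := mem_vanT_zero (D := D) (ε := ε) (m := m)
  rw [e]
  refine sub_mem (neg_mem (vanT_smul h1 (hz _) (by omega))) (Submodule.smul_mem _ _ (add_mem
    (neg_mem (vanT_smul hδ (hz _) (by omega))) (Submodule.smul_mem _ _ (add_mem
      (sum_mem fun b _ => vanT_smul (h2 b) (hz _) (by omega))
      (vanT_smul (van_rsmul h3 w) (hz _) (by omega))))))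

/-- Telescoping: a discrepancy of order `d - 1` appears in one factor, and each later factor `y`
lowers its order by at most one. -/
theorem vanT_yPowR_sub_yPowR (hσ : ε σ = 0) (hδ : δ ∈ Van D ε (d + 1))
    (hI : isqR D gi Γ (σ + δ) - isqR D gi Γ σ ∈ Van D ε d)
    (hv : v * isqR D gi Γ σ = 1) (hv' : v' * isqR D gi Γ (σ + δ) = 1) (k : ℕ) (w : ℝ)
    (τ : TensorR d m R) :
    yPowR D gi Γ (covR D θ) (σ + δ) v' k w τ - yPowR D gi Γ (covR D θ) σ v k w τ
      ∈ VanT D ε m (d - k) := by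
  induction k generalizing w τ with
  | zero =>
    change τ - τ ∈ _
    rw [sub_self]
    exact zero_mem _
  | succ k ih =>
    have h1 := ih (w - 1) (yR D gi Γ (covR D θ) (σ + δ) v' w τ)
    have h2 := vanT_yPowR (θ := θ) (gi := gi) (Γ := Γ) (v := v) hσ k (w - 1)
      (vanT_yR_sub_yR (θ := θ) hδ hI hv hv' w τ)
    have hc := isConnection_covR (m := m) D θ
    have e : yPowR D gi Γ (covR D θ) σ v k (w - 1) (yR D gi Γ (covR D θ) (σ + δ) v' w τ)
        = yPowR D gi Γ (covR D θ) σ v k (w - 1) (yR D gi Γ (covR D θ) (σ + δ) v' w τ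
          - yR D gi Γ (covR D θ) σ v w τ)
        + yPowR D gi Γ (covR D θ) σ v k (w - 1) (yR D gi Γ (covR D θ) σ v w τ) := by
      rw [← hc.yPowR_add, sub_add_cancel]
    rw [e] at h1
    have := add_mem (vanT_mono h1 (show d - (k + 1) ≤ d - k by omega))
      (vanT_mono h2 (show d - (k + 1) ≤ d - 1 - k by omega))
    rwa [sub_add_eq_sub_sub_swap, sub_add_cancel] at this

theorem rhoR_neg (σ : R) : rhoR D gi Γ (-σ) = -rhoR D gi Γ σ := by
  have := rhoR_add (D := D) (gi := gi) (Γ := Γ) σ (-σ)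
  rw [add_neg_cancel] at this
  have h0 := rhoR_add (D := D) (gi := gi) (Γ := Γ) 0 0
  rw [add_zero, left_eq_add] at h0
  rw [h0] at this
  exact (neg_eq_of_add_eq_zero_right this.symm).symm

theorem isqR_neg (σ : R) : isqR D gi Γ (-σ) = isqR D gi Γ σ := by
  simp [isqR, rhoR_neg]

theorem yR_neg {nab : Fin d → TensorR d m R → TensorR d m R} (w : ℝ) (τ : TensorR d m R) :
    yR D gi Γ nab (-σ) v w τ = -yR D gi Γ nab σ v w τ := by
  simp only [yR, lrR, rhoR_neg, map_neg, mul_neg, smul_neg w, neg_smul, Finset.sum_neg_distrib]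
  module

theorem yPowR_neg (k : ℕ) (w : ℝ) (τ : TensorR d m R) :
    yPowR D gi Γ (covR D θ) (-σ) v k w τ
      = algebraMap ℝ R ((-1) ^ k) • yPowR D gi Γ (covR D θ) σ v k w τ := by
  have hc := isConnection_covR (m := m) D θ
  induction k generalizing w τ with
  | zero => simp [yPowR]
  | succ k ih =>
    change yPowR D gi Γ (covR D θ) (-σ) v k (w - 1) (yR D gi Γ (covR D θ) (-σ) v w τ) = _
    have e : -yR D gi Γ (covR D θ) σ v w τ
        = algebraMap ℝ R (-1) • yR D gi Γ (covR D θ) σ v w τ := by simp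
    rw [ih, yR_neg, e, hc.yPowR_const_smul, smul_smul, ← map_mul, pow_succ]
    rfl

end Uniqueness

/-! ### Homogeneous polynomials with prescribed derivatives -/

section HomogeneousPolynomials

variable {E : Type} [NormedAddCommGroup E] [NormedSpace ℝ E]

/-- Induction on the order, with the target space free so that it applies to `fderiv ℝ f`. This
covers transpositions away from the last argument. The transposition of the last two arguments is
the symmetry of the second derivative under the remaining ones, and conjugation yields the rest. -/
theorem iteratedFDeriv_comp_swap {n : ℕ} : ∀ {F : Type} [NormedAddCommGroup F] [NormedSpace ℝ F]
    {f : E → F} {U : Set E} (_ : IsOpen U) (_ : ContDiffOn ℝ ∞ f U) {x : E} (_ : x ∈ U)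
    (v : Fin n → E) (a b : Fin n),
    iteratedFDeriv ℝ n f x (v ∘ Equiv.swap a b) = iteratedFDeriv ℝ n f x v := by
  induction n with
  | zero =>
    intro F _ _ f U _ _ x _ v a
    exact a.elim0
  | succ n ih =>
    intro F _ _ f U hU hf x hx v a b
    have hf' : ContDiffOn ℝ ∞ (fderiv ℝ f) U := hf.fderiv_of_isOpen hU (by simp)
    have hinner : ∀ (v : Fin (n + 1) → E) (a b : Fin n),
        iteratedFDeriv ℝ (n + 1) f x (v ∘ Equiv.swap a.castSucc b.castSucc)
          = iteratedFDeriv ℝ (n + 1) f x v := by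
      intro v a b
      rw [iteratedFDeriv_succ_apply_right, iteratedFDeriv_succ_apply_right]
      have h1 : Fin.init (v ∘ Equiv.swap a.castSucc b.castSucc)
          = Fin.init v ∘ Equiv.swap a b := by
        funext c
        change v (Equiv.swap a.castSucc b.castSucc c.castSucc) = v (Equiv.swap a b c).castSucc
        rw [(Fin.castSucc_injective n).swap_apply]
      have h2 : (v ∘ Equiv.swap a.castSucc b.castSucc) (Fin.last n) = v (Fin.last n) := by
        rw [Function.comp_apply, Equiv.swap_apply_of_ne_of_ne
          (Fin.castSucc_lt_last a).ne' (Fin.castSucc_lt_last b).ne']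
      rw [h1, h2, ih hU hf' hx]
    have hlast : ∀ (v : Fin (n + 1) → E) (a : Fin n),
        iteratedFDeriv ℝ (n + 1) f x (v ∘ Equiv.swap a.castSucc (Fin.last n))
          = iteratedFDeriv ℝ (n + 1) f x v := by
      rcases n with _ | n
      · exact fun _ a => a.elim0
      have hf'' : ContDiffOn ℝ ∞ (fderiv ℝ (fderiv ℝ f)) U := hf'.fderiv_of_isOpen hU (by simp)
      have h1 : ∀ v : Fin (n + 2) → E, iteratedFDeriv ℝ (n + 2) f x v
          = iteratedFDeriv ℝ n (fderiv ℝ (fderiv ℝ f)) x (Fin.init (Fin.init v))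
            (v (Fin.last n).castSucc) (v (Fin.last (n + 1))) := by
        intro v
        rw [iteratedFDeriv_succ_apply_right, iteratedFDeriv_succ_apply_right]
        rfl
      have hev : ∀ (u : Fin n → E) (s t : E),
          iteratedFDeriv ℝ n (fun y => fderiv ℝ (fderiv ℝ f) y s t) x u
            = iteratedFDeriv ℝ n (fderiv ℝ (fderiv ℝ f)) x u s t := by
        intro u s t
        have h3 := ((ContinuousLinearMap.apply ℝ F t).comp
          (ContinuousLinearMap.apply ℝ (E →L[ℝ] F) s)).iteratedFDeriv_comp_left
            (hf''.contDiffAt (hU.mem_nhds hx)) (i := n) (by exact_mod_cast le_top)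
        exact congrArg (fun L => L u) h3
      have h2 : ∀ (u : Fin n → E) (s t : E), iteratedFDeriv ℝ n (fderiv ℝ (fderiv ℝ f)) x u s t
          = iteratedFDeriv ℝ n (fderiv ℝ (fderiv ℝ f)) x u t s := by
        intro u s t
        have hsym : (fun y => fderiv ℝ (fderiv ℝ f) y s t)
            =ᶠ[nhds x] fun y => fderiv ℝ (fderiv ℝ f) y t s := by
          filter_upwards [hU.mem_nhds hx] with y hy
          exact (((hf.contDiffAt (hU.mem_nhds hy)).of_le (by norm_cast) :
            ContDiffAt ℝ 2 f y).isSymmSndFDerivAt (by simp)) s t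
        rw [← hev, ← hev, (hsym.iteratedFDeriv ℝ n).eq_of_nhds]
      have hl : ∀ v : Fin (n + 2) → E, iteratedFDeriv ℝ (n + 2) f x
          (v ∘ Equiv.swap (Fin.last n).castSucc (Fin.last (n + 1)))
          = iteratedFDeriv ℝ (n + 2) f x v := by
        intro v
        rw [h1, h1, Function.comp_apply, Function.comp_apply, Equiv.swap_apply_left,
          Equiv.swap_apply_right, h2]
        congr 3
        funext c
        change v (Equiv.swap _ _ c.castSucc.castSucc) = v c.castSucc.castSucc
        rw [Equiv.swap_apply_of_ne_of_ne]
        · exact fun h => (Fin.castSucc_lt_last c).ne (Fin.castSucc_injective _ h)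
        · exact (Fin.castSucc_lt_last _).ne
      intro v a
      by_cases ha : a = Fin.last n
      · rw [ha, hl]
      -- The transposition with the last argument is conjugated to that of the last two by one which
      -- fixes the last argument.
      · have h5 : Equiv.swap a.castSucc (Fin.last (n + 1))
            = Equiv.swap a.castSucc (Fin.last n).castSucc
              * Equiv.swap (Fin.last n).castSucc (Fin.last (n + 1))
              * Equiv.swap a.castSucc (Fin.last n).castSucc := by
          have hne : Fin.last (n + 1) ≠ (Fin.last n).castSucc := (Fin.castSucc_lt_last _).ne'
          have hne' : Fin.last (n + 1) ≠ a.castSucc := (Fin.castSucc_lt_last _).ne'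
          rw [← Equiv.swap_mul_swap_mul_swap hne hne',
            Equiv.swap_comm (Fin.last n).castSucc a.castSucc,
            Equiv.swap_comm (Fin.last n).castSucc (Fin.last (n + 1))]
        rw [h5, Equiv.Perm.coe_mul, Equiv.Perm.coe_mul, ← Function.comp_assoc,
          ← Function.comp_assoc, hinner, hl, hinner]
    induction a using Fin.lastCases with
    | last =>
      induction b using Fin.lastCases with
      | last => simp
      | cast b => rw [Equiv.swap_comm, hlast]
    | cast a =>
      induction b using Fin.lastCases with
      | last => exact hlast v a
      | cast b => exact hinner v a b

/-- By symmetry the derivative of the polynomial of `L` is `j + 1` times the polynomial of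
`L.curryRight`, which has degree one less and values in linear maps; induction multiplies the
constants to the factorial. -/
theorem iteratedFDeriv_homogeneous {j : ℕ} : ∀ {F : Type} [NormedAddCommGroup F] [NormedSpace ℝ F]
    (L : ContinuousMultilinearMap ℝ (fun _ : Fin j => E) F)
    (_ : ∀ v a b, L (v ∘ Equiv.swap a b) = L v) (p : E) (i : ℕ),
    (i ≠ j → iteratedFDeriv ℝ i (fun x => L fun _ => x - p) p = 0) ∧
      iteratedFDeriv ℝ j (fun x => L fun _ => x - p) p = (j.factorial : ℝ) • L := by
  induction j with
  | zero =>
    intro F _ _ L _ p i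
    have hc : (fun x => L fun _ => x - p) = fun _ => L 0 := by
      funext x
      exact congrArg L (Subsingleton.elim _ _)
    rw [hc]
    refine ⟨fun hi => ?_, ?_⟩
    · rw [iteratedFDeriv_const_of_ne hi]
      rfl
    · ext m
      simp only [iteratedFDeriv_zero_apply, Nat.factorial_zero, Nat.cast_one, one_smul]
      exact congrArg L (Subsingleton.elim _ _)
  | succ j ih =>
    intro F _ _ L hL p i
    have hu : ContDiff ℝ ∞ (fun x => L.curryRight fun _ : Fin j => x - p) :=
      L.curryRight.contDiff.comp (contDiff_pi.2 fun _ => contDiff_id.sub contDiff_const)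
    have hd : (fun y => fderiv ℝ (fun x => L fun _ => x - p) y)
        = fun y => ((j + 1 : ℕ) : ℝ) • L.curryRight fun _ : Fin j => y - p := by
      funext y
      have h := HasFDerivAt.multilinear_comp (f := L) (x := y)
        (g := fun _ x => x - p) (g' := fun _ => ContinuousLinearMap.id ℝ E)
        (fun _ => (hasFDerivAt_id y).sub_const p)
      rw [h.fderiv]
      ext w
      rw [ContinuousLinearMap.sum_apply, ContinuousLinearMap.smul_apply]
      have : ∀ b : Fin (j + 1), ((L.toContinuousLinearMap (fun _ => y - p) b).comp
          (ContinuousLinearMap.id ℝ E)) w = L.curryRight (fun _ : Fin j => y - p) w := by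
        intro b
        change L (Function.update (fun _ => y - p) b w) = L (Fin.snoc (fun _ => y - p) w)
        rw [← hL _ b (Fin.last j)]
        congr 1
        funext c
        refine Fin.lastCases ?_ (fun c => ?_) c
        · simp
        · rw [Function.comp_apply, Fin.snoc_castSucc]
          by_cases hc : c.castSucc = b
          · rw [hc, Equiv.swap_apply_left, Function.update_of_ne]
            rw [← hc]
            exact (Fin.castSucc_lt_last c).ne'
          · rw [Equiv.swap_apply_of_ne_of_ne hc (Fin.castSucc_lt_last c).ne,
              Function.update_of_ne hc]
      simp only [this, Finset.sum_const, Finset.card_univ, Fintype.card_fin, ← Nat.cast_smul_eq_nsmul ℝ]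
    have hs : ∀ v a b, L.curryRight (v ∘ Equiv.swap a b) = L.curryRight v := by
      intro v a b
      ext w
      change L (Fin.snoc (v ∘ Equiv.swap a b) w) = L (Fin.snoc v w)
      rw [← hL (Fin.snoc v w) a.castSucc b.castSucc]
      congr 1
      funext c
      refine Fin.lastCases ?_ (fun c => ?_) c
      · rw [Fin.snoc_last, Function.comp_apply, Equiv.swap_apply_of_ne_of_ne
          (Fin.castSucc_lt_last a).ne' (Fin.castSucc_lt_last b).ne', Fin.snoc_last]
      · rw [Fin.snoc_castSucc, Function.comp_apply, Function.comp_apply,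
          (Fin.castSucc_injective j).swap_apply, Fin.snoc_castSucc]
    have key : ∀ n (m : Fin (n + 1) → E),
        iteratedFDeriv ℝ (n + 1) (fun x => L fun _ => x - p) p m
          = (((j + 1 : ℕ) : ℝ) • iteratedFDeriv ℝ n (fun x => L.curryRight fun _ => x - p) p)
            (Fin.init m) (m (Fin.last n)) := by
      intro n m
      rw [iteratedFDeriv_succ_apply_right, hd, iteratedFDeriv_const_smul_apply']
      exact hu.contDiffAt.of_le (by exact_mod_cast le_top)
    refine ⟨fun hi => ?_, ?_⟩
    · rcases i with _ | i
      · ext m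
        rw [iteratedFDeriv_zero_apply]
        exact L.map_coord_zero 0 (sub_self p)
      · ext m
        rw [key, (ih L.curryRight hs p i).1 (by omega)]
        simp
    · ext m
      rw [key, (ih L.curryRight hs p j).2, Nat.factorial_succ]
      simp only [ContinuousMultilinearMap.smul_apply, ContinuousLinearMap.smul_apply,
        ContinuousMultilinearMap.curryRight_apply, Fin.snoc_init_self, smul_smul]
      push_cast
      rfl

end HomogeneousPolynomials

/-! ### Detecting the order of a differential operator by tensors that vanish at a point. -/

section JetOperators

variable {d m : ℕ} {U : TopologicalSpace.Opens (Model d)}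

theorem van_of_iteratedFDeriv {n : ℕ} {F : Model d → ℝ} {f : Sm U} (hF : ContDiff ℝ ∞ F)
    (h : Rep F f) (p : U) (h0 : ∀ i < n, iteratedFDeriv ℝ i F p = 0) :
    f ∈ Van Sm.D (Sm.ev p) n := by
  induction n generalizing F f with
  | zero => exact mem_van_zero f
  | succ n ih =>
    refine ⟨?_, fun a => ?_⟩
    · rw [← h p]
      have := congrArg (fun L => L 0) (h0 0 (by omega))
      simpa using this
    · have hF' : ContDiff ℝ ∞ (fderiv ℝ F) := hF.fderiv_right (by simp)
      refine ih (F := pd a F) (hF'.clm_apply contDiff_const) (h.pd a) fun i hi => ?_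
      have h1 : iteratedFDeriv ℝ i (fderiv ℝ F) p = 0 := by
        rw [← norm_eq_zero, norm_iteratedFDeriv_fderiv, h0 (i + 1) (by omega), norm_zero]
      have h2 := (ContinuousLinearMap.apply ℝ ℝ
        (EuclideanSpace.single a (1 : ℝ) : Model d)).iteratedFDeriv_comp_left
          (hF'.contDiffAt (x := (p : Model d))) (i := i) (by exact_mod_cast le_top)
      rw [h1] at h2
      exact h2

variable (T : TensorR d m (Sm U) → TensorR d m (Sm U))

/-- `A` are the coefficients of the operator `T` of order at most `N`. -/
structure IsJet (N : ℕ) (A : (j : ℕ) → Model d → JetCoeff d m j) : Prop where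
  smooth : ∀ j, ContDiffOn ℝ ∞ (A j) U
  rep : ∀ t τ, RepT t τ →
    RepT (fun y => ∑ j ∈ Finset.range (N + 1), A j y (iteratedFDeriv ℝ j t y)) (T τ)

variable {T}

/-- For `j ≥ n` the coefficient of order `j` is tested on the homogeneous Taylor term of degree `j`
of `t` at `p`. Its only nonzero derivative at `p` is the `j`-th, and it vanishes there to order `n`.
The coefficient itself need not be zero, as it may act on multilinear maps that are not symmetric;
only its value on jets of functions is controlled. -/
theorem IsJet.tail {N : ℕ} {A : (j : ℕ) → Model d → JetCoeff d m j} (hA : IsJet T N A)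
    {n : ℕ} (hn : n ≤ N + 1) {p : U}
    (h : ∀ τ ∈ VanT Sm.D (Sm.ev p) m n, ∀ I, Sm.ev p (T τ I) = 0)
    {t : Model d → Tensor d m} {τ : TensorR d m (Sm U)} (ht : RepT t τ) (I : Fin m → Slot d) :
    (∑ j ∈ Finset.range n, A j p (iteratedFDeriv ℝ j t p)) I = Sm.ev p (T τ I) := by
  have htc : ContDiffAt ℝ ∞ t p := ht.contDiffOn.contDiffAt (U.isOpen.mem_nhds p.2)
  have hz : ∀ j, n ≤ j → j < N + 1 → A j p (iteratedFDeriv ℝ j t p) = 0 := by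
    intro j hj hjN
    set L := iteratedFDeriv ℝ j t p with hL
    have hsym : ∀ v a b, L (v ∘ Equiv.swap a b) = L v := fun v a b =>
      iteratedFDeriv_comp_swap U.isOpen ht.contDiffOn p.2 v a b
    set q : Model d → Tensor d m := fun x => (j.factorial : ℝ)⁻¹ • L fun _ => x - p with hq
    have hL0 : ContDiff ℝ ∞ (fun x : Model d => L fun _ => x - p) :=
      L.contDiff.comp (contDiff_pi.2 fun _ => contDiff_id.sub contDiff_const)
    have hqs : ContDiff ℝ ∞ q := hL0.const_smul _
    have hqd : ∀ i, iteratedFDeriv ℝ i q p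
        = (j.factorial : ℝ)⁻¹ • iteratedFDeriv ℝ i (fun x : Model d => L fun _ => x - p) p :=
      fun i => iteratedFDeriv_const_smul_apply'
        (hL0.contDiffAt.of_le (by exact_mod_cast le_top))
    have hne : ∀ i, i ≠ j → iteratedFDeriv ℝ i q p = 0 := fun i hi => by
      rw [hqd, (iteratedFDeriv_homogeneous L hsym p i).1 hi, smul_zero]
    have heq : iteratedFDeriv ℝ j q p = L := by
      rw [hqd, (iteratedFDeriv_homogeneous L hsym p j).2, smul_smul, inv_mul_cancel₀
        (Nat.cast_ne_zero.2 (Nat.factorial_ne_zero _)), one_smul]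
    obtain ⟨κ, hκ⟩ := exists_repT_of_contDiffOn (U := U) hqs.contDiffOn
    have hκv : κ ∈ VanT Sm.D (Sm.ev p) m n := by
      refine mem_vanT.2 fun J => van_of_iteratedFDeriv (contDiff_pi.1 hqs J) (hκ J) p
        fun i hi => ?_
      have h2 := (ContinuousLinearMap.proj (R := ℝ) (φ := fun _ : Fin m → Slot d => ℝ)
        J).iteratedFDeriv_comp_left (hqs.contDiffAt (x := (p : Model d))) (i := i)
        (by exact_mod_cast le_top)
      rw [hne i (by omega)] at h2
      exact h2
    funext J
    have h3 := hA.rep q κ hκ J p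
    rw [h κ hκv J] at h3
    change (∑ i ∈ Finset.range (N + 1), A i p (iteratedFDeriv ℝ i q p)) J = 0 at h3
    rw [Finset.sum_eq_single_of_mem j (Finset.mem_range.2 hjN)
      (fun i _ hi => by rw [hne i hi, map_zero]), heq] at h3
    exact h3
  rw [← hA.rep t τ ht I p]
  refine congrFun ?_ I
  refine Finset.sum_subset (Finset.range_mono hn) fun j hj hj' => ?_
  exact hz j (by simpa using hj') (by simpa using hj)

end JetOperators

/-! ### Closure properties of differential operators with smooth coefficients. -/

section JetOperators

variable {d m : ℕ} {U : TopologicalSpace.Opens (Model d)}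

/-- `T` is a linear differential operator of order at most `N` with smooth coefficients. -/
def HasJet (T : TensorR d m (Sm U) → TensorR d m (Sm U)) (N : ℕ) : Prop := ∃ A, IsJet T N A

variable {S T : TensorR d m (Sm U) → TensorR d m (Sm U)} {N : ℕ}

theorem hasJet_id : HasJet (fun τ : TensorR d m (Sm U) => τ) 0 := by
  refine ⟨fun j _ => if h : j = 0 then
    h ▸ ContinuousMultilinearMap.apply ℝ (fun _ : Fin 0 => Model d) (Tensor d m) 0 else 0,
    fun _ => contDiffOn_const, fun t τ h I y => ?_⟩
  rw [← h I y]
  simp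

theorem HasJet.mono (h : HasJet T N) {N' : ℕ} (hN : N ≤ N') : HasJet T N' := by
  obtain ⟨A, hA⟩ := h
  refine ⟨fun j y => if j ≤ N then A j y else 0, fun j => ?_, fun t τ ht I y => ?_⟩
  · by_cases hj : j ≤ N
    · simpa only [if_pos hj] using hA.smooth j
    · simpa only [if_neg hj] using contDiffOn_const
  · rw [← hA.rep t τ ht I y]
    refine congrFun (Eq.symm ?_ : (_ : Tensor d m) = _) I
    dsimp only
    rw [← Finset.sum_subset (Finset.range_mono (Nat.add_le_add_right hN 1))]
    · exact Finset.sum_congr rfl fun j hj => by rw [if_pos (by simpa [Nat.lt_succ_iff] using hj)]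
    · intro j _ hj
      rw [if_neg (by simpa [Nat.lt_succ_iff] using hj)]
      rfl

theorem HasJet.add (hS : HasJet S N) (hT : HasJet T N) : HasJet (fun τ => S τ + T τ) N := by
  obtain ⟨A, hA⟩ := hS
  obtain ⟨B, hB⟩ := hT
  refine ⟨fun j y => A j y + B j y, fun j => (hA.smooth j).add (hB.smooth j),
    fun t τ ht I y => ?_⟩
  rw [Pi.add_apply, map_add, ← hA.rep t τ ht I y, ← hB.rep t τ ht I y]
  simp [Finset.sum_add_distrib]

theorem HasJet.matrix (hT : HasJet T N) (c : (Fin m → Slot d) → (Fin m → Slot d) → Sm U) :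
    HasJet (fun τ I => ∑ K, c I K * T τ K) N := by
  obtain ⟨A, hA⟩ := hT
  choose C hC hCc using fun I K => Sm.exists_rep (c I K)
  let E : (Fin m → Slot d) → (Fin m → Slot d) → Tensor d m →L[ℝ] Tensor d m := fun I K =>
    (ContinuousLinearMap.proj (R := ℝ) (φ := fun _ : Fin m → Slot d => ℝ) K).smulRight
      (Pi.single I (1 : ℝ))
  refine ⟨fun j y => (∑ I, ∑ K, C I K y • E I K).comp (A j y), fun j => ?_, fun t τ ht I y => ?_⟩
  · exact (ContDiffOn.sum fun I _ => ContDiffOn.sum fun K _ =>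
      (hC I K).smul contDiffOn_const).clm_comp (hA.smooth j)
  · have h1 : ∀ v : Tensor d m, (∑ I, ∑ K, C I K y • E I K) v I = ∑ K, C I K y * v K := by
      intro v
      simp only [ContinuousLinearMap.sum_apply, ContinuousLinearMap.smul_apply, E,
        ContinuousLinearMap.smulRight_apply, ContinuousLinearMap.proj_apply, Finset.sum_apply,
        Pi.smul_apply, smul_eq_mul]
      rw [Finset.sum_eq_single I (fun J _ hJ => by simp [Pi.single_eq_of_ne (Ne.symm hJ)])
        (fun h => absurd (Finset.mem_univ I) h)]
      simp
    change (∑ j ∈ Finset.range (N + 1), (∑ I, ∑ K, C I K y • E I K)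
      (A j y (iteratedFDeriv ℝ j t y))) I = _
    rw [← map_sum, h1, map_sum]
    refine Finset.sum_congr rfl fun K _ => ?_
    rw [map_mul, ← hCc I K y, ← hA.rep t τ ht K y]

theorem HasJet.smul (hT : HasJet T N) (f : Sm U) : HasJet (fun τ => f • T τ) N := by
  convert hT.matrix fun I K => if K = I then f else 0 using 3 with τ I
  simp

theorem HasJet.neg (hT : HasJet T N) : HasJet (fun τ => -T τ) N := by
  convert hT.smul (-1) using 2
  simp

theorem HasJet.sub (hS : HasJet S N) (hT : HasJet T N) : HasJet (fun τ => S τ - T τ) N := by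
  convert hS.add hT.neg using 2
  exact sub_eq_add_neg _ _

theorem HasJet.zero : HasJet (fun _ : TensorR d m (Sm U) => (0 : TensorR d m (Sm U))) N := by
  convert (hasJet_id.mono (Nat.zero_le N)).smul (0 : Sm U) using 2
  simp

theorem HasJet.sum {ι : Type*} (s : Finset ι)
    {T : ι → TensorR d m (Sm U) → TensorR d m (Sm U)} (h : ∀ i, HasJet (T i) N) :
    HasJet (fun τ => ∑ i ∈ s, T i τ) N := by
  classical
  induction s using Finset.induction_on with
  | empty => simpa using HasJet.zero
  | insert i s hi ih => simpa only [Finset.sum_insert hi] using (h i).add ih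

theorem HasJet.D (hT : HasJet T N) (a : Fin d) : HasJet (fun τ I => Sm.D a (T τ I)) (N + 1) := by
  obtain ⟨A, hA⟩ := hT
  let e : Model d := EuclideanSpace.single a 1
  -- The derivative of the `j`-jet along `e` is the `(j+1)`-jet with `e` in its first argument; `B
  -- (j + 1)` inserts it and then applies `A j`.
  let B : (j : ℕ) → Model d → JetCoeff d m j := fun j => match j with
    | 0 => 0
    | j + 1 => fun y => (A j y).comp
      ((ContinuousLinearMap.apply ℝ (ContinuousMultilinearMap ℝ (fun _ : Fin j => Model d)
        (Tensor d m)) e).comp (continuousMultilinearCurryLeftEquiv ℝ (fun _ : Fin (j + 1) => Model d)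
          (Tensor d m)).toContinuousLinearEquiv.toContinuousLinearMap)
  have hB : ∀ j, ContDiffOn ℝ ∞ (B j) U := by
    rintro (_ | j)
    · exact contDiffOn_const
    · exact (hA.smooth j).clm_comp contDiffOn_const
  -- Coefficients beyond `N` do not occur in the expression for `T`, but nothing makes them zero;
  -- they are cut off so that they do not enter at order `N + 1`.
  refine ⟨fun j y => (if j ≤ N then pd a (A j) y else 0) + B j y, fun j => ?_,
    fun t τ ht I y => ?_⟩
  · refine ContDiffOn.add ?_ (hB j)
    by_cases hj : j ≤ N
    · simpa only [if_pos hj] using contDiffOn_pd (hA.smooth j) a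
    · simpa only [if_neg hj] using contDiffOn_const
  · have h1 := (hA.rep t τ ht).pd a I y
    rw [← h1]
    refine congrFun (?_ : (_ : Tensor d m) = _) I
    have htc := ht.contDiffOn.contDiffAt (U.isOpen.mem_nhds y.2)
    have hdt : ∀ j, DifferentiableAt ℝ (iteratedFDeriv ℝ j t) y := fun j =>
      htc.differentiableAt_iteratedFDeriv (by exact_mod_cast WithTop.coe_lt_top _)
    have hdA : ∀ j, DifferentiableAt ℝ (A j) y := fun j =>
      differentiableAt_of_contDiffOn (hA.smooth j) y.2
    have h2 : pd a
        (fun z => ∑ j ∈ Finset.range (N + 1), A j z (iteratedFDeriv ℝ j t z)) (y : Model d)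
        = ∑ j ∈ Finset.range (N + 1), (pd a (A j) y (iteratedFDeriv ℝ j t y)
          + B (j + 1) y (iteratedFDeriv ℝ (j + 1) t y)) := by
      rw [pd, fderiv_fun_sum fun j _ => (hdA j).clm_apply (hdt j),
        ContinuousLinearMap.sum_apply]
      refine Finset.sum_congr rfl fun j _ => ?_
      rw [fderiv_clm_apply (hdA j) (hdt j), ContinuousLinearMap.add_apply, add_comm]
      rfl
    rw [h2, Finset.sum_add_distrib]
    simp only [ContinuousLinearMap.add_apply, Finset.sum_add_distrib]
    congr 1
    · rw [Finset.sum_range_succ, if_neg (by omega)]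
      simp only [ContinuousLinearMap.zero_apply, add_zero]
      exact Finset.sum_congr rfl fun j hj => by
        rw [if_pos (by simpa [Nat.lt_succ_iff] using hj)]
    · rw [Finset.sum_range_succ']
      simp [B]

variable {θ : Fin d → Matrix (Slot d) (Slot d) (Sm U)} {gi : Matrix (Fin d) (Fin d) (Sm U)}
  {Γ : Fin d → Fin d → Fin d → Sm U}

theorem HasJet.covR_comp (hT : HasJet T N) (a : Fin d) :
    HasJet (fun τ => covR Sm.D θ a (T τ)) (N + 1) := by
  refine (hT.D a).add ?_
  let c : (Fin m → Slot d) → (Fin m → Slot d) → Sm U := fun I K => ∑ i, ∑ L,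
    if K = Function.update I i L then θ a (I i) L else 0
  have hc : (fun τ => dActR (θ a) (T τ)) = fun τ I => ∑ K, c I K * T τ K := by
    funext τ I
    simp only [dActR, c, Finset.sum_mul, ite_mul, zero_mul]
    symm
    rw [Finset.sum_comm]
    refine Finset.sum_congr rfl fun i _ => ?_
    rw [Finset.sum_comm]
    simp
  rw [hc]
  exact (hT.matrix c).mono (Nat.le_succ N)

theorem HasJet.lapR_comp (hT : HasJet T N) :
    HasJet (fun τ => lapR gi Γ (covR Sm.D θ) (T τ)) (N + 2) :=
  HasJet.sum _ fun a => HasJet.sum _ fun b => (((hT.covR_comp b).covR_comp a).sub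
    (HasJet.sum _ fun c => ((hT.covR_comp c).smul _).mono (Nat.le_succ _))).smul _

theorem HasJet.yR_comp (hT : HasJet T N) (σ v : Sm U) (w : ℝ) :
    HasJet (fun τ => yR Sm.D gi Γ (covR Sm.D θ) σ v w (T τ)) (N + 2) :=
  (((((hT.lapR_comp.add ((hT.smul _).mono (by omega))).smul _).neg).add
    (((HasJet.sum _ fun a => HasJet.sum _ fun b => ((hT.covR_comp b).smul _).mono (by omega)).add
      ((hT.smul _).mono (by omega))).smul _)).smul _).neg

theorem HasJet.yPowR_comp (hT : HasJet T N) (σ v : Sm U) (k : ℕ) (w : ℝ) :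
    HasJet (fun τ => yPowR Sm.D gi Γ (covR Sm.D θ) σ v k w (T τ)) (N + 2 * k) := by
  induction k generalizing N w T with
  | zero => exact hT
  | succ k ih => exact (ih (hT.yR_comp σ v w) (w - 1)).mono (by omega)

theorem HasJet.tangR_comp (hT : HasJet T N) (σ u : Sm U) (a : Fin d) :
    HasJet (fun τ => tangR Sm.D gi σ u (covR Sm.D θ) a (T τ)) (N + 1) :=
  HasJet.sum _ fun c => (hT.covR_comp c).smul _

theorem HasJet.tangLapR_comp (hT : HasJet T N) (σ u : Sm U) :
    HasJet (fun τ => tangLapR Sm.D gi Γ σ u (covR Sm.D θ) (T τ)) (N + 2) :=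
  HasJet.sum _ fun a => HasJet.sum _ fun b => (HasJet.sum _ fun c =>
    (((hT.tangR_comp σ u b).covR_comp c).sub (HasJet.sum _ fun e =>
      ((hT.tangR_comp σ u e).smul _).mono (Nat.le_succ _))).smul _).smul _

theorem HasJet.iterate_tangLapR (hT : HasJet T N) (σ u : Sm U) (l : ℕ) :
    HasJet (fun τ => (tangLapR Sm.D gi Γ σ u (covR Sm.D θ))^[l]
      (T τ)) (N + 2 * l) := by
  induction l generalizing N T with
  | zero => exact hT
  | succ l ih => exact (ih (hT.tangLapR_comp σ u)).mono (by omega)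

end JetOperators

/-! ### Invertible functions and Lagrange multipliers on zero sets. -/

section Points

variable {d m : ℕ} {U : TopologicalSpace.Opens (Model d)}

theorem Sm.exists_inv {f : Sm U} (hf : ∀ y, Sm.ev y f ≠ 0) : ∃ v : Sm U, v * f = 1 := by
  obtain ⟨F, hF, h⟩ := Sm.exists_rep f
  obtain ⟨v, hv⟩ := exists_rep_of_contDiffOn (U := U) (F := fun y => (F y)⁻¹)
    (hF.inv fun y hy => by rw [h ⟨y, hy⟩]; exact hf _)
  refine ⟨v, Sm.ext fun y => ?_⟩
  rw [map_mul, ← hv y]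
  simp only [h y]
  rw [map_one, inv_mul_cancel₀ (hf y)]

theorem fderiv_eq_of_rep {F : Model d → ℝ} {f : Sm U} (h : Rep F f) (y : U) (x : Model d) :
    fderiv ℝ F y x = ∑ a, x a * Sm.ev y (Sm.D a f) := by
  have hx : x = ∑ a, x a • (EuclideanSpace.single a (1 : ℝ) : Model d) := by
    ext b
    simp [Pi.single_apply]
  conv_lhs => rw [hx]
  simp only [map_sum, map_smul, smul_eq_mul]
  exact Finset.sum_congr rfl fun a _ => by rw [← h.pd a y]; rfl

/-- The points of `U` where `σ` vanishes. -/
def zeros (σ : Sm U) : Set (Sm U →ₐ[ℝ] ℝ) := {q | ∃ y : U, q = Sm.ev y ∧ Sm.ev y σ = 0}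

/-- Lagrange multipliers: a function vanishing on the zeros of `σ` is constant, hence extremal, on
that level set, and `dσ ≠ 0` excludes the degenerate multiplier. -/
theorem isHypersurface_zeros {σ : Sm U}
    (h : ∀ y : U, Sm.ev y σ = 0 → ∃ a, Sm.ev y (Sm.D a σ) ≠ 0) :
    IsHypersurface Sm.D σ (zeros σ) := by
  refine ⟨fun q ⟨y, hq, hy⟩ => hq ▸ hy, fun f hf p ⟨y, hp, hy⟩ => ?_⟩
  subst hp
  obtain ⟨F, hF, hFr⟩ := Sm.exists_rep f
  obtain ⟨G, hG, hGr⟩ := Sm.exists_rep σ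
  have hs : ∀ {H : Model d → ℝ}, ContDiffOn ℝ ∞ H U → HasStrictFDerivAt H (fderiv ℝ H y) y :=
    fun hH => (hH.contDiffAt (U.isOpen.mem_nhds y.2)).hasStrictFDerivAt (by simp)
  have hF0 : F y = 0 := by rw [hFr y]; exact hf _ ⟨y, rfl, hy⟩
  have hext : IsLocalExtrOn F {x | G x = G y} y := by
    refine Or.inl ?_
    filter_upwards [self_mem_nhdsWithin, mem_nhdsWithin_of_mem_nhds (U.isOpen.mem_nhds y.2)]
      with x hx hxU
    have h1 : Sm.ev ⟨x, hxU⟩ σ = 0 := by rw [← hGr ⟨x, hxU⟩, ← hy, ← hGr y]; exact hx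
    have h2 : F x = 0 := by rw [hFr ⟨x, hxU⟩]; exact hf _ ⟨⟨x, hxU⟩, rfl, h1⟩
    rw [hF0, h2]
  obtain ⟨a, b, hab, he⟩ := hext.exists_multipliers_of_hasStrictFDerivAt_1d (hs hG) (hs hF)
  have hv : ∀ c, a * Sm.ev y (Sm.D c σ) + b * Sm.ev y (Sm.D c f) = 0 := by
    intro c
    have := congrArg (fun L => L (EuclideanSpace.single c (1 : ℝ) : Model d)) he
    rw [← hGr.pd c y, ← hFr.pd c y]
    exact this
  obtain ⟨c, hc⟩ := h y hy
  have hb : b ≠ 0 := by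
    rintro rfl
    have := hv c
    rw [zero_mul, add_zero] at this
    exact hab (by rw [(mul_eq_zero.1 this).resolve_right hc]; rfl)
  refine ⟨-(a / b), fun c => ?_⟩
  have := hv c
  field_simp
  linarith

end Points

/-! ### Components of a metric in a gauge -/

section GaugeMetric

variable {d : ℕ} {M : Type*} [TopologicalSpace M] [ChartedSpace (Model d) M]
  [IsManifold (𝓡 d) ∞ M] {c : ConformalStructure d M}

theorem Gauge.contMDiffOn_symm (γ : Gauge c) :
    ContMDiffOn (𝓡 d) (𝓡 d) ∞ γ.chart.symm γ.chart.target :=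
  contMDiffOn_symm_of_mem_maximalAtlas γ.chart_mem

theorem Gauge.contMDiffOn_chart (γ : Gauge c) :
    ContMDiffOn (𝓡 d) (𝓡 d) ∞ γ.chart γ.chart.source :=
  contMDiffOn_of_mem_maximalAtlas γ.chart_mem

theorem Gauge.contMDiffOn_frame (γ : Gauge c) (e : Model d) :
    ContMDiffOn (𝓡 d) ((𝓡 d).prod (𝓡 d)) ∞ (fun y : Model d =>
      (⟨γ.chart.symm y, mfderiv (𝓡 d) (𝓡 d) γ.chart.symm y e⟩ :
        TangentBundle (𝓡 d) M)) γ.chart.target := by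
  have h1 : ContMDiff (𝓡 d) ((𝓡 d).prod (𝓡 d)) ∞
      (fun y : Model d => (⟨y, e⟩ : TangentBundle (𝓡 d) (Model d))) := by
    exact contMDiff_vectorSpace_iff_contDiff.2 contDiff_const
  have h2 := γ.contMDiffOn_symm.contMDiffOn_tangentMapWithin (m := ∞) (by simp)
    γ.chart.open_target.uniqueMDiffOn
  have h3 := h2.comp h1.contMDiffOn (s := γ.chart.target) (fun y hy => hy)
  refine h3.congr fun y hy => ?_
  simp only [Function.comp, tangentMapWithin]
  rw [mfderivWithin_of_isOpen γ.chart.open_target hy]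

theorem Gauge.contDiffOn_G (γ : Gauge c) (i j : Fin d) :
    ContDiffOn ℝ ∞ (fun y => γ.G y i j) γ.chart.target := by
  rw [← contMDiffOn_iff_contDiffOn]
  have h := ContMDiffOn.clm_bundle_apply₂ (F₁ := Model d) (F₂ := Model d) (F₃ := ℝ)
    (E₁ := TangentSpace (𝓡 d)) (E₂ := TangentSpace (𝓡 d)) (E₃ := Bundle.Trivial M ℝ)
    (b := γ.chart.symm) (n := ∞) (IB := 𝓡 d) (IM := 𝓡 d) (s := γ.chart.target)
    (ψ := fun y => γ.metric.inner (γ.chart.symm y))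
    (γ.metric.contMDiff.comp_contMDiffOn γ.contMDiffOn_symm)
    (γ.contMDiffOn_frame (EuclideanSpace.single i 1))
    (γ.contMDiffOn_frame (EuclideanSpace.single j 1))
  intro y hy
  have := h y hy
  simp only [Bundle.contMDiffWithinAt_totalSpace] at this
  exact this.2

theorem Gauge.mfderiv_symm_injective (γ : Gauge c) {y : Model d} (hy : y ∈ γ.chart.target) :
    Function.Injective (mfderiv (𝓡 d) (𝓡 d) γ.chart.symm y) := by
  have h1 : MDifferentiableAt (𝓡 d) (𝓡 d) γ.chart.symm y :=
    (γ.contMDiffOn_symm.contMDiffAt (γ.chart.open_target.mem_nhds hy)).mdifferentiableAt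
      (by simp)
  have h2 : MDifferentiableAt (𝓡 d) (𝓡 d) γ.chart (γ.chart.symm y) :=
    (γ.contMDiffOn_chart.contMDiffAt
      (γ.chart.open_source.mem_nhds (γ.chart.map_target hy))).mdifferentiableAt (by simp)
  have h3 := mfderiv_comp y h2 h1
  have h4 : (γ.chart ∘ γ.chart.symm) =ᶠ[nhds y] id :=
    Filter.eventuallyEq_of_mem (γ.chart.open_target.mem_nhds hy)
      fun z hz => γ.chart.right_inv hz
  rw [h4.mfderiv_eq, mfderiv_id] at h3
  intro a b hab
  have := congrArg (mfderiv (𝓡 d) (𝓡 d) γ.chart (γ.chart.symm y)) hab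
  have h5 : ∀ e, mfderiv (𝓡 d) (𝓡 d) γ.chart (γ.chart.symm y)
      (mfderiv (𝓡 d) (𝓡 d) γ.chart.symm y e) = e := fun e => (DFunLike.congr_fun h3 e).symm
  rw [h5, h5] at this
  exact this

theorem model_eq_sum (x : Model d) : x = ∑ a, x a • (EuclideanSpace.single a (1 : ℝ) : Model d) := by
  ext b
  simp [Pi.single_apply]

theorem Gauge.inner_eq (γ : Gauge c) (y x x' : Model d) :
    γ.metric.inner (γ.chart.symm y) (mfderiv (𝓡 d) (𝓡 d) γ.chart.symm y x)
      (mfderiv (𝓡 d) (𝓡 d) γ.chart.symm y x') = ∑ i, ∑ j, x i * x' j * γ.G y i j := by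
  let L : Model d →L[ℝ] TangentSpace (𝓡 d) (γ.chart.symm y) :=
    mfderiv (𝓡 d) (𝓡 d) γ.chart.symm y
  change γ.metric.inner (γ.chart.symm y) (L x) (L x') = _
  conv_lhs => rw [model_eq_sum x, model_eq_sum x']
  simp only [map_sum, map_smul, ContinuousLinearMap.sum_apply, ContinuousLinearMap.smul_apply,
    smul_eq_mul, Finset.mul_sum, mul_assoc]
  rw [Finset.sum_comm]
  exact Finset.sum_congr rfl fun i _ => Finset.sum_congr rfl fun j _ => mul_left_comm _ _ _

theorem Gauge.G_symm (γ : Gauge c) (y : Model d) (i j : Fin d) : γ.G y i j = γ.G y j i :=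
  γ.metric.symm _ _ _

theorem Gauge.posDef_G (γ : Gauge c) {y : Model d} (hy : y ∈ γ.chart.target) :
    (γ.G y).PosDef := by
  refine Matrix.PosDef.of_dotProduct_mulVec_pos ?_ fun x hx => ?_
  · ext i j
    exact γ.G_symm y j i
  · let L : Model d →L[ℝ] TangentSpace (𝓡 d) (γ.chart.symm y) :=
      mfderiv (𝓡 d) (𝓡 d) γ.chart.symm y
    have h := γ.metric.pos (γ.chart.symm y) (L (WithLp.toLp 2 x)) fun h0 => hx (by
      have h1 : L (WithLp.toLp 2 x) = L 0 := by rw [h0, map_zero]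
      exact congrArg (WithLp.ofLp) (γ.mfderiv_symm_injective hy h1))
    have h2 := γ.inner_eq y (WithLp.toLp 2 x) (WithLp.toLp 2 x)
    rw [show γ.metric.inner (γ.chart.symm y) (L (WithLp.toLp 2 x)) (L (WithLp.toLp 2 x)) = _
      from h2] at h
    refine h.trans_eq ?_
    change _ = ∑ i, x i * ∑ j, γ.G y i j * x j
    simp only [Finset.mul_sum]
    exact Finset.sum_congr rfl fun i _ => Finset.sum_congr rfl fun j _ => by ring

/-- The determinant is nowhere zero, hence a unit of the ring of smooth functions, and the adjugate
provides the inverse there. -/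
theorem exists_repMetric {U : TopologicalSpace.Opens (Model d)}
    {G : Model d → Matrix (Fin d) (Fin d) ℝ} (hG : ∀ i j, ContDiffOn ℝ ∞ (fun y => G y i j) U)
    (hs : ∀ y i j, G y i j = G y j i) (hdet : ∀ y ∈ U, (G y).det ≠ 0) :
    ∃ g gi : Matrix (Fin d) (Fin d) (Sm U), RepMetric G g gi ∧ IsMetricPair g gi := by
  choose g hg using fun i j => exists_rep_of_contDiffOn (hG i j)
  let gm : Matrix (Fin d) (Fin d) (Sm U) := Matrix.of g
  have hev : ∀ y : U, (Sm.ev y).toRingHom.mapMatrix gm = G y := fun y => by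
    ext i j
    exact (hg i j y).symm
  obtain ⟨v, hv⟩ := Sm.exists_inv (f := gm.det) fun y => by
    have : Sm.ev y gm.det = (G y).det := by
      rw [← hev y]; exact (Sm.ev y).toRingHom.map_det gm
    rw [this]
    exact hdet y y.2
  have hinv : (v • gm.adjugate) * gm = 1 := by
    rw [Matrix.smul_mul, Matrix.adjugate_mul, smul_smul, hv, one_smul]
  have hginv : ∀ i j, Rep (fun y => (G y)⁻¹ i j) ((v • gm.adjugate) i j) := fun i j y => by
    have h1 : (Sm.ev y).toRingHom.mapMatrix (v • gm.adjugate) * G y = 1 := by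
      rw [← hev y, ← map_mul, hinv, map_one]
    have := congrFun (congrFun (Matrix.inv_eq_left_inv h1) i) j
    exact this
  refine ⟨gm, v • gm.adjugate, ⟨hg, hginv⟩, ⟨fun a b => ?_, fun a b => ?_, fun a b => ?_⟩⟩
  · exact Sm.ext fun y => (hg a b y).symm.trans ((hs y a b).trans (hg b a y))
  · exact Sm.ext fun y => by
      refine (hginv a b y).symm.trans (Eq.trans ?_ (hginv b a y))
      change (G y)⁻¹ a b = (G y)⁻¹ b a
      have : (G y).transpose = G y := by ext i j; exact hs _ _ _
      conv_lhs => rw [← this, ← Matrix.transpose_nonsing_inv]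
      rfl
  · have := congrFun (congrFun hinv a) b
    rw [Matrix.mul_apply, Matrix.one_apply] at this
    exact this

theorem Gauge.exists_repMetric (γ : Gauge c) {U : TopologicalSpace.Opens (Model d)}
    (hU : (U : Set (Model d)) ⊆ γ.chart.target) :
    ∃ g gi : Matrix (Fin d) (Fin d) (Sm U), RepMetric γ.G g gi ∧ IsMetricPair g gi :=
  ConformalTractor.exists_repMetric (fun i j => (γ.contDiffOn_G i j).mono hU) γ.G_symm
    fun _ hy => (γ.posDef_G (hU hy)).det_pos.ne'

/-! ### Change of chart -/

/-- The transition map from the second chart to the first. -/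
def Gauge.trans (γ γ' : Gauge c) (y : Model d) : Model d := γ.chart (γ'.chart.symm y)

/-- The domain of the transition map. -/
def Gauge.overlap (γ γ' : Gauge c) : TopologicalSpace.Opens (Model d) :=
  ⟨γ'.chart.target ∩ γ'.chart.symm ⁻¹' γ.chart.source,
    γ'.chart.symm.isOpen_inter_preimage γ.chart.open_source⟩

theorem Gauge.contDiffOn_trans (γ γ' : Gauge c) :
    ContDiffOn ℝ ∞ (γ.trans γ') (γ.overlap γ') := by
  rw [← contMDiffOn_iff_contDiffOn]
  exact γ.contMDiffOn_chart.comp (γ'.contMDiffOn_symm.mono Set.inter_subset_left) fun y hy => hy.2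

theorem Gauge.trans_mem {γ γ' : Gauge c} {y : Model d} (hy : y ∈ γ.overlap γ') :
    γ.trans γ' y ∈ γ'.overlap γ :=
  ⟨γ.chart.map_source hy.2, by
    simpa [Gauge.trans, γ.chart.left_inv hy.2] using γ'.chart.map_target hy.1⟩

theorem Gauge.trans_trans {γ γ' : Gauge c} {y : Model d} (hy : y ∈ γ.overlap γ') :
    γ'.trans γ (γ.trans γ' y) = y := by
  simp [Gauge.trans, γ.chart.left_inv hy.2, γ'.chart.right_inv hy.1]

theorem pd_eq_sum_of_comp {U V : TopologicalSpace.Opens (Model d)} {ψ : Model d → Model d}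
    (hψ : ContDiffOn ℝ ∞ ψ V) (hm : ∀ y ∈ V, ψ y ∈ U) {F : Model d → ℝ}
    (hF : ContDiffOn ℝ ∞ F U) (a : Fin d) {y : Model d} (hy : y ∈ V) :
    pd a (fun z => F (ψ z)) y = ∑ b, pd a (fun z => ψ z b) y * pd b F (ψ y) := by
  have h1 := differentiableAt_of_contDiffOn hF (hm y hy)
  have h2 := differentiableAt_of_contDiffOn hψ hy
  have h3 : fderiv ℝ (fun z => F (ψ z)) y = (fderiv ℝ F (ψ y)).comp (fderiv ℝ ψ y) :=
    fderiv_comp y h1 h2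
  have h4 : ∀ b, pd a (fun z => ψ z b) y = fderiv ℝ ψ y (EuclideanSpace.single a 1) b :=
    fun b => by
      have : HasFDerivAt (fun z => ψ z b) ((EuclideanSpace.proj b).comp (fderiv ℝ ψ y)) y :=
        (EuclideanSpace.proj (𝕜 := ℝ) b).hasFDerivAt.comp y h2.hasFDerivAt
      rw [pd, this.fderiv]
      rfl
  rw [pd, h3, ContinuousLinearMap.comp_apply, model_eq_sum (fderiv ℝ ψ y _), map_sum]
  exact Finset.sum_congr rfl fun b _ => by rw [map_smul, smul_eq_mul, h4]; rfl

theorem Gauge.pd_trans (γ γ' : Gauge c) {y : Model d} (hy : y ∈ γ.overlap γ') (b a : Fin d) :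
    pd a (fun z => γ.trans γ' z b) y = fderiv ℝ (γ.trans γ') y (EuclideanSpace.single a 1) b := by
  have : HasFDerivAt (fun z => γ.trans γ' z b)
      ((EuclideanSpace.proj b).comp (fderiv ℝ (γ.trans γ') y)) y :=
    (EuclideanSpace.proj (𝕜 := ℝ) b).hasFDerivAt.comp y
      (differentiableAt_of_contDiffOn (γ.contDiffOn_trans γ') hy).hasFDerivAt
  rw [pd, this.fderiv]
  rfl

theorem Gauge.G_eq_of_trans (γ γ' : Gauge c) {Ω : M → ℝ} (hΩ : IsRescaling Ω γ.metric γ'.metric)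
    {y : Model d} (hy : y ∈ γ.overlap γ') (i j : Fin d) :
    γ'.G y i j = Ω (γ'.chart.symm y) ^ 2 * ∑ a, ∑ b, pd i (fun z => γ.trans γ' z a) y
      * pd j (fun z => γ.trans γ' z b) y * γ.G (γ.trans γ' y) a b := by
  have h2 := differentiableAt_of_contDiffOn (γ.contDiffOn_trans γ') hy
  simp only [γ.pd_trans γ' hy]
  rw [← γ.inner_eq]
  have h5 : γ'.chart.symm =ᶠ[nhds y] γ.chart.symm ∘ γ.trans γ' :=
    Filter.eventuallyEq_of_mem ((γ.overlap γ').isOpen.mem_nhds hy)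
      fun z hz => by simp [Gauge.trans, γ.chart.left_inv hz.2]
  have h6 : MDifferentiableAt (𝓡 d) (𝓡 d) γ.chart.symm (γ.trans γ' y) :=
    (γ.contMDiffOn_symm.contMDiffAt
      (γ.chart.open_target.mem_nhds (γ.chart.map_source hy.2))).mdifferentiableAt (by simp)
  have h7 := mfderiv_comp y h6 h2.mdifferentiableAt
  rw [← h5.mfderiv_eq, mfderiv_eq_fderiv] at h7
  have h8 : ∀ e : Model d, (mfderiv (𝓡 d) (𝓡 d) γ'.chart.symm y e : Model d)
      = mfderiv (𝓡 d) (𝓡 d) γ.chart.symm (γ.trans γ' y) (fderiv ℝ (γ.trans γ') y e) :=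
    fun e => DFunLike.congr_fun h7 e
  have h9 : γ'.chart.symm y = γ.chart.symm (γ.trans γ' y) := h5.self_of_nhds
  -- All tangent spaces are the model space by definition, so inner products at two equal points can
  -- be compared as functions of model vectors.
  let q : M → Model d → Model d → ℝ := fun p v w => γ.metric.inner p v w
  rw [← h8, ← h8, Gauge.G, Matrix.of_apply, hΩ.eq]
  congr 1
  exact congrFun (congrFun (congrArg q h9) _) _

end GaugeMetric

/-! ### Change of gauge -/

section Comap

variable {d m : ℕ} {U V : TopologicalSpace.Opens (Model d)} {ψ : Model d → Model d}

/-- Composition with a smooth map. -/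
def Sm.comap (hψ : ContDiffOn ℝ ∞ ψ V) (hm : ∀ y ∈ V, ψ y ∈ U) : Sm U →ₐ[ℝ] Sm V where
  toFun f := ⟨fun y => f.1 ⟨ψ y, hm y y.2⟩, by
    obtain ⟨F, hF, h⟩ := f.2
    exact ⟨fun y => F (ψ y), hF.comp hψ hm, fun y => h ⟨ψ y, hm y y.2⟩⟩⟩
  map_one' := rfl
  map_mul' _ _ := rfl
  map_zero' := rfl
  map_add' _ _ := rfl
  commutes' _ := rfl

theorem Sm.ev_comap (hψ : ContDiffOn ℝ ∞ ψ V) (hm : ∀ y ∈ V, ψ y ∈ U) (f : Sm U) (y : V) :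
    Sm.ev y (Sm.comap hψ hm f) = Sm.ev ⟨ψ y, hm y y.2⟩ f := rfl

theorem Rep.comap (hψ : ContDiffOn ℝ ∞ ψ V) (hm : ∀ y ∈ V, ψ y ∈ U) {F : Model d → ℝ} {f : Sm U}
    (h : Rep F f) : Rep (fun y => F (ψ y)) (Sm.comap hψ hm f) := fun y => h ⟨ψ y, hm y y.2⟩

theorem Sm.D_comap (hψ : ContDiffOn ℝ ∞ ψ V) (hm : ∀ y ∈ V, ψ y ∈ U)
    {j : Fin d → Sm V} (hj : ∀ b, Rep (fun y => ψ y b) (j b)) (a : Fin d) (f : Sm U) :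
    Sm.D a (Sm.comap hψ hm f) = ∑ b, Sm.D a (j b) * Sm.comap hψ hm (Sm.D b f) := by
  obtain ⟨F, hF, h⟩ := Sm.exists_rep f
  refine Sm.ext fun y => ?_
  rw [← (h.comap hψ hm).pd a y, pd_eq_sum_of_comp hψ hm hF a y.2, map_sum]
  refine Finset.sum_congr rfl fun b _ => ?_
  rw [map_mul, ← (hj b).pd a y, Sm.ev_comap, ← (h.pd b)]

theorem Sm.exists_rep_apply (hψ : ContDiffOn ℝ ∞ ψ V) (b : Fin d) :
    ∃ j : Sm V, Rep (fun y => ψ y b) j :=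
  exists_rep_of_contDiffOn ((EuclideanSpace.proj (𝕜 := ℝ) b).contDiff.comp_contDiffOn hψ)

/-- The inverse Jacobian is that of `χ`, pulled back. The chain rule gives one of the two products,
and the other follows for square matrices over a commutative ring. -/
theorem isCoordChange_comap {χ : Model d → Model d} (hψ : ContDiffOn ℝ ∞ ψ V)
    (hm : ∀ y ∈ V, ψ y ∈ U) (hχ : ContDiffOn ℝ ∞ χ U) (hn : ∀ y ∈ U, χ y ∈ V)
    (hχψ : ∀ y ∈ V, χ (ψ y) = y) {j : Fin d → Sm V} (hj : ∀ b, Rep (fun y => ψ y b) (j b)) :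
    ∃ K : Matrix (Fin d) (Fin d) (Sm V), IsCoordChange Sm.D Sm.D (Sm.comap hψ hm)
      (Matrix.of fun a b => Sm.D a (j b)) K := by
  choose i hi using fun b => Sm.exists_rep_apply hχ b
  have hmul : (Matrix.of fun a b => Sm.D a (j b))
      * (Matrix.of fun a b => Sm.comap hψ hm (Sm.D a (i b))) = 1 := by
    ext a c
    rw [Matrix.mul_apply]
    simp only [Matrix.of_apply]
    rw [← Sm.D_comap hψ hm hj a (i c)]
    refine Sm.ext fun y => ?_
    rw [← ((hi c).comap hψ hm).pd a y]
    have : Set.EqOn (fun z => χ (ψ z) c) (fun z => z c) V := fun z hz => by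
      simp only [hχψ z hz]
    rw [pd_congr this a y.2, pd]
    have h : fderiv ℝ (fun z : Model d => z c) y = EuclideanSpace.proj c :=
      (EuclideanSpace.proj (𝕜 := ℝ) c).fderiv
    rw [h, Matrix.one_apply, apply_ite (Sm.ev y), map_one, map_zero]
    simp [Pi.single_apply, eq_comm]
  exact ⟨_, hmul, mul_eq_one_comm.1 hmul, fun a f => Sm.D_comap hψ hm hj a f,
    fun a b c => Sm.D_comm _ _ _⟩

end Comap

/-! ### A change of scale followed by a change of coordinates. -/

section Change

variable {d m : ℕ} {R R' : Type*} [CommRing R] [Algebra ℝ R] [CommRing R'] [Algebra ℝ R']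

theorem map_tActR (φ : R →ₐ[ℝ] R') (Q : Matrix (Slot d) (Slot d) R) (t : TensorR d m R)
    (I : Fin m → Slot d) : φ (tActR Q t I) = tActR (Q.map φ) (φ ∘ t) I := by
  simp [tActR]

theorem tensorAct_mul (A B : Matrix (Slot d) (Slot d) ℝ) (t : Tensor d m) :
    tensorAct (A * B) t = tensorAct A (tensorAct B t) := by
  funext I
  change ∑ K : Fin m → Slot d, (∏ i, (A * B) (I i) (K i)) * t K
    = ∑ L : Fin m → Slot d, (∏ i, A (I i) (L i)) * ∑ K : Fin m → Slot d, (∏ i, B (L i) (K i)) * t K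
  simp only [Matrix.mul_apply, Finset.prod_univ_sum, Finset.mul_sum, Finset.sum_mul,
    Fintype.piFinset_univ]
  rw [Finset.sum_comm]
  refine Finset.sum_congr rfl fun L _ => Finset.sum_congr rfl fun K _ => ?_
  rw [Finset.prod_mul_distrib]
  ring

theorem IsMetricPair.conformal {g gi : Matrix (Fin d) (Fin d) R} (h : IsMetricPair g gi) {o p : R}
    (hop : o * p = 1) : IsMetricPair (o ^ 2 • g) (p ^ 2 • gi) := by
  refine ⟨fun a b => ?_, fun a b => ?_, fun a b => ?_⟩
  · simp [h.symm a b]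
  · simp [h.symm_inv a b]
  · have h1 : ∀ e, (p ^ 2 • gi) a e * (o ^ 2 • g) e b = gi a e * g e b := fun e => by
      simp only [Matrix.smul_apply, smul_eq_mul]
      linear_combination (gi a e * g e b * (o * p + 1)) * hop
    simp only [h1, h.inv_mul]

variable {D : Fin d → Derivation ℝ R R} {D' : Fin d → Derivation ℝ R' R'}
  {g gi : Matrix (Fin d) (Fin d) R} {φ : R →ₐ[ℝ] R'} {J K : Matrix (Fin d) (Fin d) R'}

/-- The Laplace-Robin operator under a change of scale followed by a change of coordinates. -/
theorem IsCoordChange.lrR_rescale (hc : IsCoordChange D D' φ J K)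
    (hD' : ∀ a b f, D' a (D' b f) = D' b (D' a f))
    (hd : 3 ≤ d) (h : IsMetricPair g gi) {Υ : Fin d → R}
    (hD : ∀ a b, D a (Υ b) = D b (Υ a)) {o p r : R} (hop : o * p = 1)
    (ho : ∀ a, D a o = Υ a * o) {w : ℝ} (hr : ∀ a, D a r = algebraMap ℝ R w * Υ a * r) (σ : R)
    (τ : TensorR d m R) :
    isqR D' (K.transpose * (p ^ 2 • gi).map φ * K) (chr D' (J * (o ^ 2 • g).map φ * J.transpose)
        (K.transpose * (p ^ 2 • gi).map φ * K)) (φ (o * σ)) = φ (isqR D gi (chr D g gi) σ)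
    ∧ lrR D' (K.transpose * (p ^ 2 • gi).map φ * K)
      (chr D' (J * (o ^ 2 • g).map φ * J.transpose) (K.transpose * (p ^ 2 • gi).map φ * K))
      (covR D' (conn D' (J * (o ^ 2 • g).map φ * J.transpose)
        (K.transpose * (p ^ 2 • gi).map φ * K) (chr D' (J * (o ^ 2 • g).map φ * J.transpose)
          (K.transpose * (p ^ 2 • gi).map φ * K)))) (φ (o * σ)) w
      (tActR (jacSlot J)
        (φ ∘ (r • tActR (rescaleR o p Υ fun c => ∑ e, gi c e * Υ e) τ)))
      = tActR (jacSlot J) (φ ∘ ((p * r) • tActR (rescaleR o p Υ fun c => ∑ e, gi c e * Υ e)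
        (lrR D gi (chr D g gi) (covR D (conn D g gi (chr D g gi))) σ w τ))) := by
  set u : Fin d → R := fun c => ∑ e, gi c e * Υ e with hu'
  have hu : ∀ a, ∑ c, g a c * u c = Υ a := fun a => by
    simp only [hu']
    exact h.lower_raise Υ a
  have hΓ := isLeviCivita_chr (D := D) h
  have hpair := h.conformal hop
  have hchr := IsLeviCivita.eq_chr hpair (hΓ.conformal h.symm hu ho)
  have hsym := fun a => hc.symMat_chr hpair a
  have hcov : ∀ a (t : TensorR d m R),
      covR D (conn D (o ^ 2 • g) (p ^ 2 • gi) (chr D (o ^ 2 • g) (p ^ 2 • gi))) a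
        (tActR (rescaleR o p Υ u) t)
      = tActR (rescaleR o p Υ u) (covR D (conn D g gi (chr D g gi)) a t) := fun a t => by
    -- A change of scale is a change of frame over the identity of the ring, with Jacobian `1`.
    have := covR_change (D := D) (D' := D) (φ := AlgHom.id ℝ R) (J := 1)
      (Q := rescaleR o p Υ u) (θ := conn D g gi (chr D g gi))
      (θ' := conn D (o ^ 2 • g) (p ^ 2 • gi) (chr D (o ^ 2 • g) (p ^ 2 • gi)))
      (fun a f => by simp [Matrix.one_apply]) (fun a => by
        rw [hchr, conn_conformal hd h hΓ hu hD hop ho a]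
        simp only [Matrix.one_apply, ite_smul, one_smul, zero_smul, Finset.sum_ite_eq,
          Finset.mem_univ, if_true]
        rfl) t a
    simp only [Matrix.one_apply, ite_smul, one_smul, zero_smul, Finset.sum_ite_eq,
      Finset.mem_univ, if_true] at this
    exact this
  have hcov' := fun (a : Fin d) (t : TensorR d m R) => covR_change (D := D) (D' := D')
    (φ := φ) (J := J) (Q := jacSlot J)
    (θ := conn D (o ^ 2 • g) (p ^ 2 • gi) (chr D (o ^ 2 • g) (p ^ 2 • gi)))
    hc.chain (fun a => hc.conn_eq hD' hsym a) t a
  refine ⟨?_, ?_⟩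
  · rw [hc.isqR_eq hD' hsym, hchr, isqR_conformal hd h hΓ hu hD hop ho]
  · let Ψ : TensorR d m R →ₗ[R] TensorR d m R :=
      { toFun := tActR (rescaleR o p Υ u), map_add' := tActR_add _, map_smul' := tActR_smul _ }
    let Ψ' : TensorR d m R →+ TensorR d m R' :=
      { toFun := fun t => tActR (jacSlot J) (φ ∘ t)
        map_zero' := by
          funext I
          simp [tActR]
        map_add' := fun s t => by
          rw [← tActR_add]
          congr 1
          funext I
          simp }
    have h1 := hc.lrR_eq (gi := p ^ 2 • gi) hD' hsym (isConnection_covR D' _) Ψ' (fun f t => by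
      change tActR (jacSlot J) (φ ∘ (f • t)) = φ f • tActR (jacSlot J) (φ ∘ t)
      rw [← tActR_smul]
      congr 1
      funext I
      simp) hcov' (o * σ) w (r • Ψ τ)
    refine h1.trans ?_
    have h2 := lrR_conformal hd h hΓ hu hD hop ho σ (isConnection_covR D _)
      (isConnection_covR D (conn D (o ^ 2 • g) (p ^ 2 • gi) (chr D (o ^ 2 • g) (p ^ 2 • gi))))
      Ψ hcov hr τ
    rw [hchr] at h2 ⊢
    rw [h2]
    rfl

end Change

/-! ### Invariance of the Laplace-Robin operator between gauges. -/

section Gauges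

variable {d m : ℕ} {M : Type*} [TopologicalSpace M] [ChartedSpace (Model d) M]
  [IsManifold (𝓡 d) ∞ M] {c : ConformalStructure d M}

/-- Inverses are unique, so it suffices to represent the metric. -/
theorem RepMetric.of_isMetricPair {U : TopologicalSpace.Opens (Model d)}
    {G : Model d → Matrix (Fin d) (Fin d) ℝ} {g gi : Matrix (Fin d) (Fin d) (Sm U)}
    (h : ∀ i j, Rep (fun y => G y i j) (g i j)) (hp : IsMetricPair g gi) : RepMetric G g gi := by
  refine ⟨h, fun i j y => ?_⟩
  have h1 : gi.map (Sm.ev y) * G y = 1 := by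
    ext a b
    have := congrArg (Sm.ev y) (hp.inv_mul a b)
    rw [map_sum, apply_ite (Sm.ev y), map_one, map_zero] at this
    rw [Matrix.mul_apply, Matrix.one_apply, ← this]
    exact Finset.sum_congr rfl fun e _ => by rw [map_mul, ← h e b y]; rfl
  exact congrFun (congrFun (Matrix.inv_eq_left_inv h1) i) j

/-- The transformation law of the Laplace-Robin operator under a change of gauge. -/
theorem laplaceRobin_change (hd : 3 ≤ d) (γ γ' : Gauge c) {Ω : M → ℝ}
    (hΩ : IsRescaling Ω γ.metric γ'.metric) {s s' : Model d → Tensor d 0}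
    {t t' : Model d → Tensor d m} (w : ℝ) (hs : ContDiffOn ℝ ∞ s γ.chart.target)
    (ht : ContDiffOn ℝ ∞ t γ.chart.target)
    (hs' : ∀ y ∈ γ.overlap γ', s' y = Ω (γ'.chart.symm y) • s (γ.trans γ' y))
    (ht' : ∀ y ∈ γ.overlap γ', t' y = Ω (γ'.chart.symm y) ^ w •
      tensorAct (chartMatrix γ γ' (γ'.chart.symm y) * rescaleMatrix γ Ω (γ.trans γ' y))
        (t (γ.trans γ' y))) {y : Model d} (hy : y ∈ γ.overlap γ') :
    scaleSq γ'.G s' y = scaleSq γ.G s (γ.trans γ' y) ∧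
    laplaceRobin γ'.G s' w t' y = Ω (γ'.chart.symm y) ^ (w - 1) •
      tensorAct (chartMatrix γ γ' (γ'.chart.symm y) * rescaleMatrix γ Ω (γ.trans γ' y))
        (laplaceRobin γ.G s w t (γ.trans γ' y)) := by
  have hd0 : d ≠ 0 := by omega
  set V := γ'.overlap γ with hV
  set V' := γ.overlap γ' with hV'
  have hVt : (V : Set (Model d)) ⊆ γ.chart.target := fun z hz => hz.1
  obtain ⟨g, gi, hG, hp⟩ := γ.exists_repMetric hVt
  obtain ⟨σ0, hσ0⟩ := exists_repT_of_contDiffOn (U := V) (hs.mono hVt)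
  obtain ⟨τ, hτ⟩ := exists_repT_of_contDiffOn (U := V) (ht.mono hVt)
  set σ := σ0 Fin.elim0 with hσdef
  have hσ : RepT (U := V) s fun _ => σ := fun I => by
    rw [Subsingleton.elim I Fin.elim0]; exact hσ0 _
  -- the conformal factor
  have hΩs : ContDiffOn ℝ ∞ (fun z => Ω (γ.chart.symm z)) V := by
    rw [← contMDiffOn_iff_contDiffOn]
    exact hΩ.smooth.comp_contMDiffOn (γ.contMDiffOn_symm.mono hVt)
  have hpos : ∀ z, 0 < Ω (γ.chart.symm z) := fun z => hΩ.pos _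
  obtain ⟨o, ho⟩ := exists_rep_of_contDiffOn (U := V) hΩs
  obtain ⟨p, hp'⟩ := exists_rep_of_contDiffOn (U := V) (hΩs.inv fun z _ => (hpos z).ne')
  obtain ⟨r, hr⟩ := exists_rep_of_contDiffOn (U := V)
    (hΩs.rpow_const_of_ne (p := w) fun z _ => (hpos z).ne')
  obtain ⟨L, hL⟩ := exists_rep_of_contDiffOn (U := V) (hΩs.log fun z _ => (hpos z).ne')
  have hop : o * p = 1 := Sm.ext fun z => by
    rw [map_mul, map_one, ← ho z, ← hp' z]
    exact mul_inv_cancel₀ (hpos _).ne'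
  have hDo : ∀ a, Sm.D a o = Sm.D a L * o := fun a => Sm.ext fun z => by
    rw [map_mul, ← ho.pd a z, ← hL.pd a z, ← ho z, pd, pd,
      fderiv.log (differentiableAt_of_contDiffOn hΩs z.2) (hpos _).ne']
    simp [(hpos _).ne', mul_comm]
  have hDr : ∀ a, Sm.D a r = algebraMap ℝ (Sm V) w * Sm.D a L * r := fun a => Sm.ext fun z => by
    have h1 := (differentiableAt_of_contDiffOn hΩs z.2).hasFDerivAt
    have h2 := h1.rpow_const (p := w) (Or.inl (hpos _).ne')
    rw [map_mul, map_mul, AlgHom.commutes, ← hr.pd a z, ← hL.pd a z, ← hr z, pd, pd,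
      fderiv.log (differentiableAt_of_contDiffOn hΩs z.2) (hpos _).ne', h2.fderiv]
    simp only [ContinuousLinearMap.smul_apply, smul_eq_mul, Algebra.algebraMap_self,
      RingHom.id_apply]
    rw [Real.rpow_sub_one (hpos _).ne']
    field_simp
  -- the change of coordinates
  have hψ : ContDiffOn ℝ ∞ (γ.trans γ') V' := γ.contDiffOn_trans γ'
  have hm : ∀ z ∈ V', γ.trans γ' z ∈ V := fun z hz => Gauge.trans_mem hz
  choose j hj using fun b => Sm.exists_rep_apply hψ b
  obtain ⟨K, hc⟩ := isCoordChange_comap hψ hm (γ'.contDiffOn_trans γ)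
    (fun z hz => Gauge.trans_mem hz) (fun z hz => Gauge.trans_trans hz) hj
  set φ := Sm.comap hψ hm with hφ
  set J : Matrix (Fin d) (Fin d) (Sm V') := Matrix.of fun a b => Sm.D a (j b) with hJ
  set gi' := K.transpose * (p ^ 2 • gi).map φ * K with hgi'
  set g' := J * (o ^ 2 • g).map φ * J.transpose with hg'
  have hsymm : ∀ z ∈ V', γ.chart.symm (γ.trans γ' z) = γ'.chart.symm z := fun z hz =>
    γ.chart.left_inv hz.2
  have hG' : RepMetric γ'.G g' gi' := by
    refine RepMetric.of_isMetricPair (fun a b z => ?_) (hc.isMetricPair (hp.conformal hop))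
    refine (γ.G_eq_of_trans γ' hΩ z.2 a b).trans ?_
    rw [hg']
    simp only [Matrix.mul_apply, Matrix.transpose_apply, Matrix.map_apply, Matrix.smul_apply,
      smul_eq_mul, map_sum, map_mul, map_pow, Finset.sum_mul, Finset.mul_sum]
    rw [Finset.sum_comm]
    refine Finset.sum_congr rfl fun x _ => Finset.sum_congr rfl fun y _ => ?_
    rw [Sm.ev_comap, Sm.ev_comap, ← ho, ← hG.rep, hJ, Matrix.of_apply, Matrix.of_apply,
      ← (hj _).pd, ← (hj _).pd, ← hsymm z z.2]
    ring
  set u : Fin d → Sm V := fun c => ∑ e, gi c e * Sm.D e L with hu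
  have hQ : ∀ z : V', (jacSlot J).map (Sm.ev z) = chartMatrix γ γ' (γ'.chart.symm z) := fun z => by
    ext A B
    have h1 : γ'.chart (γ'.chart.symm z) = z := γ'.chart.right_inv z.2.1
    rcases A with _ | a | _ <;> rcases B with _ | b | _ <;>
      simp [jacSlot, chartMatrix, slots, h1]
    rw [hJ, Matrix.of_apply, ← (hj _).pd, γ.pd_trans γ' z.2]
    rfl
  have hrm : ∀ z : V, (rescaleR o p (fun b => Sm.D b L) u).map (Sm.ev z)
      = rescaleMatrix γ Ω z := fun z => by
    have e1 : ∀ b, pd b (fun z => Real.log (Ω (γ.chart.symm z))) z = Sm.ev z (Sm.D b L) :=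
      fun b => hL.pd b z
    have e2 : Sm.ev z o = Ω (γ.chart.symm z) := (ho z).symm
    have e3 : Sm.ev z p = (Ω (γ.chart.symm z))⁻¹ := (hp' z).symm
    have e4 : ∀ b e, (γ.G z)⁻¹ b e = Sm.ev z (gi b e) := fun b e => hG.rep_inv b e z
    ext A B
    rcases A with _ | a | _ <;> rcases B with _ | b | _ <;>
      simp [rescaleR, rescaleMatrix, slots, e1, e2, e3, e4, hu, apply_ite (Sm.ev z)]
    ring
  -- The algebraic transport evaluated at a point. The function `e` is a power of `Ω`: exponent `w`
  -- before the operator is applied and `w - 1` after.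
  have hact : ∀ (q : Sm V) (κ : TensorR d m (Sm V)) (k : Model d → Tensor d m) (e : M → ℝ),
      RepT k κ → Rep (fun z => e (γ.chart.symm z)) q → ∀ z : V', ∀ I, Sm.ev z
        (tActR (jacSlot J) (φ ∘ (q • tActR (rescaleR o p (fun b => Sm.D b L) u) κ)) I)
      = (e (γ'.chart.symm z) •
      tensorAct (chartMatrix γ γ' (γ'.chart.symm z) * rescaleMatrix γ Ω (γ.trans γ' z))
        (k (γ.trans γ' z))) I := by
    intro q κ k e hk hq z I
    rw [map_tActR, hQ, tensorAct_mul, ← map_smul]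
    change tensorAct _ _ I = _
    refine congrFun (congrArg (tensorAct _) (funext fun I => ?_)) I
    change Sm.ev ⟨γ.trans γ' z, hm z z.2⟩ ((q • tActR (rescaleR o p (fun b => Sm.D b L) u) κ) I) = _
    rw [Pi.smul_apply, smul_eq_mul, map_mul, ← hq, map_tActR, hrm, ← hsymm z z.2]
    congr 1
    change tensorAct _ _ I = _
    refine congrFun (congrArg (tensorAct _) (funext fun I => ?_)) I
    exact (hk I ⟨γ.trans γ' z, hm z z.2⟩).symm
  have hσ' : RepT (U := V') s' fun _ => φ (o * σ) := fun I z => by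
    have h1 := hσ I ⟨γ.trans γ' z, hm z z.2⟩
    have h2 := ho ⟨γ.trans γ' z, hm z z.2⟩
    rw [Sm.ev_comap, map_mul, ← h1, ← h2]
    refine (congrFun (hs' z z.2) I).trans ?_
    rw [← hsymm z z.2]
    rfl
  have hτ' : RepT t' (tActR (jacSlot J)
      (φ ∘ (r • tActR (rescaleR o p (fun b => Sm.D b L) u) τ))) := fun I z => by
    rw [hact r τ t (fun x => Ω x ^ w) hτ hr z I]
    exact congrFun (ht' z z.2) I
  have key := hc.lrR_rescale Sm.D_comm hd hp (Υ := fun b => Sm.D b L)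
    (fun a b => Sm.D_comm _ _ _) hop hDo hDr σ τ
  have hpr : Rep (fun z => Ω (γ.chart.symm z) ^ (w - 1)) (p * r) := fun z => by
    rw [map_mul, ← hp' z, ← hr z]
    change Ω _ ^ (w - 1) = (Ω _)⁻¹ * Ω _ ^ w
    rw [Real.rpow_sub_one (hpos _).ne', div_eq_inv_mul]
  refine ⟨?_, ?_⟩
  · rw [hG'.rep_scaleSq hd0 hσ' ⟨y, hy⟩, key.1, Sm.ev_comap, ← hG.rep_scaleSq hd0 hσ]
  · funext I
    rw [← hact _ _ _ (fun x => Ω x ^ (w - 1)) (hG.rep_laplaceRobin hd0 hσ w hτ) hpr ⟨y, hy⟩ I]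
    have := hG'.rep_laplaceRobin hd0 hσ' w hτ' I ⟨y, hy⟩
    refine this.trans ?_
    rw [nabS, key.2]

end Gauges

/-! ### Powers of the Laplace-Robin operator on tractor fields -/

section Powers

variable {d m : ℕ} {M : Type*} [TopologicalSpace M] [ChartedSpace (Model d) M]
  [IsManifold (𝓡 d) ∞ M] {c : ConformalStructure d M}

/-- The image of the chart of a gauge. -/
def Gauge.dom (γ : Gauge c) : TopologicalSpace.Opens (Model d) :=
  ⟨γ.chart.target, γ.chart.open_target⟩

/-- The component of a density as an element of the ring of smooth functions. -/
theorem exists_rep_density (σ : densities c 1) (γ : Gauge c)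
    {U : TopologicalSpace.Opens (Model d)} (hU : (U : Set (Model d)) ⊆ γ.chart.target) :
    ∃ s : Sm U, RepT (σ.1 γ) fun _ => s := by
  obtain ⟨s, hs⟩ := exists_repT_of_contDiffOn (U := U) ((σ.2.1 γ).mono hU)
  exact ⟨s Fin.elim0, fun I => by rw [Subsingleton.elim I Fin.elim0]; exact hs _⟩

theorem exists_inv_isqR (hd : d ≠ 0) {σ : densities c 1} (hσ : PositiveScale σ) (γ : Gauge c)
    {U : TopologicalSpace.Opens (Model d)} (hU : (U : Set (Model d)) ⊆ γ.chart.target)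
    {g gi : Matrix (Fin d) (Fin d) (Sm U)} (hG : RepMetric γ.G g gi) {s : Sm U}
    (hs : RepT (σ.1 γ) fun _ => s) : ∃ v, v * isqR Sm.D gi (chr Sm.D g gi) s = 1 :=
  Sm.exists_inv fun y => by
    rw [← hG.rep_scaleSq hd hs y]
    exact (hσ γ y (hU y.2)).ne'

theorem density_change (σ : densities c 1) (γ γ' : Gauge c) {Ω : M → ℝ}
    (hΩ : IsRescaling Ω γ.metric γ'.metric) {y : Model d} (hy : y ∈ γ.overlap γ') :
    σ.1 γ' y = Ω (γ'.chart.symm y) • σ.1 γ (γ.trans γ' y) := by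
  have := σ.2.2.2 γ γ' Ω hΩ (γ'.chart.symm y) hy.2 (γ'.chart.map_target hy.1)
  rwa [tensorAct_zero_rank, γ'.chart.right_inv hy.1, Real.rpow_one] at this

/-- One factor of the powers of the Laplace-Robin operator. -/
theorem yOp_mem_tractorFields (hd : 3 ≤ d) {σ : densities c 1} (hσ : PositiveScale σ) {w : ℝ}
    {f : Components c m} (hf : f ∈ tractorFields c m w) :
    (fun γ => Set.indicator γ.chart.target (yOp γ.G (σ.1 γ) w (f γ)))
      ∈ tractorFields c m (w - 1) := by
  have hd0 : d ≠ 0 := by omega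
  refine ⟨fun γ => ?_, fun γ y hy => Set.indicator_of_notMem hy _, fun γ γ' Ω hΩ p hp hp' => ?_⟩
  · obtain ⟨g, gi, hG, -⟩ := γ.exists_repMetric (U := γ.dom) subset_rfl
    obtain ⟨s, hs⟩ := exists_rep_density σ γ (U := γ.dom) subset_rfl
    obtain ⟨v, hv⟩ := exists_inv_isqR hd0 hσ γ (U := γ.dom) subset_rfl hG hs
    obtain ⟨τ, hτ⟩ := exists_repT_of_contDiffOn (U := γ.dom) (hf.1 γ)
    exact (hG.rep_yOp hd0 hs hv w hτ).contDiffOn.congr fun y hy => Set.indicator_of_mem hy _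
  · have hy : γ'.chart p ∈ γ.overlap γ' :=
      ⟨γ'.chart.map_source hp', by simpa [γ'.chart.left_inv hp'] using hp⟩
    have hψ : γ.trans γ' (γ'.chart p) = γ.chart p := by
      simp [Gauge.trans, γ'.chart.left_inv hp']
    have key := laplaceRobin_change hd γ γ' hΩ w (σ.2.1 γ) (hf.1 γ)
      (fun y hy => density_change σ γ γ' hΩ hy) (s' := σ.1 γ') (t' := f γ') (fun y hy => by
        have := hf.2.2 γ γ' Ω hΩ (γ'.chart.symm y) hy.2 (γ'.chart.map_target hy.1)
        rwa [γ'.chart.right_inv hy.1] at this) hy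
    rw [hψ, γ'.chart.left_inv hp'] at key
    dsimp only
    rw [Set.indicator_of_mem (γ'.chart.map_source hp'),
      Set.indicator_of_mem (γ.chart.map_source hp), yOp, yOp, key.1, key.2, map_neg, map_smul,
      smul_neg, smul_comm]

/-- The powers are local, so setting the intermediate result to zero outside the open image of the
chart changes nothing inside it. -/
theorem laplaceRobinPow_succ (hd : 3 ≤ d) {σ : densities c 1} (hσ : PositiveScale σ) (k : ℕ)
    {w : ℝ} {f : Components c m} (hf : f ∈ tractorFields c m w) :
    laplaceRobinPow σ (k + 1) w f = laplaceRobinPow σ k (w - 1)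
      (fun γ => Set.indicator γ.chart.target (yOp γ.G (σ.1 γ) w (f γ))) := by
  have hd0 : d ≠ 0 := by omega
  funext γ
  obtain ⟨g, gi, hG, -⟩ := γ.exists_repMetric (U := γ.dom) subset_rfl
  obtain ⟨s, hs⟩ := exists_rep_density σ γ (U := γ.dom) subset_rfl
  obtain ⟨v, hv⟩ := exists_inv_isqR hd0 hσ γ (U := γ.dom) subset_rfl hG hs
  obtain ⟨τ, hτ⟩ := exists_repT_of_contDiffOn (U := γ.dom) (hf.1 γ)
  have h1 := hG.rep_yOp hd0 hs hv w hτ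
  have h2 : RepT (U := γ.dom) (Set.indicator γ.chart.target (yOp γ.G (σ.1 γ) w (f γ)))
      (yR Sm.D gi (chr Sm.D g gi) (nabS gi g) s v w τ) := fun I y => by
    rw [← h1 I y]
    exact congrFun (Set.indicator_of_mem (show (y : Model d) ∈ γ.chart.target from y.2) _) I
  exact Set.indicator_congr fun y hy =>
    (hG.rep_yPow hd0 hs hv k (w - 1) h1).eqOn (hG.rep_yPow hd0 hs hv k (w - 1) h2) hy

theorem laplaceRobinPow_mem_tractorFields (hd : 3 ≤ d) {σ : densities c 1} (hσ : PositiveScale σ)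
    (k : ℕ) {w : ℝ} {f : Components c m} (hf : f ∈ tractorFields c m w) :
    laplaceRobinPow σ k w f ∈ tractorFields c m (w - k) := by
  induction k generalizing w f with
  | zero =>
    have : laplaceRobinPow σ 0 w f = f := by
      funext γ y
      by_cases hy : y ∈ γ.chart.target
      · exact Set.indicator_of_mem hy _
      · exact (Set.indicator_of_notMem hy _).trans (hf.2.1 γ y hy).symm
    rw [this, Nat.cast_zero, sub_zero]
    exact hf
  | succ k ih =>
    rw [laplaceRobinPow_succ hd hσ k hf]
    have := ih (yOp_mem_tractorFields hd hσ hf)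
    rwa [show w - 1 - (k : ℝ) = w - ((k + 1 : ℕ) : ℝ) by push_cast; ring] at this

end Powers

/-! ### Curves of isometries -/

section Isometries

open scoped Matrix.Norms.Operator Topology

variable {n : Type*} [Fintype n] [DecidableEq n]

theorem hasDerivAt_matrix {A : ℝ → Matrix n n ℝ} {A' : Matrix n n ℝ} {x : ℝ} :
    HasDerivAt A A' x ↔ ∀ i j, HasDerivAt (fun s => A s i j) (A' i j) x := by
  refine ⟨fun h i j => ?_, fun h => ?_⟩
  · exact (LinearMap.toContinuousLinearMap
      (Matrix.entryLinearMap ℝ ℝ i j : Matrix n n ℝ →ₗ[ℝ] ℝ)).hasFDerivAt.comp_hasDerivAt x h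
  · have h1 : ∀ B : Matrix n n ℝ, B = ∑ i, ∑ j, B i j • Matrix.single i j (1 : ℝ) := fun B => by
      conv_lhs => rw [Matrix.matrix_eq_sum_single B]
      simp [Matrix.smul_single]
    rw [h1 A', funext fun s => h1 (A s)]
    exact HasDerivAt.fun_sum fun i _ => HasDerivAt.fun_sum fun j _ => (h i j).smul_const _

/-- Matrices near the identity have a square root, which is unique near the identity. -/
theorem exists_matrix_sqrt : ∃ r : Matrix n n ℝ → Matrix n n ℝ, r 1 = 1 ∧
    HasFDerivAt r ((1 / 2 : ℝ) • ContinuousLinearMap.id ℝ (Matrix n n ℝ)) 1 ∧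
    (∀ᶠ K in 𝓝 1, r K * r K = K) ∧ ∀ᶠ K in 𝓝 1, r (K * K) = K := by
  let e : Matrix n n ℝ ≃L[ℝ] Matrix n n ℝ :=
    ContinuousLinearEquiv.smulLeft (Units.mk0 (2 : ℝ) two_ne_zero)
  have h : HasStrictFDerivAt (fun K : Matrix n n ℝ => K * K) (e : _ →L[ℝ] _) 1 := by
    have := (hasStrictFDerivAt_id (𝕜 := ℝ) (1 : Matrix n n ℝ)).mul'
      (hasStrictFDerivAt_id (𝕜 := ℝ) (1 : Matrix n n ℝ))
    refine this.congr_fderiv (ContinuousLinearMap.ext fun x => ?_)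
    change (1 : Matrix n n ℝ) * x + x * 1 = (2 : ℝ) • x
    rw [Matrix.one_mul, Matrix.mul_one, two_smul]
  refine ⟨h.localInverse _ _ _, ?_, ?_, ?_, ?_⟩
  · have := h.localInverse_apply_image
    simpa using this
  · have := h.to_localInverse.hasFDerivAt
    simp only [mul_one] at this
    refine this.congr_fderiv (ContinuousLinearMap.ext fun x => ?_)
    change (2 : ℝ)⁻¹ • x = (1 / 2 : ℝ) • x
    rw [one_div]
  · have := h.eventually_right_inverse
    rw [mul_one] at this
    exact this
  · exact h.eventually_left_inverse

/-- A curve of symmetric bilinear forms is realized by a curve of isometries with any initial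
velocity that is admissible to first order. -/
theorem exists_isometry_curve {h : ℝ → Matrix n n ℝ} {θ h' : Matrix n n ℝ}
    (hh : HasDerivAt h h' 0) (hsymm : ∀ᶠ s in 𝓝 0, (h s).transpose = h s) (hu : IsUnit (h 0))
    (hθ : θ.transpose * h 0 + h 0 * θ = h') :
    ∃ B : ℝ → Matrix n n ℝ, HasDerivAt B θ 0 ∧ B 0 = 1 ∧
      ∀ᶠ s in 𝓝 0, (B s).transpose * h 0 * B s = h s := by
  obtain ⟨r, hr1, hr, hr2, hr3⟩ := exists_matrix_sqrt (n := n)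
  have hud := (Matrix.isUnit_iff_isUnit_det _).1 hu
  set i := (h 0)⁻¹ with hi
  have hih : i * h 0 = 1 := Matrix.nonsing_inv_mul _ hud
  have hhi : h 0 * i = 1 := Matrix.mul_nonsing_inv _ hud
  have h0s : (h 0).transpose = h 0 := hsymm.self_of_nhds
  have his : i.transpose = i := by rw [hi, Matrix.transpose_nonsing_inv, h0s]
  -- The velocity splits as `½ h(0)⁻¹ h'`, the velocity of the square root of `h(0)⁻¹ h(s)`, plus
  -- `X`. The admissibility of `θ` makes `X` skew for `h(0)`, so that its exponentials are
  -- isometries of `h(0)`. The curve is the product of the two.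
  set X := θ - (1 / 2 : ℝ) • (i * h') with hX
  have hh's : h'.transpose = h' := by
    rw [← hθ, Matrix.transpose_add, Matrix.transpose_mul, Matrix.transpose_mul,
      Matrix.transpose_transpose, h0s, add_comm]
  have hXs : X.transpose = -(h 0 * X * i) := by
    have e1 : h 0 * X * i = h 0 * θ * i - (1 / 2 : ℝ) • (h' * i) := by
      rw [hX, Matrix.mul_sub, Matrix.sub_mul, Matrix.mul_smul, Matrix.smul_mul,
        ← Matrix.mul_assoc (h 0) i, hhi, Matrix.one_mul]
    have e2 : X.transpose = θ.transpose - (1 / 2 : ℝ) • (h' * i) := by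
      rw [hX, Matrix.transpose_sub, Matrix.transpose_smul, Matrix.transpose_mul, his, hh's]
    have e3 : h' * i = θ.transpose + h 0 * θ * i := by
      rw [← hθ, Matrix.add_mul, Matrix.mul_assoc, hhi, Matrix.mul_one]
    rw [e1, e2, e3]
    module
  let K : ℝ → Matrix n n ℝ := fun s => i * h s
  have hK : HasDerivAt K (i * h') 0 := hh.const_mul i
  have hK0 : K 0 = 1 := hih
  have hR : HasDerivAt (fun s => r (K s)) ((1 / 2 : ℝ) • (i * h')) 0 := by
    have h1 : HasFDerivAt r ((1 / 2 : ℝ) • ContinuousLinearMap.id ℝ (Matrix n n ℝ)) (K 0) := by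
      rwa [hK0]
    exact h1.comp_hasDerivAt (0 : ℝ) hK
  have hE := hasDerivAt_exp_smul_const (𝕂 := ℝ) X (0 : ℝ)
  rw [zero_smul, NormedSpace.exp_zero, Matrix.one_mul] at hE
  refine ⟨fun s => NormedSpace.exp (s • X) * r (K s), ?_, ?_, ?_⟩
  · have := hE.mul hR
    rw [zero_smul, NormedSpace.exp_zero, hK0, hr1, Matrix.one_mul, Matrix.mul_one] at this
    exact this.congr_deriv (sub_add_cancel _ _)
  · simp only [zero_smul, NormedSpace.exp_zero, hK0, hr1, Matrix.one_mul]
  · have t1 : Filter.Tendsto K (𝓝 0) (𝓝 1) := hK0 ▸ hK.continuousAt.tendsto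
    have t2 : Filter.Tendsto (fun s => r (K s)) (𝓝 0) (𝓝 1) := by
      have := hR.continuousAt.tendsto
      rwa [hK0, hr1] at this
    have t3 : Filter.Tendsto (fun s => i * (r (K s)).transpose * h 0) (𝓝 0) (𝓝 1) := by
      have hc : Continuous fun A : Matrix n n ℝ => i * A.transpose * h 0 :=
        (continuous_const.matrix_mul continuous_id.matrix_transpose).matrix_mul continuous_const
      have := hc.tendsto 1
      rw [Matrix.transpose_one, Matrix.mul_one, hih] at this
      exact this.comp t2
    filter_upwards [t1.eventually hr2, t3.eventually hr3, hsymm] with s e1 e2 e3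
    set Rs := r (K s) with hRs
    -- The adjoint of the square root with respect to `h(0)` is again a square root of `K s` near
    -- the identity. By uniqueness the root is self-adjoint, and therefore pulls `h(0)` back to
    -- `h(s)`.
    have f1 : i * Rs.transpose * h 0 * (i * Rs.transpose * h 0) = K s := by
      have : i * Rs.transpose * h 0 * (i * Rs.transpose * h 0)
          = i * (Rs * Rs).transpose * h 0 := by
        rw [Matrix.transpose_mul]
        calc _ = i * Rs.transpose * (h 0 * i) * Rs.transpose * h 0 := by
              simp only [Matrix.mul_assoc]
          _ = _ := by rw [hhi, Matrix.mul_one]; simp only [Matrix.mul_assoc]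
      rw [this, e1]
      change i * (i * h s).transpose * h 0 = i * h s
      rw [Matrix.transpose_mul, his, e3, Matrix.mul_assoc, Matrix.mul_assoc, hih, Matrix.mul_one]
    rw [f1] at e2
    have f2 : h 0 * Rs = Rs.transpose * h 0 := by
      conv_lhs => rw [hRs, e2]
      rw [← Matrix.mul_assoc, ← Matrix.mul_assoc, hhi, Matrix.one_mul]
    have f3 : (NormedSpace.exp (s • X)).transpose * h 0 * NormedSpace.exp (s • X) = h 0 := by
      have : (s • X).transpose = h 0 * (-(s • X)) * (h 0)⁻¹ := by
        rw [Matrix.transpose_smul, hXs, ← hi, Matrix.mul_neg, Matrix.neg_mul, Matrix.mul_smul,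
          Matrix.smul_mul, smul_neg]
      rw [← Matrix.exp_transpose, this, Matrix.exp_conj _ _ hu, Matrix.exp_neg, ← hi]
      have hue : IsUnit (NormedSpace.exp (s • X)).det :=
        (Matrix.isUnit_iff_isUnit_det _).1 (Matrix.isUnit_exp _)
      calc _ = h 0 * (NormedSpace.exp (s • X))⁻¹ * (i * h 0) * NormedSpace.exp (s • X) := by
            simp only [Matrix.mul_assoc]
        _ = _ := by
            rw [hih, Matrix.mul_one, Matrix.mul_assoc, Matrix.nonsing_inv_mul _ hue,
              Matrix.mul_one]
    rw [Matrix.transpose_mul]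
    calc _ = Rs.transpose * ((NormedSpace.exp (s • X)).transpose * h 0
            * NormedSpace.exp (s • X)) * Rs := by simp only [Matrix.mul_assoc]
      _ = h s := by
            rw [f3, ← f2, Matrix.mul_assoc, e1]
            change h 0 * (i * h s) = h s
            rw [← Matrix.mul_assoc, hhi, Matrix.one_mul]

end Isometries

/-! ### The tractor metric is parallel -/

section Gram

variable {d : ℕ} {R : Type*} [CommRing R] [Algebra ℝ R] {D : Fin d → Derivation ℝ R R}

/-- The tractor metric over a ring. -/
def gramR (gi : Matrix (Fin d) (Fin d) R) : Matrix (Slot d) (Slot d) R :=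
  Matrix.of <| slots (slots 0 (fun _ => 0) 1) (fun a => slots 0 (fun b => gi a b) 0)
    (slots 1 (fun _ => 0) 0)

variable {g gi : Matrix (Fin d) (Fin d) R} {Γ : Fin d → Fin d → Fin d → R}

theorem IsLeviCivita.compat_inv (h : IsMetricPair g gi) (hΓ : IsLeviCivita D g Γ) (c a b : Fin d) :
    D c (gi a b) = -(∑ e, Γ a c e * gi e b + ∑ e, gi a e * Γ b c e) := by
  let W : Matrix (Fin d) (Fin d) R := Matrix.of fun e a => Γ e c a
  have h1 : gi * g = 1 := by
    ext a b
    rw [Matrix.mul_apply, h.inv_mul, Matrix.one_apply]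
  have h2 : g * gi = 1 := mul_eq_one_comm.1 h1
  have h3 : g.map (D c) = W.transpose * g + g * W := by
    ext a b
    simp only [Matrix.map_apply, Matrix.add_apply, Matrix.mul_apply, Matrix.transpose_apply, W,
      Matrix.of_apply, hΓ.compat]
    congr 1
    exact Finset.sum_congr rfl fun e _ => mul_comm _ _
  have h4 : gi.map (D c) * g + gi * g.map (D c) = 0 := by
    rw [← map_derivation_mul, h1]
    ext a b
    rw [Matrix.map_apply, Matrix.one_apply, apply_ite (D c)]
    simp
  have h5 : gi.map (D c) = -(W * gi + gi * W.transpose) := by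
    calc gi.map (D c) = (gi.map (D c) * g + gi * g.map (D c)) * gi
          - gi * g.map (D c) * gi := by
          rw [Matrix.add_mul, Matrix.mul_assoc, h2, Matrix.mul_one, add_sub_cancel_right]
      _ = -(gi * W.transpose * (g * gi) + gi * g * W * gi) := by
          rw [h4, h3, Matrix.mul_add, Matrix.add_mul]
          simp only [Matrix.mul_assoc, Matrix.zero_mul, zero_sub]
      _ = _ := by rw [h1, h2, Matrix.one_mul, Matrix.mul_one, add_comm]
  have := congrFun (congrFun h5 a) b
  simpa only [Matrix.map_apply, Matrix.neg_apply, Matrix.add_apply, Matrix.mul_apply,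
    Matrix.transpose_apply, W, Matrix.of_apply] using this

/-- The tractor metric is parallel. In the middle block this is the derivative of the inverse
metric; in the mixed blocks the Schouten tensor, respectively the metric, cancels against its raised
counterpart. In the form stated it makes the connection matrix an admissible initial velocity for
`exists_isometry_curve`. -/
theorem conn_gramR (h : IsMetricPair g gi) (hΓ : IsLeviCivita D g Γ) (a : Fin d) :
    (conn D g gi Γ a).transpose * gramR gi + gramR gi * conn D g gi Γ a
      = (gramR gi).map (D a) := by
  have e1 : ∀ b, ∑ x, gi b x * sch D g gi Γ a x = ∑ x, sch D g gi Γ a x * gi x b := fun b =>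
    Finset.sum_congr rfl fun x _ => by rw [h.symm_inv b x, mul_comm]
  have e2 : ∀ b, ∑ x, gi b x * g a x = if b = a then 1 else 0 := fun b => by
    rw [← h.inv_mul b a]
    exact Finset.sum_congr rfl fun x _ => by rw [h.symm a x]
  have e3 : ∀ b, ∑ x, g a x * gi x b = if b = a then 1 else 0 := fun b => by
    rw [← e2 b]
    exact Finset.sum_congr rfl fun x _ => by rw [h.symm_inv b x, mul_comm]
  ext A B
  rcases A with _ | b | _ <;> rcases B with _ | c | _ <;>
    simp only [Matrix.add_apply, Matrix.mul_apply, Fintype.sum_sum_type, Matrix.transpose_apply,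
      Matrix.map_apply, conn, gramR, Matrix.of_apply, slots, Finset.univ_unique,
      Finset.sum_singleton, mul_zero, zero_mul, add_zero, zero_add, mul_one, one_mul, map_zero,
      Derivation.map_one_eq_zero, Finset.sum_const_zero, e1, e2, e3, neg_add_cancel,
      add_neg_cancel, hΓ.compat_inv h]
  · rw [neg_add, ← Finset.sum_neg_distrib, ← Finset.sum_neg_distrib]
    congr 1
    · exact Finset.sum_congr rfl fun x _ => by ring
    · exact Finset.sum_congr rfl fun x _ => by ring
  · split_ifs <;> simp
  · split_ifs <;> simp

theorem gramR_mul (h : IsMetricPair g gi) : gramR gi * gramR g = 1 := by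
  ext A B
  rcases A with _ | b | _ <;> rcases B with _ | c | _ <;>
    simp [Matrix.mul_apply, gramR, slots, Matrix.one_apply, h.inv_mul]

end Gram

/-! ### Tensor parts -/

section Parts

open scoped Topology

variable {d m : ℕ} {U : TopologicalSpace.Opens (Model d)}

theorem Rep.hasDerivAt {F : Model d → ℝ} {f : Sm U} (h : Rep F f) (y : U) (a : Fin d) :
    HasDerivAt (fun s : ℝ => F (y + s • EuclideanSpace.single a (1 : ℝ)))
      (Sm.ev y (Sm.D a f)) 0 := by
  rw [← h.pd a y]
  have h1 : HasDerivAt (fun s : ℝ => (y : Model d) + s • EuclideanSpace.single a (1 : ℝ))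
      (EuclideanSpace.single a (1 : ℝ)) 0 := by
    simpa using ((hasDerivAt_id (0 : ℝ)).smul_const
      (EuclideanSpace.single a (1 : ℝ) : Model d)).const_add (y : Model d)
  have h2 : HasFDerivAt F (fderiv ℝ F y)
      ((y : Model d) + (0 : ℝ) • EuclideanSpace.single a (1 : ℝ)) := by
    rw [zero_smul, add_zero]
    exact (differentiableAt_of_contDiffOn h.contDiffOn y.2).hasFDerivAt
  exact h2.comp_hasDerivAt (0 : ℝ) h1

theorem eventually_mem_line (y : U) (a : Fin d) :
    ∀ᶠ s : ℝ in 𝓝 0, (y : Model d) + s • EuclideanSpace.single a (1 : ℝ) ∈ U := by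
  have hc : Continuous fun s : ℝ => (y : Model d) + s • EuclideanSpace.single a (1 : ℝ) := by
    fun_prop
  have := hc.tendsto 0
  rw [zero_smul, add_zero] at this
  exact this.eventually (U.isOpen.mem_nhds y.2)

theorem hasDerivAt_tensorAct {A : ℝ → Matrix (Slot d) (Slot d) ℝ}
    {A' : Matrix (Slot d) (Slot d) ℝ} (hA : ∀ i j, HasDerivAt (fun s => A s i j) (A' i j) 0)
    {t : ℝ → Tensor d m} {t' : Tensor d m} (ht : ∀ I, HasDerivAt (fun s => t s I) (t' I) 0) :
    HasDerivAt (fun s => tensorAct (A s) (t s)) (lderR (A 0) A' (t 0) + tensorAct (A 0) t') 0 := by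
  rw [hasDerivAt_pi]
  intro I
  have h := HasDerivAt.fun_sum (u := Finset.univ) fun (K : Fin m → Slot d) _ =>
    (HasDerivAt.fun_finsetProd (u := Finset.univ) fun i _ => hA (I i) (K i)).mul (ht K)
  refine h.congr_deriv ?_
  rw [Finset.sum_add_distrib]
  congr 1
  simp only [lderR, smul_eq_mul]
  exact Finset.sum_congr rfl fun K _ => by
    congr 1
    exact Finset.sum_congr rfl fun i _ => mul_comm _ _

theorem mem_of_hasDerivAt {E : Type*} [NormedAddCommGroup E] [NormedSpace ℝ E]
    [FiniteDimensional ℝ E] (S : Submodule ℝ E) {f : ℝ → E} {f' : E} (hf : HasDerivAt f f' 0)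
    (h : ∀ᶠ s in 𝓝 0, f s ∈ S) : f' ∈ S := by
  have h1 := hasDerivAt_iff_tendsto_slope.1 hf
  refine S.closed_of_finiteDimensional.mem_of_tendsto h1 ?_
  filter_upwards [nhdsWithin_le_nhds h] with s hs
  rw [slope_def_module]
  exact S.smul_mem _ (S.sub_mem hs h.self_of_nhds)

theorem TensorPart.mem_fiber {Φ : TensorPart d m} {g : Matrix (Fin d) (Fin d) ℝ}
    {t : Tensor d m} : t ∈ Φ.fiber g ↔ ∀ A : Matrix (Slot d) (Slot d) ℝ,
      A.transpose * tractorGram 1 * A = tractorGram g → tensorAct A t ∈ Φ.carrier := by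
  simp [TensorPart.fiber, Submodule.mem_iInf]

variable {G : Model d → Matrix (Fin d) (Fin d) ℝ} {g gi : Matrix (Fin d) (Fin d) (Sm U)}

theorem RepMetric.tractorGram_eq (hG : RepMetric G g gi) (y : U) :
    tractorGram (G y) = (gramR gi).map (Sm.ev y) := by
  ext A B
  have : ∀ a b, (G y)⁻¹ a b = Sm.ev y (gi a b) := fun a b => hG.rep_inv a b y
  rcases A with _ | a | _ <;> rcases B with _ | b | _ <;>
    simp [tractorGram, gramR, slots, this]

/-- The tractor connection preserves tensor parts. -/
theorem RepMetric.cov_mem_fiber (hG : RepMetric G g gi) (hp : IsMetricPair g gi)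
    (Φ : TensorPart d m) {t : Model d → Tensor d m} {τ : TensorR d m (Sm U)} (ht : RepT t τ)
    (hm : ∀ y ∈ U, t y ∈ Φ.fiber (G y)) (a : Fin d) {y : Model d} (hy : y ∈ U) :
    cov G a t y ∈ Φ.fiber (G y) := by
  rw [TensorPart.mem_fiber]
  intro A0 hA0
  set x : U := ⟨y, hy⟩ with hx
  let ℓ : ℝ → Model d := fun s => y + s • EuclideanSpace.single a (1 : ℝ)
  have hℓ0 : ℓ 0 = y := by simp [ℓ]
  have hℓ : ∀ᶠ s in 𝓝 0, ℓ s ∈ U := eventually_mem_line x a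
  let θ := conn Sm.D g gi (chr Sm.D g gi) a
  let h : ℝ → Matrix (Slot d) (Slot d) ℝ := fun s => tractorGram (G (ℓ s))
  have hgs : (gramR gi).transpose = gramR gi := by
    ext A B
    rcases A with _ | a | _ <;> rcases B with _ | b | _ <;>
      simp [gramR, slots, hp.symm_inv]
  have hh : ∀ i j, HasDerivAt (fun s => h s i j) (((gramR gi).map (Sm.D a)).map (Sm.ev x) i j) 0 :=
    fun i j => by
      have hr : Rep (fun z => tractorGram (G z) i j) (gramR gi i j) := fun z => by
        dsimp only
        rw [hG.tractorGram_eq z]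
        rfl
      exact hr.hasDerivAt x a
  -- Frames along the coordinate line, isometric for the varying tractor metric, whose velocity at
  -- the point is the connection matrix.
  obtain ⟨B, hB, hB0, hBh⟩ := exists_isometry_curve (hasDerivAt_matrix.2 hh)
    (hℓ.mono fun s hs => by
      change (tractorGram (G (ℓ s))).transpose = tractorGram (G (ℓ s))
      have h1 := hG.tractorGram_eq ⟨ℓ s, hs⟩
      dsimp only at h1
      rw [h1, ← Matrix.transpose_map, hgs]) (by
      change IsUnit (tractorGram (G (ℓ 0)))
      rw [hℓ0, hG.tractorGram_eq x]
      exact (IsUnit.of_mul_eq_one _ (gramR_mul hp)).map (Sm.ev x).toRingHom.mapMatrix)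
    (θ := θ.map (Sm.ev x)) (by
      change _ * tractorGram (G (ℓ 0)) + tractorGram (G (ℓ 0)) * _ = _
      rw [hℓ0, hG.tractorGram_eq x, ← conn_gramR hp (isLeviCivita_chr hp) a, ← Matrix.transpose_map,
        ← map_mul_algHom, ← map_mul_algHom]
      ext i j
      simp only [Matrix.add_apply, Matrix.map_apply, map_add]
      rfl)
  have hcurve := hasDerivAt_tensorAct (A := fun s => A0 * B s) (A' := A0 * θ.map (Sm.ev x))
    (t := fun s => t (ℓ s)) (t' := fun I => Sm.ev x (Sm.D a (τ I)))
    (fun i j => by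
      have h1 := fun k => (hasDerivAt_matrix.1 hB k j).const_mul (A0 i k)
      have h2 := HasDerivAt.fun_sum (u := Finset.univ) fun k _ => h1 k
      exact h2) (fun I => (ht I).hasDerivAt x a)
  -- The curve `A0 B(s) t` stays in the fixed subspace `Φ.carrier`, which is closed. Its derivative
  -- at `0` therefore lies there too, and by the choice of velocity it is `A0` applied to the
  -- covariant derivative of `t`.
  have hmem := mem_of_hasDerivAt Φ.carrier hcurve (by
    filter_upwards [hℓ, hBh] with s hs hs'
    refine TensorPart.mem_fiber.1 (hm _ hs) _ ?_
    rw [Matrix.transpose_mul]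
    calc _ = (B s).transpose * (A0.transpose * tractorGram 1 * A0) * B s := by
          simp only [Matrix.mul_assoc]
      _ = _ := by
          rw [hA0]
          refine Eq.trans ?_ hs'
          change _ = (B s).transpose * tractorGram (G (ℓ 0)) * B s
          rw [hℓ0])
  convert hmem using 1
  simp only [hB0, Matrix.mul_one, hℓ0]
  have h3 := (tActR_dActR (θ.map (Sm.ev x)) A0 (t y)).symm
  rw [h3]
  change tensorAct A0 _ = tensorAct A0 _ + tensorAct A0 _
  rw [← map_add]
  congr 1
  funext I
  refine (hG.rep_cov a ht I x).trans ?_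
  rw [covR, Pi.add_apply, Pi.add_apply, map_add, add_comm]
  congr 1
  simp only [dActR, map_sum, map_mul, Matrix.map_apply]
  exact Finset.sum_congr rfl fun i _ => Finset.sum_congr rfl fun K _ => by
    rw [← ht _ x]

/-- The operator `y` preserves tensor parts. -/
theorem RepMetric.yOp_mem_fiber (hd : d ≠ 0) (hG : RepMetric G g gi) (hp : IsMetricPair g gi)
    (Φ : TensorPart d m) (s : Model d → Tensor d 0) (w : ℝ) {t : Model d → Tensor d m}
    {τ : TensorR d m (Sm U)} (ht : RepT t τ)
    (hm : ∀ y ∈ U, t y ∈ Φ.fiber (G y)) {y : Model d} (hy : y ∈ U) :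
    yOp G s w t y ∈ Φ.fiber (G y) := by
  have h1 : ∀ a, ∀ y ∈ U, cov G a t y ∈ Φ.fiber (G y) := fun a y hy =>
    hG.cov_mem_fiber hp Φ ht hm a hy
  have h2 : laplacian G t y ∈ Φ.fiber (G y) :=
    Submodule.sum_mem _ fun a _ => Submodule.sum_mem _ fun b _ => Submodule.smul_mem _ _ <|
      Submodule.sub_mem _ (hG.cov_mem_fiber hp Φ (hG.rep_cov b ht) (h1 b) a hy)
        (Submodule.sum_mem _ fun c _ => Submodule.smul_mem _ _ (h1 c y hy))
  rw [yOp, laplaceRobin_eq hd]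
  exact Submodule.neg_mem _ <| Submodule.smul_mem _ _ <| Submodule.add_mem _
    (Submodule.neg_mem _ <| Submodule.smul_mem _ _ <| Submodule.add_mem _ h2
      (Submodule.smul_mem _ _ (hm y hy)))
    (Submodule.smul_mem _ _ <| Submodule.add_mem _
      (Submodule.sum_mem _ fun a _ => Submodule.sum_mem _ fun b _ =>
        Submodule.smul_mem _ _ (h1 b y hy)) (Submodule.smul_mem _ _ (hm y hy)))

end Parts

/-! ### The extrinsic conformal Laplacians as operators on sections -/

section Operators

variable {d m : ℕ} {M : Type*} [TopologicalSpace M] [ChartedSpace (Model d) M]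
  [IsManifold (𝓡 d) ∞ M] {c : ConformalStructure d M}

/-- `g`, `gi`, `s`, `v` represent the metric, its inverse, the density `σ` and the inverse of
`I²` on the open set `U` of coordinates of the gauge `γ`. -/
structure IsLocalRep (σ : densities c 1) (γ : Gauge c) {U : TopologicalSpace.Opens (Model d)}
    (g gi : Matrix (Fin d) (Fin d) (Sm U)) (s v : Sm U) : Prop where
  sub : (U : Set (Model d)) ⊆ γ.chart.target
  metric : RepMetric γ.G g gi
  pair : IsMetricPair g gi
  rep : RepT (σ.1 γ) fun _ => s
  inv : v * isqR Sm.D gi (chr Sm.D g gi) s = 1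

theorem exists_isLocalRep (hd : d ≠ 0) {σ : densities c 1} (hσ : PositiveScale σ) (γ : Gauge c)
    {U : TopologicalSpace.Opens (Model d)} (hU : (U : Set (Model d)) ⊆ γ.chart.target) :
    ∃ (g gi : Matrix (Fin d) (Fin d) (Sm U)) (s v : Sm U), IsLocalRep σ γ g gi s v := by
  obtain ⟨g, gi, hG, hp⟩ := γ.exists_repMetric hU
  obtain ⟨s, hs⟩ := exists_rep_density σ γ hU
  obtain ⟨v, hv⟩ := exists_inv_isqR hd hσ γ hU hG hs
  exact ⟨g, gi, s, v, hU, hG, hp, hs, hv⟩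

theorem exists_repT_section {w : ℝ} {f : Components c m} (hf : f ∈ tractorFields c m w)
    (γ : Gauge c) {U : TopologicalSpace.Opens (Model d)}
    (hU : (U : Set (Model d)) ⊆ γ.chart.target) : ∃ τ : TensorR d m (Sm U), RepT (f γ) τ :=
  exists_repT_of_contDiffOn ((hf.1 γ).mono hU)

variable {σ : densities c 1} {γ : Gauge c} {U : TopologicalSpace.Opens (Model d)}
  {g gi : Matrix (Fin d) (Fin d) (Sm U)} {s v : Sm U}

theorem IsLocalRep.laplaceRobinPow_eq (h : IsLocalRep σ γ g gi s v) (hd : d ≠ 0) (k : ℕ) (w : ℝ)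
    {f : Components c m} {τ : TensorR d m (Sm U)} (hf : RepT (f γ) τ) (y : U)
    (I : Fin m → Slot d) :
    laplaceRobinPow σ k w f γ y I
      = Sm.ev y (yPowR Sm.D gi (chr Sm.D g gi) (nabS gi g) s v k w τ I) := by
  rw [← h.metric.rep_yPow hd h.rep h.inv k w hf I y]
  exact congrFun (Set.indicator_of_mem (h.sub y.2) _) I

theorem laplaceRobinPow_mem_sections (hd : 3 ≤ d) (hσ : PositiveScale σ) (Φ : TensorPart d m)
    (k : ℕ) {w : ℝ} {f : Components c m} (hf : f ∈ sections c Φ w) :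
    laplaceRobinPow σ k w f ∈ sections c Φ (w - k) := by
  have hd0 : d ≠ 0 := by omega
  refine ⟨laplaceRobinPow_mem_tractorFields hd hσ k hf.1, ?_⟩
  induction k generalizing w f with
  | zero =>
    intro γ y hy
    have h1 : laplaceRobinPow σ 0 w f γ y = f γ y := Set.indicator_of_mem hy _
    rw [h1]
    exact hf.2 γ y hy
  | succ k ih =>
    rw [laplaceRobinPow_succ hd hσ k hf.1]
    refine ih ⟨yOp_mem_tractorFields hd hσ hf.1, fun γ y hy => ?_⟩
    obtain ⟨g, gi, s, v, h⟩ := exists_isLocalRep hd0 hσ γ (U := γ.dom) subset_rfl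
    obtain ⟨τ, hτ⟩ := exists_repT_section hf.1 γ (U := γ.dom) subset_rfl
    dsimp only
    rw [Set.indicator_of_mem hy]
    exact h.metric.yOp_mem_fiber hd0 h.pair Φ _ w hτ (hf.2 γ) hy

theorem laplaceRobinPow_add (hd : d ≠ 0) (hσ : PositiveScale σ) (k : ℕ) {w : ℝ}
    {f f' : Components c m} (hf : f ∈ tractorFields c m w) (hf' : f' ∈ tractorFields c m w) :
    laplaceRobinPow σ k w (f + f') = laplaceRobinPow σ k w f + laplaceRobinPow σ k w f' := by
  funext γ y
  by_cases hy : y ∈ γ.chart.target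
  · obtain ⟨g, gi, s, v, h⟩ := exists_isLocalRep hd hσ γ (U := γ.dom) subset_rfl
    obtain ⟨τ, hτ⟩ := exists_repT_section hf γ (U := γ.dom) subset_rfl
    obtain ⟨τ', hτ'⟩ := exists_repT_section hf' γ (U := γ.dom) subset_rfl
    have hadd : RepT ((f + f') γ) (τ + τ') := fun I y =>
      (congrArg₂ (· + ·) (hτ I y) (hτ' I y)).trans (map_add _ _ _).symm
    funext I
    rw [h.laplaceRobinPow_eq hd k w hadd ⟨y, hy⟩ I, (isConnection_covR Sm.D _).yPowR_add,
      Pi.add_apply, map_add, ← h.laplaceRobinPow_eq hd k w hτ ⟨y, hy⟩ I,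
      ← h.laplaceRobinPow_eq hd k w hτ' ⟨y, hy⟩ I]
    rfl
  · simp [laplaceRobinPow, hy]

theorem laplaceRobinPow_smul (hd : d ≠ 0) (hσ : PositiveScale σ) (k : ℕ) {w : ℝ} (r : ℝ)
    {f : Components c m} (hf : f ∈ tractorFields c m w) :
    laplaceRobinPow σ k w (r • f) = r • laplaceRobinPow σ k w f := by
  funext γ y
  by_cases hy : y ∈ γ.chart.target
  · obtain ⟨g, gi, s, v, h⟩ := exists_isLocalRep hd hσ γ (U := γ.dom) subset_rfl
    obtain ⟨τ, hτ⟩ := exists_repT_section hf γ (U := γ.dom) subset_rfl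
    have hsm : RepT ((r • f) γ) (algebraMap ℝ (Sm γ.dom) r • τ) := fun I y =>
      (congrArg (r * ·) (hτ I y)).trans (by
        rw [Pi.smul_apply, smul_eq_mul, map_mul, AlgHom.commutes]
        rfl)
    funext I
    rw [h.laplaceRobinPow_eq hd k w hsm ⟨y, hy⟩ I, (isConnection_covR Sm.D _).yPowR_const_smul,
      Pi.smul_apply, smul_eq_mul, map_mul, AlgHom.commutes,
      ← h.laplaceRobinPow_eq hd k w hτ ⟨y, hy⟩ I]
    rfl
  · simp [laplaceRobinPow, hy]

/-- The powers of the Laplace-Robin operator on sections of a tensor part. -/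
def powOp (hd : 3 ≤ d) (hσ : PositiveScale σ) (Φ : TensorPart d m) (k : ℕ) {w w' : ℝ}
    (hw : w - k = w') : sections c Φ w →ₗ[ℝ] sections c Φ w' where
  toFun f := ⟨laplaceRobinPow σ k w f.1, hw ▸ laplaceRobinPow_mem_sections hd hσ Φ k f.2⟩
  map_add' f f' := Subtype.ext <| laplaceRobinPow_add (by omega) hσ k f.2.1 f'.2.1
  map_smul' r f := Subtype.ext <| laplaceRobinPow_smul (by omega) hσ k r f.2.1

theorem powOp_apply (hd : 3 ≤ d) (hσ : PositiveScale σ) (Φ : TensorPart d m) (k : ℕ) {w w' : ℝ}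
    (hw : w - k = w') (f : sections c Φ w) :
    (powOp hd hσ Φ k hw f).1 = laplaceRobinPow σ k w f.1 := rfl

theorem isDifferentialOperator_powOp (hd : 3 ≤ d) (hσ : PositiveScale σ) (Φ : TensorPart d m)
    (k : ℕ) {w w' : ℝ} (hw : w - k = w') : IsDifferentialOperator (powOp hd hσ Φ k hw) := by
  have hd0 : d ≠ 0 := by omega
  refine ⟨0 + 2 * k, fun γ => ?_⟩
  obtain ⟨g, gi, s, v, h⟩ := exists_isLocalRep hd0 hσ γ (U := γ.dom) subset_rfl
  obtain ⟨A, hA⟩ := hasJet_id.yPowR_comp (m := m) (θ := conn Sm.D g gi (chr Sm.D g gi))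
    (gi := gi) (Γ := chr Sm.D g gi) s v k w
  refine ⟨A, hA.smooth, fun f y hy => ?_⟩
  obtain ⟨τ, hτ⟩ := exists_repT_section f.2.1 γ (U := γ.dom) subset_rfl
  funext I
  rw [powOp_apply, h.laplaceRobinPow_eq hd0 k w hτ ⟨y, hy⟩ I]
  exact (hA.rep _ τ hτ I ⟨y, hy⟩).symm

theorem isTangential_powOp (hd : 3 ≤ d) (hσ : PositiveScale σ) (Φ : TensorPart d m)
    (k : ℕ) {w' : ℝ} (hw : ((k : ℝ) - d + 1) / 2 - k = w') :
    IsTangential σ (powOp hd hσ Φ k hw) := by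
  have hd0 : d ≠ 0 := by omega
  -- The operator on the other side is the same power one weight lower.
  refine ⟨powOp hd hσ Φ k (by rw [← hw]; ring), isDifferentialOperator_powOp hd hσ Φ k _,
    LinearMap.ext fun f => Subtype.ext ?_⟩
  funext γ y
  by_cases hy : y ∈ γ.chart.target
  · obtain ⟨g, gi, s, v, h⟩ := exists_isLocalRep hd0 hσ γ (U := γ.dom) subset_rfl
    obtain ⟨τ, hτ⟩ := exists_repT_section f.2.1 γ (U := γ.dom) subset_rfl
    have hs : ∀ y : γ.dom, scalar (σ.1 γ y) = Sm.ev y s := fun y => h.rep Fin.elim0 y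
    have hmul : RepT ((mulDensity Φ σ _ f).1 γ) (s • τ) := fun I y => by
      rw [Pi.smul_apply, smul_eq_mul, map_mul, ← hs y, ← hτ I y]
      rfl
    funext I
    change laplaceRobinPow σ k _ (mulDensity Φ σ _ f).1 γ y I
      = scalar (σ.1 γ y) * laplaceRobinPow σ k _ f.1 γ y I
    rw [h.laplaceRobinPow_eq hd0 k _ hmul ⟨y, hy⟩ I, h.laplaceRobinPow_eq hd0 k _ hτ ⟨y, hy⟩ I,
      (isConnection_covR Sm.D _).yPowR_smul_critical hd0 h.pair.symm_inv _ h.inv,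
      Pi.smul_apply, smul_eq_mul, map_mul, hs ⟨y, hy⟩]
  · change laplaceRobinPow σ k _ (mulDensity Φ σ _ f).1 γ y
      = scalar (σ.1 γ y) • laplaceRobinPow σ k _ f.1 γ y
    simp [laplaceRobinPow, hy]

/-! ### Near the hypersurface -/

/-- The inner product of the differentials of two densities. -/
def dualInner (G : Model d → Matrix (Fin d) (Fin d) ℝ) (s s' : Model d → Tensor d 0)
    (y : Model d) : ℝ :=
  ∑ b, ∑ e, (G y)⁻¹ b e * pd b (fun z => scalar (s z)) y * pd e (fun z => scalar (s' z)) y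

/-- The squared length `|dσ|²`. -/
abbrev normSq (G : Model d → Matrix (Fin d) (Fin d) ℝ) (s : Model d → Tensor d 0) (y : Model d) :
    ℝ := dualInner G s s y

theorem IsLocalRep.rep_pd (h : IsLocalRep σ γ g gi s v) (a : Fin d) :
    Rep (pd a fun z => scalar (σ.1 γ z)) (Sm.D a s) := (h.rep Fin.elim0).pd a

theorem vf_grad {R : Type*} [CommRing R] [Algebra ℝ R] {D : Fin d → Derivation ℝ R R}
    (gi : Matrix (Fin d) (Fin d) R) (s t : R) :
    vf D (grad D gi s) t = ∑ b, ∑ e, gi b e * D b s * D e t := by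
  rw [vf_apply, Finset.sum_comm]
  simp only [grad, Finset.sum_mul]

theorem rep_dualInner {σ' : densities c 1} {s' : Sm U} (hG : RepMetric γ.G g gi)
    (hs : RepT (σ.1 γ) fun _ => s) (hs' : RepT (σ'.1 γ) fun _ => s') :
    Rep (dualInner γ.G (σ.1 γ) (σ'.1 γ)) (vf Sm.D (grad Sm.D gi s) s') := fun y => by
  rw [vf_grad]
  have h1 : ∀ a, pd a (fun z => scalar (σ.1 γ z)) y = Sm.ev y (Sm.D a s) :=
    fun a => (hs Fin.elim0).pd a y
  have h2 : ∀ a, pd a (fun z => scalar (σ'.1 γ z)) y = Sm.ev y (Sm.D a s') :=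
    fun a => (hs' Fin.elim0).pd a y
  simp only [dualInner, map_sum, map_mul, h1, h2]
  exact Finset.sum_congr rfl fun b _ => Finset.sum_congr rfl fun e _ => by
    rw [← hG.rep_inv b e y]

theorem IsLocalRep.rep_normSq (h : IsLocalRep σ γ g gi s v) :
    Rep (normSq γ.G (σ.1 γ)) (vf Sm.D (grad Sm.D gi s) s) := rep_dualInner h.metric h.rep h.rep

theorem contDiffOn_dualInner (σ σ' : densities c 1) (γ : Gauge c) :
    ContDiffOn ℝ ∞ (dualInner γ.G (σ.1 γ) (σ'.1 γ)) γ.chart.target := by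
  obtain ⟨g, gi, hG, hp⟩ := γ.exists_repMetric (U := γ.dom) subset_rfl
  obtain ⟨s, hs⟩ := exists_rep_density σ γ (U := γ.dom) subset_rfl
  obtain ⟨s', hs'⟩ := exists_rep_density σ' γ (U := γ.dom) subset_rfl
  exact (rep_dualInner hG hs hs').contDiffOn

/-- The region where `dσ` does not vanish. -/
def Gauge.regular (γ : Gauge c) (σ : densities c 1) : TopologicalSpace.Opens (Model d) :=
  ⟨γ.chart.target ∩ normSq γ.G (σ.1 γ) ⁻¹' {0}ᶜ,
    (contDiffOn_dualInner σ σ γ).continuousOn.isOpen_inter_preimage γ.chart.open_target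
      isOpen_compl_singleton⟩

theorem Gauge.regular_subset (γ : Gauge c) (σ : densities c 1) :
    (γ.regular σ : Set (Model d)) ⊆ γ.chart.target := Set.inter_subset_left

variable {S : Set M}

/-- Where `σ = 0` both the term `2 σ ρ` of `I²` and the correction `σ^d B` disappear. -/
theorem IsConformalUnit.normSq_eq_one (hS : IsConformalUnit S σ) (hd : d ≠ 0)
    (hσ : PositiveScale σ) (γ : Gauge c) {y : Model d} (hy : y ∈ γ.chart.target)
    (h0 : scalar (σ.1 γ y) = 0) : normSq γ.G (σ.1 γ) y = 1 := by
  obtain ⟨g, gi, s, v, h⟩ := exists_isLocalRep hd hσ γ (U := γ.dom) subset_rfl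
  obtain ⟨B, hB⟩ := hS.unit
  have h1 := hB γ y hy
  rw [h0, zero_pow hd, zero_mul, add_zero, h.metric.rep_scaleSq hd h.rep ⟨y, hy⟩, isqR,
    ← vf_grad, map_add, map_mul, map_mul] at h1
  have h2 : Sm.ev ⟨y, hy⟩ s = 0 := by
    rw [← h0]
    exact (h.rep Fin.elim0 ⟨y, hy⟩).symm
  rw [h2, zero_mul, mul_zero, add_zero] at h1
  exact (h.rep_normSq ⟨y, hy⟩).trans h1

theorem IsConformalUnit.scalar_eq_zero (hS : IsConformalUnit S σ) (γ : Gauge c) {p : M}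
    (hp : p ∈ γ.chart.source) (hpS : p ∈ S) : scalar (σ.1 γ (γ.chart p)) = 0 :=
  (hS.zero_iff γ p hp).1 hpS

theorem IsConformalUnit.mem_regular (hS : IsConformalUnit S σ) (hd : d ≠ 0)
    (hσ : PositiveScale σ) (γ : Gauge c) {p : M} (hp : p ∈ γ.chart.source) (hpS : p ∈ S) :
    γ.chart p ∈ γ.regular σ := by
  refine ⟨γ.chart.map_source hp, ?_⟩
  have := hS.normSq_eq_one hd hσ γ (γ.chart.map_source hp) (hS.scalar_eq_zero γ hp hpS)
  simp [this]

theorem IsLocalRep.exists_inv_vf (h : IsLocalRep σ γ g gi s v)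
    (hU : (U : Set (Model d)) ⊆ γ.regular σ) : ∃ u, u * vf Sm.D (grad Sm.D gi s) s = 1 :=
  Sm.exists_inv fun y => by
    rw [← h.rep_normSq y]
    exact (hU y.2).2

theorem isHypersurface_of_inv {U : TopologicalSpace.Opens (Model d)} {s u : Sm U}
    {N : Fin d → Sm U} (hu : u * vf Sm.D N s = 1) : IsHypersurface Sm.D s (zeros s) := by
  refine isHypersurface_zeros fun y _ => ?_
  by_contra! hc
  have := congrArg (Sm.ev y) hu
  simp only [vf_apply, map_mul, map_sum, hc, mul_zero, Finset.sum_const_zero, map_one] at this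
  exact zero_ne_one this

/-- Near a point of `S` the components are `σ e + r` with `r` of order `k + 1`. The power kills the
first term at the point by tangentiality, and the second because `k` factors leave order at least
one. -/
theorem powOp_mem_vanishing (hd : 3 ≤ d) (hσ : PositiveScale σ) (hS : IsConformalUnit S σ)
    (Φ : TensorPart d m) (k : ℕ) {w' : ℝ} (hw : ((k : ℝ) - d + 1) / 2 - k = w') :
    vanishing c Φ (((k : ℝ) - d + 1) / 2) S
      ≤ (vanishing c Φ w' S).comap (powOp hd hσ Φ k hw) := by
  have hd0 : d ≠ 0 := by omega
  intro f hf γ p hp hpS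
  obtain ⟨g, gi, s, v, h⟩ := exists_isLocalRep hd0 hσ γ (γ.regular_subset σ)
  obtain ⟨τ, hτ⟩ := exists_repT_section f.2.1 γ (γ.regular_subset σ)
  obtain ⟨u, hu⟩ := h.exists_inv_vf subset_rfl
  have hZ := isHypersurface_of_inv hu
  set y : γ.regular σ := ⟨γ.chart p, hS.mem_regular hd0 hσ γ hp hpS⟩ with hy
  -- The division needs vanishing at all nearby zeros of `s`; these are coordinates of points of
  -- `S`.
  have hτ0 : ∀ I, ∀ q ∈ zeros s, q (τ I) = 0 := by
    rintro I q ⟨z, rfl, hz⟩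
    have hzt := γ.regular_subset σ z.2
    rw [← hτ I z]
    have h1 := hf γ (γ.chart.symm z) (γ.chart.map_target hzt)
      ((hS.zero_iff γ _ (γ.chart.map_target hzt)).2 (by
        rw [γ.chart.right_inv hzt, ← hz]
        exact h.rep Fin.elim0 z))
    rw [γ.chart.right_inv hzt] at h1
    exact congrFun h1 I
  choose e r her hr using fun I => hZ.exists_eq_mul_add Sm.D_comm hu (hτ0 I) k
  have hτe : τ = s • e + r := funext her
  have hys : Sm.ev y s = 0 := by
    rw [← h.rep Fin.elim0 y]
    exact hS.scalar_eq_zero γ hp hpS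
  have hr' : r ∈ VanT Sm.D (Sm.ev y) m (k + 1) := mem_vanT.2 fun I => hr I _ ⟨y, rfl, hys⟩
  funext I
  change laplaceRobinPow σ k _ f.1 γ y I = 0
  rw [h.laplaceRobinPow_eq hd0 k _ hτ y I, hτe, (isConnection_covR Sm.D _).yPowR_add,
    (isConnection_covR Sm.D _).yPowR_smul_critical hd0 h.pair.symm_inv _ h.inv, Pi.add_apply,
    map_add, Pi.smul_apply, smul_eq_mul, map_mul, hys, zero_mul, zero_add]
  exact eval_eq_zero (mem_vanT.1 (vanT_yPowR hys k _ hr') I) (by omega)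

/-! ### The leading term -/

theorem IsLocalRep.rep_tangProj (h : IsLocalRep σ γ g gi s v) {u : Sm U}
    (hu : u * vf Sm.D (grad Sm.D gi s) s = 1) (a b : Fin d) :
    Rep (tangProj γ.G (σ.1 γ) a b) (projR Sm.D gi s u a b) := fun y => by
  have h1 := congrArg (Sm.ev y) hu
  rw [map_mul, map_one, ← h.rep_normSq y] at h1
  have h2 : Sm.ev y (grad Sm.D gi s b)
      = ∑ e, (γ.G y)⁻¹ b e * pd e (fun z => scalar (σ.1 γ z)) y := by
    rw [grad, map_sum]
    refine Finset.sum_congr rfl fun e _ => ?_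
    rw [map_mul, h.pair.symm_inv e b, ← h.metric.rep_inv b e y, ← h.rep_pd e y]
  rw [projR, map_sub, map_mul, map_mul, h2, ← h.rep_pd a y, apply_ite (Sm.ev y), map_one, map_zero,
    tangProj, eq_inv_of_mul_eq_one_left h1, div_eq_mul_inv]
  rfl

theorem IsLocalRep.rep_tangCov (h : IsLocalRep σ γ g gi s v) {u : Sm U}
    (hu : u * vf Sm.D (grad Sm.D gi s) s = 1) (a : Fin d) {t : Model d → Tensor d m}
    {τ : TensorR d m (Sm U)} (ht : RepT t τ) :
    RepT (tangCov γ.G (σ.1 γ) a t) (tangR Sm.D gi s u (nabS gi g) a τ) := fun I y => by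
  simp only [tangCov, tangR, Finset.sum_apply, Pi.smul_apply, smul_eq_mul, map_sum, map_mul,
    h.rep_tangProj hu _ _ y, h.metric.rep_cov _ ht I y]

theorem IsLocalRep.rep_tangLaplacian (h : IsLocalRep σ γ g gi s v) {u : Sm U}
    (hu : u * vf Sm.D (grad Sm.D gi s) s = 1) {t : Model d → Tensor d m}
    {τ : TensorR d m (Sm U)} (ht : RepT t τ) :
    RepT (tangLaplacian γ.G (σ.1 γ) t)
      (tangLapR Sm.D gi (chr Sm.D g gi) s u (nabS gi g) τ) := fun I y => by
  simp only [tangLaplacian, tangLapR, Finset.sum_apply, Pi.smul_apply, Pi.sub_apply, smul_eq_mul,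
    map_sum, map_mul, map_sub, h.rep_tangProj hu _ _ y, h.metric.rep_inv _ _ y,
    h.metric.rep_christoffel _ _ _ y, h.rep_tangCov hu _ ht I y,
    h.metric.rep_cov _ (h.rep_tangCov hu _ ht) I y]

theorem IsLocalRep.rep_iterate_tangLaplacian (h : IsLocalRep σ γ g gi s v) {u : Sm U}
    (hu : u * vf Sm.D (grad Sm.D gi s) s = 1) (l : ℕ) {t : Model d → Tensor d m}
    {τ : TensorR d m (Sm U)} (ht : RepT t τ) :
    RepT ((tangLaplacian γ.G (σ.1 γ))^[l] t)
      ((tangLapR Sm.D gi (chr Sm.D g gi) s u (nabS gi g))^[l] τ) := by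
  induction l generalizing t τ with
  | zero => exact ht
  | succ l ih => exact ih (h.rep_tangLaplacian hu ht)

/-- The difference of the two operators is a jet expression of order at most `4 l`. At points of `S`
it vanishes on tensors of order `2 l` by `eval_yPowR_critical`, so only jets of order less than `2
l` contribute. -/
theorem exists_jet_leadingTerm (hd : 3 ≤ d) (hσ : PositiveScale σ) (hS : IsConformalUnit S σ)
    (l : ℕ) (γ : Gauge c) :
    ∃ A : (j : ℕ) → Model d → JetCoeff d m j, (∀ j, ContDiffOn ℝ ∞ (A j) (γ.regular σ)) ∧
      ∀ f ∈ tractorFields c m ((((2 * l : ℕ) : ℝ) - d + 1) / 2),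
        ∀ p ∈ γ.chart.source, p ∈ S →
          laplaceRobinPow σ (2 * l) ((((2 * l : ℕ) : ℝ) - d + 1) / 2) f γ (γ.chart p)
            = (Nat.doubleFactorial (2 * l - 1) : ℝ) ^ 2
                • (tangLaplacian γ.G (σ.1 γ))^[l] (f γ) (γ.chart p)
              + ∑ j ∈ Finset.range (2 * l), A j (γ.chart p)
                  (iteratedFDeriv ℝ j (f γ) (γ.chart p)) := by
  have hd0 : d ≠ 0 := by omega
  obtain ⟨g, gi, s, v, h⟩ := exists_isLocalRep hd0 hσ γ (γ.regular_subset σ)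
  obtain ⟨u, hu⟩ := h.exists_inv_vf subset_rfl
  set w : ℝ := (((2 * l : ℕ) : ℝ) - d + 1) / 2 with hw
  set C : ℝ := (Nat.doubleFactorial (2 * l - 1) : ℝ) ^ 2 with hC
  obtain ⟨A, hA⟩ := (hasJet_id.yPowR_comp (m := m) (θ := conn Sm.D g gi (chr Sm.D g gi))
    (gi := gi) (Γ := chr Sm.D g gi) s v (2 * l) w).sub
      (((hasJet_id.iterate_tangLapR (m := m) (θ := conn Sm.D g gi (chr Sm.D g gi))
        (gi := gi) (Γ := chr Sm.D g gi) s u l).smul (algebraMap ℝ _ C)).mono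
          (show 0 + 2 * l ≤ 0 + 2 * (2 * l) by omega))
  refine ⟨A, hA.smooth, fun f hf p hp hpS => ?_⟩
  obtain ⟨τ, hτ⟩ := exists_repT_section hf γ (γ.regular_subset σ)
  set y : γ.regular σ := ⟨γ.chart p, hS.mem_regular hd0 hσ γ hp hpS⟩ with hy
  have h0 : scalar (σ.1 γ (γ.chart p)) = 0 := hS.scalar_eq_zero γ hp hpS
  have hys : Sm.ev y s = 0 := by
    rw [← h.rep Fin.elim0 y]
    exact h0
  have h1 : Sm.ev y (vf Sm.D (grad Sm.D gi s) s) = 1 := by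
    rw [← h.rep_normSq y]
    exact hS.normSq_eq_one hd0 hσ γ (γ.chart.map_source hp) h0
  funext I
  have ht := hA.tail (show 2 * l ≤ 0 + 2 * (2 * l) + 1 by omega) (p := y) (fun τ hτ I => by
    rw [Pi.sub_apply, map_sub, Pi.smul_apply, smul_eq_mul, map_mul, AlgHom.commutes,
      eval_yPowR_critical hd0 Sm.D_comm h.pair.symm_inv hys h.inv h1 hu l hτ I]
    exact sub_self _) hτ I
  rw [Pi.sub_apply, map_sub, Pi.smul_apply, smul_eq_mul, map_mul, AlgHom.commutes,
    ← h.laplaceRobinPow_eq hd0 (2 * l) w hτ y I,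
    ← h.rep_iterate_tangLaplacian hu l hτ I y] at ht
  rw [Pi.add_apply, ht]
  exact (add_sub_cancel _ _).symm

end Operators

/-! ### Dependence on the conformal unit defining density -/

section Uniqueness

variable {d m : ℕ} {M : Type*} [TopologicalSpace M] [ChartedSpace (Model d) M]
  [IsManifold (𝓡 d) ∞ M] {c : ConformalStructure d M} {S : Set M} {σ σ' : densities c 1}

theorem dualInner_of_fderiv {G : Model d → Matrix (Fin d) (Fin d) ℝ} {s s' : Model d → Tensor d 0}
    {y : Model d} {e : ℝ} (h : fderiv ℝ (fun z => scalar (s' z)) y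
      = e • fderiv ℝ (fun z => scalar (s z)) y) :
    dualInner G s s' y = e * normSq G s y ∧ normSq G s' y = e ^ 2 * normSq G s y := by
  have h1 : ∀ a, pd a (fun z => scalar (s' z)) y = e * pd a (fun z => scalar (s z)) y := fun a => by
    rw [pd, h]
    rfl
  simp only [dualInner, h1, Finset.mul_sum]
  exact ⟨Finset.sum_congr rfl fun a _ => Finset.sum_congr rfl fun b _ => by ring,
    Finset.sum_congr rfl fun a _ => Finset.sum_congr rfl fun b _ => by ring⟩

/-- Conformal unit defining densities of the same hypersurface have the same differential up to
sign. -/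
theorem fderiv_eq_or_neg (hd : d ≠ 0) (hσ : PositiveScale σ) (hS : IsConformalUnit S σ)
    (hσ' : PositiveScale σ') (hS' : IsConformalUnit S σ') (γ : Gauge c) {p : M}
    (hp : p ∈ γ.chart.source) (hpS : p ∈ S) :
    ∃ e : ℝ, (e = 1 ∨ e = -1) ∧ fderiv ℝ (fun z => scalar (σ'.1 γ z)) (γ.chart p)
      = e • fderiv ℝ (fun z => scalar (σ.1 γ z)) (γ.chart p) := by
  obtain ⟨g, gi, s, v, h⟩ := exists_isLocalRep hd hσ γ (γ.regular_subset σ)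
  obtain ⟨s', hs'⟩ := exists_rep_density σ' γ (γ.regular_subset σ)
  obtain ⟨u, hu⟩ := h.exists_inv_vf subset_rfl
  set y : γ.regular σ := ⟨γ.chart p, hS.mem_regular hd hσ γ hp hpS⟩ with hy
  have hys : Sm.ev y s = 0 := by
    rw [← h.rep Fin.elim0 y]
    exact hS.scalar_eq_zero γ hp hpS
  obtain ⟨e, he⟩ := (isHypersurface_of_inv hu).lagrange s' (by
    rintro q ⟨z, rfl, hz⟩
    have hzt := γ.regular_subset σ z.2
    have h1 := (hS.zero_iff γ _ (γ.chart.map_target hzt)).2 (by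
      rw [γ.chart.right_inv hzt, ← hz]
      exact h.rep Fin.elim0 z)
    have h2 := hS'.scalar_eq_zero γ (γ.chart.map_target hzt) h1
    rw [γ.chart.right_inv hzt] at h2
    rw [← hs' Fin.elim0 z]
    exact h2) _ ⟨y, rfl, hys⟩
  have hfd : fderiv ℝ (fun z => scalar (σ'.1 γ z)) (γ.chart p)
      = e • fderiv ℝ (fun z => scalar (σ.1 γ z)) (γ.chart p) := by
    ext x
    have e1 := fderiv_eq_of_rep (hs' Fin.elim0) y x
    have e2 := fderiv_eq_of_rep (h.rep Fin.elim0) y x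
    refine e1.trans (Eq.trans ?_ (congrArg (e * ·) e2.symm))
    dsimp only
    rw [Finset.mul_sum]
    exact Finset.sum_congr rfl fun a _ => by rw [he]; ring
  -- Both differentials have unit length on `S`, which leaves only a sign for the factor.
  refine ⟨e, ?_, hfd⟩
  have h1 := (dualInner_of_fderiv (G := γ.G) hfd).2
  rw [hS.normSq_eq_one hd hσ γ (γ.chart.map_source hp) (hS.scalar_eq_zero γ hp hpS),
    hS'.normSq_eq_one hd hσ' γ (γ.chart.map_source hp) (hS'.scalar_eq_zero γ hp hpS),
    mul_one] at h1
  exact (mul_self_eq_one_iff (a := e)).1 (by rw [← sq]; exact h1.symm)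

/-- At a zero of the density the derivative of the conformal factor drops out, so the differential
transforms as a covector times `Ω`. -/
theorem hasFDerivAt_density_change (σ : densities c 1) (γ γ' : Gauge c) {Ω : M → ℝ}
    (hΩ : IsRescaling Ω γ.metric γ'.metric) {p : M} (hp : p ∈ γ.chart.source)
    (hp' : p ∈ γ'.chart.source) (h0 : scalar (σ.1 γ (γ.chart p)) = 0) :
    fderiv ℝ (fun z => scalar (σ.1 γ' z)) (γ'.chart p)
      = Ω p • (fderiv ℝ (fun z => scalar (σ.1 γ z)) (γ.chart p)).comp
        (fderiv ℝ (γ.trans γ') (γ'.chart p)) := by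
  have hy : γ'.chart p ∈ γ.overlap γ' :=
    ⟨γ'.chart.map_source hp', by simpa [γ'.chart.left_inv hp'] using hp⟩
  have hψ : γ.trans γ' (γ'.chart p) = γ.chart p := by
    simp [Gauge.trans, γ'.chart.left_inv hp']
  have h1 : (fun z => scalar (σ.1 γ' z)) =ᶠ[nhds (γ'.chart p)]
      fun z => Ω (γ'.chart.symm z) * scalar (σ.1 γ (γ.trans γ' z)) :=
    Filter.eventuallyEq_of_mem ((γ.overlap γ').isOpen.mem_nhds hy) fun z hz =>
      congrFun (density_change σ γ γ' hΩ hz) _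
  have h2 : DifferentiableAt ℝ (fun z => Ω (γ'.chart.symm z)) (γ'.chart p) := by
    refine differentiableAt_of_contDiffOn (U := γ'.dom) ?_ (γ'.chart.map_source hp')
    rw [← contMDiffOn_iff_contDiffOn]
    exact hΩ.smooth.comp_contMDiffOn γ'.contMDiffOn_symm
  have h3 : HasFDerivAt (fun z => scalar (σ.1 γ z))
      (fderiv ℝ (fun z => scalar (σ.1 γ z)) (γ.chart p)) (γ.trans γ' (γ'.chart p)) := by
    rw [hψ]
    exact (differentiableAt_of_contDiffOn (U := γ.dom) (contDiffOn_pi.1 (σ.2.1 γ) Fin.elim0)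
      (γ.chart.map_source hp)).hasFDerivAt
  have h4 := h3.comp _
    (differentiableAt_of_contDiffOn (γ.contDiffOn_trans γ') hy).hasFDerivAt
  have h5 := h2.hasFDerivAt.mul h4
  rw [h1.fderiv_eq]
  refine h5.fderiv.trans ?_
  simp only [Function.comp, hψ, h0, zero_smul, add_zero, γ'.chart.left_inv hp']

theorem fderiv_eq_smul_of_gauge (γ γ' : Gauge c) {p : M} (hp : p ∈ γ.chart.source)
    (hp' : p ∈ γ'.chart.source) (h0 : scalar (σ.1 γ (γ.chart p)) = 0)
    (h0' : scalar (σ'.1 γ (γ.chart p)) = 0) {e : ℝ}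
    (h : fderiv ℝ (fun z => scalar (σ'.1 γ z)) (γ.chart p)
      = e • fderiv ℝ (fun z => scalar (σ.1 γ z)) (γ.chart p)) :
    fderiv ℝ (fun z => scalar (σ'.1 γ' z)) (γ'.chart p)
      = e • fderiv ℝ (fun z => scalar (σ.1 γ' z)) (γ'.chart p) := by
  obtain ⟨Ω, hΩ⟩ := (c.mem_iff γ.metric γ.metric_mem γ'.metric).1 γ'.metric_mem
  rw [hasFDerivAt_density_change σ γ γ' hΩ hp hp' h0,
    hasFDerivAt_density_change σ' γ γ' hΩ hp hp' h0', h, ContinuousLinearMap.smul_comp, smul_comm]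

theorem coorientedAt_or (hd : d ≠ 0) (hσ : PositiveScale σ) (hS : IsConformalUnit S σ)
    (hσ' : PositiveScale σ') (hS' : IsConformalUnit S σ') {p : M} (hpS : p ∈ S) :
    CoorientedAt σ σ' 1 p ∨ CoorientedAt σ σ' (-1) p := by
  -- The alternative must hold with one sign for all gauges. A gauge in which the sign is not `1`
  -- has sign `-1`, and `fderiv_eq_smul_of_gauge` carries it to the others.
  refine or_iff_not_imp_left.2 fun hn γ' hp' => ?_
  simp only [CoorientedAt, not_forall] at hn
  obtain ⟨γ, hp, hn⟩ := hn
  obtain ⟨e, he | he, h⟩ := fderiv_eq_or_neg hd hσ hS hσ' hS' γ hp hpS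
  · exact absurd ⟨1, one_pos, by rw [h, he, mul_one]⟩ hn
  · exact ⟨1, one_pos, by
      rw [mul_one, ← he]
      exact fderiv_eq_smul_of_gauge γ γ' hp hp' (hS.scalar_eq_zero γ hp hpS)
        (hS'.scalar_eq_zero γ hp hpS) h⟩

theorem CoorientedAt.fderiv_eq (hd : d ≠ 0) (hσ : PositiveScale σ) (hS : IsConformalUnit S σ)
    (hσ' : PositiveScale σ') (hS' : IsConformalUnit S σ') {p : M} (hpS : p ∈ S) {ε : ℝ}
    (hε : ε = 1 ∨ ε = -1) (h : CoorientedAt σ σ' ε p) (γ : Gauge c) (hp : p ∈ γ.chart.source) :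
    fderiv ℝ (fun z => scalar (σ'.1 γ z)) (γ.chart p)
      = ε • fderiv ℝ (fun z => scalar (σ.1 γ z)) (γ.chart p) := by
  obtain ⟨r, hr, h1⟩ := h γ hp
  obtain ⟨e, he, h2⟩ := fderiv_eq_or_neg hd hσ hS hσ' hS' γ hp hpS
  have h3 : ε * r = e := smul_left_injective ℝ (hS.deriv_ne γ p hp hpS) (h1.symm.trans h2)
  have h4 : ε = e := by
    rcases hε with rfl | rfl <;> rcases he with rfl | rfl <;> linarith
  rw [h2, h4]

/-- The extrinsic conformal Laplacians of order less than the dimension depend only on the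
hypersurface and its co-orientation. -/
theorem laplaceRobinPow_eq_of_coorientedAt (hd : 3 ≤ d) (hσ : PositiveScale σ)
    (hS : IsConformalUnit S σ) (hσ' : PositiveScale σ') (hS' : IsConformalUnit S σ') {k : ℕ}
    (hk : k ≤ d - 1) {p : M} (hpS : p ∈ S) {ε : ℝ} (hε : ε = 1 ∨ ε = -1)
    (hco : CoorientedAt σ σ' ε p) {w : ℝ} {f : Components c m} (hf : f ∈ tractorFields c m w)
    (γ : Gauge c) (hp : p ∈ γ.chart.source) :
    laplaceRobinPow σ' k w f γ (γ.chart p) = ε ^ k • laplaceRobinPow σ k w f γ (γ.chart p) := by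
  have hd0 : d ≠ 0 := by omega
  have hεε : ε * ε = 1 := by rcases hε with rfl | rfl <;> norm_num
  -- On `V` the differential of `σ` is nonzero and `ε ⟨dσ, dσ'⟩` is positive. Thus the sign of the
  -- co-orientation given at `p` is the same at all points of the hypersurface in `V`, and this is
  -- needed for vanishing along it.
  let V : TopologicalSpace.Opens (Model d) :=
    ⟨γ.chart.target ∩ (fun y => ε * dualInner γ.G (σ.1 γ) (σ'.1 γ) y) ⁻¹' Set.Ioi 0,
      (continuousOn_const.mul (contDiffOn_dualInner σ σ' γ).continuousOn).isOpen_inter_preimage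
        γ.chart.open_target isOpen_Ioi⟩ ⊓ γ.regular σ
  have hVr : (V : Set (Model d)) ⊆ γ.regular σ := fun y hy => hy.2
  have hVt : (V : Set (Model d)) ⊆ γ.chart.target := hVr.trans (γ.regular_subset σ)
  obtain ⟨g, gi, s, v, h⟩ := exists_isLocalRep hd0 hσ γ hVt
  obtain ⟨u, hu⟩ := h.exists_inv_vf hVr
  obtain ⟨s', hs'⟩ := exists_rep_density σ' γ hVt
  obtain ⟨v', hv'⟩ := exists_inv_isqR hd0 hσ' γ hVt h.metric hs'
  have h' : IsLocalRep σ' γ g gi s' v' := ⟨hVt, h.metric, h.pair, hs', hv'⟩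
  obtain ⟨τ, hτ⟩ := exists_repT_section hf γ hVt
  have hZ := isHypersurface_of_inv hu
  have hmemS : ∀ z : V, Sm.ev z s = 0 → γ.chart.symm z ∈ S := fun z hz =>
    (hS.zero_iff γ _ (γ.chart.map_target (hVt z.2))).2 (by
      rw [γ.chart.right_inv (hVt z.2), ← hz]
      exact h.rep Fin.elim0 z)
  have hs0 : ∀ z : V, Sm.ev z s = 0 → Sm.ev z s' = 0 := fun z hz => by
    have h2 := hS'.scalar_eq_zero γ (γ.chart.map_target (hVt z.2)) (hmemS z hz)
    rw [γ.chart.right_inv (hVt z.2)] at h2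
    rw [← hs' Fin.elim0 z]
    exact h2
  have hn1 : ∀ z : V, Sm.ev z s = 0 → normSq γ.G (σ.1 γ) z = 1 := fun z hz =>
    hS.normSq_eq_one hd0 hσ γ (hVt z.2) (by
      rw [← hz]
      exact h.rep Fin.elim0 z)
  have hDs : ∀ z : V, Sm.ev z s = 0 → ∀ a, Sm.ev z (Sm.D a s') = ε * Sm.ev z (Sm.D a s) := by
    intro z hz a
    obtain ⟨e, he, h2⟩ := fderiv_eq_or_neg hd0 hσ hS hσ' hS' γ (γ.chart.map_target (hVt z.2))
      (hmemS z hz)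
    rw [γ.chart.right_inv (hVt z.2)] at h2
    have h3 := (dualInner_of_fderiv (G := γ.G) h2).1
    rw [hn1 z hz, mul_one] at h3
    have h4 : 0 < ε * dualInner γ.G (σ.1 γ) (σ'.1 γ) z := z.2.1.2
    rw [h3] at h4
    have h5 : e = ε := by
      rcases hε with rfl | rfl <;> rcases he with rfl | rfl <;> first | rfl | norm_num at h4
    rw [h5] at h2
    have h6 := congrArg (fun L => L (EuclideanSpace.single a (1 : ℝ))) h2
    rw [← h'.rep_pd a z, ← h.rep_pd a z]
    exact h6
  -- With the sign put in, `s` and `ε s'` have the same value and the same differential along the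
  -- zero set, so `δ` starts at order two.
  set δ : Sm V := ε • s' - s with hδ
  have hsδ : s + δ = ε • s' := by rw [hδ]; abel
  have hisq : ∀ r : Sm V, isqR Sm.D gi (chr Sm.D g gi) (ε • r) = isqR Sm.D gi (chr Sm.D g gi) r :=
    fun r => by
      rcases hε with rfl | rfl
      · rw [one_smul]
      · rw [neg_one_smul, isqR_neg]
  have hunit : ∀ {ρ : densities c 1} {r : Sm V}, RepT (ρ.1 γ) (fun _ => r) →
      IsConformalUnit S ρ → ∀ z : V, Sm.ev z r = 0 →
      isqR Sm.D gi (chr Sm.D g gi) r - 1 ∈ Van Sm.D (Sm.ev z) d := by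
    intro ρ r hr hρ z hz
    obtain ⟨B, hB⟩ := hρ.unit
    obtain ⟨b, hb⟩ := exists_repT_section B.2 γ hVt
    have : isqR Sm.D gi (chr Sm.D g gi) r = 1 + r ^ d * b Fin.elim0 := Sm.ext fun y => by
      rw [← h.metric.rep_scaleSq hd0 hr y, map_add, map_one, map_mul, map_pow, ← hr Fin.elim0 y,
        ← hb Fin.elim0 y]
      exact hB γ y (hVt y.2)
    rw [this, add_sub_cancel_left]
    exact Ideal.mul_mem_right _ _ (van_pow (mem_van_one.2 hz) d)
  have hI : ∀ q ∈ zeros s, isqR Sm.D gi (chr Sm.D g gi) (s + δ) - isqR Sm.D gi (chr Sm.D g gi) s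
      ∈ Van Sm.D q d := by
    rintro q ⟨z, rfl, hz⟩
    rw [hsδ, hisq, ← sub_sub_sub_cancel_right _ _ 1]
    exact sub_mem (hunit hs' hS' z (hs0 z hz)) (hunit h.rep hS z hz)
  have hy : γ.chart p ∈ V := by
    refine ⟨⟨γ.chart.map_source hp, ?_⟩, hS.mem_regular hd0 hσ γ hp hpS⟩
    have h1 := (dualInner_of_fderiv (G := γ.G) (hco.fderiv_eq hd0 hσ hS hσ' hS' hpS hε γ hp)).1
    rw [hS.normSq_eq_one hd0 hσ γ (γ.chart.map_source hp) (hS.scalar_eq_zero γ hp hpS),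
      mul_one] at h1
    change 0 < ε * dualInner γ.G (σ.1 γ) (σ'.1 γ) (γ.chart p)
    rw [h1, hεε]
    exact one_pos
  set y : V := ⟨γ.chart p, hy⟩ with hydef
  have hys : Sm.ev y s = 0 := by
    rw [← h.rep Fin.elim0 y]
    exact hS.scalar_eq_zero γ hp hpS
  have hvan := hZ.mem_van_of_isqR (by omega) Sm.D_comm h.pair.symm_inv
    (by
      rintro q ⟨z, rfl, hz⟩
      rw [← h.rep_normSq z]
      exact hn1 z hz) hI
    (by
      rintro q ⟨z, rfl, hz⟩
      rw [hδ, map_sub, map_smul, hs0 z hz, hz, smul_zero, sub_zero])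
    (by
      rintro q ⟨z, rfl, hz⟩ a
      rw [hδ, map_sub, map_sub, Derivation.map_smul, map_smul, hDs z hz a, smul_eq_mul,
        ← mul_assoc, hεε, one_mul, sub_self])
    (Sm.ev y) ⟨y, rfl, hys⟩
  have key := vanT_yPowR_sub_yPowR (θ := conn Sm.D g gi (chr Sm.D g gi)) hys hvan
    (hI _ ⟨y, rfl, hys⟩) h.inv (v' := v') (by rw [hsδ, hisq]; exact hv') k w τ
  have hneg : yPowR Sm.D gi (chr Sm.D g gi) (nabS gi g) (ε • s') v' k w τ
      = algebraMap ℝ (Sm V) (ε ^ k) • yPowR Sm.D gi (chr Sm.D g gi) (nabS gi g) s' v' k w τ := by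
    rcases hε with rfl | rfl
    · rw [one_smul, one_pow, map_one, one_smul]
    · rw [neg_one_smul, yPowR_neg]
  rw [hsδ] at key
  funext I
  -- The two powers agree to order `d - k`, which is at least one because `k ≤ d - 1`.
  have h1 := eval_eq_zero (mem_vanT.1 key I) (by omega)
  rw [Pi.sub_apply, map_sub, sub_eq_zero] at h1
  have h2 := congrArg (Sm.ev y) (congrFun hneg I)
  rw [Pi.smul_apply, smul_eq_mul, map_mul, AlgHom.commutes] at h2
  have h3 : ε ^ k * ε ^ k = 1 := by rw [← mul_pow, hεε, one_pow]
  have h4 := h'.laplaceRobinPow_eq hd0 k w hτ y I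
  have h5 := h.laplaceRobinPow_eq hd0 k w hτ y I
  change laplaceRobinPow σ' k w f γ y I = ε ^ k * laplaceRobinPow σ k w f γ y I
  rw [h4, h5]
  have h6 := h2.symm.trans h1
  rw [← h6, Algebra.algebraMap_self, RingHom.id_apply, ← mul_assoc, h3, one_mul]

end Uniqueness

end ConformalTractor

end

/-! ### Assembly of the four assertions. -/

theorem mainTheorem6 {d : ℕ} (hd : 3 ≤ d) {M : Type*} [TopologicalSpace M] [T2Space M]
    [SecondCountableTopology M] [ChartedSpace (Model d) M] [IsManifold (𝓡 d) ∞ M]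
    (c : ConformalStructure d M) (S : Set M) {m : ℕ} (Φ : TensorPart d m) (k : ℕ) (hk : 1 ≤ k)
    (σ : densities c 1) (hσ : IsConformalUnit S σ) (hpos : PositiveScale σ) :
    ∃ P : sections c Φ (((k : ℝ) - d + 1) / 2) →ₗ[ℝ] sections c Φ ((-(k : ℝ) - d + 1) / 2),
      (∀ f, (P f : Components c m) = laplaceRobinPow σ k (((k : ℝ) - d + 1) / 2) f) ∧
      IsDifferentialOperator P ∧
      IsTangential σ P ∧
      (∃ Q : SectionsAlong c Φ (((k : ℝ) - d + 1) / 2) S →ₗ[ℝ]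
          SectionsAlong c Φ ((-(k : ℝ) - d + 1) / 2) S,
        (∀ f, Q (restrict S f) = restrict S (P f)) ∧
        IsDifferentialOperatorAlong S Q ∧
        (Even k → HasLeadingTerm S σ Q
          ((-1 : ℝ) ^ k * (Nat.doubleFactorial (k - 1) : ℝ) ^ 2) (k / 2))) ∧
      (k ≤ d - 1 → ∀ σ' : densities c 1, IsConformalUnit S σ' → PositiveScale σ' →
        ∀ p ∈ S,
          (CoorientedAt σ σ' 1 p ∨ CoorientedAt σ σ' (-1) p) ∧
          ∀ f : sections c Φ (((k : ℝ) - d + 1) / 2), ∀ γ : Gauge c, p ∈ γ.chart.source →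
            (CoorientedAt σ σ' 1 p →
              laplaceRobinPow σ' k (((k : ℝ) - d + 1) / 2) f.1 γ (γ.chart p)
                = (P f).1 γ (γ.chart p)) ∧
            (CoorientedAt σ σ' (-1) p →
              laplaceRobinPow σ' k (((k : ℝ) - d + 1) / 2) f.1 γ (γ.chart p)
                = (-1 : ℝ) ^ k • (P f).1 γ (γ.chart p))) := by
  have hw : ((k : ℝ) - d + 1) / 2 - k = (-(k : ℝ) - d + 1) / 2 := by ring
  have hd0 : d ≠ 0 := by omega
  -- The quotient only determines sections modulo those vanishing on `S`, so any representative of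
  -- the image takes the values of the operator along `S`.
  have along : ∀ (f : sections c Φ (((k : ℝ) - d + 1) / 2))
      (h : sections c Φ ((-(k : ℝ) - d + 1) / 2)),
      Submodule.mapQ _ _ (powOp hd hpos Φ k hw) (powOp_mem_vanishing hd hpos hσ Φ k hw)
        (restrict S f) = restrict S h → ∀ γ : Gauge c, ∀ p ∈ γ.chart.source, p ∈ S →
          h.1 γ (γ.chart p) = (powOp hd hpos Φ k hw f).1 γ (γ.chart p) := by
    intro f h hfh γ p hp hpS
    have h1 : powOp hd hpos Φ k hw f - h ∈ vanishing c Φ ((-(k : ℝ) - d + 1) / 2) S :=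
      (Submodule.Quotient.eq _).1 hfh
    exact (sub_eq_zero.1 (h1 γ p hp hpS)).symm
  refine ⟨powOp hd hpos Φ k hw, fun f => rfl, isDifferentialOperator_powOp hd hpos Φ k hw,
    isTangential_powOp hd hpos Φ k hw,
    ⟨Submodule.mapQ _ _ (powOp hd hpos Φ k hw) (powOp_mem_vanishing hd hpos hσ Φ k hw),
      fun f => rfl, ?_, ?_⟩, ?_⟩
  · obtain ⟨N, hN⟩ := isDifferentialOperator_powOp hd hpos Φ k hw
    refine ⟨N, fun γ => ?_⟩
    obtain ⟨A, hA, hP⟩ := hN γ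
    exact ⟨γ.chart.target, γ.chart.open_target, subset_rfl, fun p hp _ => γ.chart.map_source hp,
      A, hA, fun f h hfh p hp hpS => (along f h hfh γ p hp hpS).trans
        (hP f _ (γ.chart.map_source hp))⟩
  · intro hev γ
    -- With `k = 2 l` the sign `(-1)^k` is `1` and the constant is the square of the double
    -- factorial.
    obtain ⟨l, rfl⟩ := even_iff_two_dvd.1 hev
    obtain ⟨A, hA, hP⟩ := exists_jet_leadingTerm (m := m) hd hpos hσ l γ
    refine ⟨γ.regular σ, (γ.regular σ).isOpen, γ.regular_subset σ,
      fun p hp hpS => hσ.mem_regular hd0 hpos γ hp hpS, A, hA, fun f h hfh p hp hpS => ?_⟩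
    rw [along f h hfh γ p hp hpS, powOp_apply, hP f.1 f.2.1 p hp hpS, hev.neg_one_pow, one_mul,
      Nat.mul_div_cancel_left l two_pos]
  · intro hkd σ' hσ' hpos' p hpS
    refine ⟨coorientedAt_or hd0 hpos hσ hpos' hσ' hpS, fun f γ hp => ⟨fun hco => ?_, fun hco =>
      laplaceRobinPow_eq_of_coorientedAt hd hpos hσ hpos' hσ' hkd hpS (Or.inr rfl) hco f.2.1 γ hp⟩⟩
    rw [laplaceRobinPow_eq_of_coorientedAt hd hpos hσ hpos' hσ' hkd hpS (Or.inl rfl) hco f.2.1 γ hp,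
      one_pow, one_smul]
    rfl
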